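/- **Superposition identity.** Let $h>0$, $a>0$, $z_0\in\mathbb R$ (the fixed bulk point is ${\bf x}_0=(a,z_0)$; in the original notation $h=h_i$, $a=u_i$, $z_0=z_i$). For $u>0$ and $z,w\in\mathbb C$ put $$G_h(u,z)=\left(\frac{ua}{u^2+a^2+(z-z_0)^2}\right)^{h}{}_2F_1\!\left[\tfrac h2,\tfrac h2+\tfrac12;h+\tfrac12\,\Big|\,\Big(\tfrac{2ua}{u^2+a^2+(z-z_0)^2}\Big)^2\right],$$ $$\widehat G_h(u,z,w)=c_h\left(\frac{a}{a^2+(z_0-w)^2}\right)^{1-h}\left(\frac{u}{u^2+(z-w)^2}\right)^{h},\qquad c_h=\frac{-2i}{4^h}\frac{\Gamma(2h)}{\Gamma(h)^2},$$ $$\widetilde G_h(u,z)=c_h\left(\frac{4^{h}\,\Gamma(1-2h)}{\Gamma(1-h)^2}\,G_h(u,z)+\frac{4^{1-h}\,\Gamma(2h-1)}{\Gamma(h)^2}\,G_{1-h}(u,z)\right),$$ with principal branches, where ${}_2F_1$ is continued analytically to $\mathbb C\setminus[1,\infty)$; $1/\Gamma$ vanishes at the poles of $\Gamma$, so that the first summand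 of $\widetilde G_h$ is $0$ for $h\in\mathbb N$, and for $h\in\{\frac12,\frac32,\dots\}$ the function $\widetilde G_h$ is defined as the limit of the formula in $h$. *Test functions.* There is $r>0$ such that, with $R=\{|\mathrm{Re}\,z-z_0|<r,\ |\mathrm{Im}\,z|<a+r\}$, the function $f(u,z)$ is continuous on $(0,\infty)\times R$, holomorphic in $z\in R$ for every $u>0$, satisfies $u^{-h}f(u,z)\to0$ as $u\to0^+$ for every $z\in R$, and $|f(u,z)|\le M(u)$ on $(0,\infty)\times R$ for a function $M$ with $\int_0^\infty\frac{du}{u^2}\int_{-r}^{r}ds\,\big(\frac{u}{u^2+s^2}\big)^{h}M(u)<\infty$. (Outside $R$, $f$ is an arbitrary complex-valued function, subject only to the convergence conditions below.) *Contours.* For $w$ on the segment $[z_0-ia,z_0+ia]$ and $\varepsilon>0$ let $C_i(\varepsilon)$ be the $\Pi$-shaped polygonal path $z_0-\varepsilon\to w-\varepsilon\to w+\varepsilon\to z_0+\varepsilon$. For $0<\varepsilon<\varepsilon_0$ let $C(\varepsilon)$ be a piecewise $C^1$, possibly unbounded, contour with $\mathrm{Re}\,z\ne z_0$ for all $z\in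 C(\varepsilon)$, consisting of a piece that ends at $z_0-\varepsilon$ and a piece that starts at $z_0+\varepsilon$ (either may be trivial), so that $C(\varepsilon)+C_i(\varepsilon)$ is a continuous curve. Suppose that $\int dw\int_0^\infty\frac{du}{u^2}\int_{C(\varepsilon)}dz\,\widehat G_h f$ converges absolutely for each such $\varepsilon$. *Conclusion.* The integral of $\frac{1}{u^2}\widetilde G_hf$ over the compact region below converges absolutely, and for all sufficiently small $\varepsilon>0$ so do the integrals of $\frac1{u^2}G_hf$ over $(0,\infty)\times C(\varepsilon)$ and of $\frac1{u^2}\widehat G_hf$ over $w$, $u$ and $C_i(\varepsilon)$. Moreover $$\lim_{\varepsilon\to0^+}\left[\int_0^\infty\!\frac{du}{u^2}\int_{C(\varepsilon)}\!dz\,G_hf-\int_{z_0-ia}^{z_0+ia}\!dw\int_0^\infty\!\frac{du}{u^2}\int_{C(\varepsilon)+C_i(\varepsilon)}\!dz\,\widehat G_hf\right]=\pi\int_0^{a}\frac{du}{u^2}\int_{z_0-i(u-a)}^{z_0+i(u-a)}dz\,\widetilde G_hf .$$ Consequently, if the limit as $\varepsilon\to0^+$ of one of the two $\varepsilon$-dependent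 integrals exists, then so does the other, and $$\lim_{\varepsilon\to0^+}\int_0^\infty\!\frac{du}{u^2}\int_{C(\varepsilon)}\!dz\,G_hf=\pi\int_0^{a}\frac{du}{u^2}\int_{z_0-i(u-a)}^{z_0+i(u-a)}dz\,\widetilde G_hf+\lim_{\varepsilon\to0^+}\int_{z_0-ia}^{z_0+ia}\!dw\int_0^\infty\!\frac{du}{u^2}\int_{C(\varepsilon)+C_i(\varepsilon)}\!dz\,\widehat G_hf .$$ -/

import Mathlib

open Set Filter Topology MeasureTheory

namespace AdS2

/-- The principal branch of Gauss' hypergeometric function `₂F₁(a, b; c; x)`: the power series in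
the open unit disc, and elsewhere on `ℂ ∖ [1, ∞)` its analytic continuation, given by the Euler
integral. (Outside the disc the function is only used with `0 < b < c`, where the Euler integral
converges.) -/
noncomputable def hyp2F1 (a b c x : ℂ) : ℂ :=
  if ‖x‖ < 1 then ordinaryHypergeometric a b c x
  else Complex.Gamma c / (Complex.Gamma b * Complex.Gamma (c - b)) *
    ∫ t in (0 : ℝ)..1, (t : ℂ) ^ (b - 1) * ((1 - t : ℝ) : ℂ) ^ (c - b - 1) * (1 - x * t) ^ (-a)

/-- `D = u² + u'² + (z - z')²`. -/
noncomputable def dist2 (u : ℝ) (z : ℂ) (u' : ℝ) (z' : ℂ) : ℂ :=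
  (u : ℂ) ^ 2 + (u' : ℂ) ^ 2 + (z - z') ^ 2

/-- The bulk-to-bulk propagator `G_h((u, z), (u', z'))`. -/
noncomputable def G (h : ℝ) (u : ℝ) (z : ℂ) (u' : ℝ) (z' : ℂ) : ℂ :=
  ((u : ℂ) * u' / dist2 u z u' z') ^ (h : ℂ) *
    hyp2F1 ((h : ℂ) / 2) ((h : ℂ) / 2 + 1 / 2) ((h : ℂ) + 1 / 2)
      ((2 * (u : ℂ) * u' / dist2 u z u' z') ^ 2)

/-- The constant `-2i 4^{-h} Γ(2h) / Γ(h)²`. -/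
noncomputable def cst (h : ℝ) : ℂ :=
  -2 * Complex.I / (4 : ℂ) ^ (h : ℂ) *
    (Complex.Gamma (2 * h) / (Complex.Gamma h * Complex.Gamma h))

/-- The modified propagator `Ĝ_h((u, z), (u', z'), w)`. -/
noncomputable def Ghat (h : ℝ) (u : ℝ) (z : ℂ) (u' : ℝ) (z' : ℂ) (w : ℂ) : ℂ :=
  cst h * ((u' : ℂ) / ((u' : ℂ) ^ 2 + (z' - w) ^ 2)) ^ (1 - (h : ℂ)) *
    ((u : ℂ) / ((u : ℂ) ^ 2 + (z - w) ^ 2)) ^ (h : ℂ)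

/-- The closed formula for the modified propagator `G̃_h` as a combination of `G_h` and
`G_{1-h}`; it is meaningful when `h - 1/2` is not an integer. -/
noncomputable def GtildeFormula (h : ℝ) (u : ℝ) (z : ℂ) (u' : ℝ) (z' : ℂ) : ℂ :=
  cst h *
    ((4 : ℂ) ^ (h : ℂ) * Complex.Gamma (1 - 2 * h) / Complex.Gamma (1 - h) ^ 2 * G h u z u' z' +
      (4 : ℂ) ^ (1 - (h : ℂ)) * Complex.Gamma (2 * h - 1) / Complex.Gamma h ^ 2 *
        G (1 - h) u z u' z')

open Classical in
/-- The modified propagator `G̃_h((u, z), (u', z'))`, `h > 0`. At `h = 1/2, 3/2, 5/2, …`, where the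
two summands of the closed formula have poles in `h` that cancel, it is the limit of the closed
formula in `h`. -/
noncomputable def Gtilde (h : ℝ) (u : ℝ) (z : ℂ) (u' : ℝ) (z' : ℂ) : ℂ :=
  if ∃ n : ℕ, h = n + 1 / 2 then limUnder (𝓝[≠] h) (fun s : ℝ => GtildeFormula s u z u' z')
  else GtildeFormula h u z u' z'

/-- The contour integral `∫ g(z) dz` over the curve `γ` restricted to the parameter set `I`. -/
noncomputable def lineInt (g : ℂ → ℂ) (γ : ℝ → ℂ) (I : Set ℝ) : ℂ :=
  ∫ s in I, g (γ s) * deriv γ s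

/-- The oriented segment from `p` to `q`, with parameter in `[0, 1]`. -/
noncomputable def seg (p q : ℂ) (s : ℝ) : ℂ := p + s * (q - p)

/-- The segment on which the boundary variable `w` runs, from `z₀ - i a` to `z₀ + i a`. -/
noncomputable def wSeg (a z₀ : ℝ) : ℝ → ℂ := seg (z₀ - Complex.I * a) (z₀ + Complex.I * a)

/-- The three sides of the Π-shaped contour `C_i(ε)` around the point `w`:
`z₀ - ε ⟶ w - ε ⟶ w + ε ⟶ z₀ + ε`. -/
noncomputable def side₁ (z₀ ε : ℝ) (w : ℂ) : ℝ → ℂ := seg (z₀ - ε) (w - ε)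
noncomputable def side₂ (ε : ℝ) (w : ℂ) : ℝ → ℂ := seg (w - ε) (w + ε)
noncomputable def side₃ (z₀ ε : ℝ) (w : ℂ) : ℝ → ℂ := seg (w + ε) (z₀ + ε)

/-- The integral over the Π-shaped contour `C_i(ε)`. -/
noncomputable def bumpInt (g : ℂ → ℂ) (z₀ ε : ℝ) (w : ℂ) : ℂ :=
  lineInt g (side₁ z₀ ε w) (Icc 0 1) + lineInt g (side₂ ε w) (Icc 0 1) +
    lineInt g (side₃ z₀ ε w) (Icc 0 1)

/-- The integral over the contour `C(ε)`, which consists of the curve `γ₁` on `(-∞, 0]` followed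
by the curve `γ₂` on `[0, ∞)`. -/
noncomputable def outerInt (g : ℂ → ℂ) (γ₁ γ₂ : ℝ → ℂ) : ℂ :=
  lineInt g γ₁ (Iic 0) + lineInt g γ₂ (Ici 0)

/-- The curve `γ` is continuous on `I` and continuously differentiable there except at the points
of a locally finite set. -/
def PiecewiseC1 (γ : ℝ → ℂ) (I : Set ℝ) : Prop :=
  ContinuousOn γ I ∧ ∃ P : Set ℝ, (∀ R : ℝ, (P ∩ Icc (-R) R).Finite) ∧
    ∀ s ∈ I \ P, DifferentiableAt ℝ γ s ∧ ContinuousAt (deriv γ) s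

/-- Admissible contours `C(ε)`: the contour avoids the line `Re z = z₀`, and inserting `C_i(ε)`,
which runs from `z₀ - ε` to `z₀ + ε`, makes it a continuous curve. A bounded piece, or an empty
one, is a curve that is eventually, or always, constant. -/
structure IsOuterContour (z₀ ε : ℝ) (γ₁ γ₂ : ℝ → ℂ) : Prop where
  left : PiecewiseC1 γ₁ (Iic 0)
  right : PiecewiseC1 γ₂ (Ici 0)
  left_end : γ₁ 0 = z₀ - ε
  right_start : γ₂ 0 = z₀ + ε
  left_re : ∀ s ≤ 0, (γ₁ s).re ≠ z₀
  right_re : ∀ s ≥ 0, (γ₂ s).re ≠ z₀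

/-- The open rectangle `|Re z - z₀| < r`, `|Im z| < a + r` around the segment
`[z₀ - i a, z₀ + i a]`; it contains all contours `C_i(ε)` with `ε < r`. -/
def rect (a z₀ r : ℝ) : Set ℂ := {z | |z.re - z₀| < r ∧ |z.im| < a + r}

/-- Test functions: near the contours `C_i(ε)` the function is holomorphic in `z` and (jointly)
continuous, `u ^ (-h) f(u, z) → 0` as `u → 0`, and `f` has a majorant `M(u)` there for which the
integral `∫ du/u² ∫ ds (u / (u² + s²)) ^ h M(u)` converges. -/
def IsTestFunction (h a z₀ : ℝ) (f : ℝ → ℂ → ℂ) : Prop :=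
  ∃ r > 0,
    (∀ u > 0, DifferentiableOn ℂ (f u) (rect a z₀ r)) ∧
    ContinuousOn (fun p : ℝ × ℂ => f p.1 p.2) (Ioi 0 ×ˢ rect a z₀ r) ∧
    (∀ z ∈ rect a z₀ r, Tendsto (fun u : ℝ => ((u ^ (-h) : ℝ) : ℂ) * f u z) (𝓝[>] 0) (𝓝 0)) ∧
    ∃ M : ℝ → ℝ, (∀ u > 0, ∀ z ∈ rect a z₀ r, ‖f u z‖ ≤ M u) ∧
      IntegrableOn (fun p : ℝ × ℝ => M p.1 / p.1 ^ 2 * (p.1 / (p.1 ^ 2 + p.2 ^ 2)) ^ h)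
        (Ioi 0 ×ˢ Ioo (-r) r)

/-- The integral of `Ĝ f` over `w`, over `u ∈ (0, ∞)` (with the measure `du/u²`) and over the curve
`Γ w` (which may depend on `w`) converges absolutely. -/
def HatConverges (h a z₀ : ℝ) (f : ℝ → ℂ → ℂ) (Γ : ℂ → ℝ → ℂ) (I : Set ℝ) : Prop :=
  IntegrableOn
    (fun p : ℝ × ℝ × ℝ =>
      ((p.2.1 : ℂ) ^ 2)⁻¹ *
        (Ghat h p.2.1 (Γ (wSeg a z₀ p.1) p.2.2) a z₀ (wSeg a z₀ p.1) *
          f p.2.1 (Γ (wSeg a z₀ p.1) p.2.2) * deriv (Γ (wSeg a z₀ p.1)) p.2.2))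
    (Icc 0 1 ×ˢ Ioi 0 ×ˢ I)

/-- The integral of `G f` over `u ∈ (0, ∞)` (with the measure `du/u²`) and over the curve `γ`
converges absolutely. -/
def BulkConverges (h a z₀ : ℝ) (f : ℝ → ℂ → ℂ) (γ : ℝ → ℂ) (I : Set ℝ) : Prop :=
  IntegrableOn
    (fun p : ℝ × ℝ =>
      ((p.1 : ℂ) ^ 2)⁻¹ * (G h p.1 (γ p.2) a z₀ * f p.1 (γ p.2) * deriv γ p.2))
    (Ioi 0 ×ˢ I)

/-- `∫_0^∞ du/u² ∫_{C(ε)} dz G f`. -/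
noncomputable def bulkIntegral (h a z₀ : ℝ) (f : ℝ → ℂ → ℂ) (γ₁ γ₂ : ℝ → ℂ) : ℂ :=
  ∫ u in Ioi (0 : ℝ), ((u : ℂ) ^ 2)⁻¹ * outerInt (fun z => G h u z a z₀ * f u z) γ₁ γ₂

/-- `∫_{z₀ - i a}^{z₀ + i a} dw ∫_0^∞ du/u² ∫_{C(ε) + C_i(ε)} dz Ĝ f`. -/
noncomputable def hatIntegral (h a z₀ : ℝ) (f : ℝ → ℂ → ℂ) (ε : ℝ) (γ₁ γ₂ : ℝ → ℂ) : ℂ :=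
  lineInt
    (fun w => ∫ u in Ioi (0 : ℝ), ((u : ℂ) ^ 2)⁻¹ *
      (outerInt (fun z => Ghat h u z a z₀ w * f u z) γ₁ γ₂ +
        bumpInt (fun z => Ghat h u z a z₀ w * f u z) z₀ ε w))
    (wSeg a z₀) (Icc 0 1)

/-- The segment from `z₀ - i (u - a)` to `z₀ + i (u - a)`. -/
noncomputable def compactSeg (a z₀ u : ℝ) : ℝ → ℂ :=
  seg (z₀ - Complex.I * (u - a)) (z₀ + Complex.I * (u - a))

/-- `∫_0^a du/u² ∫_{z₀ - i (u - a)}^{z₀ + i (u - a)} dz G̃ f`. -/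
noncomputable def compactIntegral (h a z₀ : ℝ) (f : ℝ → ℂ → ℂ) : ℂ :=
  ∫ u in Ioo (0 : ℝ) a, ((u : ℂ) ^ 2)⁻¹ *
    lineInt (fun z => Gtilde h u z a z₀ * f u z) (compactSeg a z₀ u) (Icc 0 1)

/-- The integral of `G̃ f` over the compact region converges absolutely. -/
def CompactConverges (h a z₀ : ℝ) (f : ℝ → ℂ → ℂ) : Prop :=
  IntegrableOn
    (fun p : ℝ × ℝ =>
      ((p.1 : ℂ) ^ 2)⁻¹ * (Gtilde h p.1 (compactSeg a z₀ p.1 p.2) a z₀ *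
        f p.1 (compactSeg a z₀ p.1 p.2) * deriv (compactSeg a z₀ p.1) p.2))
    (Ioo 0 a ×ˢ Icc 0 1)

end AdS2

namespace AdS2

/-! Put `ζ = z - z₀` and `w = z₀ + i a t`. Then `Ĝ_h` is `cst h` times the weight `(a (1 - t²)) ^ (h
- 1)` times the kernel `(u / (u² + (ζ - i a t)²)) ^ h`. The starting point is `superposition`: for
`Re ζ ≠ 0` the integral of `Ĝ_h` over `w` is `G_h`. For `ζ` on the imaginary axis above `i (a + u)`
everything is real up to a phase, and a Möbius map followed by a binomial expansion produces the
hypergeometric series; the rest is analytic continuation in `ζ`. By Fubini the integrals over `C(ε)`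
then cancel in the difference, which equals minus the contribution of `C_i(ε)`
(`LocalData.bulkIntegral_sub_hatIntegral`). Only the limit of that contribution is at stake.

Fix `u`. As a function of `ζ` the kernel has its cuts on the imaginary axis, at distance at least
`u` from `i a t`. For `0 < h < 1` the branch points are integrable singularities, so the vertical
sides collapse onto the cut and leave the jump of the kernel. Integrated over `t`, the jump becomes,
by a second Möbius map and Euler's integral, the Legendre function `P_{h-1}` of the invariant
distance, and it is supported between the light cones (`sin_mul_integral_outer`,
`tendsto_bumpTotal_of_lt_one`). For larger `h` the jump is not integrable. But moving the contours
from distance `ε` to a fixed distance `δ` costs only an integral of `G_h` along the real axis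
(`bumpTotal_eq_add`), so for `u ≠ a` the limit exists and is holomorphic in `h` on `Re h > 0`. So is
the Legendre integral, and the identity theorem carries the equality to all `h > 0`
(`tendsto_bumpTotal`).

The modified propagator is `cst h * legP h σ` between the light cones (`Gtilde_eq`), by a connection
formula for Legendre functions. In the strip `0 < h < 1` it is read off from the superposition
integral at `ζ = ε → 0`: the part of the `w`-segment between the branch points gives `G_{1-h}`, the
rest gives `P_{h-1}`. It is then continued in `h`. Laplace's integral for `P_{h-1}` is entire in `h`
and so supplies the values at half-integers.

The limit is exchanged with the integral over `u` by dominated convergence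
(`LocalData.exists_norm_bumpTotal_le`): the contour at distance `δ` serves as reference, and the
propagator on the real axis is bounded, uniformly in `u`, by an integrable power of the distance to
the origin. The kernel in the hypothesis on test functions is exactly the size of the kernel on the
horizontal side; it also controls the vertical sides and the Legendre function
(`norm_offKern_le_poisson`, `exists_norm_legP_le`). -/

/-! ### Holomorphic dependence on parameters; Euler's integral for `₂F₁`. -/

/-- A locally dominated integral of a family of holomorphic functions is holomorphic. -/
theorem differentiableOn_integral_of_locally_bounded {α : Type*} [MeasurableSpace α]
    {μ : Measure α} {U : Set ℂ} (hU : IsOpen U) {f : ℂ → α → ℂ}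
    (hmeas : ∀ h ∈ U, AEStronglyMeasurable (f h) μ)
    (hdiff : ∀ᵐ x ∂μ, DifferentiableOn ℂ (fun h => f h x) U)
    (hb : ∀ h₀ ∈ U, ∃ ρ > 0, ∃ bound : α → ℝ, Integrable bound μ ∧
      ∀ᵐ x ∂μ, ∀ h ∈ Metric.ball h₀ ρ, ‖f h x‖ ≤ bound x) :
    DifferentiableOn ℂ (fun h => ∫ x, f h x ∂μ) U := by
  intro h₀ hh₀
  obtain ⟨ρ₁, hρ₁, bound, hbi, hbd⟩ := hb h₀ hh₀
  obtain ⟨ρ₂, hρ₂, hball⟩ := Metric.isOpen_iff.1 hU h₀ hh₀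
  set ρ := min ρ₁ ρ₂ with hρ
  have hρ0 : 0 < ρ := lt_min hρ₁ hρ₂
  have hsub : Metric.ball h₀ ρ ⊆ U := (Metric.ball_subset_ball (min_le_right _ _)).trans hball
  have hsub1 : Metric.ball h₀ ρ ⊆ Metric.ball h₀ ρ₁ := Metric.ball_subset_ball (min_le_left _ _)
  have hmem : h₀ ∈ Metric.ball h₀ ρ := Metric.mem_ball_self hρ0
  -- Since `1/2 + 1/3 < 1`, circles of radius `ρ / 3` about these points stay in the domain, and
  -- Cauchy's estimate turns the bound on `f` into one on its derivative.
  have hcl : ∀ h ∈ Metric.ball h₀ (ρ / 2), Metric.closedBall h (ρ / 3) ⊆ Metric.ball h₀ ρ := by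
    intro h hh z hz
    rw [Metric.mem_ball] at *
    rw [Metric.mem_closedBall] at hz
    linarith [dist_triangle z h h₀]
  have key := hasDerivAt_integral_of_dominated_loc_of_deriv_le (μ := μ) (F := f) (x₀ := h₀)
    (s := Metric.ball h₀ (ρ / 2)) (bound := fun x => bound x / (ρ / 3))
    (F' := fun h x => deriv (fun k => f k x) h)
    (Metric.ball_mem_nhds _ (by positivity))
    (by filter_upwards [hU.mem_nhds hh₀] with h hh using hmeas h hh)
    (hbi.mono' (hmeas _ hh₀) (by filter_upwards [hbd] with x hx using hx _ (hsub1 hmem)))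
    ?_ ?_ (hbi.div_const _) ?_
  · exact key.2.differentiableAt.differentiableWithinAt
  -- The derivative at `h₀` is measurable in `x` as an almost everywhere limit of difference
  -- quotients along a sequence.
  · set s : ℕ → ℂ := fun n => h₀ + ((ρ / 2 * (1 / ((n : ℝ) + 1)) : ℝ) : ℂ) with hs
    have hsu : ∀ n, s n ∈ U := by
      intro n
      apply hsub
      have h1 : 1 / ((n : ℝ) + 1) ≤ 1 := by
        rw [div_le_one (by positivity)]
        linarith [(Nat.cast_nonneg n : (0 : ℝ) ≤ n)]
      have h2 : (0 : ℝ) < 1 / ((n : ℝ) + 1) := by positivity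
      have : dist (s n) h₀ = ρ / 2 * (1 / ((n : ℝ) + 1)) := by
        rw [hs, dist_eq_norm, add_sub_cancel_left, Complex.norm_real, Real.norm_of_nonneg]
        positivity
      rw [Metric.mem_ball, this]
      nlinarith
    refine aestronglyMeasurable_of_tendsto_ae atTop
      (f := fun n x => slope (fun k => f k x) h₀ (s n)) ?_ ?_
    · intro n
      simp only [slope, vsub_eq_sub]
      exact ((hmeas _ (hsu n)).sub (hmeas _ hh₀)).const_smul ((s n - h₀)⁻¹)
    · filter_upwards [hdiff] with x hx
      have hd := ((hx h₀ hh₀).differentiableAt (hU.mem_nhds hh₀)).hasDerivAt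
      refine (hasDerivAt_iff_tendsto_slope.1 hd).comp ?_
      refine tendsto_nhdsWithin_iff.2 ⟨?_, Eventually.of_forall fun n => ?_⟩
      · have h1 : Tendsto (fun n : ℕ => ρ / 2 * (1 / ((n : ℝ) + 1))) atTop (𝓝 (ρ / 2 * 0)) :=
          tendsto_one_div_add_atTop_nhds_zero_nat.const_mul _
        have h2 := (Complex.continuous_ofReal.tendsto _).comp h1
        have h3 := h2.const_add h₀
        simpa [hs, Function.comp_def] using h3
      · have : (0 : ℝ) < ρ / 2 * (1 / ((n : ℝ) + 1)) := by positivity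
        simp only [hs, mem_compl_iff, mem_singleton_iff, add_eq_left]
        exact_mod_cast this.ne'
  · filter_upwards [hdiff, hbd] with x hx hbx h hh
    refine Complex.norm_deriv_le_of_forall_mem_sphere_norm_le (by positivity)
      (DifferentiableOn.diffContOnCl ?_) ?_
    · refine hx.mono ?_
      exact Metric.closure_ball_subset_closedBall.trans ((hcl h hh).trans hsub)
    · intro z hz
      exact hbx z (hsub1 (hcl h hh (Metric.sphere_subset_closedBall hz)))
  · filter_upwards [hdiff] with x hx h hh
    have hhU : h ∈ U := hsub (Metric.ball_subset_ball (by linarith) hh)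
    exact ((hx h hhU).differentiableAt (hU.mem_nhds hhU)).hasDerivAt

/-- The binomial series with rising factorials, the form in which hypergeometric coefficients are
written. -/
theorem hasSum_one_sub_cpow (a : ℂ) {x : ℂ} (hx : ‖x‖ < 1) :
    HasSum (fun n : ℕ => (ascPochhammer ℂ n).eval a / (n.factorial : ℂ) * x ^ n)
      ((1 - x) ^ (-a)) := by
  have h := (Complex.one_div_one_sub_cpow_hasFPowerSeriesOnBall_zero a).hasSum (y := x)
    (by rw [← ENNReal.ofReal_one, Metric.eball_ofReal]; simpa using hx)
  rw [zero_add, one_div, ← Complex.cpow_neg] at h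
  refine (congrArg (fun F => HasSum F ((1 - x) ^ (-a))) (funext fun n => ?_)).mp h
  rw [FormalMultilinearSeries.ofScalars_apply_eq, smul_eq_mul]
  symm
  congr 1
  rw [Ring.choose, show a + n - 1 - n + 1 = a by ring, div_eq_iff
    (by exact_mod_cast n.factorial_ne_zero), ← Polynomial.ascPochhammer_smeval_eq_eval,
    ← Ring.factorial_nsmul_multichoose_eq_ascPochhammer, nsmul_eq_mul, mul_comm]

/-- Common engine of the hypergeometric evaluations: expand binomially and integrate term by term,
which is legitimate because the series at `‖x‖` converges absolutely. Only the moments of `T` remain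
to be computed; this serves Euler's integral, the even weight on `[-1, 1]` and the Fourier expansion
behind Laplace's integral. -/
theorem hasSum_integral_mul_one_sub_cpow {α : Type*} [MeasurableSpace α] {μ : Measure α}
    {φ T : α → ℂ} (hφ : Integrable φ μ) (hT : AEStronglyMeasurable T μ)
    (hT1 : ∀ᵐ ω ∂μ, ‖T ω‖ ≤ 1) (a : ℂ) {x : ℂ} (hx : ‖x‖ < 1) :
    HasSum (fun n : ℕ => (ascPochhammer ℂ n).eval a / (n.factorial : ℂ) * x ^ n *
      ∫ ω, φ ω * T ω ^ n ∂μ) (∫ ω, φ ω * (1 - x * T ω) ^ (-a) ∂μ) := by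
  set c : ℕ → ℂ := fun n => (ascPochhammer ℂ n).eval a / (n.factorial : ℂ) * x ^ n with hc
  have hsum : Summable fun n => ‖c n‖ := by
    have := (hasSum_one_sub_cpow a (x := (‖x‖ : ℂ)) (by simpa using hx)).summable.norm
    refine this.congr fun n => ?_
    simp [hc]
  have hint : ∀ n, Integrable (fun ω => φ ω * T ω ^ n) μ := by
    intro n
    refine hφ.mono (hφ.1.mul (hT.pow n)) ?_
    filter_upwards [hT1] with ω hω
    rw [norm_mul, norm_pow]
    exact mul_le_of_le_one_right (norm_nonneg _) (pow_le_one₀ (norm_nonneg _) hω)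
  have key := hasSum_integral_of_summable_integral_norm (μ := μ)
    (F := fun n ω => c n * (φ ω * T ω ^ n)) (fun n => (hint n).const_mul _) ?_
  · have e : ∫ ω, φ ω * (1 - x * T ω) ^ (-a) ∂μ = ∫ ω, ∑' n, c n * (φ ω * T ω ^ n) ∂μ := by
      refine integral_congr_ae ?_
      filter_upwards [hT1] with ω hω
      have hlt : ‖x * T ω‖ < 1 := by
        rw [norm_mul]
        exact (mul_le_of_le_one_right (norm_nonneg _) hω).trans_lt hx
      have h := (hasSum_one_sub_cpow a hlt).mul_left (φ ω)
      rw [← h.tsum_eq]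
      refine tsum_congr fun n => ?_
      simp only [hc, mul_pow]
      ring
    rw [e]
    refine (congrArg (fun F => HasSum F _) (funext fun n => ?_)).mp key
    rw [integral_const_mul]
  · refine Summable.of_nonneg_of_le (fun n => integral_nonneg fun ω => norm_nonneg _) (fun n => ?_)
      (hsum.mul_right (∫ ω, ‖φ ω‖ ∂μ))
    simp only [norm_mul (c n)]
    rw [integral_const_mul]
    refine mul_le_mul_of_nonneg_left ?_ (norm_nonneg _)
    refine integral_mono_ae (hint n).norm hφ.norm ?_
    filter_upwards [hT1] with ω hω
    rw [norm_mul, norm_pow]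
    exact mul_le_of_le_one_right (norm_nonneg _) (pow_le_one₀ (norm_nonneg _) hω)

/-- The moments of Euler's weight. Both `b` and `c` shift by `n` while `c - b` stays, hence a
quotient of rising factorials. -/
theorem betaIntegral_add_nat {b c : ℂ} (hb : 0 < b.re) (hcb : 0 < (c - b).re) (n : ℕ) :
    Complex.betaIntegral (b + n) (c - b) =
      (Complex.Gamma b * Complex.Gamma (c - b) / Complex.Gamma c) *
        ((ascPochhammer ℂ n).eval b * ((ascPochhammer ℂ n).eval c)⁻¹) := by
  have hc : 0 < c.re := by
    have := Complex.sub_re c b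
    linarith
  have hne : ∀ z : ℂ, 0 < z.re → ∀ k : ℕ, z ≠ -k := by
    intro z hz k h
    rw [h] at hz
    simp at hz
    linarith [(Nat.cast_nonneg k : (0 : ℝ) ≤ k)]
  have hbn : 0 < (b + n).re := by simp; positivity
  rw [Complex.betaIntegral_eq_Gamma_mul_div _ _ hbn hcb, show b + n + (c - b) = c + n by ring,
    ← Complex.Gamma_add_nat_div_Gamma_eq b (hne b hb), ← Complex.Gamma_add_nat_div_Gamma_eq c
    (hne c hc)]
  have h1 := Complex.Gamma_ne_zero_of_re_pos hb
  have h2 := Complex.Gamma_ne_zero_of_re_pos hc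
  have h3 : Complex.Gamma (c + n) ≠ 0 := Complex.Gamma_ne_zero_of_re_pos (by simp; positivity)
  field_simp

theorem hyp_eq_tsum (a b c x : ℂ) : ordinaryHypergeometric a b c x =
    ∑' n : ℕ, ordinaryHypergeometricCoefficient a b c n * x ^ n := by
  rw [ordinaryHypergeometric_eq_tsum]
  simp [ordinaryHypergeometricCoefficient]

/-- Euler's integral representation, in the unit disc. -/
theorem integral_euler_eq_hyp {a b c : ℂ} (hb : 0 < b.re) (hcb : 0 < (c - b).re) {x : ℂ}
    (hx : ‖x‖ < 1) :
    ∫ t in (0 : ℝ)..1, (t : ℂ) ^ (b - 1) * ((1 - t : ℝ) : ℂ) ^ (c - b - 1) * (1 - x * t) ^ (-a) =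
      Complex.Gamma b * Complex.Gamma (c - b) / Complex.Gamma c *
        ordinaryHypergeometric a b c x := by
  have hconv := Complex.betaIntegral_convergent hb hcb
  rw [intervalIntegrable_iff_integrableOn_Ioc_of_le zero_le_one] at hconv
  have h := hasSum_integral_mul_one_sub_cpow (T := fun t : ℝ => (t : ℂ)) hconv
    (Complex.continuous_ofReal.aestronglyMeasurable)
    (by
      filter_upwards [ae_restrict_mem measurableSet_Ioc] with t ht
      simpa [abs_of_pos ht.1] using ht.2) a hx
  rw [intervalIntegral.integral_of_le zero_le_one]
  push_cast
  rw [← h.tsum_eq, hyp_eq_tsum, ← tsum_mul_left]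
  refine tsum_congr fun n => ?_
  have : ∫ t in Ioc (0 : ℝ) 1, (t : ℂ) ^ (b - 1) * (1 - (t : ℂ)) ^ (c - b - 1) * (t : ℂ) ^ n =
      Complex.betaIntegral (b + n) (c - b) := by
    rw [Complex.betaIntegral, intervalIntegral.integral_of_le zero_le_one]
    refine setIntegral_congr_fun measurableSet_Ioc fun t ht => ?_
    have ht0 : (t : ℂ) ≠ 0 := by exact_mod_cast ht.1.ne'
    rw [show b + n - 1 = b - 1 + n by ring, Complex.cpow_add _ _ ht0, Complex.cpow_natCast]
    ring
  rw [this, betaIntegral_add_nat hb hcb, ordinaryHypergeometricCoefficient]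
  ring

/-- If `x t` is real and at least `1` with `0 ≤ t ≤ 1`, then `x` itself is real and at least `1`. So
the power in Euler's integrand never meets its cut. -/
theorem one_sub_mul_mem_slitPlane {x : ℂ} (hx : ∀ y : ℝ, 1 ≤ y → x ≠ y) {t : ℝ}
    (ht : t ∈ Icc (0 : ℝ) 1) : 1 - x * t ∈ Complex.slitPlane := by
  rw [Complex.mem_slitPlane_iff]
  by_contra! hcon
  obtain ⟨h1, h2⟩ := hcon
  simp at h1 h2
  rcases eq_or_lt_of_le ht.1 with h0 | h0
  · rw [← h0] at h1; simp at h1; linarith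
  · have him : x.im = 0 := by
      rcases h2 with h | h
      · exact h
      · exact absurd h h0.ne'
    refine hx x.re ?_ (Complex.ext (by simp) (by simp [him]))
    by_contra! hlt
    have : x.re * t < 1 := by nlinarith [ht.2]
    linarith

/-- `hyp2F1` is given by Euler's integral on the whole cut plane. -/
theorem hyp2F1_eq_integral {a b c : ℂ} (hb : 0 < b.re) (hcb : 0 < (c - b).re) (x : ℂ) :
    hyp2F1 a b c x = Complex.Gamma c / (Complex.Gamma b * Complex.Gamma (c - b)) *
    ∫ t in (0 : ℝ)..1, (t : ℂ) ^ (b - 1) * ((1 - t : ℝ) : ℂ) ^ (c - b - 1) *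
      (1 - x * t) ^ (-a) := by
  unfold hyp2F1
  split_ifs with h
  · rw [integral_euler_eq_hyp hb hcb h]
    have h1 := Complex.Gamma_ne_zero_of_re_pos hb
    have h2 := Complex.Gamma_ne_zero_of_re_pos hcb
    have h3 : Complex.Gamma c ≠ 0 := Complex.Gamma_ne_zero_of_re_pos
      (by have := Complex.sub_re c b; linarith)
    field_simp
  · rfl

theorem isOpen_cutPlane : IsOpen {x : ℂ | ∀ y : ℝ, 1 ≤ y → x ≠ y} := by
  have : {x : ℂ | ∀ y : ℝ, 1 ≤ y → x ≠ y} = (fun x : ℂ => 1 - x) ⁻¹' Complex.slitPlane := by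
    ext x
    constructor
    · intro hx
      simpa using one_sub_mul_mem_slitPlane hx (t := 1) (by simp)
    · intro hx y hy hxy
      rw [mem_preimage, hxy, Complex.mem_slitPlane_iff] at hx
      simp at hx
      linarith
  rw [this]
  exact Complex.isOpen_slitPlane.preimage (by fun_prop)

/-- Both branches of the definition of `hyp2F1` are the same Euler integral, so no gluing across the
unit circle is needed. -/
theorem differentiableOn_hyp2F1 {a b c : ℂ} (hb : 0 < b.re) (hcb : 0 < (c - b).re) :
    DifferentiableOn ℂ (hyp2F1 a b c) {x : ℂ | ∀ y : ℝ, 1 ≤ y → x ≠ y} := by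
  have hfun : hyp2F1 a b c = fun x => Complex.Gamma c / (Complex.Gamma b * Complex.Gamma (c - b)) *
      ∫ t in Ioc (0 : ℝ) 1, (t : ℂ) ^ (b - 1) * ((1 - t : ℝ) : ℂ) ^ (c - b - 1) *
      (1 - x * t) ^ (-a) := by
    ext x
    rw [hyp2F1_eq_integral hb hcb, intervalIntegral.integral_of_le zero_le_one]
  rw [hfun]
  refine DifferentiableOn.const_mul ?_ _
  have hconv := Complex.betaIntegral_convergent hb hcb
  rw [intervalIntegrable_iff_integrableOn_Ioc_of_le zero_le_one] at hconv
  have hconv' : IntegrableOn (fun t : ℝ => (t : ℂ) ^ (b - 1) * ((1 - t : ℝ) : ℂ) ^ (c - b - 1))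
      (Ioc 0 1) := by
    refine hconv.congr_fun (fun t _ => ?_) measurableSet_Ioc
    push_cast
    rfl
  refine differentiableOn_integral_of_locally_bounded isOpen_cutPlane ?_ ?_ ?_
  · intro x hx
    refine hconv'.1.mul ?_
    refine ContinuousOn.aestronglyMeasurable ?_ measurableSet_Ioc
    intro t ht
    refine ContinuousWithinAt.cpow (by fun_prop) continuousWithinAt_const ?_
    exact one_sub_mul_mem_slitPlane hx (Ioc_subset_Icc_self ht)
  · filter_upwards [ae_restrict_mem measurableSet_Ioc] with t ht x hx
    refine DifferentiableWithinAt.const_mul ?_ _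
    refine DifferentiableWithinAt.cpow_const (by fun_prop) ?_
    exact one_sub_mul_mem_slitPlane hx (Ioc_subset_Icc_self ht)
  · intro x₀ hx₀
    obtain ⟨ρ, hρ, hball⟩ := Metric.isOpen_iff.1 isOpen_cutPlane x₀ hx₀
    have hcl : Metric.closedBall x₀ (ρ / 2) ⊆ {x : ℂ | ∀ y : ℝ, 1 ≤ y → x ≠ y} :=
      (Metric.closedBall_subset_ball (by linarith)).trans hball
    have hcont : ContinuousOn (fun p : ℂ × ℝ => (1 - p.1 * p.2) ^ (-a))
        (Metric.closedBall x₀ (ρ / 2) ×ˢ Icc 0 1) := by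
      intro p hp
      refine ContinuousWithinAt.cpow (by fun_prop) continuousWithinAt_const ?_
      exact one_sub_mul_mem_slitPlane (hcl hp.1) hp.2
    obtain ⟨C, hC⟩ := ((isCompact_closedBall x₀ (ρ / 2)).prod
      isCompact_Icc).exists_bound_of_continuousOn hcont
    refine ⟨ρ / 2, by positivity, _, hconv'.norm.mul_const C, ?_⟩
    filter_upwards [ae_restrict_mem measurableSet_Ioc] with t ht x hx
    rw [norm_mul]
    exact mul_le_mul_of_nonneg_left
      (hC (x, t) ⟨Metric.ball_subset_closedBall hx, Ioc_subset_Icc_self ht⟩) (norm_nonneg _)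


/-! ### The weight `(1 - t²) ^ (h - 1)`: moments and Möbius maps. -/

/-- The factors of even and odd index are separated; this is the origin of the parameters `h / 2`
and `h / 2 + 1 / 2`. -/
theorem ascPochhammer_eval_two_mul (h : ℂ) (k : ℕ) :
    (ascPochhammer ℂ (2 * k)).eval h =
      4 ^ k * (ascPochhammer ℂ k).eval (h / 2) * (ascPochhammer ℂ k).eval (h / 2 + 1 / 2) := by
  induction k with
  | zero => simp
  | succ k ih =>
    rw [show 2 * (k + 1) = 2 * k + 1 + 1 by ring]
    simp only [ascPochhammer_succ_eval, ih]
    push_cast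
    ring

theorem intervalIntegral_symm_split {f : ℝ → ℂ} (hf : IntervalIntegrable f volume (-1) 1) :
    ∫ t in (-1 : ℝ)..1, f t = ∫ t in (0 : ℝ)..1, (f t + f (-t)) := by
  have h1 : IntervalIntegrable f volume (-1) 0 :=
    hf.mono_set (by
      rw [uIcc_of_le (by norm_num), uIcc_of_le (by norm_num)]
      exact Icc_subset_Icc_right (by norm_num))
  have h2 : IntervalIntegrable f volume 0 1 :=
    hf.mono_set (by
      rw [uIcc_of_le (by norm_num), uIcc_of_le (by norm_num)]
      exact Icc_subset_Icc_left (by norm_num))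
  have h3 : IntervalIntegrable (fun t => f (-t)) volume 0 1 := by
    simpa using ((IntervalIntegrable.iff_comp_neg (f := f)).1 h1).symm
  rw [← intervalIntegral.integral_add_adjacent_intervals h1 h2, intervalIntegral.integral_add h2 h3,
    intervalIntegral.integral_comp_neg]
  simp [add_comm]

/-- The Gegenbauer weight `(1 - t²) ^ (h - 1)`. -/
theorem integrable_weight {h : ℂ} (hh : 0 < h.re) :
    IntervalIntegrable (fun t : ℝ => ((1 - t ^ 2 : ℝ) : ℂ) ^ (h - 1)) volume (-1) 1 := by
  -- The substitution `(t + 1) / 2` turns the Beta weight with both exponents `h - 1` into this one,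
  -- up to the factor `4 ^ (h - 1)`.
  have hb := (Complex.betaIntegral_convergent hh hh).comp_add_right (c := (1 / 2 : ℝ))
  have hb2 := hb.comp_mul_left (c := (1 / 2 : ℝ))
  norm_num at hb2
  have h4 := hb2.const_mul ((4 : ℂ) ^ (h - 1))
  refine h4.congr (fun t ht => ?_)
  rw [uIoc_of_le (by norm_num)] at ht
  have h1 : (0 : ℝ) ≤ 1 / 2 * t + 1 / 2 := by linarith [ht.1]
  have h2 : (0 : ℝ) ≤ 1 - (1 / 2 * t + 1 / 2) := by linarith [ht.2]
  have e1 : ((1 : ℂ) / 2 * t + 1 / 2) = ((1 / 2 * t + 1 / 2 : ℝ) : ℂ) := by push_cast; ring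
  have e2 : (1 - ((1 / 2 * t + 1 / 2 : ℝ) : ℂ)) = ((1 - (1 / 2 * t + 1 / 2) : ℝ) : ℂ) := by
    push_cast; ring
  have e3 : (4 : ℂ) = ((4 : ℝ) : ℂ) := by norm_num
  rw [e1, e2, ← Complex.mul_cpow_ofReal_nonneg h1 h2, ← Complex.ofReal_mul, e3,
    ← Complex.mul_cpow_ofReal_nonneg (by norm_num) (by positivity), ← Complex.ofReal_mul]
  congr 2
  ring

/-- Folding at `0` and substituting `x = t²` gives a Beta integral. -/
theorem integral_weight_mul_pow_even {h : ℂ} (hh : 0 < h.re) (k : ℕ) :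
    ∫ t in (-1 : ℝ)..1, ((1 - t ^ 2 : ℝ) : ℂ) ^ (h - 1) * (t : ℂ) ^ (2 * k) =
      Complex.betaIntegral (1 / 2 + k) h := by
  have hint : IntervalIntegrable (fun t : ℝ => ((1 - t ^ 2 : ℝ) : ℂ) ^ (h - 1) * (t : ℂ) ^ (2 * k))
      volume (-1) 1 := (integrable_weight hh).mul_continuousOn (by fun_prop)
  rw [intervalIntegral_symm_split hint, Complex.betaIntegral,
    intervalIntegral.integral_of_le zero_le_one, intervalIntegral.integral_of_le zero_le_one,
    integral_Ioc_eq_integral_Ioo, integral_Ioc_eq_integral_Ioo]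
  have himg : (fun t : ℝ => t ^ 2) '' Ioo 0 1 = Ioo 0 1 := by
    ext x
    constructor
    · rintro ⟨t, ht, rfl⟩
      exact ⟨by have := ht.1; positivity, by have := ht.1; have := ht.2; simp only; nlinarith⟩
    · intro hx
      refine ⟨√x, ⟨Real.sqrt_pos.2 hx.1, ?_⟩, Real.sq_sqrt hx.1.le⟩
      rw [Real.sqrt_lt' one_pos]
      simpa using hx.2
  have hcv := integral_image_eq_integral_abs_deriv_smul (s := Ioo (0 : ℝ) 1)
    (f := fun t : ℝ => t ^ 2) (f' := fun t => 2 * t) measurableSet_Ioo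
    (fun t _ => by simpa using (hasDerivAt_pow 2 t).hasDerivWithinAt)
    (fun x hx y hy hxy => by
      have := hx.1; have := hy.1
      simpa using (pow_left_inj₀ (by linarith) (by linarith) two_ne_zero).1 hxy)
    (fun x : ℝ => (x : ℂ) ^ ((1 / 2 : ℂ) + k - 1) * (1 - (x : ℂ)) ^ (h - 1))
  rw [himg] at hcv
  rw [hcv]
  refine setIntegral_congr_fun measurableSet_Ioo fun t ht => ?_
  have ht0 : (t : ℂ) ≠ 0 := by exact_mod_cast ht.1.ne'
  have e1 : ((t ^ 2 : ℝ) : ℂ) ^ ((1 / 2 : ℂ) + k - 1) = (t : ℂ) ^ (2 * k) * (t : ℂ)⁻¹ := by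
    rw [pow_two, Complex.ofReal_mul, Complex.mul_cpow_ofReal_nonneg ht.1.le ht.1.le,
      ← Complex.cpow_add _ _ ht0, show (1 / 2 : ℂ) + k - 1 + (1 / 2 + k - 1) = ((2 * k : ℕ) : ℂ) - 1 by
        push_cast; ring, Complex.cpow_sub _ _ ht0, Complex.cpow_natCast, Complex.cpow_one]
    rfl
  rw [e1, abs_of_pos (by linarith [ht.1]), Complex.real_smul, show (-t) ^ 2 = t ^ 2 by ring]
  push_cast
  rw [show (-(t : ℂ)) ^ (2 * k) = (t : ℂ) ^ (2 * k) by rw [pow_mul, pow_mul]; ring]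
  field_simp
  ring

theorem integral_weight_mul_pow_odd {h : ℂ} (hh : 0 < h.re) (k : ℕ) :
    ∫ t in (-1 : ℝ)..1, ((1 - t ^ 2 : ℝ) : ℂ) ^ (h - 1) * (t : ℂ) ^ (2 * k + 1) = 0 := by
  have hint : IntervalIntegrable
      (fun t : ℝ => ((1 - t ^ 2 : ℝ) : ℂ) ^ (h - 1) * (t : ℂ) ^ (2 * k + 1))
      volume (-1) 1 := (integrable_weight hh).mul_continuousOn (by fun_prop)
  rw [intervalIntegral_symm_split hint]
  simp [pow_succ, pow_mul]

/-- Factor out `σ` and expand in `1 / σ`. The odd moments vanish, and in the even terms the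
duplication of `(h)_{2k}` and of `(2k)!` leaves the coefficients of `₂F₁` in `1 / σ²`. -/
theorem integral_weight_mul_sub_cpow {h : ℝ} (hh : 0 < h) {σ : ℝ} (hσ : 1 < σ) :
    ∫ t in (-1 : ℝ)..1, ((1 - t ^ 2 : ℝ) : ℂ) ^ ((h : ℂ) - 1) * ((σ - t : ℝ) : ℂ) ^ (-(h : ℂ)) =
      Complex.Gamma (1 / 2) * Complex.Gamma h / Complex.Gamma (h + 1 / 2) *
        ((σ : ℂ) ^ (-(h : ℂ)) *
          ordinaryHypergeometric ((h : ℂ) / 2) ((h : ℂ) / 2 + 1 / 2) ((h : ℂ) + 1 / 2)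
            ((1 / (σ : ℂ)) ^ 2)) := by
  have hre : 0 < (h : ℂ).re := by simpa using hh
  have hσ0 : 0 < σ := by linarith
  have hw := integrable_weight hre
  rw [intervalIntegrable_iff_integrableOn_Ioc_of_le (by norm_num)] at hw
  have hx : ‖1 / (σ : ℂ)‖ < 1 := by
    rw [norm_div, norm_one, Complex.norm_real, Real.norm_of_nonneg hσ0.le, div_lt_one hσ0]
    exact hσ
  have hs := hasSum_integral_mul_one_sub_cpow (T := fun t : ℝ => (t : ℂ)) hw
    (Complex.continuous_ofReal.aestronglyMeasurable)
    (by
      filter_upwards [ae_restrict_mem measurableSet_Ioc] with t ht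
      simpa using abs_le.2 ⟨ht.1.le, ht.2⟩) h hx
  have hI : ∫ t in (-1 : ℝ)..1, ((1 - t ^ 2 : ℝ) : ℂ) ^ ((h : ℂ) - 1) *
      ((σ - t : ℝ) : ℂ) ^ (-(h : ℂ)) = (σ : ℂ) ^ (-(h : ℂ)) *
      ∫ t in Ioc (-1 : ℝ) 1, ((1 - t ^ 2 : ℝ) : ℂ) ^ ((h : ℂ) - 1) *
        (1 - 1 / (σ : ℂ) * t) ^ (-(h : ℂ)) := by
    rw [intervalIntegral.integral_of_le (by norm_num), ← integral_const_mul]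
    refine setIntegral_congr_fun measurableSet_Ioc fun t ht => ?_
    have e : ((σ - t : ℝ) : ℂ) = ((σ * (1 - t / σ) : ℝ) : ℂ) := by
      congr 1
      field_simp
    have h1 : 0 ≤ 1 - t / σ := by
      rw [sub_nonneg, div_le_one hσ0]
      linarith [ht.2]
    rw [e, Complex.ofReal_mul, Complex.mul_cpow_ofReal_nonneg hσ0.le h1]
    push_cast
    rw [show (1 : ℂ) - t / σ = 1 - 1 / σ * t by ring]
    ring
  rw [hI, mul_left_comm]
  congr 1
  have hev := (mul_right_injective₀ (two_ne_zero (α := ℕ))).hasSum_iff (a := ∫ t in Ioc (-1 : ℝ) 1,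
      ((1 - t ^ 2 : ℝ) : ℂ) ^ ((h : ℂ) - 1) * (1 - 1 / (σ : ℂ) * t) ^ (-(h : ℂ)))
      (f := fun n : ℕ => (ascPochhammer ℂ n).eval (h : ℂ) / (n.factorial : ℂ) * (1 / (σ : ℂ)) ^ n *
      ∫ t in Ioc (-1 : ℝ) 1, ((1 - t ^ 2 : ℝ) : ℂ) ^ ((h : ℂ) - 1) * (t : ℂ) ^ n) (by
    intro n hn
    have hodd : Odd n := by
      rw [← Nat.not_even_iff_odd]
      rintro ⟨k, rfl⟩
      exact hn ⟨k, by ring⟩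
    obtain ⟨k, rfl⟩ := hodd
    have := integral_weight_mul_pow_odd hre k
    rw [intervalIntegral.integral_of_le (by norm_num)] at this
    rw [this, mul_zero])
  rw [← (hev.2 hs).tsum_eq, hyp_eq_tsum, ← tsum_mul_left]
  refine tsum_congr fun k => ?_
  have hev' := integral_weight_mul_pow_even hre k
  rw [intervalIntegral.integral_of_le (by norm_num)] at hev'
  simp only [Function.comp]
  rw [hev']
  have hB := betaIntegral_add_nat (b := 1 / 2) (c := (h : ℂ) + 1 / 2) (by norm_num)
    (by simpa using hh) k
  rw [add_sub_cancel_right] at hB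
  rw [hB, ordinaryHypergeometricCoefficient, ascPochhammer_eval_two_mul]
  -- Duplication at `h = 1`; the factor `(1/2)_k` cancels the one in the Beta moment.
  have hfac : (((2 * k).factorial : ℕ) : ℂ) =
      4 ^ k * (ascPochhammer ℂ k).eval (1 / 2) * (k.factorial : ℂ) := by
    have := ascPochhammer_eval_two_mul 1 k
    rw [ascPochhammer_eval_one, show (1 : ℂ) / 2 + 1 / 2 = 1 by norm_num,
      ascPochhammer_eval_one] at this
    exact this
  have hne : (ascPochhammer ℂ k).eval (1 / 2 : ℂ) ≠ 0 := by
    intro h0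
    rw [h0] at hfac
    simp at hfac
    exact (Nat.factorial_ne_zero _) hfac
  have hk : (k.factorial : ℂ) ≠ 0 := by exact_mod_cast k.factorial_ne_zero
  rw [hfac, ← pow_mul]
  field_simp

/-- Möbius change of variables fixing `±1`. -/
theorem integral_moebius {h β k σ : ℝ} (hβ : |β| < 1) (hk : 0 < k) (hσ : 1 ≤ σ) {B : ℝ → ℝ}
    (hB : ∀ τ ∈ Ioo (-1 : ℝ) 1,
      B ((τ + β) / (1 + β * τ)) * (1 + β * τ) ^ 2 = (1 - β ^ 2) * (k * (σ - τ))) :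
    ∫ t in Ioo (-1 : ℝ) 1, (1 - t ^ 2) ^ (h - 1) * B t ^ (-h) =
      k ^ (-h) * ∫ t in Ioo (-1 : ℝ) 1, (1 - t ^ 2) ^ (h - 1) * (σ - t) ^ (-h) := by
  obtain ⟨hβ1, hβ2⟩ := abs_lt.1 hβ
  have hpos : ∀ τ ∈ Ioo (-1 : ℝ) 1, 0 < 1 + β * τ := by
    intro τ hτ
    nlinarith [hτ.1, hτ.2, mul_pos (sub_pos.2 hτ.2) (sub_pos.2 hβ2),
      mul_pos (sub_pos.2 hτ.1) (sub_pos.2 hβ1), mul_pos (sub_pos.2 hτ.2) (sub_pos.2 hβ1),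
      mul_pos (sub_pos.2 hτ.1) (sub_pos.2 hβ2)]
  have hβsq : 0 < 1 - β ^ 2 := by nlinarith
  have himg : (fun τ : ℝ => (τ + β) / (1 + β * τ)) '' Ioo (-1) 1 = Ioo (-1) 1 := by
    ext x
    constructor
    · rintro ⟨τ, hτ, rfl⟩
      have := hpos τ hτ
      constructor
      · simp only [lt_div_iff₀ this]
        nlinarith [hτ.1, hτ.2]
      · simp only [div_lt_iff₀ this]
        nlinarith [hτ.1, hτ.2]
    · intro hx
      have h1 : 0 < 1 - β * x := by
        nlinarith [hx.1, hx.2, mul_pos (sub_pos.2 hx.2) (sub_pos.2 hβ2),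
          mul_pos (sub_pos.2 hx.1) (sub_pos.2 hβ1), mul_pos (sub_pos.2 hx.2) (sub_pos.2 hβ1),
          mul_pos (sub_pos.2 hx.1) (sub_pos.2 hβ2)]
      refine ⟨(x - β) / (1 - β * x), ⟨?_, ?_⟩, ?_⟩
      · rw [lt_div_iff₀ h1]
        nlinarith [hx.1, hx.2]
      · rw [div_lt_iff₀ h1]
        nlinarith [hx.1, hx.2]
      · have h2 : 1 + β * ((x - β) / (1 - β * x)) ≠ 0 := by
          rw [show 1 + β * ((x - β) / (1 - β * x)) = (1 - β ^ 2) / (1 - β * x) by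
            field_simp; ring]
          positivity
        simp only
        have h1' := h1.ne'
        rw [div_eq_iff h2, div_add' _ _ _ h1', mul_add, mul_one, ← mul_div_assoc, ← mul_div_assoc]
        rw [add_comm x, div_add' _ _ _ h1']
        congr 1
        ring
  have hcv := integral_image_eq_integral_abs_deriv_smul (s := Ioo (-1 : ℝ) 1)
    (f := fun τ : ℝ => (τ + β) / (1 + β * τ)) (f' := fun τ => (1 - β ^ 2) / (1 + β * τ) ^ 2)
    measurableSet_Ioo
    (fun τ hτ => by
      have h1 : HasDerivAt (fun τ : ℝ => τ + β) 1 τ := (hasDerivAt_id τ).add_const β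
      have h2 : HasDerivAt (fun τ : ℝ => 1 + β * τ) β τ := by
        simpa using ((hasDerivAt_id τ).const_mul β).const_add 1
      have := (h1.div h2 (hpos τ hτ).ne').hasDerivWithinAt (s := Ioo (-1) 1)
      refine this.congr_deriv ?_
      ring)
    (fun x hx y hy hxy => by
      have h1 := hpos x hx
      have h2 := hpos y hy
      simp only at hxy
      rw [div_eq_div_iff h1.ne' h2.ne'] at hxy
      have : (1 - β ^ 2) * (x - y) = 0 := by linarith
      rcases mul_eq_zero.1 this with h | h
      · exact absurd h hβsq.ne'
      · linarith)
    (fun t => (1 - t ^ 2) ^ (h - 1) * B t ^ (-h))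
  rw [himg] at hcv
  rw [hcv, ← integral_const_mul]
  refine setIntegral_congr_fun measurableSet_Ioo fun τ hτ => ?_
  have hp := hpos τ hτ
  have hp2 : 0 < (1 + β * τ) ^ 2 := by positivity
  have hτ2 : 0 < 1 - τ ^ 2 := by nlinarith [hτ.1, hτ.2]
  have hst : 0 < σ - τ := by linarith [hτ.2]
  have e1 : 1 - ((τ + β) / (1 + β * τ)) ^ 2 = (1 - β ^ 2) * (1 - τ ^ 2) / (1 + β * τ) ^ 2 := by
    have hp' := hp.ne'
    rw [div_pow, eq_div_iff hp2.ne', sub_mul, div_mul_cancel₀ _ hp2.ne']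
    ring
  have e2 : B ((τ + β) / (1 + β * τ)) = (1 - β ^ 2) * (k * (σ - τ)) / (1 + β * τ) ^ 2 := by
    rw [eq_div_iff hp2.ne', hB τ hτ]
  simp only [smul_eq_mul]
  rw [abs_of_pos (by positivity), e1, e2, Real.div_rpow (by positivity) hp2.le,
    Real.div_rpow (by positivity) hp2.le, Real.mul_rpow hβsq.le hτ2.le,
    Real.mul_rpow hβsq.le (by positivity), Real.mul_rpow hk.le hst.le]
  -- The Jacobian, the weight and `B` contribute the exponents `1`, `h - 1` and `-h`, whose sum is
  -- zero, so `1 - β²` and `(1 + β τ)²` both drop out.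
  have e3 : (1 - β ^ 2) * ((1 - β ^ 2) ^ (h - 1) * (1 - β ^ 2) ^ (-h)) = 1 := by
    rw [← Real.rpow_add hβsq, show h - 1 + -h = -1 by ring, Real.rpow_neg_one]
    field_simp
  have e4 : ((1 + β * τ) ^ 2) * (((1 + β * τ) ^ 2) ^ (h - 1) * ((1 + β * τ) ^ 2) ^ (-h)) = 1 := by
    rw [← Real.rpow_add hp2, show h - 1 + -h = -1 by ring, Real.rpow_neg_one]
    field_simp
  have p1 : ((1 + β * τ) ^ 2) ^ (h - 1) ≠ 0 := (Real.rpow_pos_of_pos hp2 _).ne'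
  have p2 : ((1 + β * τ) ^ 2) ^ (-h) ≠ 0 := (Real.rpow_pos_of_pos hp2 _).ne'
  set X := ((1 + β * τ) ^ 2) ^ (h - 1)
  set Y := ((1 + β * τ) ^ 2) ^ (-h)
  set Z := (1 - β ^ 2) ^ (h - 1)
  set W := (1 - β ^ 2) ^ (-h)
  calc _ = ((1 - β ^ 2) * (Z * W)) / ((1 + β * τ) ^ 2 * (X * Y)) *
        (k ^ (-h) * ((1 - τ ^ 2) ^ (h - 1) * (σ - τ) ^ (-h))) := by
        field_simp
    _ = _ := by rw [e3, e4]; ring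


/-! ### The superposition formula: `G_h` as an integral of `Ĝ_h` over `w`. -/

/-- For an integrable weight times a jointly continuous kernel, compactness of the parameter set
supplies the local bounds. -/
theorem differentiableOn_integral_mul_of_continuousOn {α : Type*} [TopologicalSpace α]
    [SecondCountableTopology α] [TopologicalSpace.PseudoMetrizableSpace α]
    [MeasurableSpace α] [OpensMeasurableSpace α] {μ : Measure α} {U : Set ℂ} (hU : IsOpen U)
    {K s : Set α} (hK : IsCompact K) (hs : MeasurableSet s) (hsK : s ⊆ K)
    {φ : α → ℂ} (hφ : IntegrableOn φ s μ) {f : ℂ → α → ℂ}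
    (hf : ContinuousOn (fun p : ℂ × α => f p.1 p.2) (U ×ˢ K))
    (hd : ∀ t ∈ s, DifferentiableOn ℂ (fun z => f z t) U) :
    DifferentiableOn ℂ (fun z => ∫ t in s, φ t * f z t ∂μ) U := by
  refine differentiableOn_integral_of_locally_bounded hU ?_ ?_ ?_
  · intro z hz
    refine hφ.1.mul (ContinuousOn.aestronglyMeasurable ?_ hs)
    exact hf.comp (f := fun t => (z, t)) (by fun_prop) (fun t ht => ⟨hz, hsK ht⟩)
  · filter_upwards [ae_restrict_mem hs] with t ht
    exact (hd t ht).const_mul _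
  · intro z₀ hz₀
    obtain ⟨ρ, hρ, hball⟩ := Metric.isOpen_iff.1 hU z₀ hz₀
    have hcl : Metric.closedBall z₀ (ρ / 2) ⊆ U :=
      (Metric.closedBall_subset_ball (by linarith)).trans hball
    obtain ⟨C, hC⟩ := ((isCompact_closedBall z₀ (ρ / 2)).prod hK).exists_bound_of_continuousOn
      (hf.mono (prod_mono hcl subset_rfl))
    refine ⟨ρ / 2, by positivity, _, hφ.norm.mul_const C, ?_⟩
    filter_upwards [ae_restrict_mem hs] with t ht x hx
    rw [norm_mul]
    exact mul_le_mul_of_nonneg_left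
      (hC (x, t) ⟨Metric.ball_subset_closedBall hx, hsK ht⟩) (norm_nonneg _)

theorem arg_add_arg_mem_of_re_pos {x y : ℂ} (hx : 0 < x.re) (hy : 0 < y.re) :
    x.arg + y.arg ∈ Ioo (-Real.pi) Real.pi := by
  have h1 := abs_lt.1 (Complex.abs_arg_lt_pi_div_two_iff.2 (Or.inl hx))
  have h2 := abs_lt.1 (Complex.abs_arg_lt_pi_div_two_iff.2 (Or.inl hy))
  constructor <;> linarith [h1.1, h1.2, h2.1, h2.2]

theorem ne_zero_of_re_pos {x : ℂ} (hx : 0 < x.re) : x ≠ 0 := by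
  rintro rfl
  simp at hx

theorem mul_cpow_of_re_pos {x y : ℂ} (hx : 0 < x.re) (hy : 0 < y.re) (s : ℂ) :
    (x * y) ^ s = x ^ s * y ^ s := by
  have hx0 := ne_zero_of_re_pos hx
  have hy0 := ne_zero_of_re_pos hy
  rw [Complex.cpow_def_of_ne_zero hx0, Complex.cpow_def_of_ne_zero hy0,
    Complex.cpow_def_of_ne_zero (mul_ne_zero hx0 hy0), ← Complex.exp_add,
    (Complex.log_mul_eq_add_log_iff hx0 hy0).2
      (Ioo_subset_Ioc_self (arg_add_arg_mem_of_re_pos hx hy)), add_mul]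

theorem ofReal_mul_cpow {u : ℝ} (hu : 0 < u) {x : ℂ} (hx : x ≠ 0) (s : ℂ) :
    ((u : ℂ) * x) ^ s = (u : ℂ) ^ s * x ^ s := by
  have hu0 : (u : ℂ) ≠ 0 := by exact_mod_cast hu.ne'
  rw [Complex.cpow_def_of_ne_zero hx, Complex.cpow_def_of_ne_zero hu0,
    Complex.cpow_def_of_ne_zero (mul_ne_zero hu0 hx), ← Complex.exp_add,
    Complex.log_ofReal_mul hu hx, Complex.ofReal_log hu.le, add_mul]

theorem div_mul_cpow_of_re_pos {u : ℝ} (hu : 0 < u) {x y : ℂ} (hx : 0 < x.re) (hy : 0 < y.re)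
    (s : ℂ) : ((u : ℂ) / (x * y)) ^ s = (u : ℂ) ^ s * (x ^ (-s) * y ^ (-s)) := by
  have hx0 := ne_zero_of_re_pos hx
  have hy0 := ne_zero_of_re_pos hy
  have hmem := arg_add_arg_mem_of_re_pos hx hy
  have harg : (x * y).arg ≠ Real.pi := by
    rw [Complex.arg_mul hx0 hy0 (Ioo_subset_Ioc_self hmem)]
    exact hmem.2.ne
  rw [div_eq_mul_inv, ofReal_mul_cpow hu (inv_ne_zero (mul_ne_zero hx0 hy0)),
    Complex.inv_cpow _ _ harg, ← Complex.cpow_neg, mul_cpow_of_re_pos hx hy]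

/-- The domain on which the superposition integral is continued in `ζ`. -/
def contDomain (b : ℝ) : Set ℂ := {ζ | 0 < ζ.re} ∪ {ζ | b < ζ.im}

theorem isOpen_contDomain (b : ℝ) : IsOpen (contDomain b) :=
  (isOpen_lt continuous_const Complex.continuous_re).union
    (isOpen_lt continuous_const Complex.continuous_im)

theorem isPreconnected_contDomain (b : ℝ) : IsPreconnected (contDomain b) := by
  refine IsPreconnected.union ⟨1, b + 1⟩ (by simp) (by simp) ?_ ?_
  · exact (convex_halfSpace_re_gt 0).isPreconnected
  · exact (convex_halfSpace_im_gt b).isPreconnected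

theorem add_I_mul_mem_slitPlane {b c : ℝ} (hc : |c| ≤ b) {ζ : ℂ} (hζ : ζ ∈ contDomain b) :
    ζ + Complex.I * c ∈ Complex.slitPlane := by
  rw [Complex.mem_slitPlane_iff]
  rcases hζ with h | h
  · left
    simpa using h
  · right
    have h' : b < ζ.im := h
    have := (abs_le.1 hc).1
    simp
    linarith

/-- Otherwise `w = u² + a² + ζ²` would be real with `|w| ≤ 2ua`. Then `-(u + a)² ≤ ζ² ≤ -(u - a)²`,
so `ζ` would be imaginary with `|Im ζ| ≤ a + u`, and such points are not in the domain. -/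
theorem sq_div_mem_cutPlane {a u : ℝ} (ha : 0 < a) (hu : 0 < u) {ζ : ℂ}
    (hζ : ζ ∈ contDomain (a + u)) (y : ℝ) (hy : 1 ≤ y) :
    (2 * (u : ℂ) * a / ((u : ℂ) ^ 2 + (a : ℂ) ^ 2 + ζ ^ 2)) ^ 2 ≠ y := by
  intro h
  set w : ℂ := (u : ℂ) ^ 2 + (a : ℂ) ^ 2 + ζ ^ 2 with hw
  have hw0 : w ≠ 0 := by
    intro h0
    rw [h0, div_zero] at h
    have : (0 : ℝ) = y := by exact_mod_cast (by simpa using h : (0 : ℂ) = y)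
    linarith
  rw [div_pow, div_eq_iff (pow_ne_zero 2 hw0)] at h
  have hre := congrArg Complex.re h
  have him := congrArg Complex.im h
  have hwre : w.re = u ^ 2 + a ^ 2 + (ζ.re ^ 2 - ζ.im ^ 2) := by
    simp [hw, pow_two]
  have hwim : w.im = 2 * ζ.re * ζ.im := by
    simp [hw, pow_two]; ring
  have e : (2 * (u : ℂ) * a) ^ 2 = (((2 * u * a) ^ 2 : ℝ) : ℂ) := by push_cast; ring
  rw [e] at hre him
  simp [pow_two] at hre him
  have hua : 0 < u * a := mul_pos hu ha
  have him' : w.re * w.im = 0 := by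
    rcases him with h | h
    · linarith
    · linarith
  have hwi : w.im = 0 := by
    rcases mul_eq_zero.1 him' with h0 | h0
    · rw [h0] at hre
      nlinarith [mul_self_nonneg w.im]
    · exact h0
  rw [hwi] at hre
  have hle : w.re ^ 2 ≤ (2 * u * a) ^ 2 := by nlinarith [mul_self_nonneg w.re]
  have h1 := abs_le_of_sq_le_sq' hle (by positivity)
  rw [hwim] at hwi
  rcases hζ with h0 | h0
  · have h0' : 0 < ζ.re := h0
    have : ζ.im = 0 := by
      rcases mul_eq_zero.1 hwi with h2 | h2
      · linarith
      · exact h2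
    rw [hwre, this] at h1
    nlinarith [sq_nonneg (u - a)]
  · have h0' : a + u < ζ.im := h0
    have : ζ.re = 0 := by
      rcases mul_eq_zero.1 hwi with h2 | h2
      · linarith
      · linarith
    rw [hwre, this] at h1
    nlinarith [sq_nonneg (u + a)]

theorem sum_sq_ne_zero {a u : ℝ} (ha : 0 < a) (hu : 0 < u) {ζ : ℂ}
    (hζ : ζ ∈ contDomain (a + u)) : (u : ℂ) ^ 2 + (a : ℂ) ^ 2 + ζ ^ 2 ≠ 0 := by
  intro h
  have hre := congrArg Complex.re h
  have him := congrArg Complex.im h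
  simp [pow_two] at hre him
  rcases hζ with h0 | h0
  · have h0' : 0 < ζ.re := h0
    have : ζ.im = 0 := by
      have : ζ.re * ζ.im = 0 := by linarith
      rcases mul_eq_zero.1 this with h2 | h2
      · linarith
      · exact h2
    rw [this] at hre
    nlinarith
  · have h0' : a + u < ζ.im := h0
    have : ζ.re = 0 := by
      have : ζ.re * ζ.im = 0 := by linarith
      rcases mul_eq_zero.1 this with h2 | h2
      · exact h2
      · linarith
    rw [this] at hre
    nlinarith [mul_pos ha hu]

/-- By Legendre's duplication formula the constant `cst h` is exactly the one that normalises the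
integral of the weight, up to the `i` from `dw`. -/
theorem cst_mul_gamma {h : ℝ} (hh : 0 < h) :
    cst h * Complex.I * (Complex.Gamma (1 / 2) * Complex.Gamma h / Complex.Gamma (h + 1 / 2)) =
      1 := by
  have hre : 0 < (h : ℂ).re := by simpa using hh
  have h1 := Complex.Gamma_ne_zero_of_re_pos hre
  have h2 : Complex.Gamma (h + 1 / 2) ≠ 0 := Complex.Gamma_ne_zero_of_re_pos (by simp; linarith)
  have hdup := Complex.Gamma_mul_Gamma_add_half h
  have hpi : (Real.sqrt Real.pi : ℂ) ≠ 0 := by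
    exact_mod_cast (Real.sqrt_pos.2 Real.pi_pos).ne'
  have h4 : (4 : ℂ) ^ (h : ℂ) ≠ 0 := by simp [Complex.cpow_eq_zero_iff]
  have e2 : (2 : ℂ) ^ (1 - 2 * (h : ℂ)) = 2 / (4 : ℂ) ^ (h : ℂ) := by
    rw [Complex.cpow_sub _ _ two_ne_zero, Complex.cpow_one]
    congr 1
    rw [show (4 : ℂ) = ((2 : ℝ) : ℂ) * ((2 : ℝ) : ℂ) by norm_num,
      Complex.mul_cpow_ofReal_nonneg (by norm_num) (by norm_num), ← Complex.cpow_add _ _ (by simp)]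
    congr 1
    ring
  rw [e2] at hdup
  have hg : Complex.Gamma (1 / 2) = (Real.sqrt Real.pi : ℂ) := by
    rw [Complex.Gamma_one_half_eq]
    rw [Real.sqrt_eq_rpow, Complex.ofReal_cpow Real.pi_pos.le]
    norm_num
  unfold cst
  rw [hg, div_mul_div_comm, div_mul_eq_mul_div, div_mul_div_comm, div_eq_one_iff_eq
    (mul_ne_zero (mul_ne_zero h4 (mul_ne_zero h1 h1)) h2)]
  have hI : Complex.I * Complex.I = -1 := Complex.I_mul_I
  have hdup' : Complex.Gamma (2 * (h : ℂ)) * 2 * (Real.sqrt Real.pi : ℂ) =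
      Complex.Gamma h * Complex.Gamma (h + 1 / 2) * 4 ^ (h : ℂ) := by
    rw [hdup]
    field_simp
  linear_combination (-2 * Complex.Gamma (2 * h) * Real.sqrt Real.pi * Complex.Gamma h) * hI
    + Complex.Gamma h * hdup'

/-- Here every base is `i` times a positive number, so the complex powers become real ones. The
quadratic `(S - a t)² - u²` has the root `t = (S + u) / a`; the Möbius map with `β = a / (S + u)`
sends it to infinity, leaving a factor linear in `τ` and thus the integral already evaluated. -/
theorem continued_kernel_eq {h a u S : ℝ} (hh : 0 < h) (ha : 0 < a) (hu : 0 < u) (hS : a + u < S) :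
    ∫ t in Ioc (-1 : ℝ) 1, ((1 - t ^ 2 : ℝ) : ℂ) ^ ((h : ℂ) - 1) *
      ((Complex.I * S + Complex.I * ((u - a * t : ℝ) : ℂ)) ^ (-(h : ℂ)) *
        (Complex.I * S + Complex.I * ((-u - a * t : ℝ) : ℂ)) ^ (-(h : ℂ))) =
    Complex.Gamma (1 / 2) * Complex.Gamma h / Complex.Gamma (h + 1 / 2) *
      ((Complex.I * S + Complex.I * ((Real.sqrt (u ^ 2 + a ^ 2) : ℝ) : ℂ)) ^ (-(h : ℂ)) *
        (Complex.I * S + Complex.I * ((-Real.sqrt (u ^ 2 + a ^ 2) : ℝ) : ℂ)) ^ (-(h : ℂ)) *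
        hyp2F1 ((h : ℂ) / 2) ((h : ℂ) / 2 + 1 / 2) ((h : ℂ) + 1 / 2)
          ((2 * (u : ℂ) * a / ((u : ℂ) ^ 2 + (a : ℂ) ^ 2 + (Complex.I * S) ^ 2)) ^ 2)) := by
  set ρ := Real.sqrt (u ^ 2 + a ^ 2) with hρ
  have hρ2 : ρ ^ 2 = u ^ 2 + a ^ 2 := Real.sq_sqrt (by positivity)
  have hρ0 : 0 ≤ ρ := Real.sqrt_nonneg _
  have hρlt : ρ < S := by nlinarith [mul_pos ha hu]
  have hua : 0 < 2 * a * u := by positivity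
  set σ := (S ^ 2 - u ^ 2 - a ^ 2) / (2 * a * u) with hσ
  have hσ1 : 1 < σ := by
    rw [hσ, lt_div_iff₀ hua]
    nlinarith
  have hpow : ∀ c : ℝ, 0 < c → (Complex.I * (c : ℂ)) ^ (-(h : ℂ)) =
      Complex.I ^ (-(h : ℂ)) * ((c ^ (-h) : ℝ) : ℂ) := by
    intro c hc
    rw [mul_comm, ofReal_mul_cpow hc Complex.I_ne_zero, Complex.ofReal_cpow hc.le, mul_comm]
    push_cast
    rfl
  have hq : 0 < S + u := by linarith
  have hmob := integral_moebius (h := h) (β := a / (S + u)) (k := 2 * a * u) (σ := σ)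
    (B := fun t => (S - a * t) ^ 2 - u ^ 2) (by
      rw [abs_of_pos (by positivity), div_lt_one hq]
      linarith) hua hσ1.le (by
      intro τ hτ
      have hne : 1 + a / (S + u) * τ ≠ 0 := by
        have : 0 < S + u + a * τ := by nlinarith [hτ.1, hτ.2]
        rw [show 1 + a / (S + u) * τ = (S + u + a * τ) / (S + u) by field_simp]
        positivity
      have hne' : S + u + a * τ ≠ 0 := by nlinarith [hτ.1, hτ.2]
      rw [show (S - a * ((τ + a / (S + u)) / (1 + a / (S + u) * τ))) ^ 2 - u ^ 2 =
        ((S * (1 + a / (S + u) * τ) - a * (τ + a / (S + u))) ^ 2 -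
          u ^ 2 * (1 + a / (S + u) * τ) ^ 2) / (1 + a / (S + u) * τ) ^ 2 by
          rw [eq_div_iff (pow_ne_zero 2 hne), sub_mul, ← mul_pow, sub_mul, mul_assoc,
            div_mul_cancel₀ _ hne], div_mul_cancel₀ _ (pow_ne_zero 2 hne), mul_sub, hσ,
        mul_div_cancel₀ _ hua.ne']
      field_simp
      ring)
  have hQ := integral_weight_mul_sub_cpow hh hσ1
  -- both sides reduce to real integrals
  have hL : ∫ t in Ioc (-1 : ℝ) 1, ((1 - t ^ 2 : ℝ) : ℂ) ^ ((h : ℂ) - 1) *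
      ((Complex.I * S + Complex.I * ((u - a * t : ℝ) : ℂ)) ^ (-(h : ℂ)) *
        (Complex.I * S + Complex.I * ((-u - a * t : ℝ) : ℂ)) ^ (-(h : ℂ))) =
      (Complex.I ^ (-(h : ℂ))) ^ 2 *
        ((∫ t in Ioo (-1 : ℝ) 1, (1 - t ^ 2) ^ (h - 1) * ((S - a * t) ^ 2 - u ^ 2) ^ (-h) : ℝ) :
          ℂ) := by
    rw [← integral_complex_ofReal, integral_Ioc_eq_integral_Ioo, ← integral_const_mul]
    refine setIntegral_congr_fun measurableSet_Ioo fun t ht => ?_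
    have h1 : 0 < S + (u - a * t) := by nlinarith [ht.1, ht.2]
    have h2 : 0 < S + (-u - a * t) := by nlinarith [ht.1, ht.2]
    have h3 : 0 ≤ 1 - t ^ 2 := by nlinarith [ht.1, ht.2]
    rw [← mul_add, ← mul_add, ← Complex.ofReal_add, ← Complex.ofReal_add, hpow _ h1, hpow _ h2,
      show (S - a * t) ^ 2 - u ^ 2 = (S + (u - a * t)) * (S + (-u - a * t)) by ring,
      Real.mul_rpow h1.le h2.le]
    push_cast [Complex.ofReal_cpow h3]
    ring
  have hR : ((∫ t in Ioo (-1 : ℝ) 1, (1 - t ^ 2) ^ (h - 1) * (σ - t) ^ (-h) : ℝ) : ℂ) =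
      ∫ t in (-1 : ℝ)..1, ((1 - t ^ 2 : ℝ) : ℂ) ^ ((h : ℂ) - 1) *
        ((σ - t : ℝ) : ℂ) ^ (-(h : ℂ)) := by
    rw [← integral_complex_ofReal, intervalIntegral.integral_of_le (by norm_num),
      integral_Ioc_eq_integral_Ioo]
    refine setIntegral_congr_fun measurableSet_Ioo fun t ht => ?_
    have h3 : 0 ≤ 1 - t ^ 2 := by nlinarith [ht.1, ht.2]
    have h4 : 0 ≤ σ - t := by linarith [ht.2]
    rw [Complex.ofReal_mul, Complex.ofReal_cpow h3, Complex.ofReal_cpow h4]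
    push_cast
    rfl
  rw [hL, hmob, Complex.ofReal_mul, hR, hQ]
  have harg : (2 * (u : ℂ) * a / ((u : ℂ) ^ 2 + (a : ℂ) ^ 2 + (Complex.I * S) ^ 2)) ^ 2 =
      (1 / (σ : ℂ)) ^ 2 := by
    rw [hσ]
    push_cast
    rw [mul_pow, Complex.I_sq, one_div_div, div_pow, div_pow]
    congr 1 <;> ring
  have hlt : ‖(1 / (σ : ℂ)) ^ 2‖ < 1 := by
    rw [norm_pow, norm_div, norm_one, Complex.norm_real, Real.norm_of_nonneg (by linarith)]
    have : 1 / σ < 1 := by rw [div_lt_one (by linarith)]; exact hσ1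
    exact pow_lt_one₀ (by positivity) this two_ne_zero
  rw [harg, hyp2F1, if_pos hlt, ← mul_add, ← mul_add, ← Complex.ofReal_add, ← Complex.ofReal_add,
    hpow _ (by linarith), hpow _ (by linarith)]
  have e : (((2 * a * u) ^ (-h) : ℝ) : ℂ) * (σ : ℂ) ^ (-(h : ℂ)) =
      (((S + ρ) ^ (-h) : ℝ) : ℂ) * (((S + -ρ) ^ (-h) : ℝ) : ℂ) := by
    have e1 : (σ : ℂ) ^ (-(h : ℂ)) = ((σ ^ (-h) : ℝ) : ℂ) := by
      rw [Complex.ofReal_cpow (by linarith)]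
      push_cast
      rfl
    rw [e1, ← Complex.ofReal_mul, ← Complex.ofReal_mul, ← Real.mul_rpow hua.le (by linarith),
      ← Real.mul_rpow (by linarith) (by linarith), hσ, mul_div_cancel₀ _ hua.ne']
    congr 2
    nlinarith
  linear_combination ((Complex.I ^ (-(h : ℂ))) ^ 2 * (Complex.Gamma (1 / 2) * Complex.Gamma h /
    Complex.Gamma (h + 1 / 2)) * ordinaryHypergeometric ((h : ℂ) / 2) ((h : ℂ) / 2 + 1 / 2)
      ((h : ℂ) + 1 / 2) ((1 / (σ : ℂ)) ^ 2)) * e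


theorem differentiableOn_hyp2F1_sq {h a u : ℝ} (hh : 0 < h) (ha : 0 < a) (hu : 0 < u) :
    DifferentiableOn ℂ (fun ζ : ℂ => hyp2F1 ((h : ℂ) / 2) ((h : ℂ) / 2 + 1 / 2) ((h : ℂ) + 1 / 2)
      ((2 * (u : ℂ) * a / ((u : ℂ) ^ 2 + (a : ℂ) ^ 2 + ζ ^ 2)) ^ 2)) (contDomain (a + u)) := by
  have h1 : DifferentiableOn ℂ (fun ζ : ℂ => 2 * (u : ℂ) * a / ((u : ℂ) ^ 2 + (a : ℂ) ^ 2 + ζ ^ 2))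
      (contDomain (a + u)) := by
    refine DifferentiableOn.div (by fun_prop) (by fun_prop) fun z hz => sum_sq_ne_zero ha hu hz
  have h2 := h1.pow 2
  have h3 := differentiableOn_hyp2F1 (a := (h : ℂ) / 2) (b := (h : ℂ) / 2 + 1 / 2)
    (c := (h : ℂ) + 1 / 2) (by simp; linarith)
    (by rw [show (h : ℂ) + 1 / 2 - (h / 2 + 1 / 2) = h / 2 by ring]; simp; linarith)
  exact h3.comp h2 fun z hz y hy => sq_div_mem_cutPlane ha hu hz y hy

-- Identity theorem on the connected domain `contDomain (a + u)`, starting from the imaginary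
-- half-axis. The denominators are kept factorised because each linear factor stays in the slit
-- plane on the whole domain, whereas the principal power of their product would meet its cut.
set_option maxHeartbeats 800000 in
theorem continued_superposition {h a u : ℝ} (hh : 0 < h) (ha : 0 < a) (hu : 0 < u) {ζ : ℂ}
    (hζ : ζ ∈ contDomain (a + u)) :
    ∫ t in Ioc (-1 : ℝ) 1, ((1 - t ^ 2 : ℝ) : ℂ) ^ ((h : ℂ) - 1) *
      ((ζ + Complex.I * ((u - a * t : ℝ) : ℂ)) ^ (-(h : ℂ)) *
        (ζ + Complex.I * ((-u - a * t : ℝ) : ℂ)) ^ (-(h : ℂ))) =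
    Complex.Gamma (1 / 2) * Complex.Gamma h / Complex.Gamma (h + 1 / 2) *
      ((ζ + Complex.I * ((Real.sqrt (u ^ 2 + a ^ 2) : ℝ) : ℂ)) ^ (-(h : ℂ)) *
        (ζ + Complex.I * ((-Real.sqrt (u ^ 2 + a ^ 2) : ℝ) : ℂ)) ^ (-(h : ℂ)) *
        hyp2F1 ((h : ℂ) / 2) ((h : ℂ) / 2 + 1 / 2) ((h : ℂ) + 1 / 2)
          ((2 * (u : ℂ) * a / ((u : ℂ) ^ 2 + (a : ℂ) ^ 2 + ζ ^ 2)) ^ 2)) := by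
  have hre : 0 < (h : ℂ).re := by simpa using hh
  have hopen := isOpen_contDomain (a + u)
  have hw := integrable_weight hre
  rw [intervalIntegrable_iff_integrableOn_Ioc_of_le (by norm_num)] at hw
  have habs1 : ∀ t ∈ Icc (-1 : ℝ) 1, |u - a * t| ≤ a + u := by
    intro t ht
    rw [abs_le]
    constructor <;> nlinarith [ht.1, ht.2]
  have habs2 : ∀ t ∈ Icc (-1 : ℝ) 1, |-u - a * t| ≤ a + u := by
    intro t ht
    rw [abs_le]
    constructor <;> nlinarith [ht.1, ht.2]
  have hρ2 : Real.sqrt (u ^ 2 + a ^ 2) ≤ a + u := by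
    rw [Real.sqrt_le_left (by positivity)]
    nlinarith [mul_pos ha hu]
  have hρ1 : |Real.sqrt (u ^ 2 + a ^ 2)| ≤ a + u := by
    rwa [abs_of_nonneg (Real.sqrt_nonneg _)]
  have hρ3 : |-Real.sqrt (u ^ 2 + a ^ 2)| ≤ a + u := by
    rwa [abs_neg]
  have hLd := differentiableOn_integral_mul_of_continuousOn (μ := volume) hopen
    (isCompact_Icc (a := (-1 : ℝ)) (b := 1)) measurableSet_Ioc Ioc_subset_Icc_self hw
    (f := fun ζ t => (ζ + Complex.I * ((u - a * t : ℝ) : ℂ)) ^ (-(h : ℂ)) *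
        (ζ + Complex.I * ((-u - a * t : ℝ) : ℂ)) ^ (-(h : ℂ))) ?_ ?_
  rotate_left
  · intro p hp
    refine ContinuousWithinAt.mul ?_ ?_
    · refine ContinuousWithinAt.cpow ?_ continuousWithinAt_const
        (add_I_mul_mem_slitPlane (habs1 _ hp.2) hp.1)
      exact Continuous.continuousWithinAt (by fun_prop)
    · refine ContinuousWithinAt.cpow ?_ continuousWithinAt_const
        (add_I_mul_mem_slitPlane (habs2 _ hp.2) hp.1)
      exact Continuous.continuousWithinAt (by fun_prop)
  · intro t ht z hz
    have ht' := Ioc_subset_Icc_self ht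
    refine DifferentiableWithinAt.mul ?_ ?_
    · exact DifferentiableWithinAt.cpow_const (by fun_prop)
        (add_I_mul_mem_slitPlane (habs1 _ ht') hz)
    · exact DifferentiableWithinAt.cpow_const (by fun_prop)
        (add_I_mul_mem_slitPlane (habs2 _ ht') hz)
  have hRd : DifferentiableOn ℂ (fun ζ : ℂ => Complex.Gamma (1 / 2) * Complex.Gamma h /
      Complex.Gamma (h + 1 / 2) *
      ((ζ + Complex.I * ((Real.sqrt (u ^ 2 + a ^ 2) : ℝ) : ℂ)) ^ (-(h : ℂ)) *
        (ζ + Complex.I * ((-Real.sqrt (u ^ 2 + a ^ 2) : ℝ) : ℂ)) ^ (-(h : ℂ)) *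
        hyp2F1 ((h : ℂ) / 2) ((h : ℂ) / 2 + 1 / 2) ((h : ℂ) + 1 / 2)
          ((2 * (u : ℂ) * a / ((u : ℂ) ^ 2 + (a : ℂ) ^ 2 + ζ ^ 2)) ^ 2)))
      (contDomain (a + u)) := by
    refine DifferentiableOn.const_mul (DifferentiableOn.mul (DifferentiableOn.mul ?_ ?_) ?_) _
    · intro z hz
      exact DifferentiableWithinAt.cpow_const (by fun_prop) (add_I_mul_mem_slitPlane hρ1 hz)
    · intro z hz
      exact DifferentiableWithinAt.cpow_const (by fun_prop) (add_I_mul_mem_slitPlane hρ3 hz)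
    · exact differentiableOn_hyp2F1_sq hh ha hu
  have hz₀ : Complex.I * ((a + u + 1 : ℝ) : ℂ) ∈ contDomain (a + u) := by
    right
    simp
  refine AnalyticOnNhd.eqOn_of_preconnected_of_mem_closure (hLd.analyticOnNhd hopen)
    (hRd.analyticOnNhd hopen) (isPreconnected_contDomain _) hz₀ ?_ hζ
  refine mem_closure_of_tendsto (b := atTop)
    (f := fun n : ℕ => Complex.I * ((a + u + 1 + 1 / ((n : ℝ) + 1) : ℝ) : ℂ)) ?_ ?_
  · have h1 : Tendsto (fun n : ℕ => a + u + 1 + 1 / ((n : ℝ) + 1)) atTop (𝓝 (a + u + 1 + 0)) :=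
      tendsto_one_div_add_atTop_nhds_zero_nat.const_add _
    rw [add_zero] at h1
    exact ((Complex.continuous_ofReal.tendsto _).comp h1).const_mul _
  · refine Eventually.of_forall fun n => ?_
    have hpos : (0 : ℝ) < 1 / ((n : ℝ) + 1) := by positivity
    refine ⟨continued_kernel_eq hh ha hu (by linarith), ?_⟩
    simp only [mem_singleton_iff, mul_eq_mul_left_iff, Complex.I_ne_zero, or_false]
    intro heq
    have := Complex.ofReal_injective heq
    linarith

/-- The kernel of the boundary representation, with `w = i a t`. -/
noncomputable def kern (h : ℂ) (a u : ℝ) (ζ : ℂ) (t : ℝ) : ℂ :=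
  ((u : ℂ) / ((u : ℂ) ^ 2 + (ζ - Complex.I * (a * t)) ^ 2)) ^ h

/-- The weight of the boundary representation, with `w = i a t`. -/
noncomputable def wt (h : ℂ) (a t : ℝ) : ℂ := ((a * (1 - t ^ 2) : ℝ) : ℂ) ^ (h - 1)

theorem kern_neg_neg (h : ℂ) (a u : ℝ) (ζ : ℂ) (t : ℝ) :
    kern h a u (-ζ) (-t) = kern h a u ζ t := by
  unfold kern
  congr 3
  push_cast
  ring

theorem wt_neg (h : ℂ) (a t : ℝ) : wt h a (-t) = wt h a t := by
  unfold wt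
  congr 3
  ring

/-- For `Re ζ > 0` all linear factors have positive real part, so the arguments add without crossing
`±π` and the factorised powers recombine into the principal power of the quotient. -/
theorem superposition_of_re_pos {h a u : ℝ} (hh : 0 < h) (ha : 0 < a) (hu : 0 < u) {ζ : ℂ}
    (hζ : 0 < ζ.re) :
    cst h * (Complex.I * a) * ∫ t in (-1 : ℝ)..1, wt h a t * kern h a u ζ t = G h u ζ a 0 := by
  have hmem : ζ ∈ contDomain (a + u) := Or.inl hζ
  have hre : ∀ c : ℝ, 0 < (ζ + Complex.I * (c : ℂ)).re := by
    intro c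
    simpa using hζ
  have hk : ∀ t : ℝ, kern h a u ζ t = (u : ℂ) ^ (h : ℂ) *
      ((ζ + Complex.I * ((u - a * t : ℝ) : ℂ)) ^ (-(h : ℂ)) *
        (ζ + Complex.I * ((-u - a * t : ℝ) : ℂ)) ^ (-(h : ℂ))) := by
    intro t
    rw [← div_mul_cpow_of_re_pos hu (hre _) (hre _), kern]
    congr 2
    push_cast
    linear_combination ((u : ℂ) ^ 2) * Complex.I_sq
  have hwt : ∀ t ∈ Ioc (-1 : ℝ) 1, wt h a t =
      (a : ℂ) ^ ((h : ℂ) - 1) * ((1 - t ^ 2 : ℝ) : ℂ) ^ ((h : ℂ) - 1) := by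
    intro t ht
    rw [wt, Complex.ofReal_mul, Complex.mul_cpow_ofReal_nonneg ha.le (by nlinarith [ht.1, ht.2])]
  have hint : ∫ t in (-1 : ℝ)..1, wt h a t * kern h a u ζ t =
      (a : ℂ) ^ ((h : ℂ) - 1) * (u : ℂ) ^ (h : ℂ) *
      ∫ t in Ioc (-1 : ℝ) 1, ((1 - t ^ 2 : ℝ) : ℂ) ^ ((h : ℂ) - 1) *
      ((ζ + Complex.I * ((u - a * t : ℝ) : ℂ)) ^ (-(h : ℂ)) *
        (ζ + Complex.I * ((-u - a * t : ℝ) : ℂ)) ^ (-(h : ℂ))) := by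
    rw [intervalIntegral.integral_of_le (by norm_num), ← integral_const_mul]
    refine setIntegral_congr_fun measurableSet_Ioc fun t ht => ?_
    rw [hwt t ht, hk]
    ring
  rw [hint, continued_superposition hh ha hu hmem]
  have ha0 : (a : ℂ) ≠ 0 := by exact_mod_cast ha.ne'
  have hsq : (((Real.sqrt (u ^ 2 + a ^ 2) : ℝ) : ℂ)) ^ 2 = (u : ℂ) ^ 2 + (a : ℂ) ^ 2 := by
    rw [← Complex.ofReal_pow, Real.sq_sqrt (by positivity)]
    push_cast
    rfl
  have hD : dist2 u ζ a 0 = (ζ + Complex.I * ((Real.sqrt (u ^ 2 + a ^ 2) : ℝ) : ℂ)) *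
      (ζ + Complex.I * ((-Real.sqrt (u ^ 2 + a ^ 2) : ℝ) : ℂ)) := by
    rw [dist2]
    push_cast
    linear_combination (-1 : ℂ) * hsq +
      ((Real.sqrt (u ^ 2 + a ^ 2) : ℝ) : ℂ) ^ 2 * Complex.I_sq
  have hG : ((u : ℂ) * a / dist2 u ζ a 0) ^ (h : ℂ) = (u : ℂ) ^ (h : ℂ) * (a : ℂ) ^ (h : ℂ) *
      ((ζ + Complex.I * ((Real.sqrt (u ^ 2 + a ^ 2) : ℝ) : ℂ)) ^ (-(h : ℂ)) *
        (ζ + Complex.I * ((-Real.sqrt (u ^ 2 + a ^ 2) : ℝ) : ℂ)) ^ (-(h : ℂ))) := by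
    rw [hD, ← Complex.ofReal_mul, div_mul_cpow_of_re_pos (mul_pos hu ha) (hre _) (hre _),
      Complex.ofReal_mul, Complex.mul_cpow_ofReal_nonneg hu.le ha.le]
  rw [G, hG, show dist2 u ζ a 0 = (u : ℂ) ^ 2 + (a : ℂ) ^ 2 + ζ ^ 2 by simp [dist2],
    Complex.cpow_sub _ _ ha0, Complex.cpow_one]
  have hc := cst_mul_gamma hh
  set X := Complex.Gamma (1 / 2) * Complex.Gamma h / Complex.Gamma (h + 1 / 2)
  set Y := hyp2F1 ((h : ℂ) / 2) ((h : ℂ) / 2 + 1 / 2) ((h : ℂ) + 1 / 2)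
    ((2 * (u : ℂ) * a / ((u : ℂ) ^ 2 + (a : ℂ) ^ 2 + ζ ^ 2)) ^ 2)
  set Z := (ζ + Complex.I * ((Real.sqrt (u ^ 2 + a ^ 2) : ℝ) : ℂ)) ^ (-(h : ℂ))
  set W := (ζ + Complex.I * ((-Real.sqrt (u ^ 2 + a ^ 2) : ℝ) : ℂ)) ^ (-(h : ℂ))
  calc _ = (cst h * Complex.I * X) * ((a / a : ℂ) * ((u : ℂ) ^ (h : ℂ) * (a : ℂ) ^ (h : ℂ) *
        (Z * W) * Y)) := by ring
    _ = _ := by rw [hc, div_self ha0]; ring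

theorem G_neg (h u a : ℝ) (ζ : ℂ) : G h u (-ζ) a 0 = G h u ζ a 0 := by
  simp [G, dist2]

/-- The left half-plane follows from the symmetry `(ζ, t) ↦ (-ζ, -t)` of kernel and weight. -/
theorem superposition {h a u : ℝ} (hh : 0 < h) (ha : 0 < a) (hu : 0 < u) {ζ : ℂ}
    (hζ : ζ.re ≠ 0) :
    cst h * (Complex.I * a) * ∫ t in (-1 : ℝ)..1, wt h a t * kern h a u ζ t = G h u ζ a 0 := by
  rcases lt_or_gt_of_ne hζ with h0 | h0
  · rw [← G_neg, ← superposition_of_re_pos hh ha hu (ζ := -ζ) (by simpa using h0)]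
    congr 1
    have := intervalIntegral.integral_comp_neg (a := -1) (b := 1)
      (fun t => wt h a t * kern h a u (-ζ) t)
    rw [neg_neg] at this
    rw [← this]
    refine intervalIntegral.integral_congr fun t _ => ?_
    simp only [wt_neg, kern_neg_neg]
  · exact superposition_of_re_pos hh ha hu h0


/-! ### The hypergeometric series as a function of its parameters. -/

theorem hypCoeff_succ (a b c : ℂ) (n : ℕ) :
    ordinaryHypergeometricCoefficient a b c (n + 1) =
      ordinaryHypergeometricCoefficient a b c n * ((a + n) * (b + n) / ((c + n) * (n + 1))) := by
  simp only [ordinaryHypergeometricCoefficient, ascPochhammer_succ_eval, Nat.factorial_succ]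
  push_cast
  rw [mul_inv, mul_inv, div_eq_mul_inv, mul_inv]
  ring

theorem exists_pos_le_norm_add_nat {c : ℂ} (hc : ∀ k : ℕ, c + k ≠ 0) :
    ∃ η > 0, ∀ k : ℕ, η ≤ ‖c + k‖ := by
  have hfin : ∀ N : ℕ, ∃ η > 0, ∀ k < N, η ≤ ‖c + k‖ := by
    intro N
    induction N with
    | zero => exact ⟨1, one_pos, fun k hk => absurd hk (Nat.not_lt_zero k)⟩
    | succ N ih =>
      obtain ⟨η, hη, h⟩ := ih
      refine ⟨min η ‖c + N‖, lt_min hη (norm_pos_iff.2 (hc N)), fun k hk => ?_⟩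
      rcases Nat.lt_succ_iff_lt_or_eq.1 hk with h1 | h1
      · exact (min_le_left _ _).trans (h k h1)
      · rw [h1]
        exact min_le_right _ _
  obtain ⟨N, hN⟩ := exists_nat_ge (‖c‖ + 1)
  obtain ⟨η, hη, h⟩ := hfin N
  refine ⟨min η 1, lt_min hη one_pos, fun k => ?_⟩
  rcases lt_or_ge k N with hk | hk
  · exact (min_le_left _ _).trans (h k hk)
  · refine (min_le_right _ _).trans ?_
    have h1 : (N : ℝ) ≤ k := by exact_mod_cast hk
    have h2 : ‖(k : ℂ)‖ ≤ ‖c + k‖ + ‖c‖ := by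
      have := norm_sub_le (c + k) c
      rwa [add_sub_cancel_left] at this
    rw [Complex.norm_natCast] at h2
    linarith

/-- The coefficients of `₂F₁` have a majorant that is locally uniform in the parameters. -/
theorem exists_hypCoeff_majorant {X : Type*} [TopologicalSpace X] {A B C : X → ℂ} {x₀ : X}
    (hA : ContinuousAt A x₀) (hB : ContinuousAt B x₀) (hC : ContinuousAt C x₀)
    (hC0 : ∀ k : ℕ, C x₀ + k ≠ 0) :
    ∃ m : ℕ → ℝ, (∀ n, 0 ≤ m n) ∧ (∀ q : ℝ, 0 ≤ q → q < 1 → Summable fun n => m n * q ^ n) ∧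
      ∀ᶠ x in 𝓝 x₀, ∀ n, ‖ordinaryHypergeometricCoefficient (A x) (B x) (C x) n‖ ≤ m n := by
  obtain ⟨η, hη, hηC⟩ := exists_pos_le_norm_add_nat hC0
  set R := ‖A x₀‖ + ‖B x₀‖ + ‖C x₀‖ + 1 with hR
  have hR1 : 1 ≤ R := by
    have := norm_nonneg (A x₀); have := norm_nonneg (B x₀); have := norm_nonneg (C x₀)
    linarith
  have hden : ∀ k : ℕ, 0 < max (η / 2) (k - R) * ((k : ℝ) + 1) := fun k =>
    mul_pos (lt_max_of_lt_left (by positivity)) (by positivity)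
  -- A bound for the ratio `(A + k)(B + k) / ((C + k)(k + 1))` of consecutive coefficients near
  -- `x₀`: the numerators are at most `R + k`, and `‖C + k‖` is at least both `η / 2` and `k - R`.
  -- As `g k → 1`, the ratio test gives summability for every `q < 1`.
  set g : ℕ → ℝ := fun k => (R + k) ^ 2 / (max (η / 2) (k - R) * ((k : ℝ) + 1)) with hg
  have hg0 : ∀ k, 0 ≤ g k := fun k => div_nonneg (by positivity) (hden k).le
  refine ⟨fun n => ∏ k ∈ Finset.range n, g k, fun n => Finset.prod_nonneg fun k _ => hg0 k, ?_, ?_⟩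
  · intro q hq0 hq1
    have hlim : Tendsto (fun k : ℕ => g k * q) atTop (𝓝 (1 * 1 * q)) := by
      refine Tendsto.mul_const _ ?_
      have h1 := tendsto_add_mul_div_add_mul_atTop_nhds (𝕜 := ℝ) R (-R) 1 one_ne_zero
      have h2 := tendsto_add_mul_div_add_mul_atTop_nhds (𝕜 := ℝ) R 1 1 one_ne_zero
      have h3 := h1.mul h2
      rw [div_one] at h3
      refine h3.congr' ?_
      filter_upwards [eventually_ge_atTop (Nat.ceil (R + η / 2))] with k hk
      have hk' : R + η / 2 ≤ k := (Nat.le_ceil _).trans (by exact_mod_cast hk)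
      simp only [hg]
      rw [max_eq_right (by linarith), div_mul_div_comm]
      congr 1 <;> ring
    rw [one_mul, one_mul] at hlim
    obtain ⟨q', hq', hq'1⟩ := exists_between hq1
    refine summable_of_ratio_norm_eventually_le hq'1 ?_
    filter_upwards [hlim.eventually_le_const hq'] with k hk
    rw [Finset.prod_range_succ, pow_succ, show (∏ x ∈ Finset.range k, g x) * g k * (q ^ k * q) =
      (g k * q) * ((∏ x ∈ Finset.range k, g x) * q ^ k) by ring, norm_mul]
    refine mul_le_mul_of_nonneg_right ?_ (norm_nonneg _)
    rw [Real.norm_of_nonneg (mul_nonneg (hg0 k) hq0)]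
    exact hk
  · have eA : ∀ᶠ x in 𝓝 x₀, ‖A x‖ < R :=
      hA.norm.eventually_lt_const (by
        have := norm_nonneg (B x₀); have := norm_nonneg (C x₀); simp only [hR]; linarith)
    have eB : ∀ᶠ x in 𝓝 x₀, ‖B x‖ < R :=
      hB.norm.eventually_lt_const (by
        have := norm_nonneg (A x₀); have := norm_nonneg (C x₀); simp only [hR]; linarith)
    have eC : ∀ᶠ x in 𝓝 x₀, ‖C x‖ < R :=
      hC.norm.eventually_lt_const (by
        have := norm_nonneg (B x₀); have := norm_nonneg (A x₀); simp only [hR]; linarith)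
    have eC' : ∀ᶠ x in 𝓝 x₀, ‖C x - C x₀‖ < η / 2 :=
      (hC.sub_const (C x₀)).norm.eventually_lt_const (by simpa using by positivity)
    filter_upwards [eA, eB, eC, eC'] with x hxA hxB hxC hxC' n
    induction n with
    | zero => simp [ordinaryHypergeometricCoefficient]
    | succ n ih =>
      rw [hypCoeff_succ, norm_mul, Finset.prod_range_succ]
      refine mul_le_mul ih ?_ (norm_nonneg _) (Finset.prod_nonneg fun k _ => hg0 k)
      have hn1 : ‖((n : ℂ) + 1)‖ = n + 1 := by
        rw [← Nat.cast_succ, Complex.norm_natCast]; push_cast; rfl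
      rw [norm_div, norm_mul, norm_mul, hn1]
      have b1 : ‖A x + n‖ ≤ R + n := (norm_add_le _ _).trans (by
        rw [Complex.norm_natCast]; linarith)
      have b2 : ‖B x + n‖ ≤ R + n := (norm_add_le _ _).trans (by
        rw [Complex.norm_natCast]; linarith)
      have b3 : max (η / 2) (n - R) ≤ ‖C x + n‖ := by
        refine max_le ?_ ?_
        · have h1 := hηC n
          have h2 : ‖C x₀ + n‖ ≤ ‖C x + n‖ + ‖C x - C x₀‖ := by
            have := norm_sub_le (C x + n) (C x - C x₀)
            rwa [show C x + n - (C x - C x₀) = C x₀ + n by ring] at this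
          linarith
        · have h2 : ‖(n : ℂ)‖ ≤ ‖C x + n‖ + ‖C x‖ := by
            have := norm_sub_le (C x + n) (C x)
            rwa [add_sub_cancel_left] at this
          rw [Complex.norm_natCast] at h2
          linarith
      refine div_le_div₀ (by positivity) ?_ (hden n) ?_
      · rw [pow_two]
        exact mul_le_mul b1 b2 (norm_nonneg _) (by positivity)
      · exact mul_le_mul_of_nonneg_right b3 (by positivity)

theorem norm_hyp_le {a b c x : ℂ} {m : ℕ → ℝ} {q : ℝ}
    (hm : ∀ n, ‖ordinaryHypergeometricCoefficient a b c n‖ ≤ m n)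
    (hs : Summable fun n => m n * q ^ n) (hx : ‖x‖ ≤ q) :
    ‖ordinaryHypergeometric a b c x‖ ≤ ∑' n, m n * q ^ n := by
  rw [hyp_eq_tsum]
  refine tsum_of_norm_bounded hs.hasSum fun n => ?_
  rw [norm_mul, norm_pow]
  exact mul_le_mul (hm n) (pow_le_pow_left₀ (norm_nonneg _) hx n) (by positivity)
    ((norm_nonneg _).trans (hm n))

theorem exists_hyp_bound {X : Type*} [TopologicalSpace X] {A B C : X → ℂ} {x₀ : X}
    (hA : ContinuousAt A x₀) (hB : ContinuousAt B x₀) (hC : ContinuousAt C x₀)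
    (hC0 : ∀ k : ℕ, C x₀ + k ≠ 0) {q : ℝ} (hq0 : 0 ≤ q) (hq : q < 1) :
    ∃ M : ℝ, ∀ᶠ x in 𝓝 x₀, ∀ z : ℂ, ‖z‖ ≤ q →
      ‖ordinaryHypergeometric (A x) (B x) (C x) z‖ ≤ M := by
  obtain ⟨m, hm0, hms, hm⟩ := exists_hypCoeff_majorant hA hB hC hC0
  refine ⟨∑' n, m n * q ^ n, ?_⟩
  filter_upwards [hm] with x hx z hz
  exact norm_hyp_le hx (hms q hq0 hq) hz

theorem continuousOn_hyp {a b c : ℂ} (hc : ∀ k : ℕ, c + k ≠ 0) {q : ℝ} (hq0 : 0 ≤ q)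
    (hq : q < 1) : ContinuousOn (ordinaryHypergeometric a b c : ℂ → ℂ) (Metric.closedBall 0 q) := by
  obtain ⟨m, hm0, hms, hm⟩ := exists_hypCoeff_majorant (X := ℂ) (A := fun _ => a) (B := fun _ => b)
    (C := fun _ => c) (x₀ := 0) continuousAt_const continuousAt_const continuousAt_const hc
  have hm' := hm.self_of_nhds
  have : (ordinaryHypergeometric a b c : ℂ → ℂ) =
      fun x => ∑' n : ℕ, ordinaryHypergeometricCoefficient a b c n * x ^ n := by
    ext x
    exact hyp_eq_tsum a b c x
  rw [this]
  refine continuousOn_tsum (u := fun n => m n * q ^ n) (fun n => by fun_prop) (hms q hq0 hq) ?_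
  intro n x hx
  rw [norm_mul, norm_pow]
  exact mul_le_mul (hm' n) (pow_le_pow_left₀ (norm_nonneg _) (by simpa using hx) n)
    (by positivity) (hm0 n)

/-- `₂F₁` is holomorphic in its parameters. -/
theorem differentiableOn_hyp_param {U : Set ℂ} (hU : IsOpen U) {A B C : ℂ → ℂ}
    (hA : DifferentiableOn ℂ A U) (hB : DifferentiableOn ℂ B U) (hC : DifferentiableOn ℂ C U)
    (hC0 : ∀ h ∈ U, ∀ k : ℕ, C h + k ≠ 0) {x : ℂ} (hx : ‖x‖ < 1) :
    DifferentiableOn ℂ (fun h => ordinaryHypergeometric (A h) (B h) (C h) x) U := by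
  intro h₀ hh₀
  have hn := hU.mem_nhds hh₀
  obtain ⟨m, hm0, hms, hm⟩ := exists_hypCoeff_majorant (hA.continuousOn.continuousAt hn)
    (hB.continuousOn.continuousAt hn) (hC.continuousOn.continuousAt hn) (hC0 h₀ hh₀)
  obtain ⟨V, hV, hVo, hVm⟩ := eventually_nhds_iff.1 (hm.and hn)
  have hfun : (fun h => ordinaryHypergeometric (A h) (B h) (C h) x) = fun h =>
      ∑' n : ℕ, ordinaryHypergeometricCoefficient (A h) (B h) (C h) n * x ^ n := by
    ext h
    exact hyp_eq_tsum _ _ _ _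
  rw [hfun]
  refine DifferentiableAt.differentiableWithinAt ?_
  refine DifferentiableOn.differentiableAt (s := V) ?_ (hVo.mem_nhds hVm)
  refine Complex.differentiableOn_tsum_of_summable_norm (hms ‖x‖ (norm_nonneg _) hx) ?_ hVo ?_
  · intro n h hh
    have hhU := (hV h hh).2
    refine DifferentiableWithinAt.mul_const ?_ _
    have hd : ∀ {F : ℂ → ℂ}, DifferentiableOn ℂ F U →
        DifferentiableAt ℂ (fun h => (ascPochhammer ℂ n).eval (F h)) h := by
      intro F hF
      exact (ascPochhammer ℂ n).differentiableAt.comp h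
        ((hF h hhU).differentiableAt (hU.mem_nhds hhU))
    refine DifferentiableAt.differentiableWithinAt ?_
    refine DifferentiableAt.mul (((hd hA).const_mul _).mul (hd hB)) ((hd hC).inv ?_)
    rw [Ne, ascPochhammer_eval_eq_zero_iff]
    rintro ⟨k, -, hk⟩
    exact hC0 h hhU k (by rw [hk]; ring)
  · intro n h hh
    rw [norm_mul, norm_pow]
    exact mul_le_mul_of_nonneg_right ((hV h hh).1 n) (by positivity)


/-! ### The Legendre function and the integrated discontinuity. -/

/-- Laplace's integral for the Legendre function `P_{-h} = P_{h-1}`. -/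
noncomputable def legP (h : ℂ) (σ : ℝ) : ℂ :=
  (1 / (2 * Real.pi) : ℝ) * ∫ φ in Ioc (-Real.pi) Real.pi,
    ((σ + Real.sqrt (σ ^ 2 - 1) * Real.cos φ : ℝ) : ℂ) ^ (-h)

theorem integral_exp_int_mul (n : ℤ) :
    ∫ φ in Ioc (-Real.pi) Real.pi, Complex.exp (Complex.I * n * φ) =
      if n = 0 then (2 * Real.pi : ℂ) else 0 := by
  rw [← intervalIntegral.integral_of_le (by linarith [Real.pi_pos])]
  split_ifs with h
  · simp [h]
    ring
  · have hn : Complex.I * (n : ℂ) ≠ 0 := by simp [h]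
    rw [integral_exp_mul_complex hn, div_eq_zero_iff]
    left
    rw [sub_eq_zero, Complex.exp_eq_exp_iff_exists_int]
    exact ⟨n, by push_cast; ring⟩

theorem norm_neg_exp_I_mul (φ : ℝ) : ‖-Complex.exp (Complex.I * φ)‖ = 1 := by
  rw [norm_neg, mul_comm, Complex.norm_exp_ofReal_mul_I]

/-- The Fourier coefficients of `(1 + r e^{-iφ}) ^ (-h)`; the double signs fit the form `1 - x T` of
the general expansion. -/
theorem integral_fourier_cpow (h : ℂ) {r : ℝ} (hr0 : 0 ≤ r) (hr : r < 1) (n : ℕ) :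
    ∫ φ in Ioc (-Real.pi) Real.pi, (-Complex.exp (Complex.I * φ)) ^ n *
      (1 - r * (-Complex.exp (-(Complex.I * φ)))) ^ (-h) =
    (2 * Real.pi) * ((ascPochhammer ℂ n).eval h / (n.factorial : ℂ) * (r : ℂ) ^ n) := by
  have hφ : Integrable (fun φ : ℝ => (-Complex.exp (Complex.I * φ)) ^ n)
      (volume.restrict (Ioc (-Real.pi) Real.pi)) := by
    refine Integrable.mono' (g := fun _ => (1 : ℝ)) (by simp)
      (Continuous.aestronglyMeasurable (by fun_prop)) (Eventually.of_forall fun φ => ?_)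
    rw [norm_pow, norm_neg_exp_I_mul, one_pow]
  have hs := hasSum_integral_mul_one_sub_cpow (T := fun φ : ℝ => -Complex.exp (-(Complex.I * φ)))
    hφ (Continuous.aestronglyMeasurable (by fun_prop)) (Eventually.of_forall fun φ => by
      have := norm_neg_exp_I_mul (-φ)
      push_cast at this
      rw [show Complex.I * -(φ : ℂ) = -(Complex.I * φ) by ring] at this
      exact this.le) h
    (x := (r : ℂ)) (by rw [Complex.norm_real, Real.norm_of_nonneg hr0]; exact hr)
  rw [← hs.tsum_eq, tsum_eq_single n]
  · have : ∀ φ : ℝ, (-Complex.exp (Complex.I * φ)) ^ n * (-Complex.exp (-(Complex.I * φ))) ^ n =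
        1 := by
      intro φ
      rw [← mul_pow, neg_mul_neg, ← Complex.exp_add, add_neg_cancel, Complex.exp_zero, one_pow]
    simp only [this]
    simp [Real.pi_pos.le]
    ring
  · intro m hm
    have : ∀ φ : ℝ, (-Complex.exp (Complex.I * φ)) ^ n * (-Complex.exp (-(Complex.I * φ))) ^ m =
        (-1) ^ (n + m) * Complex.exp (Complex.I * ((n - m : ℤ) : ℂ) * φ) := by
      intro φ
      rw [neg_pow, neg_pow (Complex.exp _) m, ← Complex.exp_nat_mul, ← Complex.exp_nat_mul,
        mul_mul_mul_comm, ← pow_add, ← Complex.exp_add]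
      congr 2
      push_cast
      ring
    simp only [this]
    rw [integral_const_mul, integral_exp_int_mul, if_neg (by omega), mul_zero, mul_zero]

theorem one_add_mul_exp_re_pos {r : ℝ} (hr0 : 0 ≤ r) (hr : r < 1) (φ : ℝ) :
    0 < (1 - (r : ℂ) * (-Complex.exp (Complex.I * φ))).re := by
  have h1 : ‖(r : ℂ) * (-Complex.exp (Complex.I * φ))‖ < 1 := by
    rw [norm_mul, norm_neg_exp_I_mul, mul_one, Complex.norm_real, Real.norm_of_nonneg hr0]
    exact hr
  have := (Complex.abs_re_le_norm ((r : ℂ) * (-Complex.exp (Complex.I * φ)))).trans_lt h1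
  rw [Complex.sub_re, Complex.one_re]
  linarith [(abs_lt.1 this).2]

/-- With `r² = (σ - 1) / (σ + 1)` the base in Laplace's integral is `(σ + 1) / 2` times `(1 + r
e^{iφ})(1 + r e^{-iφ})`. Parseval's identity then gives the sum of `((h)_n / n!)² r^{2n}`. -/
theorem legP_eq_hyp (h : ℂ) {σ : ℝ} (hσ : 1 ≤ σ) :
    legP h σ = (((σ + 1) / 2 : ℝ) : ℂ) ^ (-h) *
      ordinaryHypergeometric h h 1 (((σ - 1) / (σ + 1) : ℝ) : ℂ) := by
  set Y := (σ - 1) / (σ + 1) with hY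
  have hY0 : 0 ≤ Y := div_nonneg (by linarith) (by linarith)
  have hY1 : Y < 1 := by rw [hY, div_lt_one (by linarith)]; linarith
  set r := Real.sqrt Y with hr
  have hr2 : r ^ 2 = Y := Real.sq_sqrt hY0
  have hr0 : 0 ≤ r := Real.sqrt_nonneg _
  have hr1 : r < 1 := by
    rw [hr, Real.sqrt_lt' one_pos]
    simpa using hY1
  have hm : 0 < (σ + 1) / 2 := by linarith
  have hsq : Real.sqrt (σ ^ 2 - 1) = (σ + 1) * r := by
    rw [Real.sqrt_eq_iff_mul_self_eq (by nlinarith) (by positivity)]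
    rw [show (σ + 1) * r * ((σ + 1) * r) = (σ + 1) ^ 2 * r ^ 2 by ring, hr2, hY]
    field_simp
    ring
  have hexp : ∀ φ : ℝ, ((σ + Real.sqrt (σ ^ 2 - 1) * Real.cos φ : ℝ) : ℂ) ^ (-h) =
      (((σ + 1) / 2 : ℝ) : ℂ) ^ (-h) * ((1 - r * (-Complex.exp (-(Complex.I * φ)))) ^ (-h) *
        (1 - r * (-Complex.exp (Complex.I * φ))) ^ (-h)) := by
    intro φ
    have h1 := one_add_mul_exp_re_pos hr0 hr1 φ
    have h2 := one_add_mul_exp_re_pos hr0 hr1 (-φ)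
    rw [show Complex.I * ((-φ : ℝ) : ℂ) = -(Complex.I * φ) by push_cast; ring] at h2
    rw [← mul_cpow_of_re_pos h2 h1, ← ofReal_mul_cpow hm (mul_ne_zero (ne_zero_of_re_pos h2)
      (ne_zero_of_re_pos h1))]
    congr 1
    rw [hsq]
    have hc : Complex.exp (Complex.I * φ) + Complex.exp (-(Complex.I * φ)) =
        2 * Complex.cos φ := by
      rw [Complex.two_cos, mul_comm Complex.I, neg_mul]
    have he : Complex.exp (Complex.I * φ) * Complex.exp (-(Complex.I * φ)) = 1 := by
      rw [← Complex.exp_add, add_neg_cancel, Complex.exp_zero]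
    have hr2' : (r : ℂ) ^ 2 * (σ + 1) = σ - 1 := by
      have : r ^ 2 * (σ + 1) = σ - 1 := by
        rw [hr2, hY]
        field_simp
      exact_mod_cast this
    push_cast
    linear_combination (-(σ + 1) / 2 * r : ℂ) * hc - ((σ + 1) / 2 * r ^ 2 : ℂ) * he - hr2' / 2
  have hφ : Integrable (fun φ : ℝ => (1 - (r : ℂ) * (-Complex.exp (-(Complex.I * φ)))) ^ (-h))
      (volume.restrict (Ioc (-Real.pi) Real.pi)) := by
    refine Continuous.integrableOn_Ioc ?_
    refine Continuous.cpow (by fun_prop) continuous_const fun φ => ?_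
    have h2 := one_add_mul_exp_re_pos hr0 hr1 (-φ)
    rw [show Complex.I * ((-φ : ℝ) : ℂ) = -(Complex.I * φ) by push_cast; ring] at h2
    exact Or.inl h2
  have hs := hasSum_integral_mul_one_sub_cpow (T := fun φ : ℝ => -Complex.exp (Complex.I * φ))
    hφ (Continuous.aestronglyMeasurable (by fun_prop)) (Eventually.of_forall fun φ =>
      (norm_neg_exp_I_mul φ).le) h
    (x := (r : ℂ)) (by rw [Complex.norm_real, Real.norm_of_nonneg hr0]; exact hr1)
  unfold legP
  simp only [hexp]
  rw [integral_const_mul, ← hs.tsum_eq, hyp_eq_tsum, mul_left_comm, ← tsum_mul_left]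
  congr 1
  refine tsum_congr fun n => ?_
  have := integral_fourier_cpow h hr0 hr1 n
  rw [show (∫ φ in Ioc (-Real.pi) Real.pi, (1 - (r : ℂ) * (-Complex.exp (-(Complex.I * φ)))) ^ (-h) *
    (-Complex.exp (Complex.I * φ)) ^ n) = ∫ φ in Ioc (-Real.pi) Real.pi,
      (-Complex.exp (Complex.I * φ)) ^ n *
      (1 - r * (-Complex.exp (-(Complex.I * φ)))) ^ (-h) by
    congr 1; ext φ; ring, this, ordinaryHypergeometricCoefficient, ascPochhammer_eval_one, ← hr2]
  have hpi : (Real.pi : ℂ) ≠ 0 := by exact_mod_cast Real.pi_pos.ne'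
  have hn : (n.factorial : ℂ) ≠ 0 := by exact_mod_cast n.factorial_ne_zero
  push_cast
  field_simp
  ring

/-- Möbius change of variables sending `a, p` to `0, 1`, where `p = y + u`. -/
theorem integral_outer_moebius {h a u y : ℝ} (hu : 0 < u) (hy : 0 ≤ y)
    (hyu : y + u < a) :
    ∫ s in Ioo (y + u) a, (a / (a ^ 2 - s ^ 2)) ^ (1 - h) * (u / ((s - y) ^ 2 - u ^ 2)) ^ h =
      1 / 2 * (((u + a) ^ 2 - y ^ 2) / (4 * u * a)) ^ (-h) *
        ∫ q in Ioo (0 : ℝ) 1, q ^ (h - 1) * (1 - q) ^ (-h) *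
          (1 - ((a - u) ^ 2 - y ^ 2) / ((a + u) ^ 2 - y ^ 2) * q) ^ (-h) := by
  have ha : 0 < a := by linarith
  set p := y + u with hp
  have hap : 0 < a - p := by linarith
  have hap' : 0 < a + p := by linarith
  set d : ℝ → ℝ := fun q => (a + p) + q * (a - p) with hd
  have hdpos : ∀ q ∈ Ioo (0 : ℝ) 1, 0 < d q := fun q hq => by
    simp only [hd]
    nlinarith [hq.1]
  set f : ℝ → ℝ := fun q => a * ((a + p) - q * (a - p)) / d q with hf
  have himg : f '' Ioo 0 1 = Ioo p a := by
    ext s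
    constructor
    · rintro ⟨q, hq, rfl⟩
      have := hdpos q hq
      simp only [hf]
      constructor
      · rw [lt_div_iff₀ this]
        simp only [hd]
        nlinarith [hq.1, hq.2, mul_pos (mul_pos hap hap') (sub_pos.2 hq.2)]
      · rw [div_lt_iff₀ this]
        simp only [hd]
        nlinarith [hq.1, hq.2, mul_pos (mul_pos ha hap) hq.1]
    · intro hs
      have h1 : 0 < a + s := by linarith [hs.1]
      have h3 : 0 < a - s := by linarith [hs.2]
      refine ⟨(a + p) * (a - s) / ((a - p) * (a + s)), ⟨by positivity, ?_⟩, ?_⟩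
      · rw [div_lt_one (by positivity)]
        nlinarith [hs.1, hs.2]
      · simp only [hf, hd]
        rw [div_eq_iff (by positivity)]
        field_simp
        ring
  have hder : ∀ q ∈ Ioo (0 : ℝ) 1, HasDerivWithinAt f (-(2 * a * (a ^ 2 - p ^ 2)) / d q ^ 2)
      (Ioo 0 1) q := by
    intro q hq
    have h1 : HasDerivAt (fun q : ℝ => a * ((a + p) - q * (a - p))) (a * (-(1 * (a - p)))) q :=
      (((hasDerivAt_id q).mul_const (a - p)).const_sub (a + p)).const_mul a
    have h2 : HasDerivAt d (1 * (a - p)) q :=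
      ((hasDerivAt_id q).mul_const (a - p)).const_add (a + p)
    refine ((h1.div h2 (hdpos q hq).ne').congr_deriv ?_).hasDerivWithinAt
    congr 1
    simp only [hd]
    ring
  have hcv := integral_image_eq_integral_abs_deriv_smul (s := Ioo (0 : ℝ) 1) measurableSet_Ioo hder
    (fun x hx z hz hxz => by
      have h1 := hdpos x hx
      have h2 := hdpos z hz
      simp only [hf] at hxz
      rw [div_eq_div_iff h1.ne' h2.ne'] at hxz
      simp only [hd] at hxz
      have : (2 * a * ((a + p) * (a - p))) * (x - z) = 0 := by linarith
      rcases mul_eq_zero.1 this with h | h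
      · exact absurd h (by positivity)
      · linarith)
    (fun s => (a / (a ^ 2 - s ^ 2)) ^ (1 - h) * (u / ((s - y) ^ 2 - u ^ 2)) ^ h)
  rw [himg] at hcv
  rw [hcv, ← integral_const_mul]
  refine setIntegral_congr_fun measurableSet_Ioo fun q hq => ?_
  have hdq := hdpos q hq
  have hq0 := hq.1
  have hq1 : 0 < 1 - q := sub_pos.2 hq.2
  have hap2 : 0 < a ^ 2 - p ^ 2 := by nlinarith
  -- `κ` is the common factor of the two bases, which carry the exponents `1 - h` and `h`; their
  -- product `κ` cancels against the Jacobian `1 / (2κ)`.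
  set κ := d q ^ 2 / (4 * a * (a ^ 2 - p ^ 2)) with hκ
  have hκ0 : 0 < κ := by positivity
  set m := ((u + a) ^ 2 - y ^ 2) / (4 * u * a) with hm
  have hm0' : 0 < (a + u) ^ 2 - y ^ 2 := by nlinarith
  have hm0 : 0 < m := div_pos (by linarith [hm0']) (by positivity)
  set Y := ((a - u) ^ 2 - y ^ 2) / ((a + u) ^ 2 - y ^ 2) with hY
  have hY1 : Y ≤ 1 := by
    rw [hY, div_le_one hm0']
    nlinarith
  have hYq : 0 < 1 - Y * q := by nlinarith
  have e1 : a / (a ^ 2 - f q ^ 2) = κ * q⁻¹ := by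
    have : a ^ 2 - f q ^ 2 = a ^ 2 * (4 * q * (a ^ 2 - p ^ 2)) / d q ^ 2 := by
      simp only [hf]
      rw [eq_div_iff (by positivity), div_pow, sub_mul, div_mul_cancel₀ _ (by positivity)]
      simp only [hd]
      ring
    rw [this, hκ]
    field_simp
  have e2 : u / ((f q - y) ^ 2 - u ^ 2) = κ * (m⁻¹ * ((1 - q)⁻¹ * (1 - Y * q)⁻¹)) := by
    have h1 : (f q - y) ^ 2 - u ^ 2 = 4 * u * a * (m * (1 - Y * q)) * ((a ^ 2 - p ^ 2) * (1 - q)) /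
        d q ^ 2 := by
      have h2 : 4 * u * a * (m * (1 - Y * q)) = (u + a) ^ 2 - y ^ 2 - q * ((a - u) ^ 2 - y ^ 2) := by
        rw [hm, hY]
        field_simp
        ring
      rw [h2, eq_div_iff (by positivity), show ((f q - y) ^ 2 - u ^ 2) * d q ^ 2 =
        (f q * d q - y * d q) ^ 2 - u ^ 2 * d q ^ 2 by ring]
      simp only [hf]
      rw [div_mul_cancel₀ _ hdq.ne']
      simp only [hd, hp]
      ring
    rw [h1, hκ]
    field_simp
  have e3 : |-(2 * a * (a ^ 2 - p ^ 2)) / d q ^ 2| = 1 / (2 * κ) := by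
    rw [neg_div, abs_neg, abs_of_pos (by positivity), hκ]
    field_simp
    ring
  rw [e1, e2, e3, smul_eq_mul, Real.mul_rpow hκ0.le (by positivity),
    Real.mul_rpow hκ0.le (by positivity), Real.mul_rpow (by positivity) (by positivity),
    Real.mul_rpow (by positivity) (by positivity), Real.inv_rpow hq0.le, Real.inv_rpow hm0.le,
    Real.inv_rpow hq1.le, Real.inv_rpow hYq.le, ← Real.rpow_neg hq0.le, ← Real.rpow_neg hm0.le,
    ← Real.rpow_neg hq1.le, ← Real.rpow_neg hYq.le, neg_sub]
  have e4 : κ ^ (1 - h) * κ ^ h = κ := by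
    rw [← Real.rpow_add hκ0, sub_add_cancel, Real.rpow_one]
  calc _ = 1 / (2 * κ) * (κ ^ (1 - h) * κ ^ h) * (q ^ (h - 1) * (m ^ (-h) * ((1 - q) ^ (-h) *
        (1 - Y * q) ^ (-h)))) := by ring
    _ = _ := by
      rw [e4]
      field_simp

/-- The integral of the discontinuity of the kernel is a Legendre function. -/
theorem sin_mul_integral_outer {h a u y : ℝ} (hh : 0 < h) (hh1 : h < 1) (hu : 0 < u) (hy : 0 ≤ y)
    (hyu : y + u < a) :
    (Real.sin (Real.pi * h) : ℂ) * ((∫ s in Ioo (y + u) a,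
      (a / (a ^ 2 - s ^ 2)) ^ (1 - h) * (u / ((s - y) ^ 2 - u ^ 2)) ^ h : ℝ) : ℂ) =
      Real.pi / 2 * legP h ((u ^ 2 + a ^ 2 - y ^ 2) / (2 * u * a)) := by
  have ha : 0 < a := by linarith
  have hm0' : 0 < (a + u) ^ 2 - y ^ 2 := by nlinarith
  have hm0 : 0 < ((u + a) ^ 2 - y ^ 2) / (4 * u * a) := div_pos (by linarith) (by positivity)
  set σ := (u ^ 2 + a ^ 2 - y ^ 2) / (2 * u * a) with hσ
  have hσ1 : 1 ≤ σ := by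
    rw [hσ, le_div_iff₀ (by positivity)]
    nlinarith
  have e1 : (σ + 1) / 2 = ((u + a) ^ 2 - y ^ 2) / (4 * u * a) := by
    rw [hσ]
    field_simp
    ring
  have e2 : (σ - 1) / (σ + 1) = ((a - u) ^ 2 - y ^ 2) / ((a + u) ^ 2 - y ^ 2) := by
    have : σ + 1 ≠ 0 := by positivity
    rw [div_eq_div_iff this hm0'.ne', hσ]
    field_simp
    ring
  have hY1 : ‖((((a - u) ^ 2 - y ^ 2) / ((a + u) ^ 2 - y ^ 2) : ℝ) : ℂ)‖ < 1 := by
    rw [Complex.norm_real, Real.norm_of_nonneg, div_lt_one hm0']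
    · nlinarith
    · exact div_nonneg (by nlinarith) hm0'.le
  rw [legP_eq_hyp h hσ1, integral_outer_moebius hu hy hyu, e1, e2]
  set Y := ((a - u) ^ 2 - y ^ 2) / ((a + u) ^ 2 - y ^ 2) with hY
  have hY1' : Y ≤ 1 := by
    rw [hY, div_le_one hm0']
    nlinarith
  -- With `c = 1` the Gamma factor is `Γ(h) Γ(1 - h) = π / sin(πh)`, which absorbs the sine.
  have hE := integral_euler_eq_hyp (a := h) (b := h) (c := 1) (by simpa using hh)
    (by simpa using hh1) hY1
  have hI : ((∫ q in Ioo (0 : ℝ) 1, q ^ (h - 1) * (1 - q) ^ (-h) * (1 - Y * q) ^ (-h) : ℝ) : ℂ) =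
      ∫ t in (0 : ℝ)..1, (t : ℂ) ^ ((h : ℂ) - 1) * ((1 - t : ℝ) : ℂ) ^ (1 - (h : ℂ) - 1) *
        (1 - (Y : ℂ) * t) ^ (-(h : ℂ)) := by
    rw [← integral_complex_ofReal, intervalIntegral.integral_of_le zero_le_one,
      integral_Ioc_eq_integral_Ioo]
    refine setIntegral_congr_fun measurableSet_Ioo fun q hq => ?_
    have h1 : 0 ≤ 1 - q := (sub_pos.2 hq.2).le
    have h2 : 0 ≤ 1 - Y * q := by nlinarith [hq.1, hq.2]
    rw [Complex.ofReal_mul, Complex.ofReal_mul, Complex.ofReal_cpow hq.1.le, Complex.ofReal_cpow h1,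
      Complex.ofReal_cpow h2]
    push_cast
    rw [show (1 : ℂ) - h - 1 = -h by ring]
  rw [Complex.ofReal_mul, hI, hE, Complex.Gamma_mul_Gamma_one_sub, Complex.Gamma_one, div_one,
    Complex.ofReal_mul, Complex.ofReal_cpow hm0.le]
  have hsin : Complex.sin (Real.pi * h) ≠ 0 := by
    have : 0 < Real.sin (Real.pi * h) :=
      Real.sin_pos_of_pos_of_lt_pi (by positivity) (by nlinarith [Real.pi_pos])
    exact_mod_cast this.ne'
  push_cast
  field_simp


/-! ### Size and boundary values of the kernel at its cuts. -/

theorem intervalIntegrable_abs_rpow {r : ℝ} (hr : -1 < r) (a b : ℝ) :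
    IntervalIntegrable (fun x : ℝ => |x| ^ r) volume a b := by
  have hpos : ∀ b : ℝ, 0 ≤ b → IntervalIntegrable (fun x : ℝ => |x| ^ r) volume 0 b := by
    intro b hb
    refine (intervalIntegral.intervalIntegrable_rpow' hr).congr fun x hx => ?_
    rw [uIoc_of_le hb] at hx
    rw [abs_of_pos hx.1]
  have hall : ∀ b : ℝ, IntervalIntegrable (fun x : ℝ => |x| ^ r) volume 0 b := by
    intro b
    rcases le_total 0 b with hb | hb
    · exact hpos b hb
    · have := (IntervalIntegrable.iff_comp_neg (f := fun x : ℝ => |x| ^ r)).1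
        (hpos (-b) (by linarith))
      simpa using this
  exact (hall a).symm.trans (hall b)

theorem intervalIntegrable_abs_sub_rpow {r : ℝ} (hr : -1 < r) (c a b : ℝ) :
    IntervalIntegrable (fun x : ℝ => |c - x| ^ r) volume a b := by
  have := (intervalIntegrable_abs_rpow hr (c - a) (c - b)).comp_sub_left c
  simpa using this

/-- A product of two integrable power singularities at different points is integrable. -/
theorem integrableOn_mul_abs_rpow {h c : ℝ} (hh : 0 < h) (hh1 : h < 1) (hc : c < 1) :
    IntegrableOn (fun t : ℝ => (1 - t) ^ (h - 1) * |c - t| ^ (-h)) (Ioo 0 1) := by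
  set κ := (1 - c) / 2 with hκ
  have hκ0 : 0 < κ := by rw [hκ]; linarith
  have i1 : IntegrableOn (fun t : ℝ => |c - t| ^ (-h)) (Ioo 0 1) := by
    have := intervalIntegrable_abs_sub_rpow (r := -h) (by linarith) c 0 1
    rw [intervalIntegrable_iff_integrableOn_Ioo_of_le zero_le_one] at this
    exact this
  have i2 : IntegrableOn (fun t : ℝ => |1 - t| ^ (h - 1)) (Ioo 0 1) := by
    have := intervalIntegrable_abs_sub_rpow (r := h - 1) (by linarith) 1 0 1
    rw [intervalIntegrable_iff_integrableOn_Ioo_of_le zero_le_one] at this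
    exact this
  refine ((i1.const_mul (κ ^ (h - 1))).add (i2.const_mul (κ ^ (-h)))).mono' ?_ ?_
  · refine Measurable.aestronglyMeasurable ?_
    fun_prop
  · filter_upwards [ae_restrict_mem measurableSet_Ioo] with t ht
    have h1 : 0 < 1 - t := by linarith [ht.2]
    rw [norm_mul, Real.norm_of_nonneg (Real.rpow_nonneg h1.le _),
      Real.norm_of_nonneg (Real.rpow_nonneg (abs_nonneg _) _)]
    simp only [Pi.add_apply]
    rw [abs_of_pos h1]
    -- The singular points `1` and `c` are `2κ` apart, so at every `t` one of the two factors is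
    -- bounded by a power of `κ`.
    rcases le_or_gt κ (1 - t) with h2 | h2
    · have := Real.rpow_le_rpow_of_nonpos hκ0 h2 (by linarith : h - 1 ≤ 0)
      have h3 : 0 ≤ κ ^ (-h) * (1 - t) ^ (h - 1) := by positivity
      nlinarith [mul_le_mul_of_nonneg_right this (Real.rpow_nonneg (abs_nonneg (c - t)) (-h))]
    · have h4 : κ ≤ |c - t| := by
        rw [abs_sub_comm]
        exact le_trans (by rw [hκ] at *; linarith) (le_abs_self _)
      have := Real.rpow_le_rpow_of_nonpos hκ0 h4 (by linarith : -h ≤ 0)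
      have h3 : 0 ≤ κ ^ (h - 1) * |c - t| ^ (-h) := by positivity
      nlinarith [mul_le_mul_of_nonneg_left this (Real.rpow_nonneg h1.le (h - 1))]

/-- The kernel at horizontal distance `ε` and vertical distance `d` from the branch cut. -/
noncomputable def offKern (h : ℂ) (u ε d : ℝ) : ℂ :=
  ((u : ℂ) / ((u : ℂ) ^ 2 + ((ε : ℂ) - Complex.I * d) ^ 2)) ^ h

theorem kern_eq_offKern (h : ℂ) (a u ε y t : ℝ) :
    kern h a u ((ε : ℂ) + Complex.I * y) t = offKern h u ε (a * t - y) := by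
  unfold kern offKern
  congr 3
  push_cast
  ring

theorem offKern_neg_neg (h : ℂ) (u ε d : ℝ) : offKern h u (-ε) (-d) = offKern h u ε d := by
  unfold offKern
  congr 3
  push_cast
  ring

theorem offDen_re (u ε d : ℝ) :
    ((u : ℂ) ^ 2 + ((ε : ℂ) - Complex.I * d) ^ 2).re = u ^ 2 + ε ^ 2 - d ^ 2 := by
  simp [pow_two]
  ring

theorem offDen_im (u ε d : ℝ) :
    ((u : ℂ) ^ 2 + ((ε : ℂ) - Complex.I * d) ^ 2).im = -(2 * ε * d) := by
  simp [pow_two]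
  ring

theorem offDen_normSq (u ε d : ℝ) :
    ‖(u : ℂ) ^ 2 + ((ε : ℂ) - Complex.I * d) ^ 2‖ ^ 2 =
      (u ^ 2 - d ^ 2) ^ 2 + ε ^ 4 + 2 * ε ^ 2 * (u ^ 2 + d ^ 2) := by
  rw [Complex.sq_norm, Complex.normSq_apply, offDen_re, offDen_im]
  ring

theorem norm_offKern (h u ε d : ℝ) (hu : 0 < u) :
    ‖offKern h u ε d‖ = (u / ‖(u : ℂ) ^ 2 + ((ε : ℂ) - Complex.I * d) ^ 2‖) ^ h := by
  unfold offKern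
  rw [Complex.norm_cpow_real, norm_div, Complex.norm_real, Real.norm_of_nonneg hu.le]

/-- The denominator has modulus at least `|u² - d²| ≥ |u - |d|| u`. The bound does not involve `ε`,
so it dominates the limit `ε → 0`. -/
theorem norm_offKern_le {h u ε d : ℝ} (hh : 0 < h) (hu : 0 < u) (hd : |d| ≠ u) :
    ‖offKern h u ε d‖ ≤ |u - abs d| ^ (-h) := by
  have h0 : 0 < |u - abs d| := abs_pos.2 (sub_ne_zero.2 hd.symm)
  rw [norm_offKern h u ε d hu, Real.rpow_neg h0.le, ← Real.inv_rpow h0.le]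
  refine Real.rpow_le_rpow (by positivity) ?_ hh.le
  have h1 : |u - abs d| * u ≤ ‖(u : ℂ) ^ 2 + ((ε : ℂ) - Complex.I * d) ^ 2‖ := by
    refine le_of_sq_le_sq ?_ (norm_nonneg _)
    rw [offDen_normSq]
    have h2 : (|u - abs d| * u) ^ 2 ≤ (u ^ 2 - d ^ 2) ^ 2 := by
      rw [show u ^ 2 - d ^ 2 = (u - |d|) * (u + |d|) by rw [← sq_abs d]; ring, mul_pow, mul_pow,
        sq_abs]
      refine mul_le_mul_of_nonneg_left ?_ (sq_nonneg _)
      nlinarith [abs_nonneg d]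
    nlinarith [sq_nonneg (ε ^ 2), sq_nonneg (ε * u), sq_nonneg (ε * d)]
  rw [div_le_iff₀ (lt_of_lt_of_le (by positivity) h1), inv_mul_eq_div, le_div_iff₀ h0]
  linarith

theorem continuousAt_offDen (u d ε : ℝ) : ContinuousAt
    (fun ε : ℝ => (u : ℂ) ^ 2 + ((ε : ℂ) - Complex.I * d) ^ 2) ε := by
  fun_prop

theorem offDen_zero (u d : ℝ) :
    (u : ℂ) ^ 2 + (((0 : ℝ) : ℂ) - Complex.I * d) ^ 2 = ((u ^ 2 - d ^ 2 : ℝ) : ℂ) := by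
  push_cast
  linear_combination (d : ℂ) ^ 2 * Complex.I_sq

theorem tendsto_offKern_of_lt {h u d : ℝ} (hu : 0 < u) (hd : |d| < u) :
    Tendsto (fun ε : ℝ => offKern h u ε d) (𝓝 0)
      (𝓝 (((u / (u ^ 2 - d ^ 2)) ^ h : ℝ) : ℂ)) := by
  have h1 : 0 < u ^ 2 - d ^ 2 := by
    rw [← sq_abs d]
    nlinarith [abs_nonneg d]
  have hc := continuousAt_offDen u d 0
  have hne : (u : ℂ) ^ 2 + (((0 : ℝ) : ℂ) - Complex.I * d) ^ 2 ≠ 0 := by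
    rw [offDen_zero]
    exact_mod_cast h1.ne'
  have h2 : ContinuousAt (fun ε : ℝ => offKern h u ε d) 0 := by
    unfold offKern
    refine ContinuousAt.cpow (continuousAt_const.div hc hne) continuousAt_const ?_
    rw [offDen_zero, ← Complex.ofReal_div]
    exact Or.inl (by rw [Complex.ofReal_re]; positivity)
  have h3 := h2.tendsto
  convert h3 using 2
  rw [offKern, offDen_zero, ← Complex.ofReal_div, Complex.ofReal_cpow (by positivity)]

/-- Beyond the branch point the denominator tends to a negative number with imaginary part `-2εd <
0`, so the quotient approaches the negative axis from above and its argument tends to `π`. -/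
theorem tendsto_offKern_of_gt {h u d : ℝ} (hu : 0 < u) (hd : u < d) :
    Tendsto (fun ε : ℝ => offKern h u ε d) (𝓝[>] 0)
      (𝓝 (Complex.exp (Complex.I * Real.pi * h) * ((u / (d ^ 2 - u ^ 2)) ^ h : ℝ))) := by
  have h1 : 0 < d ^ 2 - u ^ 2 := by nlinarith
  set q := u / (d ^ 2 - u ^ 2) with hq
  have hq0 : 0 < q := by positivity
  have hc := continuousAt_offDen u d 0
  have hne : (u : ℂ) ^ 2 + (((0 : ℝ) : ℂ) - Complex.I * d) ^ 2 ≠ 0 := by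
    rw [offDen_zero]
    exact_mod_cast (by linarith : u ^ 2 - d ^ 2 < 0).ne
  have hval : (u : ℂ) / ((u : ℂ) ^ 2 + (((0 : ℝ) : ℂ) - Complex.I * d) ^ 2) = ((-q : ℝ) : ℂ) := by
    rw [offDen_zero, ← Complex.ofReal_div, hq, ← div_neg, neg_sub]
  have hlim : Tendsto (fun ε : ℝ => (u : ℂ) / ((u : ℂ) ^ 2 + ((ε : ℂ) - Complex.I * d) ^ 2))
      (𝓝[>] 0) (𝓝[{z : ℂ | 0 ≤ z.im}] ((-q : ℝ) : ℂ)) := by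
    refine tendsto_nhdsWithin_iff.2 ⟨?_, ?_⟩
    · rw [← hval]
      exact (continuousAt_const.div hc hne).tendsto.mono_left nhdsWithin_le_nhds
    · filter_upwards [self_mem_nhdsWithin] with ε hε
      have hε0 : (0 : ℝ) < ε := hε
      change (0 : ℝ) ≤ Complex.im _
      rw [Complex.div_im, offDen_im, offDen_re]
      simp only [Complex.ofReal_re, Complex.ofReal_im, zero_mul, zero_div, zero_sub]
      rw [mul_neg, neg_div, neg_neg]
      have : 0 < d := by linarith
      exact div_nonneg (by positivity) (Complex.normSq_nonneg _)
  have hlog := (Complex.tendsto_log_nhdsWithin_im_nonneg_of_re_neg_of_im_zero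
    (z := ((-q : ℝ) : ℂ)) (by simpa using hq0) (by simp)).comp hlim
  have hexp := (Complex.continuous_exp.tendsto _).comp (hlog.mul_const (h : ℂ))
  have heq : Complex.exp ((((Real.log ‖((-q : ℝ) : ℂ)‖ : ℝ) : ℂ) + Real.pi * Complex.I) * h) =
      Complex.exp (Complex.I * Real.pi * h) * ((q ^ h : ℝ) : ℂ) := by
    rw [Complex.norm_real, norm_neg, Real.norm_of_nonneg hq0.le, add_mul, Complex.exp_add, mul_comm,
      Real.rpow_def_of_pos hq0]
    push_cast
    congr 2
    ring
  rw [heq] at hexp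
  refine hexp.congr' ?_
  filter_upwards [self_mem_nhdsWithin] with ε hε
  have hε0 : (0 : ℝ) < ε := hε
  have hden : (u : ℂ) ^ 2 + ((ε : ℂ) - Complex.I * d) ^ 2 ≠ 0 := by
    intro h0
    have him := congrArg Complex.im h0
    rw [offDen_im, Complex.zero_im] at him
    have hd0 : 0 < d := by linarith
    have : 0 < ε * d := by positivity
    linarith
  rw [offKern, Complex.cpow_def_of_ne_zero
    (div_ne_zero (by exact_mod_cast hu.ne') hden)]
  rfl

/-- Changing the sign of `ε` conjugates the base, and conjugation commutes with the principal power
off the negative axis. -/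
theorem tendsto_offKern_of_gt' {h u d : ℝ} (hu : 0 < u) (hd : u < d) :
    Tendsto (fun ε : ℝ => offKern h u (-ε) d) (𝓝[>] 0)
      (𝓝 (Complex.exp (-(Complex.I * Real.pi * h)) * ((u / (d ^ 2 - u ^ 2)) ^ h : ℝ))) := by
  have h1 := tendsto_offKern_of_gt (h := h) hu hd
  have h2 := (Complex.continuous_conj.tendsto _).comp h1
  have e : (starRingEnd ℂ) (Complex.exp (Complex.I * Real.pi * h) *
      ((u / (d ^ 2 - u ^ 2)) ^ h : ℝ)) =
      Complex.exp (-(Complex.I * Real.pi * h)) * ((u / (d ^ 2 - u ^ 2)) ^ h : ℝ) := by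
    rw [map_mul, ← Complex.exp_conj, Complex.conj_ofReal]
    congr 2
    simp
  rw [e] at h2
  refine h2.congr' ?_
  filter_upwards [self_mem_nhdsWithin] with ε hε
  have hε0 : (0 : ℝ) < ε := hε
  have hd0 : 0 < d := by linarith
  simp only [Function.comp, offKern]
  have harg : ((u : ℂ) / ((u : ℂ) ^ 2 + ((ε : ℂ) - Complex.I * d) ^ 2)).arg ≠ Real.pi := by
    intro h0
    rw [Complex.arg_eq_pi_iff] at h0
    have := h0.2
    rw [Complex.div_im, offDen_im, offDen_re] at this
    simp only [Complex.ofReal_re, Complex.ofReal_im, zero_mul, zero_div, zero_sub] at this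
    have hns : Complex.normSq ((u : ℂ) ^ 2 + ((ε : ℂ) - Complex.I * d) ^ 2) ≠ 0 := by
      rw [Complex.normSq_apply, offDen_im]
      have : 0 < (2 * ε * d) ^ 2 := by positivity
      nlinarith [mul_self_nonneg ((u : ℂ) ^ 2 + ((ε : ℂ) - Complex.I * d) ^ 2).re]
    rw [neg_eq_zero, div_eq_zero_iff] at this
    rcases this with h | h
    · have : 0 < u * (2 * ε * d) := by positivity
      linarith
    · exact hns h
  have hconj := Complex.conj_cpow _ (h : ℂ) harg
  rw [Complex.conj_ofReal] at hconj
  rw [← hconj]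
  simp only [Complex.conj_ofReal, map_div₀, map_add, map_pow, map_sub, map_mul, Complex.conj_I]
  congr 3
  push_cast
  ring


/-! ### Regularity of the kernel; the propagator as a function of distance. -/

theorem ofReal_div_mem_slitPlane {u : ℝ} (hu : 0 < u) {z : ℂ} (hz : z ∈ Complex.slitPlane) :
    (u : ℂ) / z ∈ Complex.slitPlane := by
  have hz0 := Complex.slitPlane_ne_zero hz
  have h1 : z⁻¹ ∈ Complex.slitPlane := by
    rw [Complex.mem_slitPlane_iff_arg] at hz ⊢
    refine ⟨?_, inv_ne_zero hz0⟩
    rw [Complex.arg_inv, if_neg hz.1]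
    intro h
    linarith [Complex.neg_pi_lt_arg z]
  rw [div_eq_mul_inv, Complex.mem_slitPlane_iff_arg, Complex.arg_real_mul _ hu]
  rw [Complex.mem_slitPlane_iff_arg] at h1
  exact ⟨h1.1, mul_ne_zero (by exact_mod_cast hu.ne') h1.2⟩

/-- Only imaginary `v` can make the sum a nonpositive real number. Hence the kernel is regular off
the imaginary axis and on the whole horizontal line through `w`, which is where `C_i(ε)` runs. -/
theorem sq_add_sq_mem_slitPlane {u : ℝ} (hu : 0 < u) {v : ℂ} (hv : v.re ≠ 0 ∨ v.im = 0) :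
    (u : ℂ) ^ 2 + v ^ 2 ∈ Complex.slitPlane := by
  rw [Complex.mem_slitPlane_iff]
  by_cases h : v.im = 0
  · left
    simp only [pow_two, Complex.add_re, Complex.mul_re, Complex.ofReal_re, Complex.ofReal_im, h,
      mul_zero, sub_zero]
    exact add_pos_of_pos_of_nonneg (mul_pos hu hu) (mul_self_nonneg _)
  · right
    simp [pow_two]
    have := mul_ne_zero (hv.resolve_right h) h
    intro h0
    apply this
    linarith

theorem kern_den_mem_slitPlane {a u t : ℝ} {ζ : ℂ} (hu : 0 < u)
    (hζ : ζ.re ≠ 0 ∨ ζ.im = a * t) :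
    (u : ℂ) ^ 2 + (ζ - Complex.I * (a * t)) ^ 2 ∈ Complex.slitPlane := by
  refine sq_add_sq_mem_slitPlane hu (hζ.imp (fun h => ?_) fun h => ?_)
  · simpa using h
  · simp [h]

theorem continuousAt_kern {a : ℝ} {p : ℂ × ℝ × ℂ × ℝ} (hu : 0 < p.2.1)
    (hζ : p.2.2.1.re ≠ 0 ∨ p.2.2.1.im = a * p.2.2.2) :
    ContinuousAt (fun p : ℂ × ℝ × ℂ × ℝ => kern p.1 a p.2.1 p.2.2.1 p.2.2.2) p := by
  have hmem := kern_den_mem_slitPlane hu hζ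
  unfold kern
  refine ContinuousAt.cpow ?_ (by fun_prop) (ofReal_div_mem_slitPlane hu hmem)
  exact ContinuousAt.div (by fun_prop) (by fun_prop) (Complex.slitPlane_ne_zero hmem)

/-- The bulk-to-bulk propagator as a function of the invariant distance. -/
noncomputable def gfun (h : ℂ) (σ : ℝ) : ℂ :=
  ((1 / (2 * σ) : ℝ) : ℂ) ^ h *
    ordinaryHypergeometric (h / 2) (h / 2 + 1 / 2) (h + 1 / 2) ((1 / (σ : ℂ)) ^ 2)

theorem norm_one_div_sq_lt_one {σ : ℝ} (hσ : 1 < σ) : ‖(1 / (σ : ℂ)) ^ 2‖ < 1 := by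
  rw [norm_pow, norm_div, norm_one, Complex.norm_real, Real.norm_of_nonneg (by linarith)]
  have : 1 / σ < 1 := by rw [div_lt_one (by linarith)]; exact hσ
  exact pow_lt_one₀ (by positivity) this two_ne_zero

theorem G_eq_gfun (h : ℝ) {u a σ z₀ : ℝ} {z : ℂ} (hu : 0 < u) (ha : 0 < a) (hσ : 1 < σ)
    (hD : dist2 u z a z₀ = ((2 * u * a * σ : ℝ) : ℂ)) : G h u z a z₀ = gfun h σ := by
  have hu' : (u : ℂ) ≠ 0 := by exact_mod_cast hu.ne'
  have ha' : (a : ℂ) ≠ 0 := by exact_mod_cast ha.ne'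
  have e1 : (u : ℂ) * a / ((2 * u * a * σ : ℝ) : ℂ) = ((1 / (2 * σ) : ℝ) : ℂ) := by
    push_cast
    field_simp
  have e2 : 2 * (u : ℂ) * a / ((2 * u * a * σ : ℝ) : ℂ) = 1 / (σ : ℂ) := by
    push_cast
    field_simp
  rw [G, hD, e1, e2, hyp2F1, if_pos (norm_one_div_sq_lt_one hσ), gfun]

theorem continuousAt_gfun {h : ℂ} (hc : ∀ k : ℕ, h + 1 / 2 + k ≠ 0) {σ : ℝ} (hσ : 1 < σ) :
    ContinuousAt (gfun h) σ := by
  have h0 : (σ : ℂ) ≠ 0 := by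
    have : σ ≠ 0 := by linarith
    exact_mod_cast this
  have hc1 : ContinuousAt (fun σ : ℝ => (1 / (σ : ℂ)) ^ 2) σ :=
    (continuousAt_const.div (by fun_prop) h0).pow 2
  unfold gfun
  refine ContinuousAt.mul ?_ ?_
  · refine ContinuousAt.cpow ?_ continuousAt_const ?_
    · refine Complex.continuous_ofReal.continuousAt.comp ?_
      exact continuousAt_const.div (by fun_prop) (by linarith)
    · exact Or.inl (by rw [Complex.ofReal_re]; exact div_pos one_pos (by linarith))
  · obtain ⟨q, hq1, hq2⟩ := exists_between (norm_one_div_sq_lt_one hσ)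
    have hq0 : 0 ≤ q := (norm_nonneg _).trans hq1.le
    refine ContinuousAt.comp (g := ordinaryHypergeometric (h / 2) (h / 2 + 1 / 2) (h + 1 / 2))
      ?_ hc1
    refine (continuousOn_hyp hc hq0 hq2).continuousAt ?_
    exact mem_of_superset (Metric.isOpen_ball.mem_nhds (by
      rw [mem_ball_zero_iff]; exact hq1)) Metric.ball_subset_closedBall

/-- The value of `∫ (1 - t²) ^ (h - 1) dt`. -/
noncomputable def cQ (h : ℂ) : ℂ :=
  Complex.Gamma (1 / 2) * Complex.Gamma h / Complex.Gamma (h + 1 / 2)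

/-- Scaling `t = u x` makes the two factors change roles: `(1 - x²) ^ (-h)` becomes the weight, with
`h' = 1 - h` in place of `h`. The Möbius map with `β = -u` then leads to the standard integral. This
is how `G_{1-h}` enters. -/
theorem two_mul_integral_inner {h u : ℝ} (hh1 : h < 1) (hu : 0 < u) (hu1 : u < 1) :
    ((2 * ∫ t in Ioo 0 u, (1 - t ^ 2) ^ (h - 1) * (u / (u ^ 2 - t ^ 2)) ^ h : ℝ) : ℂ) =
      cQ (1 - h) * gfun (1 - h) ((1 + u ^ 2) / (2 * u)) := by
  set σ := (1 + u ^ 2) / (2 * u) with hσ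
  have hσ1 : 1 < σ := by
    rw [hσ, lt_div_iff₀ (by positivity)]
    nlinarith [mul_pos (sub_pos.2 hu1) (sub_pos.2 hu1)]
  set h' := 1 - h with hh'
  have hh'0 : 0 < h' := by linarith
  have hw := integrable_weight (h := (h' : ℂ)) (by simpa using hh'0)
  have hB : ∀ t ∈ Icc (-1 : ℝ) 1, 0 < 1 - u ^ 2 * t ^ 2 := by
    intro t ht
    have h1 : t ^ 2 ≤ 1 := by nlinarith [ht.1, ht.2]
    nlinarith [sq_nonneg t]
  have hint : IntervalIntegrable (fun t : ℝ => ((1 - t ^ 2 : ℝ) : ℂ) ^ ((h' : ℂ) - 1) *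
      (((1 - u ^ 2 * t ^ 2) ^ (-h') : ℝ) : ℂ)) volume (-1) 1 := by
    refine hw.mul_continuousOn ?_
    rw [uIcc_of_le (by norm_num)]
    refine Complex.continuous_ofReal.comp_continuousOn ?_
    exact ContinuousOn.rpow_const (by fun_prop) fun t ht => Or.inl (hB t ht).ne'
  have hsplit := intervalIntegral_symm_split hint
  have hmob := integral_moebius (h := h') (β := -u) (k := 2 * u) (σ := σ)
    (B := fun t => 1 - u ^ 2 * t ^ 2) (by rwa [abs_neg, abs_of_pos hu]) (by positivity) hσ1.le (by
      intro τ hτ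
      have hne : 1 + -u * τ ≠ 0 := by nlinarith [hτ.1, hτ.2]
      rw [sub_mul, mul_assoc (u ^ 2), ← mul_pow, div_mul_cancel₀ _ hne, hσ]
      field_simp
      ring)
  have hQ := integral_weight_mul_sub_cpow hh'0 hσ1
  have e1 : ∫ t in (-1 : ℝ)..1, ((1 - t ^ 2 : ℝ) : ℂ) ^ ((h' : ℂ) - 1) *
      (((1 - u ^ 2 * t ^ 2) ^ (-h') : ℝ) : ℂ) =
      ((∫ t in Ioo (-1 : ℝ) 1, (1 - t ^ 2) ^ (h' - 1) * (1 - u ^ 2 * t ^ 2) ^ (-h') : ℝ) : ℂ) := by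
    rw [← integral_complex_ofReal, intervalIntegral.integral_of_le (by norm_num),
      integral_Ioc_eq_integral_Ioo]
    refine setIntegral_congr_fun measurableSet_Ioo fun t ht => ?_
    have h3 : 0 ≤ 1 - t ^ 2 := by nlinarith [ht.1, ht.2]
    rw [Complex.ofReal_mul, Complex.ofReal_cpow h3]
    push_cast
    rfl
  have e2 : ∫ t in (-1 : ℝ)..1, ((1 - t ^ 2 : ℝ) : ℂ) ^ ((h' : ℂ) - 1) *
      ((σ - t : ℝ) : ℂ) ^ (-(h' : ℂ)) =
      ((∫ t in Ioo (-1 : ℝ) 1, (1 - t ^ 2) ^ (h' - 1) * (σ - t) ^ (-h') : ℝ) : ℂ) := by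
    rw [← integral_complex_ofReal, intervalIntegral.integral_of_le (by norm_num),
      integral_Ioc_eq_integral_Ioo]
    refine setIntegral_congr_fun measurableSet_Ioo fun t ht => ?_
    have h3 : 0 ≤ 1 - t ^ 2 := by nlinarith [ht.1, ht.2]
    have h4 : 0 ≤ σ - t := by linarith [ht.2]
    rw [Complex.ofReal_mul, Complex.ofReal_cpow h3, Complex.ofReal_cpow h4]
    push_cast
    rfl
  have e3 : ∫ t in Ioo 0 u, (1 - t ^ 2) ^ (h - 1) * (u / (u ^ 2 - t ^ 2)) ^ h =
      u ^ h' * ∫ x in Ioo (0 : ℝ) 1, (1 - x ^ 2) ^ (h' - 1) * (1 - u ^ 2 * x ^ 2) ^ (-h') := by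
    rw [← integral_Ioc_eq_integral_Ioo, ← integral_Ioc_eq_integral_Ioo,
      ← intervalIntegral.integral_of_le hu.le, ← intervalIntegral.integral_of_le zero_le_one]
    have := intervalIntegral.integral_comp_mul_left (a := 0) (b := 1)
      (fun t => (1 - t ^ 2) ^ (h - 1) * (u / (u ^ 2 - t ^ 2)) ^ h) hu.ne'
    rw [mul_zero, mul_one, smul_eq_mul, eq_inv_mul_iff_mul_eq₀ hu.ne'] at this
    rw [← this, ← intervalIntegral.integral_const_mul, ← intervalIntegral.integral_const_mul]
    refine intervalIntegral.integral_congr_ae ?_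
    have hne : ∀ᵐ x : ℝ, x ≠ 1 := by simp [ae_iff]
    filter_upwards [hne] with x hx1 hx
    rw [uIoc_of_le zero_le_one] at hx
    have hx2 : x < 1 := lt_of_le_of_ne hx.2 hx1
    have h5 : 0 < 1 - x ^ 2 := by nlinarith [hx.1]
    have h6 := hB x ⟨by linarith [hx.1], hx.2⟩
    rw [show u / (u ^ 2 - (u * x) ^ 2) = u⁻¹ * (1 - x ^ 2)⁻¹ by field_simp,
      Real.mul_rpow (by positivity) (by positivity), Real.inv_rpow hu.le, Real.inv_rpow h5.le,
      ← Real.rpow_neg h5.le, show h' - 1 = -h by rw [hh']; ring, show -h' = h - 1 by rw [hh']; ring,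
      mul_pow, ← Real.rpow_neg hu.le, hh', Real.rpow_sub hu, Real.rpow_one, Real.rpow_neg hu.le]
    ring
  have e4 : ∫ t in (0 : ℝ)..1, (((1 - t ^ 2 : ℝ) : ℂ) ^ ((h' : ℂ) - 1) *
      (((1 - u ^ 2 * t ^ 2) ^ (-h') : ℝ) : ℂ) + ((1 - (-t) ^ 2 : ℝ) : ℂ) ^ ((h' : ℂ) - 1) *
      (((1 - u ^ 2 * (-t) ^ 2) ^ (-h') : ℝ) : ℂ)) =
      ((2 * ∫ x in Ioo (0 : ℝ) 1, (1 - x ^ 2) ^ (h' - 1) * (1 - u ^ 2 * x ^ 2) ^ (-h') : ℝ) : ℂ) := by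
    rw [← integral_const_mul, ← integral_complex_ofReal,
      intervalIntegral.integral_of_le zero_le_one, integral_Ioc_eq_integral_Ioo]
    refine setIntegral_congr_fun measurableSet_Ioo fun t ht => ?_
    have h3 : 0 ≤ 1 - t ^ 2 := by nlinarith [ht.1, ht.2]
    simp only [neg_sq]
    rw [Complex.ofReal_mul, Complex.ofReal_mul, Complex.ofReal_cpow h3]
    push_cast
    ring
  rw [e4, e1, hmob] at hsplit
  rw [e3, mul_left_comm, Complex.ofReal_mul, ← hsplit, Complex.ofReal_mul, ← e2, hQ, cQ, gfun]
  have hσ0 : 0 ≤ σ := by linarith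
  have e5 : ((u ^ h' : ℝ) : ℂ) * (((2 * u) ^ (-h') : ℝ) : ℂ) * (σ : ℂ) ^ (-(h' : ℂ)) =
      ((1 / (2 * σ) : ℝ) : ℂ) ^ (h' : ℂ) := by
    rw [← Complex.ofReal_neg, ← Complex.ofReal_cpow hσ0, ← Complex.ofReal_mul, ← Complex.ofReal_mul,
      ← Complex.ofReal_cpow (by positivity), Real.mul_rpow (by norm_num) hu.le, one_div,
      Real.inv_rpow (by positivity), ← Real.rpow_neg (by positivity),
      Real.mul_rpow (by norm_num) hσ0, Real.rpow_neg hu.le]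
    congr 1
    have : u ^ h' ≠ 0 := (Real.rpow_pos_of_pos hu _).ne'
    field_simp
  have e6 : ((h' : ℝ) : ℂ) = 1 - (h : ℂ) := by rw [hh']; push_cast; rfl
  rw [← e6, ← e5]
  ring


/-! ### The connection formula in the strip `0 < h < 1`. -/

theorem wt_eq_ofReal {h a t : ℝ} (ha : 0 ≤ a) (ht : t ∈ Icc (-1 : ℝ) 1) :
    wt h a t = (((a * (1 - t ^ 2)) ^ (h - 1) : ℝ) : ℂ) := by
  have h3 : 0 ≤ 1 - t ^ 2 := by nlinarith [ht.1, ht.2]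
  rw [wt, Complex.ofReal_cpow (by positivity)]
  push_cast
  rfl

theorem integrableOn_wt {h : ℂ} (hh : 0 < h.re) {a : ℝ} (ha : 0 < a) :
    IntegrableOn (wt h a) (Ioo (-1) 1) := by
  have h1 := integrable_weight hh
  rw [intervalIntegrable_iff_integrableOn_Ioo_of_le (by norm_num)] at h1
  have h2 : IntegrableOn (fun t : ℝ => (a : ℂ) ^ (h - 1) * ((1 - t ^ 2 : ℝ) : ℂ) ^ (h - 1))
      (Ioo (-1) 1) := h1.const_mul _
  refine h2.congr_fun (fun t ht => ?_) measurableSet_Ioo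
  have h3 : 0 ≤ 1 - t ^ 2 := by nlinarith [ht.1, ht.2]
  rw [wt, Complex.ofReal_mul, Complex.mul_cpow_ofReal_nonneg ha.le h3]

theorem continuous_kern (h : ℂ) (a : ℝ) {u : ℝ} (hu : 0 < u) {ζ : ℂ} (hζ : ζ.re ≠ 0) :
    Continuous (kern h a u ζ) := by
  rw [continuous_iff_continuousAt]
  intro t
  exact ContinuousAt.comp (f := fun t : ℝ => ((h, u, ζ, t) : ℂ × ℝ × ℂ × ℝ))
    (continuousAt_kern (a := a) hu (Or.inl hζ)) (by fun_prop)

theorem integrableOn_wt_mul {h : ℂ} (hh : 0 < h.re) {a : ℝ} (ha : 0 < a) {g : ℝ → ℂ}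
    (hg : Continuous g) : IntegrableOn (fun t => wt h a t * g t) (Ioo (-1) 1) := by
  rw [← integrableOn_Icc_iff_integrableOn_Ioo]
  refine IntegrableOn.mul_continuousOn ?_ hg.continuousOn isCompact_Icc
  rw [integrableOn_Icc_iff_integrableOn_Ioo]
  exact integrableOn_wt hh ha

theorem norm_wt_le {h a t : ℝ} (ha : 0 < a) (hh1 : h ≤ 1) (ht : t ∈ Ioo (0 : ℝ) 1) :
    ‖wt h a t‖ ≤ a ^ (h - 1) * (1 - t) ^ (h - 1) := by
  have h3 : 0 < 1 - t := by linarith [ht.2]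
  have h4 : 1 - t ≤ 1 - t ^ 2 := by nlinarith [ht.1]
  rw [wt_eq_ofReal ha.le ⟨by linarith [ht.1], ht.2.le⟩, Complex.norm_real, Real.norm_of_nonneg
    (Real.rpow_nonneg (mul_nonneg ha.le (by linarith)) _), Real.mul_rpow ha.le (by linarith)]
  exact mul_le_mul_of_nonneg_left (Real.rpow_le_rpow_of_nonpos h3 h4 (by linarith))
    (Real.rpow_nonneg ha.le _)

theorem exp_add_exp_neg (h : ℝ) : Complex.exp (Complex.I * Real.pi * h) +
    Complex.exp (-(Complex.I * Real.pi * h)) = ((2 * Real.cos (Real.pi * h) : ℝ) : ℂ) := by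
  push_cast
  rw [Complex.two_cos, show -((Real.pi : ℂ) * h) * Complex.I = -(Complex.I * Real.pi * h) by ring,
    show (Real.pi : ℂ) * h * Complex.I = Complex.I * Real.pi * h by ring]

/-- Connection formula for the Legendre functions in the strip `0 < h < 1`. -/
theorem connection_of_lt_one {h : ℝ} (hh : 0 < h) (hh1 : h < 1) {σ : ℝ} (hσ : 1 < σ) :
    (Real.sin (Real.pi * h) : ℂ) * (cQ h * gfun h σ - cQ (1 - h) * gfun (1 - h) σ) =
      Real.pi * Real.cos (Real.pi * h) * legP h σ := by
  -- The root in `(0, 1)` of `u² + 1 = 2uσ`: with it the bulk points `(u, 0)` and `(1, 0)` have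
  -- invariant distance `σ`.
  set u := σ - Real.sqrt (σ ^ 2 - 1) with hu
  have hs2 : Real.sqrt (σ ^ 2 - 1) ^ 2 = σ ^ 2 - 1 := Real.sq_sqrt (by nlinarith)
  have hs0 := Real.sqrt_nonneg (σ ^ 2 - 1)
  have hu0 : 0 < u := by nlinarith
  have hu1 : u < 1 := by nlinarith
  have hquad : u ^ 2 + 1 = 2 * u * σ := by
    rw [hu]
    linear_combination hs2
  have hσu : (1 + u ^ 2) / (2 * u) = σ := by
    rw [div_eq_iff (by positivity)]
    linarith
  have hre : 0 < (h : ℂ).re := by simpa using hh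
  set A : ℝ → ℝ := fun t => (1 - t ^ 2) ^ (h - 1) with hA
  set B1 : ℝ → ℝ := fun t => A t * (u / (u ^ 2 - t ^ 2)) ^ h with hB1
  set B2 : ℝ → ℝ := fun t => A t * (u / (t ^ 2 - u ^ 2)) ^ h with hB2
  -- The superposition integrand at `ζ = ε`, folded to `(0, 1)`, so that `t` and `-t` show the two
  -- sides `±ε` of the cut. In the limit the sides agree for `t < u`, and for `t > u` their phases
  -- `e^{±iπh}` add up to `2 cos(πh)`.
  set Φ : ℝ → ℝ → ℂ := fun ε t => wt h 1 t * (offKern h u ε t + offKern h u (-ε) t) with hΦ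
  set lim : ℝ → ℂ := fun t => if t < u then ((2 * B1 t : ℝ) : ℂ) else
    ((2 * Real.cos (Real.pi * h) * B2 t : ℝ) : ℂ) with hlim
  have hker : ∀ ε t : ℝ, kern h 1 u ε t = offKern h u ε t := by
    intro ε t
    have := kern_eq_offKern h 1 u ε 0 t
    simpa using this
  have hcont : ∀ ε : ℝ, ε ≠ 0 → Continuous (offKern h u ε) := by
    intro ε hε
    have := continuous_kern h 1 hu0 (ζ := (ε : ℂ)) (by simpa using hε)
    exact this.congr (hker ε)
  have hwtA : ∀ t ∈ Ioo (0 : ℝ) 1, wt h 1 t = ((A t : ℝ) : ℂ) := by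
    intro t ht
    rw [wt_eq_ofReal zero_le_one ⟨by linarith [ht.1], ht.2.le⟩, one_mul]
  have hne : ∀ᵐ t : ℝ ∂(volume.restrict (Ioo (0 : ℝ) 1)), t ≠ u :=
    ae_restrict_of_ae (by simp [ae_iff])
  have hb : ∀ ε t : ℝ, t ∈ Ioo (0 : ℝ) 1 → t ≠ u →
      ‖Φ ε t‖ ≤ 2 * ((1 - t) ^ (h - 1) * |u - t| ^ (-h)) := by
    intro ε t ht htu
    have h1 := norm_wt_le (h := h) one_pos hh1.le ht
    rw [Real.one_rpow, one_mul] at h1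
    have h2 : ∀ ε, ‖offKern h u ε t‖ ≤ |u - t| ^ (-h) := by
      intro ε
      have := norm_offKern_le (ε := ε) (d := t) hh hu0 (by rwa [abs_of_pos ht.1])
      rwa [abs_of_pos ht.1] at this
    have h3 : ‖offKern h u ε t + offKern h u (-ε) t‖ ≤ 2 * |u - t| ^ (-h) :=
      (norm_add_le _ _).trans (by linarith [h2 ε, h2 (-ε)])
    calc ‖Φ ε t‖ ≤ (1 - t) ^ (h - 1) * (2 * |u - t| ^ (-h)) := by
          rw [hΦ, norm_mul]
          exact mul_le_mul h1 h3 (norm_nonneg _) (Real.rpow_nonneg (by linarith [ht.2]) _)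
      _ = _ := by ring
  have hbint : IntegrableOn (fun t => 2 * ((1 - t) ^ (h - 1) * |u - t| ^ (-h))) (Ioo (0 : ℝ) 1) :=
    (integrableOn_mul_abs_rpow hh hh1 hu1).const_mul 2
  have hpt : ∀ t ∈ Ioo (0 : ℝ) 1, t ≠ u → Tendsto (fun ε => Φ ε t) (𝓝[>] 0) (𝓝 (lim t)) := by
    intro t ht htu
    have hwt := hwtA t ht
    rcases lt_or_gt_of_ne htu with h1 | h1
    · have t1 := tendsto_offKern_of_lt (h := h) hu0 (d := t) (by rwa [abs_of_pos ht.1])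
      have t2 : Tendsto (fun ε : ℝ => -ε) (𝓝 0) (𝓝 0) := by
        simpa using (continuous_neg (G := ℝ)).tendsto 0
      have t3 := ((t1.add (t1.comp t2)).const_mul (wt h 1 t)).mono_left
        (nhdsWithin_le_nhds (s := Ioi (0 : ℝ)))
      have e : lim t = wt h 1 t * ((((u / (u ^ 2 - t ^ 2)) ^ h : ℝ) : ℂ) +
          (((u / (u ^ 2 - t ^ 2)) ^ h : ℝ) : ℂ)) := by
        simp only [hlim, if_pos h1, hwt, hB1]
        push_cast
        ring
      rw [e]
      exact t3
    · have t1 := tendsto_offKern_of_gt (h := h) hu0 h1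
      have t2 := tendsto_offKern_of_gt' (h := h) hu0 h1
      have t3 := (t1.add t2).const_mul (wt h 1 t)
      rw [← add_mul, exp_add_exp_neg] at t3
      have e : lim t = wt h 1 t * (((2 * Real.cos (Real.pi * h) : ℝ) : ℂ) *
          (((u / (t ^ 2 - u ^ 2)) ^ h : ℝ) : ℂ)) := by
        simp only [hlim, if_neg (not_lt.2 h1.le), hwt, hB2]
        push_cast
        ring
      rw [e]
      exact t3
  have hDCT : Tendsto (fun ε => ∫ t in Ioo (0 : ℝ) 1, Φ ε t) (𝓝[>] 0)
      (𝓝 (∫ t in Ioo (0 : ℝ) 1, lim t)) := by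
    refine tendsto_integral_filter_of_dominated_convergence _ ?_ ?_ hbint ?_
    · filter_upwards [self_mem_nhdsWithin] with ε hε
      have hε' : ε ≠ 0 := ne_of_gt hε
      refine ((integrableOn_wt hre one_pos).1.mono_set (Ioo_subset_Ioo_left (by norm_num))).mul ?_
      exact ((hcont ε hε').add (hcont (-ε) (neg_ne_zero.2 hε'))).aestronglyMeasurable
    · refine Eventually.of_forall fun ε => ?_
      filter_upwards [hne, ae_restrict_mem measurableSet_Ioo] with t h1 h2
      exact hb ε t h2 h1
    · filter_upwards [hne, ae_restrict_mem measurableSet_Ioo] with t h1 h2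
      exact hpt t h2 h1
  have hlimint : IntegrableOn lim (Ioo 0 1) := by
    refine Integrable.mono' hbint (Measurable.aestronglyMeasurable ?_) ?_
    · exact Measurable.ite measurableSet_Iio (by fun_prop) (by fun_prop)
    · filter_upwards [hne, ae_restrict_mem measurableSet_Ioo] with t h1 h2
      exact le_of_tendsto (hpt t h2 h1).norm (Eventually.of_forall fun ε => hb ε t h2 h1)
  have hlimint' : IntegrableOn lim (Ioc 0 1) := by rwa [integrableOn_Ioc_iff_integrableOn_Ioo]
  have hsplit : ∫ t in Ioo (0 : ℝ) 1, lim t =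
      ((2 * ∫ t in Ioo 0 u, B1 t : ℝ) : ℂ) +
        2 * Real.cos (Real.pi * h) * ((∫ t in Ioo u 1, B2 t : ℝ) : ℂ) := by
    rw [← integral_Ioc_eq_integral_Ioo, ← Ioc_union_Ioc_eq_Ioc hu0.le hu1.le,
      setIntegral_union (Ioc_disjoint_Ioc_of_le le_rfl) measurableSet_Ioc
      (hlimint'.mono_set (Ioc_subset_Ioc_right hu1.le))
      (hlimint'.mono_set (Ioc_subset_Ioc_left hu0.le)),
      integral_Ioc_eq_integral_Ioo, integral_Ioc_eq_integral_Ioo]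
    congr 1
    · rw [← integral_const_mul, ← integral_complex_ofReal]
      refine setIntegral_congr_fun measurableSet_Ioo fun t ht => ?_
      simp only [hlim, if_pos ht.2]
    · rw [← integral_complex_ofReal, ← integral_const_mul]
      refine setIntegral_congr_fun measurableSet_Ioo fun t ht => ?_
      simp only [hlim, if_neg (not_lt.2 ht.1.le)]
      push_cast
      ring
  have hG : Tendsto (fun ε : ℝ => G h u (ε : ℂ) 1 0) (𝓝[>] 0) (𝓝 (gfun h σ)) := by
    set S : ℝ → ℝ := fun ε => σ + ε ^ 2 / (2 * u) with hS
    have h1 : Tendsto S (𝓝[>] 0) (𝓝 σ) := by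
      have : Tendsto S (𝓝 0) (𝓝 (S 0)) := Continuous.tendsto (by fun_prop) 0
      simp only [hS] at this
      rw [zero_pow two_ne_zero, zero_div, add_zero] at this
      exact this.mono_left nhdsWithin_le_nhds
    have hc : ∀ k : ℕ, (h : ℂ) + 1 / 2 + k ≠ 0 := by
      intro k hk
      have := congrArg Complex.re hk
      simp at this
      linarith [(Nat.cast_nonneg k : (0 : ℝ) ≤ k)]
    refine ((continuousAt_gfun hc hσ).tendsto.comp h1).congr fun ε => ?_
    refine (G_eq_gfun h hu0 one_pos ?_ ?_).symm
    · exact lt_of_lt_of_le hσ (le_add_of_nonneg_right (by positivity))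
    · rw [dist2, Complex.ofReal_zero, sub_zero, hS,
        show 2 * u * 1 * (σ + ε ^ 2 / (2 * u)) = 2 * u * σ + ε ^ 2 by field_simp, ← hquad]
      push_cast
      ring
  have hGeq : ∀ ε : ℝ, 0 < ε →
      cst h * Complex.I * ∫ t in Ioo (0 : ℝ) 1, Φ ε t = G h u (ε : ℂ) 1 0 := by
    intro ε hε
    have hζ : (ε : ℂ).re ≠ 0 := by simpa using hε.ne'
    have h1 := superposition hh one_pos hu0 hζ
    rw [intervalIntegral_symm_split, intervalIntegral.integral_of_le zero_le_one,
      integral_Ioc_eq_integral_Ioo] at h1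
    · rw [← h1, Complex.ofReal_one, mul_one]
      congr 1
      refine setIntegral_congr_fun measurableSet_Ioo fun t ht => ?_
      simp only [hΦ, hker, wt_neg]
      rw [← offKern_neg_neg h u (-ε) t, neg_neg]
      ring
    · rw [intervalIntegrable_iff_integrableOn_Ioo_of_le (by norm_num)]
      exact integrableOn_wt_mul hre one_pos (continuous_kern _ _ hu0 hζ)
  have hmain : cst h * Complex.I * ∫ t in Ioo (0 : ℝ) 1, lim t = gfun h σ := by
    refine tendsto_nhds_unique (hDCT.const_mul (cst h * Complex.I)) (hG.congr' ?_)
    filter_upwards [self_mem_nhdsWithin] with ε hε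
    exact (hGeq ε hε).symm
  -- The part below the branch point yields `G_{1-h}`, the part above it the Legendre function.
  have hin := two_mul_integral_inner hh1 hu0 hu1
  rw [hσu] at hin
  have hout := sin_mul_integral_outer hh hh1 hu0 le_rfl (y := 0) (a := 1) (by linarith)
  have hout2 : ∫ s in Ioo (0 + u) 1, ((1 : ℝ) / (1 ^ 2 - s ^ 2)) ^ (1 - h) *
      (u / ((s - 0) ^ 2 - u ^ 2)) ^ h = ∫ t in Ioo u 1, B2 t := by
    rw [zero_add]
    refine setIntegral_congr_fun measurableSet_Ioo fun t ht => ?_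
    have h3 : 0 < 1 - t ^ 2 := by nlinarith [ht.1, ht.2]
    rw [hB2, hA, sub_zero, one_pow, one_div, Real.inv_rpow h3.le, ← Real.rpow_neg h3.le, neg_sub]
  rw [hout2, show (u ^ 2 + 1 ^ 2 - 0 ^ 2) / (2 * u * 1) = σ by rw [← hσu]; ring] at hout
  rw [hsplit, hin] at hmain
  have hcst := cst_mul_gamma hh
  change cst h * Complex.I * cQ h = 1 at hcst
  have e : cQ h * gfun h σ = cQ (1 - h) * gfun (1 - h) σ +
      2 * Real.cos (Real.pi * h) * ((∫ t in Ioo u 1, B2 t : ℝ) : ℂ) := by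
    rw [← hmain]
    linear_combination (cQ (1 - h) * gfun (1 - h) σ +
      2 * Real.cos (Real.pi * h) * ((∫ t in Ioo u 1, B2 t : ℝ) : ℂ)) * hcst
  rw [e]
  linear_combination 2 * (Real.cos (Real.pi * h) : ℂ) * hout


/-! ### Continuation of the connection formula in `h`; `Gtilde` as a Legendre function. -/

/-- The base in Laplace's integral is positive and continuous on a compact interval, so the integral
is entire in `h`; this is what removes the poles at half-integers. -/
theorem differentiable_legP {σ : ℝ} (hσ : 1 ≤ σ) : Differentiable ℂ fun h => legP h σ := by
  have hpos : ∀ φ : ℝ, 0 < σ + Real.sqrt (σ ^ 2 - 1) * Real.cos φ := by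
    intro φ
    have h1 : Real.sqrt (σ ^ 2 - 1) < σ := by
      rw [Real.sqrt_lt' (by linarith)]
      linarith
    nlinarith [Real.sqrt_nonneg (σ ^ 2 - 1), Real.neg_one_le_cos φ, Real.cos_le_one φ]
  have hb : ∀ φ : ℝ, ((σ + Real.sqrt (σ ^ 2 - 1) * Real.cos φ : ℝ) : ℂ) ≠ 0 := fun φ => by
    exact_mod_cast (hpos φ).ne'
  rw [← differentiableOn_univ]
  unfold legP
  refine DifferentiableOn.const_mul ?_ _
  have := differentiableOn_integral_mul_of_continuousOn (μ := volume) isOpen_univ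
    (isCompact_Icc (a := -Real.pi) (b := Real.pi)) measurableSet_Ioc Ioc_subset_Icc_self
    (φ := fun _ => (1 : ℂ)) (by simp)
    (f := fun h φ => ((σ + Real.sqrt (σ ^ 2 - 1) * Real.cos φ : ℝ) : ℂ) ^ (-h)) ?_ ?_
  · simpa only [one_mul] using this
  · refine Continuous.continuousOn ?_
    rw [continuous_iff_continuousAt]
    intro p
    refine ContinuousAt.cpow (by fun_prop) (by fun_prop) ?_
    exact Or.inl (by rw [Complex.ofReal_re]; exact hpos _)
  · intro φ _
    refine Differentiable.differentiableOn fun h => ?_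
    exact (differentiableAt_id.neg).const_cpow (Or.inl (hb φ))

/-- The coefficients in the connection formula. -/
noncomputable def connCoeff (h : ℂ) : ℂ :=
  Complex.Gamma (1 / 2 - h) * (Complex.Gamma (1 - h))⁻¹ / (Real.sqrt Real.pi : ℂ)

theorem sqrt_pi_ne_zero : (Real.sqrt Real.pi : ℂ) ≠ 0 := by
  exact_mod_cast (Real.sqrt_pos.2 Real.pi_pos).ne'

/-- Duplication at `1/2 - h`. Where `1 - h` is a pole, `Gamma` takes the value `0` and division by
it gives `0`, so both sides vanish there, in accordance with `1 / Γ`. -/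
theorem four_cpow_mul_gamma (h : ℂ) :
    (4 : ℂ) ^ h * Complex.Gamma (1 - 2 * h) / Complex.Gamma (1 - h) ^ 2 = connCoeff h := by
  have hdup := Complex.Gamma_mul_Gamma_add_half (1 / 2 - h)
  rw [show 1 / 2 - h + 1 / 2 = 1 - h by ring, show 2 * (1 / 2 - h) = 1 - 2 * h by ring,
    show 1 - (1 - 2 * h) = (2 : ℕ) * h by push_cast; ring, Complex.cpow_nat_mul] at hdup
  have h4 : (4 : ℂ) ^ h = (2 ^ h) ^ 2 := by
    have := Complex.natCast_mul_natCast_cpow 2 2 h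
    norm_num at this
    rw [this, pow_two]
  rw [h4, connCoeff]
  by_cases hg : Complex.Gamma (1 - h) = 0
  · simp [hg]
  · have hq := sqrt_pi_ne_zero
    rw [← div_eq_mul_inv, div_div, div_eq_div_iff (pow_ne_zero 2 hg) (mul_ne_zero hg hq)]
    linear_combination -Complex.Gamma (1 - h) * hdup

theorem cos_ne_zero_iff_ne (h : ℂ) :
    Complex.cos (Real.pi * h) ≠ 0 ↔ ∀ n : ℤ, h ≠ n + 1 / 2 := by
  have hpi : (Real.pi : ℂ) ≠ 0 := by exact_mod_cast Real.pi_ne_zero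
  rw [Ne, Complex.cos_eq_zero_iff]
  push Not
  refine forall_congr' fun n => ?_
  refine not_congr ⟨fun e => ?_, fun e => ?_⟩
  · refine mul_left_cancel₀ hpi ?_
    rw [e]
    ring
  · rw [e]
    ring

/-- Reflection at `h` and at `h + 1/2`. It puts the strip formula in a form whose coefficients
continue meromorphically in `h`. -/
theorem connCoeff_eq {h : ℝ} (hh : 0 < h) (hh1 : h < 1) (hc : Real.cos (Real.pi * h) ≠ 0) :
    Real.pi * Real.cos (Real.pi * h) * connCoeff h = Real.sin (Real.pi * h) * cQ h := by
  have r1 := Complex.Gamma_mul_Gamma_one_sub (h : ℂ)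
  have r2 := Complex.Gamma_mul_Gamma_one_sub ((h : ℂ) + 1 / 2)
  rw [mul_add, show (Real.pi : ℂ) * (1 / 2) = Real.pi / 2 by ring, Complex.sin_add_pi_div_two,
    show (1 : ℂ) - (h + 1 / 2) = 1 / 2 - h by ring] at r2
  have hs : Real.sin (Real.pi * h) ≠ 0 := by
    refine (Real.sin_pos_of_pos_of_lt_pi (by positivity) ?_).ne'
    nlinarith [Real.pi_pos]
  have hs' : Complex.sin (Real.pi * h) ≠ 0 := by exact_mod_cast hs
  have hc' : Complex.cos (Real.pi * h) ≠ 0 := by exact_mod_cast hc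
  have g1 : Complex.Gamma (h + 1 / 2) ≠ 0 := Complex.Gamma_ne_zero_of_re_pos (by simp; linarith)
  have g2 : Complex.Gamma (1 - h) ≠ 0 := Complex.Gamma_ne_zero_of_re_pos (by simp; linarith)
  have hpi : (Real.pi : ℂ) = (Real.sqrt Real.pi : ℂ) * Real.sqrt Real.pi := by
    exact_mod_cast (Real.mul_self_sqrt Real.pi_pos.le).symm
  have hq := sqrt_pi_ne_zero
  rw [eq_div_iff hs'] at r1
  rw [eq_div_iff hc'] at r2
  rw [connCoeff, cQ, Complex.Gamma_one_half_eq,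
    show ((Real.pi : ℝ) : ℂ) ^ (1 / 2 : ℂ) = (Real.sqrt Real.pi : ℂ) by
      rw [Real.sqrt_eq_rpow, Complex.ofReal_cpow Real.pi_pos.le]; norm_num]
  push_cast
  generalize Complex.Gamma (h + 1 / 2) = x at *
  generalize Complex.Gamma (1 / 2 - h) = y at *
  field_simp
  linear_combination (Real.pi : ℂ) * r2 - (Real.sqrt Real.pi : ℂ) ^ 2 * r1 + (Real.pi : ℂ) * hpi

theorem differentiableOn_connCoeff :
    DifferentiableOn ℂ connCoeff {h | Complex.cos (Real.pi * h) ≠ 0} := by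
  intro h hh
  have hh := (cos_ne_zero_iff_ne h).1 hh
  refine DifferentiableAt.differentiableWithinAt ?_
  unfold connCoeff
  refine DifferentiableAt.div_const (DifferentiableAt.mul ?_ ?_) _
  · refine (Complex.differentiableAt_Gamma (1 / 2 - h) fun m e => ?_).comp h (by fun_prop)
    refine hh m ?_
    push_cast
    linear_combination -e
  · exact (Complex.differentiable_one_div_Gamma (1 - h)).comp h (by fun_prop)

theorem differentiableOn_gfun {σ : ℝ} (hσ : 1 < σ) {U : Set ℂ} (hU : IsOpen U) {A : ℂ → ℂ}
    (hA : DifferentiableOn ℂ A U) (hc : ∀ h ∈ U, ∀ k : ℕ, A h + 1 / 2 + k ≠ 0) :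
    DifferentiableOn ℂ (fun h => gfun (A h) σ) U := by
  unfold gfun
  refine DifferentiableOn.mul ?_ ?_
  · refine hA.const_cpow (Or.inl ?_)
    have : 1 / (2 * σ) ≠ 0 := by positivity
    exact_mod_cast this
  · exact differentiableOn_hyp_param hU (by fun_prop) (by fun_prop) (by fun_prop) hc
      (norm_one_div_sq_lt_one hσ)

theorem cos_pi_mul_one_sub (h : ℂ) :
    Complex.cos (Real.pi * (1 - h)) = -Complex.cos (Real.pi * h) := by
  rw [mul_sub, mul_one, Complex.cos_pi_sub]

/-- Connection formula for the Legendre functions, off the half-integers. -/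
theorem connection_eq_legP {σ : ℝ} (hσ : 1 < σ) {h : ℂ} (hc : Complex.cos (Real.pi * h) ≠ 0) :
    connCoeff h * gfun h σ + connCoeff (1 - h) * gfun (1 - h) σ = legP h σ := by
  set U : Set ℂ := {h | Complex.cos (Real.pi * h) ≠ 0} with hUdef
  have hU : IsOpen U := isOpen_ne_fun (by fun_prop) (by fun_prop)
  have hneU : ∀ h ∈ U, ∀ n : ℤ, h ≠ n + 1 / 2 := fun h hh => (cos_ne_zero_iff_ne h).1 hh
  -- Removing a countable set leaves the plane connected, so the identity theorem applies off the
  -- half-integers.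
  have hcount : (Uᶜ).Countable := by
    refine (countable_range fun n : ℤ => (n : ℂ) + 1 / 2).mono fun h hh => ?_
    by_contra hr
    refine hh ((cos_ne_zero_iff_ne h).2 fun n e => hr ⟨n, e.symm⟩)
  have hconn : IsPreconnected U := by
    have := (hcount.isConnected_compl_of_one_lt_rank (by simp)).isPreconnected
    rwa [compl_compl] at this
  have hmaps : MapsTo (fun h : ℂ => 1 - h) U U := by
    intro h hh
    change Complex.cos (Real.pi * (1 - h)) ≠ 0
    rw [cos_pi_mul_one_sub]
    exact neg_ne_zero.2 hh
  have d1 : DifferentiableOn ℂ (fun h => connCoeff h * gfun h σ +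
      connCoeff (1 - h) * gfun (1 - h) σ) U := by
    refine DifferentiableOn.add (DifferentiableOn.mul differentiableOn_connCoeff ?_)
      (DifferentiableOn.mul ?_ ?_)
    · refine differentiableOn_gfun hσ hU differentiableOn_id fun h hh k e => ?_
      refine hneU h hh (-1 - k) ?_
      push_cast
      linear_combination e
    · exact differentiableOn_connCoeff.comp (by fun_prop) hmaps
    · refine differentiableOn_gfun hσ hU (by fun_prop) fun h hh k e => ?_
      refine hneU h hh (1 + k) ?_
      push_cast
      linear_combination -e
  have d2 : DifferentiableOn ℂ (fun h => legP h σ) U := (differentiable_legP hσ.le).differentiableOn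
  -- On `(0, 1/2)` the cosine does not vanish and can be divided out of the strip formula.
  have hreal : ∀ h : ℝ, 0 < h → h < 1 / 2 → connCoeff h * gfun h σ +
      connCoeff (1 - h) * gfun (1 - h) σ = legP h σ := by
    intro h hh0 hh1
    have hcos : Real.cos (Real.pi * h) ≠ 0 := by
      refine (Real.cos_pos_of_mem_Ioo ⟨?_, ?_⟩).ne'
      · nlinarith [Real.pi_pos]
      · nlinarith [Real.pi_pos]
    have hcos' : Real.cos (Real.pi * (1 - h)) = -Real.cos (Real.pi * h) := by
      rw [mul_sub, mul_one, Real.cos_pi_sub]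
    have hsin' : Real.sin (Real.pi * (1 - h)) = Real.sin (Real.pi * h) := by
      rw [mul_sub, mul_one, Real.sin_pi_sub]
    have c1 := connCoeff_eq hh0 (by linarith) hcos
    have c2 := connCoeff_eq (h := 1 - h) (by linarith) (by linarith)
      (by rw [hcos']; exact neg_ne_zero.2 hcos)
    rw [hcos', hsin'] at c2
    push_cast at c1 c2
    have c3 := connection_of_lt_one hh0 (by linarith) hσ
    push_cast at c3
    have hne : (Real.pi : ℂ) * Complex.cos (Real.pi * h) ≠ 0 := by
      have : Real.pi * Real.cos (Real.pi * h) ≠ 0 := mul_ne_zero Real.pi_ne_zero hcos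
      exact_mod_cast this
    refine mul_left_cancel₀ hne ?_
    linear_combination c3 + gfun h σ * c1 - gfun (1 - h) σ * c2
  have h4 : ((1 / 4 : ℝ) : ℂ) ∈ U := by
    change Complex.cos (Real.pi * ((1 / 4 : ℝ) : ℂ)) ≠ 0
    have : Real.cos (Real.pi * (1 / 4)) ≠ 0 := by
      refine (Real.cos_pos_of_mem_Ioo ⟨?_, ?_⟩).ne'
      · nlinarith [Real.pi_pos]
      · nlinarith [Real.pi_pos]
    exact_mod_cast this
  refine (d1.analyticOnNhd hU).eqOn_of_preconnected_of_frequently_eq (d2.analyticOnNhd hU) hconn h4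
    ?_ hc
  have ht : Tendsto (fun x : ℝ => (x : ℂ)) (𝓝[≠] (1 / 4)) (𝓝[≠] ((1 / 4 : ℝ) : ℂ)) := by
    refine tendsto_nhdsWithin_iff.2 ⟨?_, ?_⟩
    · exact (Complex.continuous_ofReal.tendsto _).mono_left nhdsWithin_le_nhds
    · filter_upwards [self_mem_nhdsWithin] with x hx
      exact fun e => hx (Complex.ofReal_injective e)
  refine ht.frequently (Eventually.frequently ?_)
  filter_upwards [mem_nhdsWithin_of_mem_nhds (Ioo_mem_nhds (a := (0 : ℝ)) (b := 1 / 2)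
    (by norm_num) (by norm_num))] with x hx
  exact hreal x hx.1 hx.2

theorem continuousAt_cst {h : ℝ} (hh : 0 < h) : ContinuousAt cst h := by
  unfold cst
  have g : ∀ c : ℝ, 0 < c → ContinuousAt (fun h : ℝ => Complex.Gamma (c * h)) h := by
    intro c hc
    have h1 : ContinuousAt Complex.Gamma (c * h) := by
      refine (Complex.differentiableAt_Gamma _ fun m e => ?_).continuousAt
      have := congrArg Complex.re e
      simp at this
      nlinarith [mul_pos hc hh, (Nat.cast_nonneg m : (0 : ℝ) ≤ m)]
    exact ContinuousAt.comp (f := fun h : ℝ => (c : ℂ) * h) h1 (by fun_prop)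
  have g1 := g 1 one_pos
  have g2 := g 2 two_pos
  simp only [Complex.ofReal_one, one_mul, Complex.ofReal_ofNat] at g1 g2
  have h0 : Complex.Gamma h ≠ 0 := Complex.Gamma_ne_zero_of_re_pos (by simpa using hh)
  refine ContinuousAt.mul (ContinuousAt.div (by fun_prop) ?_ ?_)
    (g2.div (g1.mul g1) (mul_ne_zero h0 h0))
  · refine ContinuousAt.cpow (by fun_prop) (by fun_prop) ?_
    exact Or.inl (by norm_num)
  · simp [Complex.cpow_eq_zero_iff]

theorem GtildeFormula_eq (h : ℝ) {u a σ z₀ : ℝ} {z : ℂ} (hu : 0 < u) (ha : 0 < a) (hσ : 1 < σ)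
    (hD : dist2 u z a z₀ = ((2 * u * a * σ : ℝ) : ℂ)) (hc : Complex.cos (Real.pi * h) ≠ 0) :
    GtildeFormula h u z a z₀ = cst h * legP h σ := by
  have h1 := four_cpow_mul_gamma h
  have h2 := four_cpow_mul_gamma (1 - h)
  rw [show 1 - 2 * (1 - (h : ℂ)) = 2 * h - 1 by ring, sub_sub_cancel] at h2
  rw [GtildeFormula, h1, h2, G_eq_gfun h hu ha hσ hD, G_eq_gfun (1 - h) hu ha hσ hD,
    ← connection_eq_legP hσ hc]
  push_cast
  rfl

/-- At half-integers the limit in the definition exists because `cst s * legP s σ` is continuous in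
`s` and equals the closed formula at all nearby `s`; so one expression covers every `h > 0`. -/
theorem Gtilde_eq {h : ℝ} (hh : 0 < h) {u a σ z₀ : ℝ} {z : ℂ} (hu : 0 < u) (ha : 0 < a)
    (hσ : 1 < σ) (hD : dist2 u z a z₀ = ((2 * u * a * σ : ℝ) : ℂ)) :
    Gtilde h u z a z₀ = cst h * legP h σ := by
  rw [Gtilde]
  split_ifs with hn
  · obtain ⟨n, hn⟩ := hn
    refine Tendsto.limUnder_eq ?_
    have hcont : ContinuousAt (fun s : ℝ => cst s * legP s σ) h := by
      refine (continuousAt_cst hh).mul ?_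
      exact ContinuousAt.comp (f := fun s : ℝ => (s : ℂ))
        (differentiable_legP hσ.le).continuous.continuousAt (by fun_prop)
    refine (hcont.tendsto.mono_left nhdsWithin_le_nhds).congr' ?_
    -- No other half-integer lies at distance less than `1` from `h`.
    have hnear : ∀ᶠ s in 𝓝[≠] h, s ∈ Ioo (h - 1) (h + 1) :=
      mem_nhdsWithin_of_mem_nhds (Ioo_mem_nhds (by linarith) (by linarith))
    filter_upwards [hnear, self_mem_nhdsWithin] with s hs hsh
    refine (GtildeFormula_eq s hu ha hσ hD ((cos_ne_zero_iff_ne _).2 fun m e => hsh ?_)).symm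
    have e' : s = m + 1 / 2 := Complex.ofReal_injective (by push_cast; exact e)
    rw [e', hn] at hs
    have h1 : (m : ℝ) < n + 1 := by linarith [hs.2]
    have h2 : (n : ℝ) < m + 1 := by linarith [hs.1]
    have h3 : m < n + 1 := by exact_mod_cast h1
    have h4 : (n : ℤ) < m + 1 := by exact_mod_cast h2
    have h5 : m = n := by omega
    change s = h
    rw [e', hn, h5]
    simp
  · refine GtildeFormula_eq h hu ha hσ hD ((cos_ne_zero_iff_ne _).2 fun m e => hn ?_)
    have e' : h = m + 1 / 2 := Complex.ofReal_injective (by push_cast; exact e)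
    have h1 : (-1 : ℝ) < m := by linarith
    have h2 : -1 < m := by exact_mod_cast h1
    obtain ⟨n, rfl⟩ := Int.eq_ofNat_of_zero_le (by omega : 0 ≤ m)
    exact ⟨n, by simpa using e'⟩


/-! ### Integrals over the Π-shaped contours and their deformation. -/

theorem differentiableAt_kern {h : ℂ} {a u t : ℝ} {ζ : ℂ} (hu : 0 < u)
    (hζ : ζ.re ≠ 0 ∨ ζ.im = a * t) : DifferentiableAt ℂ (fun ζ => kern h a u ζ t) ζ := by
  have hmem := kern_den_mem_slitPlane hu hζ
  unfold kern
  refine DifferentiableAt.cpow_const ?_ (ofReal_div_mem_slitPlane hu hmem)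
  exact DifferentiableAt.div (by fun_prop) (by fun_prop) (Complex.slitPlane_ne_zero hmem)

/-- The integral of `g` over the Π-shaped contour `-ε ⟶ iy - ε ⟶ iy + ε ⟶ ε`. -/
noncomputable def bump (g : ℂ → ℂ) (ε y : ℝ) : ℂ :=
  ∫ s in (0 : ℝ)..1, (Complex.I * y * (g (-ε + Complex.I * (s * y : ℝ)) -
    g (ε + Complex.I * (s * y : ℝ))) + 2 * ε * g (Complex.I * y + ((2 * s - 1) * ε : ℝ)))

/-- A function is regular for the contours around `iy` if it is holomorphic off the imaginary axis
and continuous on the horizontal segment through `iy`. -/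
structure BumpRegular (g : ℂ → ℂ) (a r y : ℝ) : Prop where
  diff : ∀ ζ ∈ rect a 0 r, ζ.re ≠ 0 → DifferentiableAt ℂ g ζ
  cont : ∀ s : ℝ, |s| < r → ContinuousAt (fun s : ℝ => g (Complex.I * y + s)) s
  mem : |y| < a + r

theorem mem_rect {a r x y : ℝ} (hx : |x| < r) (hy : |y| < a + r) :
    (x : ℂ) + Complex.I * y ∈ rect a 0 r := by
  constructor <;> simpa

theorem isOpen_rect (a z₀ r : ℝ) : IsOpen (rect a z₀ r) := by
  have h1 : IsOpen {z : ℂ | |z.re - z₀| < r} := isOpen_lt (by fun_prop) (by fun_prop)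
  have h2 : IsOpen {z : ℂ | |z.im| < a + r} := isOpen_lt (by fun_prop) (by fun_prop)
  exact h1.inter h2

theorem abs_le_of_mem_uIcc {y η : ℝ} (h : η ∈ uIcc 0 y) : |η| ≤ |y| := by
  have := abs_sub_left_of_mem_uIcc h
  simpa using this

theorem BumpRegular.continuousOn_vert {g : ℂ → ℂ} {a r y : ℝ} (hg : BumpRegular g a r y) {x : ℝ}
    (hx : |x| < r) (hx0 : x ≠ 0) :
    ContinuousOn (fun η : ℝ => g (x + Complex.I * η)) (uIcc 0 y) := by
  intro η hη
  refine ContinuousAt.continuousWithinAt ?_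
  have h1 := (hg.diff _ (mem_rect hx ((abs_le_of_mem_uIcc hη).trans_lt hg.mem))
    (by simpa using hx0)).continuousAt
  exact ContinuousAt.comp (f := fun η : ℝ => (x : ℂ) + Complex.I * η) h1 (by fun_prop)

theorem BumpRegular.continuousOn_horiz {g : ℂ → ℂ} {a r y : ℝ} (hg : BumpRegular g a r y) :
    ContinuousOn (fun s : ℝ => g (Complex.I * y + s)) (Ioo (-r) r) :=
  fun s hs => (hg.cont s (abs_lt.2 hs)).continuousWithinAt

/-- The vertical sides are combined into an integral of the difference between the two sides of the
imaginary axis, the form in which `ε → 0` can be taken. -/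
theorem bump_eq {g : ℂ → ℂ} {a r y ε : ℝ} (hg : BumpRegular g a r y) (hε : 0 < ε) (hεr : ε < r) :
    bump g ε y = Complex.I * (∫ η in (0 : ℝ)..y, (g (-ε + Complex.I * η) - g (ε + Complex.I * η))) +
      ∫ s in (-ε)..ε, g (Complex.I * y + s) := by
  have habs : |ε| < r := by rwa [abs_of_pos hε]
  have habs' : |(-ε)| < r := by rwa [abs_neg]
  have c1 := hg.continuousOn_vert habs' (neg_ne_zero.2 hε.ne')
  have c2 := hg.continuousOn_vert habs hε.ne'
  rw [Complex.ofReal_neg] at c1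
  have hm : MapsTo (fun s : ℝ => s * y) (uIcc 0 1) (uIcc 0 y) := by
    intro s hs
    rw [uIcc_of_le zero_le_one] at hs
    rcases le_total 0 y with h0 | h0
    · rw [uIcc_of_le h0]
      exact ⟨mul_nonneg hs.1 h0, by nlinarith [hs.2]⟩
    · rw [uIcc_of_ge h0]
      exact ⟨by nlinarith [hs.1, hs.2], mul_nonpos_of_nonneg_of_nonpos hs.1 h0⟩
  have hm2 : MapsTo (fun s : ℝ => (2 * s - 1) * ε) (uIcc 0 1) (Ioo (-r) r) := by
    intro s hs
    rw [uIcc_of_le zero_le_one] at hs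
    constructor <;> nlinarith [hs.1, hs.2]
  have i1 : IntervalIntegrable (fun s : ℝ => Complex.I * y * (g (-ε + Complex.I * (s * y : ℝ)) -
      g (ε + Complex.I * (s * y : ℝ)))) volume 0 1 := by
    refine ContinuousOn.intervalIntegrable (continuousOn_const.mul ?_)
    exact (c1.sub c2).comp (by fun_prop) hm
  have i2 : IntervalIntegrable (fun s : ℝ => 2 * (ε : ℂ) *
      g (Complex.I * y + ((2 * s - 1) * ε : ℝ))) volume 0 1 := by
    refine ContinuousOn.intervalIntegrable (continuousOn_const.mul ?_)
    exact hg.continuousOn_horiz.comp (by fun_prop) hm2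
  rw [bump, intervalIntegral.integral_add i1 i2]
  congr 1
  · rw [intervalIntegral.integral_const_mul, mul_assoc]
    congr 1
    have := intervalIntegral.smul_integral_comp_mul_right (a := 0) (b := 1)
      (f := fun η : ℝ => g (-ε + Complex.I * η) - g (ε + Complex.I * η)) y
    rwa [zero_mul, one_mul, Complex.real_smul] at this
  · rw [intervalIntegral.integral_const_mul]
    have := intervalIntegral.smul_integral_comp_mul_add (a := 0) (b := 1)
      (f := fun s : ℝ => g (Complex.I * y + s)) (2 * ε) (-ε)
    rw [Complex.real_smul, show 2 * ε * 0 + -ε = -ε by ring, show 2 * ε * 1 + -ε = ε by ring] at this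
    rw [← this, Complex.ofReal_mul, Complex.ofReal_ofNat]
    congr 1
    refine intervalIntegral.integral_congr fun s _ => ?_
    congr 3
    ring

/-- Cauchy's theorem on the two rectangles between the vertical lines at distance `ε` and `δ`, which
miss the imaginary axis. The correction runs along the real axis and does not depend on `y`, so the
superposition formula can be applied to it afterwards. -/
theorem bump_eq_sub {g : ℂ → ℂ} {a r y ε δ : ℝ} (hg : BumpRegular g a r y) (hε : 0 < ε)
    (hεδ : ε ≤ δ) (hδr : δ < r) :
    bump g ε y = bump g δ y - ∫ s in ε..δ, (g s + g (-s)) := by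
  have hδ : 0 < δ := hε.trans_le hεδ
  have hrect : ∀ p q : ℝ, p ≤ q → -r < p → q < r → (0 < p ∨ q < 0) →
      (∫ x in p..q, g x) - (∫ x in p..q, g (Complex.I * y + x)) +
        Complex.I * (∫ η in (0 : ℝ)..y, g (q + Complex.I * η)) -
        Complex.I * (∫ η in (0 : ℝ)..y, g (p + Complex.I * η)) = 0 := by
    intro p q hpq hp hq h0
    have hre : ∀ x ∈ Icc p q, |x| < r ∧ x ≠ 0 := by
      intro x hx
      refine ⟨abs_lt.2 ⟨by linarith [hx.1], by linarith [hx.2]⟩, ?_⟩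
      rcases h0 with h0 | h0
      · exact (h0.trans_le hx.1).ne'
      · exact (lt_of_le_of_lt hx.2 h0).ne
    have := Complex.integral_boundary_rect_eq_zero_of_differentiableOn g p (q + Complex.I * y) ?_
    · simp only [Complex.ofReal_re, Complex.ofReal_im, Complex.add_re, Complex.add_im,
        Complex.mul_re, Complex.mul_im, Complex.I_re, Complex.I_im, zero_mul, one_mul, mul_zero,
        add_zero, zero_add, smul_eq_mul, Complex.ofReal_zero, sub_self] at this
      rw [← this]
      simp only [mul_comm Complex.I, add_comm (_ * Complex.I)]
    · intro ζ hζ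
      rw [Complex.mem_reProdIm] at hζ
      simp only [Complex.ofReal_re, Complex.ofReal_im, Complex.add_re, Complex.add_im,
        Complex.mul_re, Complex.mul_im, Complex.I_re, Complex.I_im, zero_mul, one_mul, mul_zero,
        add_zero, zero_add, sub_self, uIcc_of_le hpq] at hζ
      refine (hg.diff ζ ⟨?_, ?_⟩ (hre _ hζ.1).2).differentiableWithinAt
      · simpa using (hre _ hζ.1).1
      · exact (abs_le_of_mem_uIcc hζ.2).trans_lt hg.mem
  have ih : ∀ p q : ℝ, |p| < r → |q| < r →
      IntervalIntegrable (fun s : ℝ => g (Complex.I * y + s)) volume p q := by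
    intro p q hp hq
    refine ContinuousOn.intervalIntegrable (hg.continuousOn_horiz.mono ?_)
    exact (ordConnected_Ioo.uIcc_subset (abs_lt.1 hp) (abs_lt.1 hq))
  have aδ : |δ| < r := by rwa [abs_of_pos hδ]
  have aδ' : |(-δ)| < r := by rwa [abs_neg]
  have aε : |ε| < r := by rw [abs_of_pos hε]; linarith
  have aε' : |(-ε)| < r := by rwa [abs_neg]
  have hsplit : ∫ s in (-δ)..δ, g (Complex.I * y + s) =
      (∫ s in (-δ)..(-ε), g (Complex.I * y + s)) + (∫ s in (-ε)..ε, g (Complex.I * y + s)) +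
        ∫ s in ε..δ, g (Complex.I * y + s) := by
    rw [intervalIntegral.integral_add_adjacent_intervals (ih _ _ aδ' aε') (ih _ _ aε' aε),
      intervalIntegral.integral_add_adjacent_intervals (ih _ _ aδ' aε) (ih _ _ aε aδ)]
  have r1 := hrect ε δ hεδ (by linarith) hδr (Or.inl hε)
  have r2 := hrect (-δ) (-ε) (by linarith) (by linarith) (by linarith) (Or.inr (by linarith))
  have hy0 : |(0 : ℝ)| < a + r := by rw [abs_zero]; exact (abs_nonneg y).trans_lt hg.mem
  have hcr : ∀ x : ℝ, |x| < r → x ≠ 0 → ContinuousAt (fun x : ℝ => g x) x := by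
    intro x hx hx0
    have h1 := (hg.diff _ (mem_rect hx hy0) (by simpa using hx0)).continuousAt
    rw [Complex.ofReal_zero, mul_zero, add_zero] at h1
    exact ContinuousAt.comp (f := fun x : ℝ => (x : ℂ)) h1 (by fun_prop)
  have i1 : IntervalIntegrable (fun x : ℝ => g x) volume ε δ := by
    refine ContinuousOn.intervalIntegrable fun x hx => ContinuousAt.continuousWithinAt ?_
    rw [uIcc_of_le hεδ] at hx
    exact hcr x (abs_lt.2 ⟨by linarith [hx.1], by linarith [hx.2]⟩) (hε.trans_le hx.1).ne'
  have i2 : IntervalIntegrable (fun x : ℝ => g (-x)) volume ε δ := by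
    refine ContinuousOn.intervalIntegrable fun x hx => ContinuousAt.continuousWithinAt ?_
    rw [uIcc_of_le hεδ] at hx
    have h1 := hcr (-x) (abs_lt.2 ⟨by linarith [hx.2], by linarith [hx.1]⟩)
      (neg_ne_zero.2 (hε.trans_le hx.1).ne')
    have h2 := ContinuousAt.comp (f := fun x : ℝ => -x) h1 continuousAt_neg
    refine h2.congr (Eventually.of_forall fun x => ?_)
    simp
  have e2 : ∫ x in ε..δ, g (-x) = ∫ x in (-δ)..(-ε), g x := by
    rw [← intervalIntegral.integral_comp_neg]
    simp
  have iv : ∀ x : ℝ, |x| < r → x ≠ 0 →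
      IntervalIntegrable (fun η : ℝ => g (x + Complex.I * η)) volume 0 y := fun x hx hx0 =>
    (hg.continuousOn_vert hx hx0).intervalIntegrable
  have v1 := iv _ aδ' (neg_ne_zero.2 hδ.ne')
  have v2 := iv _ aε' (neg_ne_zero.2 hε.ne')
  rw [Complex.ofReal_neg] at v1 v2
  rw [bump_eq hg hε (hεδ.trans_lt hδr), bump_eq hg hδ hδr, hsplit,
    intervalIntegral.integral_sub v2 (iv _ aε hε.ne'),
    intervalIntegral.integral_sub v1 (iv _ aδ hδ.ne'), intervalIntegral.integral_add i1 i2, e2]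
  rw [Complex.ofReal_neg, Complex.ofReal_neg] at r2
  linear_combination r1 + r2


/-! ### The contribution of all contours at fixed `u`. -/

/-- The integrand of `bump` for the kernel of the superposition formula. -/
noncomputable def bumpFun (h : ℂ) (a u : ℝ) (F : ℂ → ℂ) (ε t s : ℝ) : ℂ :=
  Complex.I * (a * t : ℝ) *
    (kern h a u (-ε + Complex.I * (s * (a * t) : ℝ)) t * F (-ε + Complex.I * (s * (a * t) : ℝ)) -
      kern h a u (ε + Complex.I * (s * (a * t) : ℝ)) t * F (ε + Complex.I * (s * (a * t) : ℝ))) +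
  2 * ε * (kern h a u (Complex.I * (a * t : ℝ) + ((2 * s - 1) * ε : ℝ)) t *
    F (Complex.I * (a * t : ℝ) + ((2 * s - 1) * ε : ℝ)))

theorem integral_bumpFun (h : ℂ) (a u : ℝ) (F : ℂ → ℂ) (ε t : ℝ) :
    ∫ s in Icc (0 : ℝ) 1, bumpFun h a u F ε t s =
      bump (fun ζ => kern h a u ζ t * F ζ) ε (a * t) := by
  rw [bump, intervalIntegral.integral_of_le zero_le_one, integral_Icc_eq_integral_Ioc]
  rfl

theorem abs_mul_lt {a r t : ℝ} (ha : 0 < a) (hr : 0 < r) (ht : t ∈ Icc (-1 : ℝ) 1) :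
    |a * t| < a + r := by
  rw [abs_mul, abs_of_pos ha]
  have : |t| ≤ 1 := abs_le.2 ht
  nlinarith

/-- Joint continuity up to the ends of the parameter ranges, with `h` included: it serves both
integrability at fixed `h` and holomorphy in `h`. -/
theorem continuousOn_bumpFun {a r ε : ℝ} (ha : 0 < a) (hr : 0 < r) (hε : 0 < ε) (hεr : ε < r)
    {f : ℝ → ℂ → ℂ} (hf : ContinuousOn (fun p : ℝ × ℂ => f p.1 p.2) (Ioi 0 ×ˢ rect a 0 r)) :
    ContinuousOn (fun p : ℂ × ℝ × ℝ × ℝ => bumpFun p.1 a p.2.1 (f p.2.1) ε p.2.2.1 p.2.2.2)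
      (univ ×ˢ Ioi 0 ×ˢ Icc (-1) 1 ×ˢ Icc 0 1) := by
  rintro ⟨h, u, t, s⟩ ⟨-, hu, ht, hs⟩
  change (0 : ℝ) < u at hu
  change t ∈ Icc (-1 : ℝ) 1 at ht
  change s ∈ Icc (0 : ℝ) 1 at hs
  refine ContinuousAt.continuousWithinAt ?_
  have hopen : IsOpen (Ioi (0 : ℝ) ×ˢ rect a 0 r) := isOpen_Ioi.prod (isOpen_rect a 0 r)
  have key : ∀ ζ : ℂ × ℝ × ℝ × ℝ → ℂ, Continuous ζ → ζ (h, u, t, s) ∈ rect a 0 r →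
      ((ζ (h, u, t, s)).re ≠ 0 ∨ (ζ (h, u, t, s)).im = a * t) →
      ContinuousAt (fun p : ℂ × ℝ × ℝ × ℝ =>
        kern p.1 a p.2.1 (ζ p) p.2.2.1 * f p.2.1 (ζ p)) (h, u, t, s) := by
    intro ζ hζc hζ hζ2
    refine ContinuousAt.mul ?_ ?_
    · exact ContinuousAt.comp (f := fun p : ℂ × ℝ × ℝ × ℝ =>
        ((p.1, p.2.1, ζ p, p.2.2.1) : ℂ × ℝ × ℂ × ℝ)) (x := (h, u, t, s))
        (continuousAt_kern (a := a) (p := (h, u, ζ (h, u, t, s), t)) hu hζ2) (by fun_prop)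
    · exact ContinuousAt.comp (f := fun p : ℂ × ℝ × ℝ × ℝ => ((p.2.1, ζ p) : ℝ × ℂ))
        (x := (h, u, t, s)) (hf.continuousAt (hopen.mem_nhds (x := (u, ζ (h, u, t, s))) ⟨hu, hζ⟩)) (by fun_prop)
  have hat := abs_mul_lt ha hr ht
  have hsat : |s * (a * t)| < a + r := by
    rw [abs_mul, abs_of_nonneg hs.1]
    nlinarith [hs.2, abs_nonneg (a * t)]
  have hεa : |ε| < r := by rwa [abs_of_pos hε]
  have hs2 : |(2 * s - 1) * ε| < r := by
    rw [abs_mul, abs_of_pos hε]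
    have : |2 * s - 1| ≤ 1 := abs_le.2 ⟨by linarith [hs.1], by linarith [hs.2]⟩
    nlinarith
  unfold bumpFun
  refine ContinuousAt.add (ContinuousAt.mul (by fun_prop) (ContinuousAt.sub ?_ ?_))
    (ContinuousAt.mul (by fun_prop) ?_)
  · refine key (fun p => -ε + Complex.I * (p.2.2.2 * (a * p.2.2.1) : ℝ)) (by fun_prop) ?_ ?_
    · have := mem_rect (x := -ε) (by rwa [abs_neg]) hsat
      rwa [Complex.ofReal_neg] at this
    · left
      simpa using hε.ne'
  · refine key (fun p => ε + Complex.I * (p.2.2.2 * (a * p.2.2.1) : ℝ)) (by fun_prop)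
      (mem_rect hεa hsat) ?_
    left
    simpa using hε.ne'
  · refine key (fun p => Complex.I * (a * p.2.2.1 : ℝ) + ((2 * p.2.2.2 - 1) * ε : ℝ)) (by fun_prop)
      ?_ ?_
    · have := mem_rect hs2 hat
      rwa [add_comm] at this
    · right
      simp

/-- The contribution of the contours `C_i(ε)`, up to the factor `cst h * I`. -/
noncomputable def bumpTotal (h : ℂ) (a u : ℝ) (F : ℂ → ℂ) (ε : ℝ) : ℂ :=
  -(a : ℂ) * ∫ p in Ioo (-1 : ℝ) 1 ×ˢ Icc (0 : ℝ) 1, wt h a p.1 * bumpFun h a u F ε p.1 p.2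

theorem integrableOn_wt_prod {h : ℂ} (hh : 0 < h.re) {a : ℝ} (ha : 0 < a) :
    IntegrableOn (fun p : ℝ × ℝ => wt h a p.1) (Ioo (-1) 1 ×ˢ Icc 0 1) := by
  rw [IntegrableOn, Measure.volume_eq_prod, ← Measure.prod_restrict]
  exact (integrableOn_wt hh ha).comp_fst _

theorem integrableOn_wt_mul_bumpFun {h : ℂ} (hh : 0 < h.re) {a r ε u : ℝ} (ha : 0 < a) (hr : 0 < r)
    (hε : 0 < ε) (hεr : ε < r) (hu : 0 < u) {F : ℂ → ℂ} (hF : ContinuousOn F (rect a 0 r)) :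
    IntegrableOn (fun p : ℝ × ℝ => wt h a p.1 * bumpFun h a u F ε p.1 p.2)
      (Ioo (-1) 1 ×ˢ Icc 0 1) := by
  have hc := continuousOn_bumpFun ha hr hε hεr (f := fun _ => F)
    (hF.comp (by fun_prop) fun p hp => hp.2)
  refine (integrableOn_wt_prod hh ha).mul_continuousOn_of_subset (K := Icc (-1) 1 ×ˢ Icc 0 1) ?_
    (measurableSet_Ioo.prod measurableSet_Icc) (isCompact_Icc.prod isCompact_Icc)
    (prod_mono Ioo_subset_Icc_self le_rfl)
  exact hc.comp (f := fun p : ℝ × ℝ => ((h, u, p.1, p.2) : ℂ × ℝ × ℝ × ℝ)) (by fun_prop)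
    fun p hp => ⟨mem_univ _, hu, hp.1, hp.2⟩

theorem integrableOn_wt_mul_bump {h : ℂ} (hh : 0 < h.re) {a r ε u : ℝ} (ha : 0 < a) (hr : 0 < r)
    (hε : 0 < ε) (hεr : ε < r) (hu : 0 < u) {F : ℂ → ℂ} (hF : ContinuousOn F (rect a 0 r)) :
    IntegrableOn (fun t => wt h a t * bump (fun ζ => kern h a u ζ t * F ζ) ε (a * t))
      (Ioo (-1) 1) := by
  have h1 := integrableOn_wt_mul_bumpFun hh ha hr hε hεr hu hF
  rw [IntegrableOn, Measure.volume_eq_prod, ← Measure.prod_restrict] at h1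
  refine h1.integral_prod_left.congr (Eventually.of_forall fun t => ?_)
  change ∫ s, wt h a t * bumpFun h a u F ε t s ∂_ = _
  rw [integral_const_mul, integral_bumpFun]

theorem bumpTotal_eq {h : ℂ} (hh : 0 < h.re) {a r ε u : ℝ} (ha : 0 < a) (hr : 0 < r)
    (hε : 0 < ε) (hεr : ε < r) (hu : 0 < u) {F : ℂ → ℂ} (hF : ContinuousOn F (rect a 0 r)) :
    bumpTotal h a u F ε = -(a : ℂ) * ∫ t in Ioo (-1 : ℝ) 1,
      wt h a t * bump (fun ζ => kern h a u ζ t * F ζ) ε (a * t) := by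
  have h1 := integrableOn_wt_mul_bumpFun hh ha hr hε hεr hu hF
  rw [bumpTotal, Measure.volume_eq_prod, setIntegral_prod _ h1]
  congr 2
  ext t
  change ∫ s in Icc (0 : ℝ) 1, wt h a t * bumpFun h a u F ε t s = _
  rw [integral_const_mul, integral_bumpFun]

theorem bumpRegular_kern {h : ℂ} {a r u t : ℝ} (ha : 0 < a) (hr : 0 < r) (hu : 0 < u)
    (ht : t ∈ Icc (-1 : ℝ) 1) {F : ℂ → ℂ} (hF : DifferentiableOn ℂ F (rect a 0 r)) :
    BumpRegular (fun ζ => kern h a u ζ t * F ζ) a r (a * t) := by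
  have hat := abs_mul_lt ha hr ht
  have hF' : ∀ ζ ∈ rect a 0 r, DifferentiableAt ℂ F ζ := fun ζ hζ =>
    hF.differentiableAt ((isOpen_rect a 0 r).mem_nhds hζ)
  refine ⟨fun ζ hζ h0 => (differentiableAt_kern hu (Or.inl h0)).mul (hF' ζ hζ), fun s hs => ?_, hat⟩
  have hm : Complex.I * ((a * t : ℝ) : ℂ) + s ∈ rect a 0 r := by
    rw [add_comm]
    exact mem_rect hs hat
  have := ((differentiableAt_kern (h := h) hu (a := a) (t := t)
    (ζ := Complex.I * ((a * t : ℝ) : ℂ) + s) (Or.inr (by simp))).mul (hF' _ hm)).continuousAt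
  exact ContinuousAt.comp (f := fun s : ℝ => Complex.I * ((a * t : ℝ) : ℂ) + s) this (by fun_prop)

theorem neg_mem_rect {a r : ℝ} {ζ : ℂ} (h : ζ ∈ rect a 0 r) : -ζ ∈ rect a 0 r := by
  obtain ⟨h1, h2⟩ := h
  constructor
  · simpa using h1
  · simpa using h2

theorem BumpRegular.comp_neg {g : ℂ → ℂ} {a r y : ℝ} (hg : BumpRegular g a r y) :
    BumpRegular (fun ζ => g (-ζ)) a r (-y) where
  diff ζ hζ h0 := (hg.diff (-ζ) (neg_mem_rect hζ) (by simpa using h0)).comp ζ differentiable_neg.differentiableAt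
  cont s hs := by
    have h1 := hg.cont (-s) (by rwa [abs_neg])
    refine (ContinuousAt.comp (f := fun s : ℝ => -s) h1 continuousAt_neg).congr
      (Eventually.of_forall fun s => ?_)
    simp only [Function.comp]
    congr 1
    push_cast
    ring
  mem := by simpa using hg.mem

theorem bump_comp_neg {g : ℂ → ℂ} {a r y ε : ℝ} (hg : BumpRegular g a r y) (hε : 0 < ε)
    (hεr : ε < r) : bump (fun ζ => g (-ζ)) ε (-y) = bump g ε y := by
  rw [bump_eq hg hε hεr, bump_eq hg.comp_neg hε hεr]
  congr 1
  · congr 1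
    have := intervalIntegral.integral_comp_neg (a := 0) (b := y) (fun η : ℝ =>
      g (-(-ε + Complex.I * η)) - g (-(ε + Complex.I * η)))
    rw [neg_zero] at this
    rw [intervalIntegral.integral_symm, ← this, ← intervalIntegral.integral_neg]
    refine intervalIntegral.integral_congr fun η _ => ?_
    simp only [neg_sub]
    congr 2
    · push_cast
      ring
    · push_cast
      ring
  · have := intervalIntegral.integral_comp_neg (a := -ε) (b := ε)
      (fun s : ℝ => g (Complex.I * y + s))
    rw [neg_neg] at this
    rw [← this]
    refine intervalIntegral.integral_congr fun η _ => ?_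
    congr 1
    push_cast
    ring

/-- Reflection in the origin carries the contour around `-i a t` to the one around `i a t`. It
reduces `t < 0` to `t > 0` at the price of replacing `F ζ` by `F (-ζ)`. -/
theorem bump_kern_neg {h : ℂ} {a r u t ε : ℝ} (ha : 0 < a) (hr : 0 < r) (hu : 0 < u)
    (ht : t ∈ Icc (-1 : ℝ) 1) {F : ℂ → ℂ} (hF : DifferentiableOn ℂ F (rect a 0 r)) (hε : 0 < ε)
    (hεr : ε < r) :
    bump (fun ζ => kern h a u ζ (-t) * F ζ) ε (a * -t) =
      bump (fun ζ => kern h a u ζ t * F (-ζ)) ε (a * t) := by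
  have hF' : DifferentiableOn ℂ (fun ζ => F (-ζ)) (rect a 0 r) :=
    hF.comp differentiable_neg.differentiableOn fun ζ hζ => neg_mem_rect hζ
  rw [← bump_comp_neg (bumpRegular_kern ha hr hu ht hF') hε hεr, mul_neg]
  congr 1
  ext ζ
  rw [neg_neg, ← kern_neg_neg, neg_neg]

theorem bumpTotal_eq_half {h : ℂ} (hh : 0 < h.re) {a r ε u : ℝ} (ha : 0 < a) (hr : 0 < r)
    (hε : 0 < ε) (hεr : ε < r) (hu : 0 < u) {F : ℂ → ℂ} (hF : DifferentiableOn ℂ F (rect a 0 r)) :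
    bumpTotal h a u F ε = -(a : ℂ) *
      ((∫ t in Ioo (0 : ℝ) 1, wt h a t * bump (fun ζ => kern h a u ζ t * F ζ) ε (a * t)) +
        ∫ t in Ioo (0 : ℝ) 1, wt h a t * bump (fun ζ => kern h a u ζ t * F (-ζ)) ε (a * t)) := by
  have hF' : DifferentiableOn ℂ (fun ζ => F (-ζ)) (rect a 0 r) :=
    hF.comp differentiable_neg.differentiableOn fun ζ hζ => neg_mem_rect hζ
  have i1 := integrableOn_wt_mul_bump hh ha hr hε hεr hu hF.continuousOn
  have i2 := integrableOn_wt_mul_bump hh ha hr hε hεr hu hF'.continuousOn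
  have hs : Ioo (0 : ℝ) 1 ⊆ Ioo (-1) 1 := Ioo_subset_Ioo_left (by norm_num)
  rw [bumpTotal_eq hh ha hr hε hεr hu hF.continuousOn, ← integral_Ioc_eq_integral_Ioo,
    ← intervalIntegral.integral_of_le (by norm_num), intervalIntegral_symm_split
      (by rwa [intervalIntegrable_iff_integrableOn_Ioo_of_le (by norm_num)]),
    ← integral_add (i1.mono_set hs) (i2.mono_set hs), intervalIntegral.integral_of_le zero_le_one,
    integral_Ioc_eq_integral_Ioo]
  congr 1
  refine setIntegral_congr_fun measurableSet_Ioo fun t ht => ?_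
  rw [wt_neg, bump_kern_neg ha hr hu ⟨by linarith [ht.1], ht.2.le⟩ hF hε hεr]


/-! ### The limit `ε → 0` at fixed `u`, for `0 < h < 1`. -/

/-- The jump of the kernel across the branch cut, up to a factor. -/
noncomputable def cutKern (h a u t η : ℝ) : ℝ :=
  if η < a * t - u then (u / ((a * t - η - u) * (a * t - η + u))) ^ h else 0

theorem measurable_cutKern (h a u : ℝ) : Measurable fun p : ℝ × ℝ => cutKern h a u p.1 p.2 := by
  unfold cutKern
  exact Measurable.ite (measurableSet_lt (by fun_prop) (by fun_prop)) (by fun_prop) (by fun_prop)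

/-- The integral of `|x| ^ (-h)` over a symmetric interval. -/
noncomputable def singInt (h R : ℝ) : ℝ := ∫ v in Ioo (-R) R, |v| ^ (-h)

theorem integrableOn_sing {h : ℝ} (hh1 : h < 1) {R : ℝ} (hR : 0 ≤ R) :
    IntegrableOn (fun v : ℝ => |v| ^ (-h)) (Ioo (-R) R) := by
  have := intervalIntegrable_abs_rpow (r := -h) (by linarith) (-R) R
  rwa [intervalIntegrable_iff_integrableOn_Ioo_of_le (by linarith)] at this

theorem integrableOn_sing_shift {h : ℝ} (hh1 : h < 1) (c : ℝ) {a : ℝ} (ha : 0 ≤ a) :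
    IntegrableOn (fun η : ℝ => |c + η| ^ (-h)) (Ioo 0 a) := by
  have := intervalIntegrable_abs_sub_rpow (r := -h) (by linarith) (-c) 0 a
  rw [intervalIntegrable_iff_integrableOn_Ioo_of_le ha] at this
  refine this.congr_fun (fun η _ => ?_) measurableSet_Ioo
  simp only
  rw [← abs_neg]
  congr 2
  ring

/-- The bound does not depend on the position of the singularity, which makes the estimates below
uniform in `t`. -/
theorem integral_sing_shift_le {h : ℝ} (hh1 : h < 1) {c a R : ℝ} (ha : 0 ≤ a) (h1 : -R ≤ c)
    (h2 : c + a ≤ R) : ∫ η in Ioo 0 a, |c + η| ^ (-h) ≤ singInt h R := by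
  have hR : 0 ≤ R := by linarith
  have e : ∫ η in Ioo 0 a, |c + η| ^ (-h) = ∫ v in Ioo c (c + a), |v| ^ (-h) := by
    rw [← integral_Ioc_eq_integral_Ioo, ← integral_Ioc_eq_integral_Ioo,
      ← intervalIntegral.integral_of_le ha, ← intervalIntegral.integral_of_le (by linarith)]
    have := intervalIntegral.integral_comp_add_left (a := 0) (b := a) (fun v => |v| ^ (-h)) c
    rwa [add_zero] at this
  rw [e, singInt]
  exact setIntegral_mono_set (integrableOn_sing hh1 hR)
    (Eventually.of_forall fun v => Real.rpow_nonneg (abs_nonneg _) _)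
    (Ioo_subset_Ioo h1 h2).eventuallyLE

theorem norm_kern_line_le {h a u t η ε : ℝ} (hh : 0 < h) (hu : 0 < u) (hη : η < a * t)
    (hne : η ≠ a * t - u) :
    ‖kern h a u (ε + Complex.I * η) t‖ ≤ |(u - a * t) + η| ^ (-h) := by
  rw [kern_eq_offKern]
  have h1 : |a * t - η| = a * t - η := abs_of_pos (by linarith)
  have := norm_offKern_le (h := h) (ε := ε) (d := a * t - η) hh hu
    (by rw [h1]; intro e; apply hne; linarith)
  rwa [h1, show u - (a * t - η) = (u - a * t) + η by ring] at this

theorem norm_kern_horiz_le {h a u t s : ℝ} (hh : 0 < h) (hu : 0 < u) :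
    ‖kern h a u (Complex.I * (a * t : ℝ) + s) t‖ ≤ u ^ (-h) := by
  rw [add_comm, kern_eq_offKern, sub_self]
  have := norm_offKern_le (h := h) (ε := s) (d := 0) hh hu (by simpa using hu.ne)
  rwa [abs_zero, sub_zero, abs_of_pos hu] at this

/-- Below the branch point `a t - u` the phases `e^{-iπh}` and `e^{iπh}` of the two sides differ by
`-2i sin(πh)`; above it the two limits agree and nothing is left. -/
theorem tendsto_kern_jump {h a u t η : ℝ} (hu : 0 < u) (hη : η < a * t) (hne : η ≠ a * t - u)
    {F : ℂ → ℂ} (hF : ContinuousAt F (Complex.I * η)) :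
    Tendsto (fun ε : ℝ => kern h a u (-ε + Complex.I * η) t * F (-ε + Complex.I * η) -
      kern h a u (ε + Complex.I * η) t * F (ε + Complex.I * η)) (𝓝[>] 0)
      (𝓝 (-(2 * Complex.I * Real.sin (Real.pi * h)) * (cutKern h a u t η * F (Complex.I * η)))) := by
  have tF1 : Tendsto (fun ε : ℝ => F (ε + Complex.I * η)) (𝓝[>] 0) (𝓝 (F (Complex.I * η))) := by
    have h1 : Tendsto (fun ε : ℝ => (ε : ℂ) + Complex.I * η) (𝓝 0) (𝓝 (Complex.I * η)) := by
      have : Continuous fun ε : ℝ => (ε : ℂ) + Complex.I * η := by fun_prop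
      simpa using this.tendsto 0
    exact (hF.tendsto.comp h1).mono_left nhdsWithin_le_nhds
  have tF2 : Tendsto (fun ε : ℝ => F (-ε + Complex.I * η)) (𝓝[>] 0) (𝓝 (F (Complex.I * η))) := by
    have h1 : Tendsto (fun ε : ℝ => -(ε : ℂ) + Complex.I * η) (𝓝 0) (𝓝 (Complex.I * η)) := by
      have : Continuous fun ε : ℝ => -(ε : ℂ) + Complex.I * η := by fun_prop
      simpa using this.tendsto 0
    exact (hF.tendsto.comp h1).mono_left nhdsWithin_le_nhds
  have ek : ∀ ε : ℝ, kern h a u (ε + Complex.I * η) t = offKern h u ε (a * t - η) := fun ε =>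
    kern_eq_offKern h a u ε η t
  have ek' : ∀ ε : ℝ, kern h a u (-ε + Complex.I * η) t = offKern h u (-ε) (a * t - η) := by
    intro ε
    rw [← ek (-ε), Complex.ofReal_neg]
  simp only [ek, ek']
  rcases lt_or_gt_of_ne hne with hlt | hgt
  · have hd : u < a * t - η := by linarith
    have t1 := (tendsto_offKern_of_gt' (h := h) hu hd).mul tF2
    have t2 := (tendsto_offKern_of_gt (h := h) hu hd).mul tF1
    convert t1.sub t2 using 2
    rw [cutKern, if_pos hlt,
      show (a * t - η - u) * (a * t - η + u) = (a * t - η) ^ 2 - u ^ 2 by ring]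
    have hs : Complex.exp (-(Complex.I * Real.pi * h)) - Complex.exp (Complex.I * Real.pi * h) =
        -(2 * Complex.I * Real.sin (Real.pi * h)) := by
      push_cast
      rw [Complex.sin, show -((Real.pi : ℂ) * h) * Complex.I = -(Complex.I * Real.pi * h) by ring,
        show (Real.pi : ℂ) * h * Complex.I = Complex.I * Real.pi * h by ring]
      linear_combination (Complex.exp (-(Complex.I * Real.pi * h)) -
        Complex.exp (Complex.I * Real.pi * h)) * Complex.I_sq
    rw [← hs]
    ring
  · have hd : |a * t - η| < u := abs_lt.2 ⟨by linarith, by linarith⟩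
    have t0 : Tendsto (fun ε : ℝ => -ε) (𝓝 0) (𝓝 0) := by
      simpa using (continuous_neg (G := ℝ)).tendsto 0
    have t1 := (((tendsto_offKern_of_lt (h := h) hu hd).comp t0).mono_left
      (nhdsWithin_le_nhds (s := Ioi (0 : ℝ)))).mul tF2
    have t2 := ((tendsto_offKern_of_lt (h := h) hu hd).mono_left
      (nhdsWithin_le_nhds (s := Ioi (0 : ℝ)))).mul tF1
    rw [cutKern, if_neg (by linarith), Complex.ofReal_zero, zero_mul, mul_zero]
    have := t1.sub t2
    rwa [sub_self] at this

theorem exists_bound_near_segment {a r : ℝ} (hr : 0 < r) {F : ℂ → ℂ}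
    (hF : ContinuousOn F (rect a 0 r)) :
    ∃ C : ℝ, 0 ≤ C ∧ ∀ x y : ℝ, |x| ≤ r / 2 → |y| ≤ a → ‖F (x + Complex.I * y)‖ ≤ C := by
  have hK : IsCompact ((fun p : ℝ × ℝ => (p.1 : ℂ) + Complex.I * p.2) ''
      (Icc (-(r / 2)) (r / 2) ×ˢ Icc (-a) a)) :=
    (isCompact_Icc.prod isCompact_Icc).image (by fun_prop)
  obtain ⟨C, hC⟩ := hK.exists_bound_of_continuousOn (hF.mono (by
    rintro _ ⟨⟨x, y⟩, ⟨hx, hy⟩, rfl⟩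
    exact mem_rect ((abs_le.2 hx).trans_lt (by linarith)) ((abs_le.2 hy).trans_lt (by linarith))))
  refine ⟨max C 0, le_max_right _ _, fun x y hx hy => (hC _ ?_).trans (le_max_left _ _)⟩
  exact ⟨(x, y), ⟨abs_le.1 hx, abs_le.1 hy⟩, rfl⟩

theorem norm_jump_le {h a u r t η ε C : ℝ} (hh : 0 < h) (hu : 0 < u) {F : ℂ → ℂ}
    (hC : ∀ x y : ℝ, |x| ≤ r / 2 → |y| ≤ a → ‖F (x + Complex.I * y)‖ ≤ C)
    (hε : |ε| ≤ r / 2) (hη : η < a * t) (hηa : |η| ≤ a) (hne : η ≠ a * t - u) :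
    ‖kern h a u (-ε + Complex.I * η) t * F (-ε + Complex.I * η) -
      kern h a u (ε + Complex.I * η) t * F (ε + Complex.I * η)‖ ≤
      |(u - a * t) + η| ^ (-h) * (2 * C) := by
  have k1 := norm_kern_line_le (ε := ε) hh hu hη hne
  have k2 := norm_kern_line_le (ε := -ε) hh hu hη hne
  have f1 := hC ε η hε hηa
  have f2 := hC (-ε) η (by rwa [abs_neg]) hηa
  rw [Complex.ofReal_neg] at k2 f2
  refine (norm_sub_le _ _).trans ?_
  rw [norm_mul, norm_mul]
  have := mul_le_mul k1 f1 (norm_nonneg _) (Real.rpow_nonneg (abs_nonneg _) _)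
  have := mul_le_mul k2 f2 (norm_nonneg _) (Real.rpow_nonneg (abs_nonneg _) _)
  linarith

theorem norm_integral_horiz_le {h a u r t ε C : ℝ} (hh : 0 < h) (ha : 0 < a) (hu : 0 < u)
    (ht : t ∈ Icc (-1 : ℝ) 1) {F : ℂ → ℂ}
    (hC : ∀ x y : ℝ, |x| ≤ r / 2 → |y| ≤ a → ‖F (x + Complex.I * y)‖ ≤ C)
    (hε : 0 ≤ ε) (hεr : ε ≤ r / 2) :
    ‖∫ s in (-ε)..ε, kern h a u (Complex.I * (a * t : ℝ) + s) t *
      F (Complex.I * (a * t : ℝ) + s)‖ ≤ u ^ (-h) * C * |ε - -ε| := by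
  refine intervalIntegral.norm_integral_le_of_norm_le_const fun s hs => ?_
  rw [uIoc_of_le (by linarith)] at hs
  have f1 := hC s (a * t) (abs_le.2 ⟨by linarith [hs.1], by linarith [hs.2]⟩)
    (abs_le.2 ⟨by nlinarith [ht.1], by nlinarith [ht.2]⟩)
  rw [add_comm] at f1
  rw [norm_mul]
  exact mul_le_mul (norm_kern_horiz_le hh hu) f1 (norm_nonneg _) (Real.rpow_nonneg hu.le _)

/-- The bound is uniform in `ε` and `t`; the vertical sides need `h < 1` for the exponent `-h` to be
integrable. -/
theorem norm_bump_le {h a u r t ε C : ℝ} (hh : 0 < h) (hh1 : h < 1) (ha : 0 < a) (hu : 0 < u)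
    (hr : 0 < r) (ht : t ∈ Ioo (0 : ℝ) 1) {F : ℂ → ℂ} (hF : DifferentiableOn ℂ F (rect a 0 r))
    (hC0 : 0 ≤ C) (hC : ∀ x y : ℝ, |x| ≤ r / 2 → |y| ≤ a → ‖F (x + Complex.I * y)‖ ≤ C)
    (hε : 0 < ε) (hεr : ε ≤ r / 2) :
    ‖bump (fun ζ => kern h a u ζ t * F ζ) ε (a * t)‖ ≤
      singInt h (a + u) * (2 * C) + u ^ (-h) * C * r := by
  have hat0 : 0 < a * t := mul_pos ha ht.1
  have hata : a * t < a := by nlinarith [ht.2]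
  have ht' : t ∈ Icc (-1 : ℝ) 1 := ⟨by linarith [ht.1], ht.2.le⟩
  have hne : ∀ᵐ η : ℝ ∂(volume.restrict (Ioo 0 (a * t))), η ≠ a * t - u :=
    ae_restrict_of_ae (by simp [ae_iff])
  rw [bump_eq (bumpRegular_kern (F := F) ha hr hu ht' hF) hε (by linarith)]
  refine norm_add_le_of_le ?_ ?_
  · rw [norm_mul, Complex.norm_I, one_mul, intervalIntegral.integral_of_le hat0.le,
      integral_Ioc_eq_integral_Ioo]
    refine (norm_integral_le_of_norm_le
      ((integrableOn_sing_shift hh1 (u - a * t) hat0.le).mul_const (2 * C)) ?_).trans ?_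
    · filter_upwards [hne, ae_restrict_mem measurableSet_Ioo] with η h1 h2
      exact norm_jump_le hh hu hC (by rwa [abs_of_pos hε]) h2.2
        (abs_le.2 ⟨by linarith [h2.1], by linarith [h2.2]⟩) h1
    · rw [integral_mul_const]
      refine mul_le_mul_of_nonneg_right ?_ (by positivity)
      exact integral_sing_shift_le hh1 hat0.le (by linarith) (by linarith)
  · refine (norm_integral_horiz_le hh ha hu ht' hC hε.le hεr).trans ?_
    refine mul_le_mul_of_nonneg_left ?_ (mul_nonneg (Real.rpow_nonneg hu.le _) hC0)
    rw [abs_of_pos (by linarith)]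
    linarith

/-- The horizontal side has bounded integrand and length `2ε`, so it disappears. The vertical sides
give the jump, with `i · (-2i sin(πh)) = 2 sin(πh)`. The range of `η` is widened to `(0, a)`, where
`cutKern` vanishes anyway, so that Fubini can be applied on a product. -/
theorem tendsto_bump {h a u r t : ℝ} (hh : 0 < h) (hh1 : h < 1) (ha : 0 < a) (hu : 0 < u)
    (hr : 0 < r) (ht : t ∈ Ioo (0 : ℝ) 1) {F : ℂ → ℂ} (hF : DifferentiableOn ℂ F (rect a 0 r)) :
    Tendsto (fun ε => bump (fun ζ => kern h a u ζ t * F ζ) ε (a * t)) (𝓝[>] 0)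
      (𝓝 (2 * Real.sin (Real.pi * h) *
        ∫ η in Ioo 0 a, (cutKern h a u t η : ℂ) * F (Complex.I * η))) := by
  obtain ⟨C, hC0, hC⟩ := exists_bound_near_segment hr hF.continuousOn
  have hat0 : 0 < a * t := mul_pos ha ht.1
  have hata : a * t < a := by nlinarith [ht.2]
  have hFc : ∀ ζ ∈ rect a 0 r, ContinuousAt F ζ := fun ζ hζ =>
    hF.continuousOn.continuousAt ((isOpen_rect a 0 r).mem_nhds hζ)
  have hsmall : ∀ᶠ ε in 𝓝[>] (0 : ℝ), 0 < ε ∧ ε ≤ r / 2 := by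
    filter_upwards [Ioc_mem_nhdsGT (half_pos hr)] with ε hε using hε
  have hne : ∀ᵐ η : ℝ ∂(volume.restrict (Ioo 0 (a * t))), η ≠ a * t - u :=
    ae_restrict_of_ae (by simp [ae_iff])
  have hreg := bumpRegular_kern (h := h) (F := F) ha hr hu (t := t) ⟨by linarith [ht.1], ht.2.le⟩ hF
  have hT1 : Tendsto (fun ε : ℝ => ∫ η in Ioo 0 (a * t),
      (kern h a u (-ε + Complex.I * η) t * F (-ε + Complex.I * η) -
        kern h a u (ε + Complex.I * η) t * F (ε + Complex.I * η))) (𝓝[>] 0)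
      (𝓝 (∫ η in Ioo 0 (a * t), -(2 * Complex.I * Real.sin (Real.pi * h)) *
        (cutKern h a u t η * F (Complex.I * η)))) := by
    refine tendsto_integral_filter_of_dominated_convergence
      (fun η => |(u - a * t) + η| ^ (-h) * (2 * C)) ?_ ?_ ?_ ?_
    · filter_upwards [hsmall] with ε hε
      have hx : |ε| < r := by rw [abs_of_pos hε.1]; linarith
      have c2 := hreg.continuousOn_vert hx hε.1.ne'
      have c1 := hreg.continuousOn_vert (x := -ε) (by rwa [abs_neg]) (neg_ne_zero.2 hε.1.ne')
      rw [Complex.ofReal_neg] at c1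
      refine ((c1.sub c2).mono ?_).aestronglyMeasurable measurableSet_Ioo
      rw [uIcc_of_le hat0.le]
      exact Ioo_subset_Icc_self
    · filter_upwards [hsmall] with ε hε
      filter_upwards [hne, ae_restrict_mem measurableSet_Ioo] with η h1 h2
      exact norm_jump_le hh hu hC (by rw [abs_of_pos hε.1]; exact hε.2) h2.2
        (abs_le.2 ⟨by linarith [h2.1], by linarith [h2.2]⟩) h1
    · exact (integrableOn_sing_shift hh1 _ hat0.le).mul_const _
    · filter_upwards [hne, ae_restrict_mem measurableSet_Ioo] with η h1 h2
      refine tendsto_kern_jump hu h2.2 h1 (hFc _ ?_)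
      have := mem_rect (x := 0) (y := η) (a := a) (r := r) (by rwa [abs_zero])
        (abs_lt.2 ⟨by linarith [h2.1], by linarith [h2.2]⟩)
      rwa [Complex.ofReal_zero, zero_add] at this
  have hT2 : Tendsto (fun ε : ℝ => ∫ s in (-ε)..ε, kern h a u (Complex.I * (a * t : ℝ) + s) t *
      F (Complex.I * (a * t : ℝ) + s)) (𝓝[>] 0) (𝓝 0) := by
    have h0 : Tendsto (fun ε : ℝ => u ^ (-h) * C * |ε - -ε|) (𝓝[>] 0) (𝓝 0) := by
      have : Continuous (fun ε : ℝ => u ^ (-h) * C * |ε - -ε|) := by fun_prop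
      simpa using (this.tendsto 0).mono_left nhdsWithin_le_nhds
    refine squeeze_zero_norm' ?_ h0
    filter_upwards [hsmall] with ε hε
    exact norm_integral_horiz_le hh ha hu ⟨by linarith [ht.1], ht.2.le⟩ hC hε.1.le hε.2
  have hT := (hT1.const_mul Complex.I).add hT2
  have hval : Complex.I * (∫ η in Ioo 0 (a * t), -(2 * Complex.I * Real.sin (Real.pi * h)) *
        ((cutKern h a u t η : ℂ) * F (Complex.I * η))) + 0 = 2 * Real.sin (Real.pi * h) *
        ∫ η in Ioo 0 a, (cutKern h a u t η : ℂ) * F (Complex.I * η) := by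
    rw [integral_const_mul, add_zero]
    have e : ∫ η in Ioo 0 a, (cutKern h a u t η : ℂ) * F (Complex.I * η) =
        ∫ η in Ioo 0 (a * t), (cutKern h a u t η : ℂ) * F (Complex.I * η) := by
      refine setIntegral_eq_of_subset_of_forall_sdiff_eq_zero measurableSet_Ioo
        (Ioo_subset_Ioo_right hata.le) fun η hη => ?_
      rw [cutKern, if_neg, Complex.ofReal_zero, zero_mul]
      intro h1
      exact hη.2 ⟨hη.1.1, by linarith⟩
    rw [e]
    linear_combination (-(2 * Real.sin (Real.pi * h) *
      ∫ η in Ioo 0 (a * t), (cutKern h a u t η : ℂ) * F (Complex.I * η))) * Complex.I_sq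
  rw [hval] at hT
  refine hT.congr' ?_
  filter_upwards [hsmall] with ε hε
  rw [bump_eq hreg hε.1 (by linarith [hε.2]), intervalIntegral.integral_of_le hat0.le,
    integral_Ioc_eq_integral_Ioo]

/-- The symmetric half of the total contribution of the contours has a limit for `0 < h < 1`. -/
theorem tendsto_half {h a u r : ℝ} (hh : 0 < h) (hh1 : h < 1) (ha : 0 < a) (hu : 0 < u)
    (hr : 0 < r) {F : ℂ → ℂ} (hF : DifferentiableOn ℂ F (rect a 0 r)) :
    Tendsto (fun ε => ∫ t in Ioo (0 : ℝ) 1,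
        wt h a t * bump (fun ζ => kern h a u ζ t * F ζ) ε (a * t)) (𝓝[>] 0)
      (𝓝 (∫ t in Ioo (0 : ℝ) 1, wt h a t * (2 * Real.sin (Real.pi * h) *
        ∫ η in Ioo 0 a, (cutKern h a u t η : ℂ) * F (Complex.I * η)))) := by
  obtain ⟨C, hC0, hC⟩ := exists_bound_near_segment hr hF.continuousOn
  have hre : 0 < (h : ℂ).re := by simpa using hh
  have hsmall : ∀ᶠ ε in 𝓝[>] (0 : ℝ), 0 < ε ∧ ε ≤ r / 2 := by
    filter_upwards [Ioc_mem_nhdsGT (half_pos hr)] with ε hε using hε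
  have hs : Ioo (0 : ℝ) 1 ⊆ Ioo (-1) 1 := Ioo_subset_Ioo_left (by norm_num)
  refine tendsto_integral_filter_of_dominated_convergence
    (fun t => ‖wt h a t‖ * (singInt h (a + u) * (2 * C) + u ^ (-h) * C * r)) ?_ ?_ ?_ ?_
  · filter_upwards [hsmall] with ε hε
    exact ((integrableOn_wt_mul_bump hre ha hr hε.1 (by linarith [hε.2]) hu
      hF.continuousOn).mono_set hs).1
  · filter_upwards [hsmall] with ε hε
    filter_upwards [ae_restrict_mem measurableSet_Ioo] with t ht
    rw [norm_mul]
    exact mul_le_mul_of_nonneg_left (norm_bump_le hh hh1 ha hu hr ht hF hC0 hC hε.1 hε.2)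
      (norm_nonneg _)
  · exact (((integrableOn_wt hre ha).mono_set hs).norm).mul_const _
  · filter_upwards [ae_restrict_mem measurableSet_Ioo] with t ht
    exact (tendsto_bump hh hh1 ha hu hr ht hF).const_mul _

theorem norm_cutKern_le {h a u t η : ℝ} (hh : 0 < h) (hu : 0 < u) :
    ‖(cutKern h a u t η : ℂ)‖ ≤ |(u - a * t) + η| ^ (-h) := by
  rw [cutKern]
  split_ifs with h1
  · have h2 : 0 < a * t - η - u := by linarith
    have h3 : 0 < a * t - η + u := by linarith
    have e : |u - a * t + η| = a * t - η - u := by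
      rw [← abs_neg, abs_of_pos (by linarith)]
      ring
    rw [Complex.norm_real, Real.norm_of_nonneg (by positivity), e, Real.rpow_neg h2.le,
      ← Real.inv_rpow h2.le]
    refine Real.rpow_le_rpow (by positivity) ?_ hh.le
    rw [inv_eq_one_div, div_le_div_iff₀ (by positivity) h2]
    nlinarith
  · rw [Complex.ofReal_zero, norm_zero]
    positivity

/-- Only `t` with `a t > η + u` contribute, hence nothing once `η + u ≥ a`: this is where the light
cones appear. The substitution `s = a t` gives the integrated discontinuity. -/
theorem integral_wt_mul_cutKern {h a u η : ℝ} (hh : 0 < h) (hh1 : h < 1) (ha : 0 < a) (hu : 0 < u)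
    (hη : η ∈ Ioo 0 a) :
    Real.sin (Real.pi * h) * ∫ t in Ioo (0 : ℝ) 1, wt h a t * (cutKern h a u t η : ℂ) =
      if η + u < a then Real.pi / (2 * a) * legP h ((u ^ 2 + a ^ 2 - η ^ 2) / (2 * u * a)) else 0 := by
  split_ifs with h1
  · have hs := sin_mul_integral_outer hh hh1 hu hη.1.le h1
    have e : ∫ t in Ioo (0 : ℝ) 1, wt h a t * (cutKern h a u t η : ℂ) = (a : ℂ)⁻¹ *
        ((∫ s in Ioo (η + u) a, (a / (a ^ 2 - s ^ 2)) ^ (1 - h) *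
          (u / ((s - η) ^ 2 - u ^ 2)) ^ h : ℝ) : ℂ) := by
      set g : ℝ → ℝ := fun s => if η + u < s then (a / (a ^ 2 - s ^ 2)) ^ (1 - h) *
          (u / ((s - η) ^ 2 - u ^ 2)) ^ h else 0 with hg
      have e1 : ∫ s in Ioo (η + u) a, (a / (a ^ 2 - s ^ 2)) ^ (1 - h) *
          (u / ((s - η) ^ 2 - u ^ 2)) ^ h = ∫ s in Ioo 0 a, g s := by
        rw [setIntegral_eq_of_subset_of_forall_sdiff_eq_zero (t := Ioo 0 a) (s := Ioo (η + u) a)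
          measurableSet_Ioo (Ioo_subset_Ioo_left (by linarith [hη.1])) (f := g)]
        · refine setIntegral_congr_fun measurableSet_Ioo fun s hs => ?_
          simp only [hg, if_pos hs.1]
        · intro s hs
          simp only [hg]
          rw [if_neg]
          exact fun h2 => hs.2 ⟨h2, hs.1.2⟩
      have e2 : ∫ t in Ioo (0 : ℝ) 1, wt h a t * (cutKern h a u t η : ℂ) =
          ((∫ t in Ioo (0 : ℝ) 1, g (a * t) : ℝ) : ℂ) := by
        rw [← integral_complex_ofReal]
        refine setIntegral_congr_fun measurableSet_Ioo fun t ht => ?_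
        simp only [hg]
        rw [wt_eq_ofReal ha.le ⟨by linarith [ht.1], ht.2.le⟩, cutKern]
        have h3 : 0 < 1 - t ^ 2 := by nlinarith [ht.1, ht.2]
        by_cases h2 : η + u < a * t
        · rw [if_pos h2, if_pos (by linarith), ← Complex.ofReal_mul,
            show a / (a ^ 2 - (a * t) ^ 2) = (a * (1 - t ^ 2))⁻¹ by field_simp,
            Real.inv_rpow (by positivity), ← Real.rpow_neg (by positivity), neg_sub,
            show (a * t - η - u) * (a * t - η + u) = (a * t - η) ^ 2 - u ^ 2 by ring]
        · rw [if_neg h2, if_neg (by linarith), Complex.ofReal_zero, mul_zero]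
      rw [e1, e2, ← integral_Ioc_eq_integral_Ioo, ← integral_Ioc_eq_integral_Ioo,
        ← intervalIntegral.integral_of_le zero_le_one, ← intervalIntegral.integral_of_le ha.le]
      have := intervalIntegral.integral_comp_mul_left (a := 0) (b := 1) g ha.ne'
      rw [mul_zero, mul_one, smul_eq_mul] at this
      rw [this]
      push_cast
      rfl
    rw [e, mul_left_comm, hs]
    have : (a : ℂ) ≠ 0 := by exact_mod_cast ha.ne'
    field_simp
  · rw [setIntegral_congr_fun (g := fun _ => (0 : ℂ)) measurableSet_Ioo, integral_zero, mul_zero]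
    intro t ht
    simp only
    rw [cutKern, if_neg, Complex.ofReal_zero, mul_zero]
    intro h2
    have : a * t < a := by nlinarith [ht.2]
    linarith

/-- The value of the limit, in terms of the Legendre function. -/
theorem integral_half {h a u r : ℝ} (hh : 0 < h) (hh1 : h < 1) (ha : 0 < a) (hu : 0 < u)
    (hr : 0 < r) {F : ℂ → ℂ} (hF : DifferentiableOn ℂ F (rect a 0 r)) :
    ∫ t in Ioo (0 : ℝ) 1, wt h a t * (2 * Real.sin (Real.pi * h) *
        ∫ η in Ioo 0 a, (cutKern h a u t η : ℂ) * F (Complex.I * η)) =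
      Real.pi / a * ∫ η in Ioo 0 (a - u),
        legP h ((u ^ 2 + a ^ 2 - η ^ 2) / (2 * u * a)) * F (Complex.I * η) := by
  obtain ⟨C, hC0, hC⟩ := exists_bound_near_segment hr hF.continuousOn
  have hre : 0 < (h : ℂ).re := by simpa using hh
  have hs : Ioo (0 : ℝ) 1 ⊆ Ioo (-1) 1 := Ioo_subset_Ioo_left (by norm_num)
  -- Absolute integrability for Fubini: the integral over `η` is at most a constant times `singInt`,
  -- wherever the singularity lies, and the weight is integrable in `t`.
  have hint : Integrable (Function.uncurry fun t η : ℝ =>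
      wt h a t * ((cutKern h a u t η : ℂ) * F (Complex.I * η)))
      ((volume.restrict (Ioo 0 1)).prod (volume.restrict (Ioo 0 a))) := by
    have hFm : AEStronglyMeasurable (fun η : ℝ => F (Complex.I * η))
        (volume.restrict (Ioo 0 a)) := by
      refine ContinuousOn.aestronglyMeasurable ?_ measurableSet_Ioo
      refine hF.continuousOn.comp (by fun_prop) fun η hη => ?_
      have := mem_rect (x := 0) (y := η) (a := a) (r := r) (by rwa [abs_zero])
        (abs_lt.2 ⟨by linarith [hη.1], by linarith [hη.2]⟩)
      rwa [Complex.ofReal_zero, zero_add] at this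
    have hwm : Measurable (wt h a) := by
      unfold wt
      fun_prop
    have hm : AEStronglyMeasurable (Function.uncurry fun t η : ℝ =>
        wt h a t * ((cutKern h a u t η : ℂ) * F (Complex.I * η)))
        ((volume.restrict (Ioo 0 1)).prod (volume.restrict (Ioo 0 a))) := by
      refine AEStronglyMeasurable.mul (hwm.comp measurable_fst).aestronglyMeasurable
        (AEStronglyMeasurable.mul ?_ hFm.comp_snd)
      exact (Complex.measurable_ofReal.comp (measurable_cutKern h a u)).aestronglyMeasurable
    have hb : ∀ t : ℝ, ∀ η ∈ Ioo 0 a, ‖wt h a t * ((cutKern h a u t η : ℂ) * F (Complex.I * η))‖ ≤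
        ‖wt h a t‖ * (|(u - a * t) + η| ^ (-h) * C) := by
      intro t η hη
      have f1 := hC 0 η (by rw [abs_zero]; positivity) (abs_le.2 ⟨by linarith [hη.1], hη.2.le⟩)
      rw [Complex.ofReal_zero, zero_add] at f1
      rw [norm_mul, norm_mul]
      exact mul_le_mul_of_nonneg_left (mul_le_mul (norm_cutKern_le hh hu) f1 (norm_nonneg _)
        (by positivity)) (norm_nonneg _)
    have hbi : ∀ t : ℝ, IntegrableOn (fun η => ‖wt h a t‖ * (|(u - a * t) + η| ^ (-h) * C))
        (Ioo 0 a) := fun t =>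
      ((integrableOn_sing_shift hh1 (u - a * t) ha.le).mul_const C).const_mul _
    rw [integrable_prod_iff hm]
    constructor
    · filter_upwards [hm.prodMk_left] with t hmt
      refine Integrable.mono' (hbi t) hmt ?_
      filter_upwards [ae_restrict_mem measurableSet_Ioo] with η hη
      exact hb t η hη
    · refine Integrable.mono' (((integrableOn_wt hre ha).mono_set hs).norm.mul_const
        (singInt h (2 * a + u) * C)) hm.norm.integral_prod_right' ?_
      filter_upwards [ae_restrict_mem measurableSet_Ioo] with t ht
      have hata : a * t < a := by nlinarith [ht.2]
      have hat : 0 < a * t := mul_pos ha ht.1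
      rw [Real.norm_of_nonneg (integral_nonneg fun η => norm_nonneg _)]
      refine (integral_mono_of_nonneg (Eventually.of_forall fun η => norm_nonneg _) (hbi t)
        ?_).trans ?_
      · filter_upwards [ae_restrict_mem measurableSet_Ioo] with η hη
        exact hb t η hη
      · rw [integral_const_mul, integral_mul_const]
        refine mul_le_mul_of_nonneg_left (mul_le_mul_of_nonneg_right ?_ hC0) (norm_nonneg _)
        exact integral_sing_shift_le hh1 ha.le (by linarith) (by linarith)
  have e1 : ∫ t in Ioo (0 : ℝ) 1, wt h a t * (2 * Real.sin (Real.pi * h) *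
        ∫ η in Ioo 0 a, (cutKern h a u t η : ℂ) * F (Complex.I * η)) =
      2 * Real.sin (Real.pi * h) * ∫ t in Ioo (0 : ℝ) 1, ∫ η in Ioo 0 a,
        wt h a t * ((cutKern h a u t η : ℂ) * F (Complex.I * η)) := by
    rw [← integral_const_mul]
    congr 1
    ext t
    rw [integral_const_mul]
    ring
  have hval : ∀ η ∈ Ioo 0 a, 2 * (Real.sin (Real.pi * h) : ℂ) * ∫ t in Ioo (0 : ℝ) 1,
      wt h a t * ((cutKern h a u t η : ℂ) * F (Complex.I * η)) = if η + u < a then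
        Real.pi / a * (legP h ((u ^ 2 + a ^ 2 - η ^ 2) / (2 * u * a)) * F (Complex.I * η)) else
        0 := by
    intro η hη
    have e2 : ∫ t in Ioo (0 : ℝ) 1, wt h a t * ((cutKern h a u t η : ℂ) * F (Complex.I * η)) =
        (∫ t in Ioo (0 : ℝ) 1, wt h a t * (cutKern h a u t η : ℂ)) * F (Complex.I * η) := by
      rw [← integral_mul_const]
      congr 1
      ext t
      ring
    have e3 := integral_wt_mul_cutKern hh hh1 ha hu hη
    rw [e2, show ∀ x y z : ℂ, 2 * x * (y * z) = 2 * (x * y) * z from fun x y z => by ring, e3]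
    have : (a : ℂ) ≠ 0 := by exact_mod_cast ha.ne'
    split_ifs
    · field_simp
    · ring
  rw [e1, integral_integral_swap hint, ← integral_const_mul, ← integral_const_mul,
    setIntegral_eq_of_subset_of_forall_sdiff_eq_zero (t := Ioo 0 a) (s := Ioo 0 (a - u))
      measurableSet_Ioo (Ioo_subset_Ioo_right (by linarith))]
  · refine setIntegral_congr_fun measurableSet_Ioo fun η hη => ?_
    rw [hval η ⟨hη.1, by linarith [hη.2]⟩, if_pos (by linarith [hη.2])]
  · intro η hη
    rw [hval η hη.1, if_neg]
    exact fun h2 => hη.2 ⟨hη.1.1, by linarith⟩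

/-- For `0 < h < 1` the contribution of the contours converges to an integral over the segment
between the light cones. -/
theorem tendsto_bumpTotal_of_lt_one {h a u r : ℝ} (hh : 0 < h) (hh1 : h < 1) (ha : 0 < a)
    (hu : 0 < u) (hr : 0 < r) {F : ℂ → ℂ} (hF : DifferentiableOn ℂ F (rect a 0 r)) :
    Tendsto (fun ε => bumpTotal h a u F ε) (𝓝[>] 0) (𝓝 (-Real.pi *
      ((∫ η in Ioo 0 (a - u), legP h ((u ^ 2 + a ^ 2 - η ^ 2) / (2 * u * a)) * F (Complex.I * η)) +
      ∫ η in Ioo 0 (a - u), legP h ((u ^ 2 + a ^ 2 - η ^ 2) / (2 * u * a)) *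
        F (-(Complex.I * η))))) := by
  have hre : 0 < (h : ℂ).re := by simpa using hh
  have hF' : DifferentiableOn ℂ (fun ζ => F (-ζ)) (rect a 0 r) :=
    hF.comp differentiable_neg.differentiableOn fun ζ hζ => neg_mem_rect hζ
  have t1 := ((tendsto_half hh hh1 ha hu hr hF).add (tendsto_half hh hh1 ha hu hr hF')).const_mul
    (-(a : ℂ))
  rw [integral_half hh hh1 ha hu hr hF, integral_half hh hh1 ha hu hr hF', ← mul_add] at t1
  have ha' : (a : ℂ) ≠ 0 := by exact_mod_cast ha.ne'
  rw [← mul_assoc, show -(a : ℂ) * (Real.pi / a) = -Real.pi by field_simp] at t1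
  refine t1.congr' ?_
  filter_upwards [Ioo_mem_nhdsGT hr] with ε hε
  exact (bumpTotal_eq_half hre ha hr hε.1 hε.2 hu hF).symm


/-! ### Continuation of the limit in `h`. -/

/-- The invariant distance of a point on the real axis from the bulk point. -/
noncomputable def sig (a u s : ℝ) : ℝ := (u ^ 2 + a ^ 2 + s ^ 2) / (2 * u * a)

theorem one_lt_sig {a u s : ℝ} (ha : 0 < a) (hu : 0 < u) (h : u ≠ a ∨ s ≠ 0) : 1 < sig a u s := by
  rw [sig, lt_div_iff₀ (by positivity)]
  rcases h with h | h
  · have := sq_pos_of_ne_zero (sub_ne_zero.2 h)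
    nlinarith [sq_nonneg s]
  · have := sq_pos_of_ne_zero h
    nlinarith [sq_nonneg (u - a)]

theorem dist2_ofReal {a u : ℝ} (ha : 0 < a) (hu : 0 < u) (s : ℝ) :
    dist2 u s a 0 = ((2 * u * a * sig a u s : ℝ) : ℂ) := by
  rw [sig, mul_div_cancel₀ _ (by positivity), dist2]
  push_cast
  ring

theorem G_ofReal {h a u s : ℝ} (ha : 0 < a) (hu : 0 < u) (hs : u ≠ a ∨ s ≠ 0) :
    G h u s a 0 = gfun h (sig a u s) := by
  have := G_eq_gfun h (z₀ := 0) hu ha (one_lt_sig ha hu hs)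
    (by rw [Complex.ofReal_zero]; exact dist2_ofReal ha hu s)
  rwa [Complex.ofReal_zero] at this

theorem integral_wt_mul_kern {h a u s : ℝ} (hh : 0 < h) (ha : 0 < a) (hu : 0 < u) (hs : s ≠ 0) :
    a * ∫ t in Ioo (-1 : ℝ) 1, wt h a t * kern h a u s t = cQ h * gfun h (sig a u s) := by
  have h1 := superposition hh ha hu (ζ := (s : ℂ)) (by simpa using hs)
  rw [G_ofReal ha hu (Or.inr hs), intervalIntegral.integral_of_le (by norm_num),
    integral_Ioc_eq_integral_Ioo] at h1
  have h2 := cst_mul_gamma hh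
  change cst h * Complex.I * cQ h = 1 at h2
  rw [← h1]
  linear_combination (-(a : ℂ) * ∫ t in Ioo (-1 : ℝ) 1, wt h a t * kern h a u s t) * h2

theorem integrable_wt_mul_kern_mul {h : ℂ} {a u r ε δ : ℝ} (hh : 0 < h.re) (ha : 0 < a)
    (hu : 0 < u) (hε : 0 < ε) (hδr : δ < r) {F : ℂ → ℂ} (hF : ContinuousOn F (rect a 0 r)) :
    Integrable (Function.uncurry fun t s : ℝ =>
      wt h a t * (kern h a u s t * F s + kern h a u (-s) t * F (-s)))
      ((volume.restrict (Ioo (-1) 1)).prod (volume.restrict (Icc ε δ))) := by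
  rw [Measure.prod_restrict]
  have hw : IntegrableOn (fun p : ℝ × ℝ => wt h a p.1) (Ioo (-1) 1 ×ˢ Icc ε δ) := by
    rw [IntegrableOn, Measure.volume_eq_prod, ← Measure.prod_restrict]
    exact (integrableOn_wt hh ha).comp_fst _
  refine hw.mul_continuousOn_of_subset (K := Icc (-1) 1 ×ˢ Icc ε δ) ?_
    (measurableSet_Ioo.prod measurableSet_Icc) (isCompact_Icc.prod isCompact_Icc)
    (prod_mono Ioo_subset_Icc_self le_rfl)
  rintro ⟨t, s⟩ ⟨-, hs⟩
  change s ∈ Icc ε δ at hs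
  have hs0 : 0 < s := hε.trans_le hs.1
  have hr : 0 < r := hs0.trans_le (hs.2.trans hδr.le)
  have hm : ((s : ℝ) : ℂ) ∈ rect a 0 r := by
    have := mem_rect (a := a) (r := r) (x := s) (y := 0)
      (by rw [abs_of_pos hs0]; linarith [hs.2]) (by rw [abs_zero]; positivity)
    simpa using this
  have hFc : ∀ ζ ∈ rect a 0 r, ContinuousAt F ζ := fun ζ hζ =>
    hF.continuousAt ((isOpen_rect a 0 r).mem_nhds hζ)
  refine ContinuousAt.continuousWithinAt ?_
  have key : ∀ ζ : ℝ × ℝ → ℂ, Continuous ζ → ζ (t, s) ∈ rect a 0 r → (ζ (t, s)).re ≠ 0 →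
      ContinuousAt (fun p : ℝ × ℝ => kern h a u (ζ p) p.1 * F (ζ p)) (t, s) := by
    intro ζ hζ hmem hre
    refine ContinuousAt.mul ?_ ?_
    · exact ContinuousAt.comp (f := fun p : ℝ × ℝ => ((h, u, ζ p, p.1) : ℂ × ℝ × ℂ × ℝ))
        (x := (t, s)) (continuousAt_kern (a := a) (p := (h, u, ζ (t, s), t)) hu (Or.inl hre))
        (by fun_prop)
    · exact ContinuousAt.comp (f := ζ) (x := (t, s)) (hFc _ hmem) (by fun_prop)
  exact (key (fun p => (p.2 : ℂ)) (by fun_prop) hm (by simpa using hs0.ne')).add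
    (key (fun p => -(p.2 : ℂ)) (by fun_prop) (neg_mem_rect hm) (by simpa using hs0.ne'))

/-- The correction between the contours at distance `ε` and `δ` runs along the real axis, and
integrating it over `w` turns the kernel into the propagator. The whole dependence on `ε` then sits
in one ordinary integral, with no restriction `h < 1`. -/
theorem bumpTotal_eq_add {h a u r ε δ : ℝ} (hh : 0 < h) (ha : 0 < a) (hu : 0 < u)
    (hε : 0 < ε) (hεδ : ε ≤ δ) (hδr : δ < r) {F : ℂ → ℂ} (hF : DifferentiableOn ℂ F (rect a 0 r)) :
    bumpTotal h a u F ε = bumpTotal h a u F δ +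
      cQ h * ∫ s in ε..δ, gfun h (sig a u s) * (F s + F (-s)) := by
  have hre : 0 < (h : ℂ).re := by simpa using hh
  have hr : 0 < r := by linarith
  have hδ : 0 < δ := by linarith
  have hint := integrable_wt_mul_kern_mul (h := h) hre ha hu hε hδr hF.continuousOn
  have i1 := integrableOn_wt_mul_bump hre ha hr hδ hδr hu hF.continuousOn
  have i2 := hint.integral_prod_left
  simp only [Function.uncurry] at i2
  have e : ∀ t ∈ Ioo (-1 : ℝ) 1, wt h a t * bump (fun ζ => kern h a u ζ t * F ζ) ε (a * t) =
      wt h a t * bump (fun ζ => kern h a u ζ t * F ζ) δ (a * t) - ∫ s in Icc ε δ,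
        wt h a t * (kern h a u s t * F s + kern h a u (-s) t * F (-s)) := by
    intro t ht
    rw [bump_eq_sub (bumpRegular_kern ha hr hu (Ioo_subset_Icc_self ht) hF) hε hεδ hδr, mul_sub,
      integral_const_mul, intervalIntegral.integral_of_le hεδ, integral_Icc_eq_integral_Ioc]
  rw [bumpTotal_eq hre ha hr hε (by linarith) hu hF.continuousOn,
    bumpTotal_eq hre ha hr hδ hδr hu hF.continuousOn, setIntegral_congr_fun measurableSet_Ioo e,
    integral_sub i1 i2, integral_integral_swap hint, mul_sub, sub_eq_add_neg]
  congr 1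
  rw [neg_mul, neg_neg, ← integral_const_mul, ← intervalIntegral.integral_const_mul,
    intervalIntegral.integral_of_le hεδ, ← integral_Icc_eq_integral_Ioc]
  refine setIntegral_congr_fun measurableSet_Icc fun s hs => ?_
  have hs0 : s ≠ 0 := (hε.trans_le hs.1).ne'
  have k1 := integral_wt_mul_kern hh ha hu hs0
  have k2 := integral_wt_mul_kern hh ha hu (neg_ne_zero.2 hs0)
  have hsig : sig a u (-s) = sig a u s := by rw [sig, neg_sq, sig]
  rw [hsig, Complex.ofReal_neg] at k2
  have j1 := integrableOn_wt_mul hre ha (continuous_kern h a hu (ζ := (s : ℂ)) (by simpa using hs0))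
  have j2 := integrableOn_wt_mul hre ha
    (continuous_kern h a hu (ζ := -(s : ℂ)) (by simpa using hs0))
  have e3 : ∫ t in Ioo (-1 : ℝ) 1,
      wt h a t * (kern h a u s t * F s + kern h a u (-s) t * F (-s)) =
      (∫ t in Ioo (-1 : ℝ) 1, wt h a t * kern h a u s t) * F s +
        (∫ t in Ioo (-1 : ℝ) 1, wt h a t * kern h a u (-s) t) * F (-s) := by
    rw [← integral_mul_const, ← integral_mul_const,
      ← integral_add (j1.mul_const _) (j2.mul_const _)]
    congr 1
    ext t
    ring
  rw [e3]
  linear_combination F s * k1 + F (-s) * k2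

theorem differentiable_kern_param {a u t : ℝ} {ζ : ℂ} (hu : 0 < u)
    (hζ : ζ.re ≠ 0 ∨ ζ.im = a * t) : Differentiable ℂ fun h => kern h a u ζ t := by
  have hmem := ofReal_div_mem_slitPlane hu (kern_den_mem_slitPlane hu hζ)
  unfold kern
  exact fun h => differentiableAt_id.const_cpow (Or.inl (Complex.slitPlane_ne_zero hmem))

theorem differentiableOn_bumpTotal {a r ε u : ℝ} (ha : 0 < a) (hr : 0 < r)
    (hε : 0 < ε) (hεr : ε < r) (hu : 0 < u) {F : ℂ → ℂ} (hF : ContinuousOn F (rect a 0 r)) :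
    DifferentiableOn ℂ (fun h => bumpTotal h a u F ε) {h | 0 < h.re} := by
  intro h₀ hh₀
  change 0 < h₀.re at hh₀
  -- On `Re h > κ` the weight is the fixed integrable weight of exponent `κ - 1` times `(a (1 - t²))
  -- ^ (h - κ)`, which is continuous up to `t = ±1`.
  obtain ⟨κ, hκ0, hκ⟩ := exists_between hh₀
  refine DifferentiableAt.differentiableWithinAt ?_
  have hU : IsOpen {h : ℂ | κ < h.re} := isOpen_lt continuous_const Complex.continuous_re
  refine DifferentiableOn.differentiableAt (s := {h : ℂ | κ < h.re}) ?_ (hU.mem_nhds hκ)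
  unfold bumpTotal
  refine DifferentiableOn.const_mul ?_ _
  have hc := continuousOn_bumpFun ha hr hε hεr (f := fun _ => F)
    (hF.comp (by fun_prop) fun p hp => hp.2)
  have hmain := differentiableOn_integral_mul_of_continuousOn (μ := volume) hU
    (K := Icc (-1 : ℝ) 1 ×ˢ Icc (0 : ℝ) 1) (s := Ioo (-1 : ℝ) 1 ×ˢ Icc (0 : ℝ) 1)
    (isCompact_Icc.prod isCompact_Icc) (measurableSet_Ioo.prod measurableSet_Icc)
    (prod_mono Ioo_subset_Icc_self le_rfl) (φ := fun p : ℝ × ℝ => wt κ a p.1)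
    (integrableOn_wt_prod (by simpa using hκ0) ha)
    (f := fun h p => ((a * (1 - p.1 ^ 2) : ℝ) : ℂ) ^ (h - κ) * bumpFun h a u F ε p.1 p.2) ?_ ?_
  · refine hmain.congr fun h _ => ?_
    refine setIntegral_congr_fun (measurableSet_Ioo.prod measurableSet_Icc) fun p hp => ?_
    have h3 : 0 < 1 - p.1 ^ 2 := by nlinarith [hp.1.1, hp.1.2]
    have h4 : ((a * (1 - p.1 ^ 2) : ℝ) : ℂ) ≠ 0 := by exact_mod_cast (mul_pos ha h3).ne'
    rw [← mul_assoc, wt, wt, ← Complex.cpow_add _ _ h4]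
    congr 2
    ring
  · refine ContinuousOn.mul ?_ ?_
    · rintro ⟨h, t, s⟩ ⟨hh, ht, hs⟩
      refine ContinuousAt.continuousWithinAt ?_
      have hh' : 0 < (h - κ).re := by
        rw [Complex.sub_re, Complex.ofReal_re]
        exact sub_pos.2 hh
      exact ContinuousAt.comp (f := fun p : ℂ × ℝ × ℝ => ((a * (1 - p.2.1 ^ 2), p.1 - κ) : ℝ × ℂ))
        (x := (h, t, s)) (Complex.continuousAt_ofReal_cpow _ _ (Or.inl hh')) (by fun_prop)
    · exact hc.comp (f := fun p : ℂ × ℝ × ℝ => ((p.1, u, p.2.1, p.2.2) : ℂ × ℝ × ℝ × ℝ))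
        (by fun_prop) fun p hp => ⟨mem_univ _, hu, hp.2.1, hp.2.2⟩
  · intro p hp
    have h3 : 0 < 1 - p.1 ^ 2 := by nlinarith [hp.1.1, hp.1.2]
    have h4 : ((a * (1 - p.1 ^ 2) : ℝ) : ℂ) ≠ 0 := by exact_mod_cast (mul_pos ha h3).ne'
    refine DifferentiableOn.mul ?_ ?_
    · exact DifferentiableOn.const_cpow (by fun_prop) (Or.inl h4)
    · refine Differentiable.differentiableOn ?_
      have k1 := differentiable_kern_param (a := a) (t := p.1)
        (ζ := -ε + Complex.I * (p.2 * (a * p.1) : ℝ)) hu (Or.inl (by simpa using hε.ne'))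
      have k2 := differentiable_kern_param (a := a) (t := p.1)
        (ζ := ε + Complex.I * (p.2 * (a * p.1) : ℝ)) hu (Or.inl (by simpa using hε.ne'))
      have k3 := differentiable_kern_param (a := a) (t := p.1)
        (ζ := Complex.I * (a * p.1 : ℝ) + ((2 * p.2 - 1) * ε : ℝ)) hu (Or.inr (by simp))
      unfold bumpFun
      exact (((k1.mul_const _).sub (k2.mul_const _)).const_mul _).add ((k3.mul_const _).const_mul _)

/-- The base is at least `σ - √(σ² - 1) = 1 / (σ + √(σ² - 1)) ≥ 1 / (2σ)`. -/
theorem norm_legP_le {h : ℂ} (hh : 0 ≤ h.re) {σ : ℝ} (hσ : 1 ≤ σ) :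
    ‖legP h σ‖ ≤ (2 * σ) ^ h.re := by
  set q := Real.sqrt (σ ^ 2 - 1) with hq
  have hq0 : 0 ≤ q := Real.sqrt_nonneg _
  have hq2 : q ^ 2 = σ ^ 2 - 1 := Real.sq_sqrt (by nlinarith)
  have hqσ : q ≤ σ := by nlinarith
  have hpos : ∀ φ : ℝ, 1 / (2 * σ) ≤ σ + q * Real.cos φ := by
    intro φ
    have h1 : σ - q ≤ σ + q * Real.cos φ := by nlinarith [Real.neg_one_le_cos φ]
    refine le_trans ?_ h1
    rw [div_le_iff₀ (by positivity)]
    nlinarith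
  have hσ0 : 0 < 1 / (2 * σ) := by positivity
  have hb : ‖∫ φ in Ioc (-Real.pi) Real.pi, ((σ + q * Real.cos φ : ℝ) : ℂ) ^ (-h)‖ ≤
      (2 * σ) ^ h.re * volume.real (Ioc (-Real.pi) Real.pi) := by
    refine norm_setIntegral_le_of_norm_le_const (by simp) fun φ _ => ?_
    rw [Complex.norm_cpow_eq_rpow_re_of_pos (hσ0.trans_le (hpos φ)), Complex.neg_re]
    refine (Real.rpow_le_rpow_of_nonpos hσ0 (hpos φ) (by linarith)).trans_eq ?_
    rw [one_div, Real.inv_rpow (by positivity), Real.rpow_neg (by positivity), inv_inv]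
  rw [Real.volume_real_Ioc_of_le (by linarith [Real.pi_pos])] at hb
  have hpi : 0 ≤ 1 / (2 * Real.pi) := div_nonneg zero_le_one (by linarith [Real.pi_pos])
  rw [legP, norm_mul, Complex.norm_real, Real.norm_of_nonneg hpi]
  refine (mul_le_mul_of_nonneg_left hb hpi).trans_eq ?_
  have := Real.pi_pos
  field_simp
  ring

theorem measurable_legP (h : ℂ) : Measurable (legP h) := by
  unfold legP
  refine Measurable.const_mul ?_ _
  have : Measurable (Function.uncurry fun σ φ : ℝ =>
      ((σ + Real.sqrt (σ ^ 2 - 1) * Real.cos φ : ℝ) : ℂ) ^ (-h)) := by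
    unfold Function.uncurry
    fun_prop
  exact this.stronglyMeasurable.integral_prod_right.measurable

theorem exists_gfun_bound {h₀ : ℂ} (hh : 0 < h₀.re) {σ₀ : ℝ} (hσ : 1 < σ₀) :
    ∃ M : ℝ, ∀ᶠ h in 𝓝 h₀, ∀ σ : ℝ, σ₀ ≤ σ → ‖gfun h σ‖ ≤ M := by
  have hc : ∀ k : ℕ, h₀ + 1 / 2 + k ≠ 0 := by
    intro k hk
    have := congrArg Complex.re hk
    simp at this
    linarith [(Nat.cast_nonneg k : (0 : ℝ) ≤ k)]
  obtain ⟨M, hM⟩ := exists_hyp_bound (A := fun h : ℂ => h / 2) (B := fun h => h / 2 + 1 / 2)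
    (C := fun h => h + 1 / 2) (x₀ := h₀) (by fun_prop) (by fun_prop) (by fun_prop) hc
    (norm_nonneg _) (norm_one_div_sq_lt_one hσ)
  have hre : ∀ᶠ h in 𝓝 h₀, 0 < h.re :=
    (isOpen_lt continuous_const Complex.continuous_re).mem_nhds hh
  refine ⟨1 * M, ?_⟩
  filter_upwards [hM, hre] with h h1 h2 σ hσσ
  have hσ0 : 0 < 1 / (2 * σ) := by
    have : 0 < σ := by linarith
    positivity
  rw [gfun, norm_mul]
  refine mul_le_mul ?_ (h1 _ ?_) (norm_nonneg _) zero_le_one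
  · rw [Complex.norm_cpow_eq_rpow_re_of_pos hσ0]
    refine Real.rpow_le_one hσ0.le ?_ h2.le
    rw [div_le_one (by linarith)]
    linarith
  · rw [norm_pow, norm_pow, norm_div, norm_div, norm_one, Complex.norm_real, Complex.norm_real,
      Real.norm_of_nonneg (by linarith), Real.norm_of_nonneg (by linarith)]
    exact pow_le_pow_left₀ (one_div_nonneg.2 (by linarith)) (one_div_le_one_div_of_le (by linarith) hσσ) 2

theorem differentiableOn_integral_legP {b S : ℝ} {σ : ℝ → ℝ} (hσm : Measurable σ)
    (hσ : ∀ η ∈ Ioo 0 b, 1 ≤ σ η ∧ σ η ≤ S) (hS : 1 ≤ S) {E : ℝ → ℂ} (hE : IntegrableOn E (Ioo 0 b)) :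
    DifferentiableOn ℂ (fun h => ∫ η in Ioo 0 b, legP h (σ η) * E η) {h | 0 < h.re} := by
  have hU : IsOpen {h : ℂ | 0 < h.re} := isOpen_lt continuous_const Complex.continuous_re
  refine differentiableOn_integral_of_locally_bounded hU ?_ ?_ ?_
  · intro h _
    exact ((measurable_legP h).comp hσm).aestronglyMeasurable.mul hE.1
  · filter_upwards [ae_restrict_mem measurableSet_Ioo] with η hη
    exact ((differentiable_legP (hσ η hη).1).mul_const _).differentiableOn
  · intro h₀ hh₀
    refine ⟨h₀.re, hh₀, fun η => (2 * S) ^ (2 * h₀.re) * ‖E η‖, hE.norm.const_mul _, ?_⟩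
    filter_upwards [ae_restrict_mem measurableSet_Ioo] with η hη h hh
    have h1 : |h.re - h₀.re| < h₀.re := by
      rw [← Complex.sub_re]
      exact (Complex.abs_re_le_norm _).trans_lt (mem_ball_iff_norm.1 hh)
    rw [abs_lt] at h1
    rw [norm_mul]
    refine mul_le_mul_of_nonneg_right ?_ (norm_nonneg _)
    refine (norm_legP_le (by linarith) (hσ η hη).1).trans ?_
    have h2 : (2 * σ η) ^ h.re ≤ (2 * S) ^ h.re :=
      Real.rpow_le_rpow (by linarith [(hσ η hη).1]) (by linarith [(hσ η hη).2]) (by linarith)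
    refine h2.trans ?_
    exact Real.rpow_le_rpow_of_exponent_le (by linarith) (by linarith)

theorem differentiableOn_cQ : DifferentiableOn ℂ cQ {h | 0 < h.re} := by
  intro h hh
  change 0 < h.re at hh
  have g : ∀ z : ℂ, 0 < z.re → DifferentiableAt ℂ Complex.Gamma z := by
    intro z hz
    refine Complex.differentiableAt_Gamma z fun m e => ?_
    rw [e] at hz
    simp at hz
    linarith [(Nat.cast_nonneg m : (0 : ℝ) ≤ m)]
  have h2 : 0 < (h + 1 / 2).re := by
    simp
    linarith
  unfold cQ
  refine DifferentiableAt.differentiableWithinAt (DifferentiableAt.div ?_ ?_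
    (Complex.Gamma_ne_zero_of_re_pos h2))
  · exact (g h hh).const_mul _
  · exact (g _ h2).comp h (by fun_prop)

theorem differentiableOn_integral_gfun {σ₀ : ℝ} (hσ₀ : 1 < σ₀) {T : Set ℝ}
    {σ : ℝ → ℝ} (hσc : Continuous σ) (hσ : ∀ s, σ₀ ≤ σ s) {E : ℝ → ℂ}
    (hE : IntegrableOn E T) :
    DifferentiableOn ℂ (fun h => ∫ s in T, gfun h (σ s) * E s) {h | 0 < h.re} := by
  have hU : IsOpen {h : ℂ | 0 < h.re} := isOpen_lt continuous_const Complex.continuous_re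
  have hc : ∀ h : ℂ, 0 < h.re → ∀ k : ℕ, h + 1 / 2 + k ≠ 0 := by
    intro h hh k hk
    have := congrArg Complex.re hk
    simp at this
    linarith [(Nat.cast_nonneg k : (0 : ℝ) ≤ k)]
  refine differentiableOn_integral_of_locally_bounded hU ?_ ?_ ?_
  · intro h hh
    refine AEStronglyMeasurable.mul (Continuous.aestronglyMeasurable ?_) hE.1
    rw [continuous_iff_continuousAt]
    exact fun s => ContinuousAt.comp (f := σ) (continuousAt_gfun (hc h hh) (hσ₀.trans_le (hσ s)))
      hσc.continuousAt
  · exact Eventually.of_forall fun s => (differentiableOn_gfun (hσ₀.trans_le (hσ s)) hU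
      differentiableOn_id fun h hh => hc h hh).mul_const _
  · intro h₀ hh₀
    obtain ⟨M, hM⟩ := exists_gfun_bound hh₀ hσ₀
    obtain ⟨ρ, hρ, hb⟩ := Metric.eventually_nhds_iff_ball.1 hM
    refine ⟨ρ, hρ, fun s => M * ‖E s‖, hE.norm.const_mul _, Eventually.of_forall fun s h hh => ?_⟩
    rw [norm_mul]
    exact mul_le_mul_of_nonneg_right (hb h hh _ (hσ s)) (norm_nonneg _)

theorem integrableOn_comp_real {a r δ : ℝ} (ha : 0 < a) (hδr : δ < r) {F : ℂ → ℂ}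
    (hF : ContinuousOn F (rect a 0 r)) :
    IntegrableOn (fun s : ℝ => F s + F (-s)) (Icc 0 δ) := by
  refine ContinuousOn.integrableOn_compact isCompact_Icc ?_
  have hm : ∀ s ∈ Icc 0 δ, (s : ℂ) ∈ rect a 0 r := by
    intro s hs
    have := mem_rect (a := a) (r := r) (x := s) (y := 0)
      (by rw [abs_of_nonneg hs.1]; linarith [hs.2])
      (by rw [abs_zero]; linarith [hs.1, hs.2])
    simpa using this
  exact (hF.comp (by fun_prop) hm).add (hF.comp (by fun_prop) fun s hs => neg_mem_rect (hm s hs))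

theorem integrableOn_comp_imag {a r b : ℝ} (hr : 0 < r) (hb : b < a) {F : ℂ → ℂ}
    (hF : ContinuousOn F (rect a 0 r)) :
    IntegrableOn (fun η : ℝ => F (Complex.I * η)) (Ioo 0 b) := by
  refine (ContinuousOn.integrableOn_compact (isCompact_Icc (a := 0) (b := b)) ?_).mono_set
    Ioo_subset_Icc_self
  refine hF.comp (by fun_prop) fun η hη => ?_
  have := mem_rect (x := 0) (y := η) (a := a) (r := r) (by rwa [abs_zero])
    (abs_lt.2 ⟨by linarith [hη.1, hη.2], by linarith [hη.2]⟩)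
  rwa [Complex.ofReal_zero, zero_add] at this

/-- The contribution of the contours converges to an integral over the segment between the light
cones. -/
theorem tendsto_bumpTotal {h a u r : ℝ} (hh : 0 < h) (ha : 0 < a) (hu : 0 < u) (hua : u ≠ a)
    (hr : 0 < r) {F : ℂ → ℂ} (hF : DifferentiableOn ℂ F (rect a 0 r)) :
    Tendsto (fun ε => bumpTotal h a u F ε) (𝓝[>] 0) (𝓝 (-Real.pi *
      ((∫ η in Ioo 0 (a - u), legP h ((u ^ 2 + a ^ 2 - η ^ 2) / (2 * u * a)) * F (Complex.I * η)) +
      ∫ η in Ioo 0 (a - u), legP h ((u ^ 2 + a ^ 2 - η ^ 2) / (2 * u * a)) *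
        F (-(Complex.I * η))))) := by
  have hF' : DifferentiableOn ℂ (fun ζ => F (-ζ)) (rect a 0 r) :=
    hF.comp differentiable_neg.differentiableOn fun ζ hζ => neg_mem_rect hζ
  set δ := r / 2 with hδ
  have hδ0 : 0 < δ := half_pos hr
  have hδr : δ < r := half_lt_self hr
  set U : Set ℂ := {h | 0 < h.re} with hUdef
  have hU : IsOpen U := isOpen_lt continuous_const Complex.continuous_re
  have hconv : Convex ℝ U := by
    have := convex_halfSpace_gt (𝕜 := ℝ) (f := Complex.re) Complex.reCLM.isLinear 0
    exact this
  set E : ℝ → ℂ := fun s => F s + F (-s) with hE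
  have hEi : IntegrableOn E (Icc 0 δ) := integrableOn_comp_real ha hδr hF.continuousOn
  -- `A` is the limit computed through the contour at fixed distance `δ`, `B` the value found by
  -- collapsing the contour. Both are holomorphic for `Re h > 0` and they agree on `(0, 1)`.
  set A : ℂ → ℂ := fun h => bumpTotal h a u F δ +
    cQ h * ∫ s in Icc 0 δ, gfun h (sig a u s) * E s with hA
  set B : ℂ → ℂ := fun h => -Real.pi *
      ((∫ η in Ioo 0 (a - u), legP h ((u ^ 2 + a ^ 2 - η ^ 2) / (2 * u * a)) * F (Complex.I * η)) +
      ∫ η in Ioo 0 (a - u), legP h ((u ^ 2 + a ^ 2 - η ^ 2) / (2 * u * a)) *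
        F (-(Complex.I * η))) with hB
  -- Because `u ≠ a`, the invariant distance on the real axis stays away from the singular value
  -- `1`.
  have hσ0 := one_lt_sig (s := 0) ha hu (Or.inl hua)
  have hσge : ∀ s, sig a u 0 ≤ sig a u s := by
    intro s
    unfold sig
    exact div_le_div_of_nonneg_right (by nlinarith [sq_nonneg s]) (by positivity)
  have hσc : Continuous (sig a u) := by
    unfold sig
    fun_prop
  have dA : DifferentiableOn ℂ A U := (differentiableOn_bumpTotal ha hr hδ0 hδr hu
    hF.continuousOn).add (differentiableOn_cQ.mul
      (differentiableOn_integral_gfun hσ0 hσc hσge hEi))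
  have hσl : ∀ η ∈ Ioo 0 (a - u), 1 ≤ (u ^ 2 + a ^ 2 - η ^ 2) / (2 * u * a) ∧
      (u ^ 2 + a ^ 2 - η ^ 2) / (2 * u * a) ≤ sig a u 0 := by
    intro η hη
    constructor
    · rw [le_div_iff₀ (by positivity)]
      nlinarith [hη.1, hη.2]
    · unfold sig
      exact div_le_div_of_nonneg_right (by nlinarith [sq_nonneg η]) (by positivity)
  have dB : DifferentiableOn ℂ B U := by
    refine DifferentiableOn.const_mul (DifferentiableOn.add ?_ ?_) _
    · exact differentiableOn_integral_legP (by fun_prop) hσl hσ0.le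
        (integrableOn_comp_imag hr (by linarith) hF.continuousOn)
    · exact differentiableOn_integral_legP (by fun_prop) hσl hσ0.le
        (integrableOn_comp_imag hr (by linarith) hF'.continuousOn)
  have hlim : ∀ h : ℝ, 0 < h → Tendsto (fun ε => bumpTotal h a u F ε) (𝓝[>] 0) (𝓝 (A h)) := by
    intro h hh
    have hgi : IntegrableOn (fun s => gfun h (sig a u s) * E s) (Icc 0 δ) := by
      refine IntegrableOn.continuousOn_mul ?_ hEi isCompact_Icc
      intro s _
      refine ContinuousAt.continuousWithinAt (ContinuousAt.comp (f := sig a u) (continuousAt_gfun ?_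
        (hσ0.trans_le (hσge s))) hσc.continuousAt)
      intro k hk
      have := congrArg Complex.re hk
      simp at this
      linarith [(Nat.cast_nonneg k : (0 : ℝ) ≤ k)]
    have hcont : ContinuousOn (fun ε => ∫ s in ε..δ, gfun h (sig a u s) * E s) (Icc 0 δ) := by
      have h1 := intervalIntegral.continuousOn_primitive_interval_left (a := 0) (b := δ) (μ := volume)
        (f := fun s => gfun h (sig a u s) * E s) (by rwa [uIcc_of_le hδ0.le])
      rwa [uIcc_of_le hδ0.le] at h1
    have h0 : Tendsto (fun ε => ∫ s in ε..δ, gfun h (sig a u s) * E s) (𝓝[>] 0)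
        (𝓝 (∫ s in (0 : ℝ)..δ, gfun h (sig a u s) * E s)) := by
      have h2 := hcont 0 ⟨le_rfl, hδ0.le⟩
      refine h2.tendsto.mono_left ?_
      rw [← nhdsWithin_Ioc_eq_nhdsGT hδ0]
      exact nhdsWithin_mono _ Ioc_subset_Icc_self
    rw [intervalIntegral.integral_of_le hδ0.le, ← integral_Icc_eq_integral_Ioc] at h0
    refine ((h0.const_mul (cQ h)).const_add (bumpTotal h a u F δ)).congr' ?_
    filter_upwards [Ioc_mem_nhdsGT hδ0] with ε hε
    exact (bumpTotal_eq_add hh ha hu hε.1 hε.2 hδr hF).symm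
  have hreal : ∀ h : ℝ, 0 < h → h < 1 → A h = B h := fun h hh hh1 =>
    tendsto_nhds_unique (hlim h hh) (tendsto_bumpTotal_of_lt_one hh hh1 ha hu hr hF)
  have hAB : EqOn A B U := by
    have h4 : ((1 / 2 : ℝ) : ℂ) ∈ U := by
      change 0 < ((1 / 2 : ℝ) : ℂ).re
      rw [Complex.ofReal_re]
      norm_num
    refine (dA.analyticOnNhd hU).eqOn_of_preconnected_of_frequently_eq (dB.analyticOnNhd hU)
      hconv.isPreconnected h4 ?_
    have ht : Tendsto (fun x : ℝ => (x : ℂ)) (𝓝[≠] (1 / 2)) (𝓝[≠] ((1 / 2 : ℝ) : ℂ)) := by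
      refine tendsto_nhdsWithin_iff.2 ⟨?_, ?_⟩
      · exact (Complex.continuous_ofReal.tendsto _).mono_left nhdsWithin_le_nhds
      · filter_upwards [self_mem_nhdsWithin] with x hx
        exact fun e => hx (Complex.ofReal_injective e)
    refine ht.frequently (Eventually.frequently ?_)
    filter_upwards [mem_nhdsWithin_of_mem_nhds (Ioo_mem_nhds (a := (0 : ℝ)) (b := 1)
      (by norm_num) (by norm_num))] with x hx
    exact hreal x hx.1 hx.2
  have hfin := hlim h hh
  rwa [hAB (show (h : ℂ) ∈ U by change 0 < (h : ℂ).re; simpa using hh)] at hfin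


/-! ### Majorants for the integration over `u`. -/

/-- The kernel of the majorant in the definition of the test functions. -/
noncomputable def poisson (h b u : ℝ) : ℝ := (u / (u ^ 2 + b ^ 2)) ^ h

theorem poisson_nonneg {h b u : ℝ} (hu : 0 ≤ u) : 0 ≤ poisson h b u :=
  Real.rpow_nonneg (by positivity) _

/-- One has `u⁴ ≤ 2 (u² - d²)² + 2 d⁴`, and `d⁴ ≤ a² d²` is absorbed by the term `2 ε² d²` of the
denominator at the price of `a² / ε²`. The constant may depend on `ε`, since this serves only the
convergence at each fixed `ε`. -/
theorem norm_offKern_le_poisson {h a u ε d : ℝ} (hh : 0 < h) (hu : 0 < u) (hε : ε ≠ 0)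
    (hd : |d| ≤ a) :
    ‖offKern h u ε d‖ ≤ Real.sqrt (3 + a ^ 2 / ε ^ 2) ^ h * poisson h ε u := by
  set κ := Real.sqrt (3 + a ^ 2 / ε ^ 2) with hκ
  have hκ2 : κ ^ 2 = 3 + a ^ 2 / ε ^ 2 := Real.sq_sqrt (by positivity)
  have hκ0 : 0 ≤ κ := Real.sqrt_nonneg _
  have hε2 : 0 < ε ^ 2 := by positivity
  set D := ‖(u : ℂ) ^ 2 + ((ε : ℂ) - Complex.I * d) ^ 2‖ with hD
  have hD2 : D ^ 2 = (u ^ 2 - d ^ 2) ^ 2 + ε ^ 4 + 2 * ε ^ 2 * (u ^ 2 + d ^ 2) :=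
    offDen_normSq u ε d
  have hd2 : d ^ 2 ≤ a ^ 2 := sq_le_sq' (by linarith [(abs_le.1 hd).1]) (abs_le.1 hd).2
  have hD0 : 0 ≤ D := norm_nonneg _
  have hDpos : 0 < D := by
    refine lt_of_le_of_ne hD0 fun e => ?_
    rw [← e] at hD2
    have : 0 < 2 * ε ^ 2 * (u ^ 2 + d ^ 2) := by positivity
    nlinarith [sq_nonneg (u ^ 2 - d ^ 2), sq_nonneg (ε ^ 2)]
  have key : u ^ 2 + ε ^ 2 ≤ κ * D := by
    refine le_of_sq_le_sq ?_ (by positivity)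
    rw [mul_pow, hκ2, hD2]
    have e1 : 2 * (d ^ 2) ^ 2 ≤ a ^ 2 / ε ^ 2 * (2 * ε ^ 2 * d ^ 2) := by
      have : a ^ 2 / ε ^ 2 * (2 * ε ^ 2 * d ^ 2) = 2 * (a ^ 2 * d ^ 2) := by field_simp
      rw [this]
      nlinarith [sq_nonneg d]
    have e2 : 0 ≤ a ^ 2 / ε ^ 2 * ((u ^ 2 - d ^ 2) ^ 2 + ε ^ 4 + 2 * ε ^ 2 * u ^ 2) := by positivity
    have e3 : 0 ≤ ε ^ 2 * d ^ 2 := by positivity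
    have e4 : 0 ≤ ε ^ 2 * u ^ 2 := by positivity
    nlinarith [sq_nonneg (u ^ 2 - 2 * d ^ 2), sq_nonneg (ε ^ 2), sq_nonneg (u ^ 2 - d ^ 2)]
  rw [norm_offKern h u ε d hu, poisson, ← Real.mul_rpow hκ0 (by positivity)]
  refine Real.rpow_le_rpow (by positivity) ?_ hh.le
  rw [← mul_div_assoc, div_le_div_iff₀ hDpos (by positivity)]
  nlinarith

theorem poisson_le {h b c u : ℝ} (hh : 0 < h) (hb : b ≠ 0) (hu : 0 < u) :
    poisson h b u ≤ (1 + c ^ 2 / b ^ 2) ^ h * poisson h c u := by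
  rw [poisson, poisson, ← Real.mul_rpow (by positivity) (by positivity)]
  refine Real.rpow_le_rpow (by positivity) ?_ hh.le
  rw [← mul_div_assoc, div_le_div_iff₀ (by positivity) (by positivity)]
  have e : u ^ 2 + c ^ 2 ≤ (1 + c ^ 2 / b ^ 2) * (u ^ 2 + b ^ 2) := by
    have e1 : c ^ 2 / b ^ 2 * b ^ 2 = c ^ 2 := by field_simp
    have e2 : 0 ≤ c ^ 2 / b ^ 2 * u ^ 2 := by positivity
    nlinarith [sq_nonneg b]
  nlinarith

theorem measurable_poisson (h b : ℝ) : Measurable (poisson h b) := by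
  unfold poisson
  fun_prop

/-- By Fubini almost every slice of the hypothesis is integrable in `u`. One slice at some `c ≠ 0`
suffices, because the kernels at different nonzero distances are comparable. -/
theorem integrableOn_majorant {h r : ℝ} (hh : 0 < h) (hr : 0 < r) {M : ℝ → ℝ}
    (hM : IntegrableOn (fun p : ℝ × ℝ => M p.1 / p.1 ^ 2 * (p.1 / (p.1 ^ 2 + p.2 ^ 2)) ^ h)
      (Ioi 0 ×ˢ Ioo (-r) r)) {b : ℝ} (hb : b ≠ 0) :
    IntegrableOn (fun u => M u / u ^ 2 * poisson h b u) (Ioi 0) := by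
  rw [IntegrableOn, Measure.volume_eq_prod, ← Measure.prod_restrict] at hM
  have hne : ∀ᵐ s : ℝ ∂(volume.restrict (Ioo (-r) r)), s ≠ 0 := ae_restrict_of_ae (by simp [ae_iff])
  have : NeBot (ae (volume.restrict (Ioo (-r) r))) := by
    rw [ae_neBot, Ne, Measure.restrict_eq_zero, Real.volume_Ioo]
    simp
    linarith
  obtain ⟨c, hc, hc0⟩ := (hM.prod_left_ae.and hne).exists
  simp only at hc
  have hg : Integrable (fun u => (1 + c ^ 2 / b ^ 2) ^ h *
    (M u / u ^ 2 * (u / (u ^ 2 + c ^ 2)) ^ h)) (volume.restrict (Ioi 0)) := hc.const_mul _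
  refine hg.mono ?_ ?_
  -- Measurability of `M` is known only through the slice at `c`, so the positive kernel of that
  -- slice is divided out.
  · have e : (fun u => M u / u ^ 2 * poisson h b u) =ᵐ[volume.restrict (Ioi 0)]
        fun u => (M u / u ^ 2 * (u / (u ^ 2 + c ^ 2)) ^ h) * (poisson h c u)⁻¹ * poisson h b u := by
      filter_upwards [ae_restrict_mem measurableSet_Ioi] with u hu
      have hu' : 0 < u := hu
      have h0 : poisson h c u ≠ 0 := (Real.rpow_pos_of_pos (by positivity) _).ne'
      change _ = M u / u ^ 2 * poisson h c u * (poisson h c u)⁻¹ * poisson h b u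
      rw [mul_inv_cancel_right₀ h0]
    refine AEStronglyMeasurable.congr ?_ e.symm
    exact (hc.1.mul (measurable_poisson h c).inv.aestronglyMeasurable).mul
      (measurable_poisson h b).aestronglyMeasurable
  · filter_upwards [ae_restrict_mem measurableSet_Ioi] with u hu
    have hu' : 0 < u := hu
    have h1 := poisson_le (c := c) hh hb hu'
    have h2 := poisson_nonneg (h := h) (b := b) hu'.le
    have h3 := poisson_nonneg (h := h) (b := c) hu'.le
    change ‖M u / u ^ 2 * poisson h b u‖ ≤ ‖(1 + c ^ 2 / b ^ 2) ^ h * (M u / u ^ 2 * poisson h c u)‖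
    rw [mul_left_comm, norm_mul, norm_mul (M u / u ^ 2), Real.norm_of_nonneg h2,
      Real.norm_of_nonneg (h2.trans h1)]
    exact mul_le_mul_of_nonneg_left h1 (norm_nonneg _)

theorem integrableOn_rpow_one_sub {p : ℝ} (hp : -1 < p) :
    IntegrableOn (fun t : ℝ => (1 - t) ^ p) (Ioo (-1) 1) := by
  have := intervalIntegrable_abs_sub_rpow hp 1 (-1) 1
  rw [intervalIntegrable_iff_integrableOn_Ioo_of_le (by norm_num)] at this
  refine this.congr_fun (fun t ht => ?_) measurableSet_Ioo
  simp only
  rw [abs_of_pos (by linarith [ht.2])]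

theorem integrableOn_rpow_one_add {p : ℝ} (hp : -1 < p) :
    IntegrableOn (fun t : ℝ => (1 + t) ^ p) (Ioo (-1) 1) := by
  have := intervalIntegrable_abs_sub_rpow hp (-1) (-1) 1
  rw [intervalIntegrable_iff_integrableOn_Ioo_of_le (by norm_num)] at this
  refine this.congr_fun (fun t ht => ?_) measurableSet_Ioo
  simp only
  rw [abs_of_neg (by linarith [ht.1])]
  congr 1
  ring

/-- In the integral of the weight against `(σ - t) ^ (-h)` the exponent is split as `-κ + (κ - h)`:
the first part is bounded through `σ - t ≥ σ - 1`, the second through `σ - t ≥ σ (1 - t) / 2`. The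
result has full decay `σ ^ (-h)` at infinity and a singularity at `σ = 1` as weak as desired. -/
theorem exists_norm_gfun_le {h κ : ℝ} (hκ : 0 < κ) (hκh : κ < h) (hκ1 : κ < 1) :
    ∃ C : ℝ, 0 ≤ C ∧ ∀ σ : ℝ, 1 < σ → ‖gfun h σ‖ ≤ C * ((σ - 1) ^ (-κ) * σ ^ (κ - h)) := by
  have hh : 0 < h := hκ.trans hκh
  set maj : ℝ → ℝ := fun t => 2 ^ (h - κ) * (2 ^ h * ((1 + t) ^ (h - 1) + (1 - t) ^ (κ - 1))) with hmaj
  have hmi : IntegrableOn maj (Ioo (-1) 1) :=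
    (((integrableOn_rpow_one_add (by linarith)).add
      (integrableOn_rpow_one_sub (by linarith))).const_mul _).const_mul _
  have hmaj0 : ∀ t ∈ Ioo (-1 : ℝ) 1, 0 ≤ maj t := by
    intro t ht
    have h1 : 0 < 1 + t := by linarith [ht.1]
    have h2 : 0 < 1 - t := by linarith [ht.2]
    positivity
  have hI0 : 0 ≤ ∫ t in Ioo (-1 : ℝ) 1, maj t := setIntegral_nonneg measurableSet_Ioo hmaj0
  refine ⟨‖cst h * Complex.I‖ * (2 ^ (-h) * ∫ t in Ioo (-1 : ℝ) 1, maj t), by positivity,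
    fun σ hσ => ?_⟩
  have hσ0 : 0 < σ := by linarith
  have hQ := integral_weight_mul_sub_cpow hh hσ
  have e1 : gfun h σ = cst h * Complex.I * ((2 ^ (-h) : ℝ) * ∫ t in Ioo (-1 : ℝ) 1,
      ((1 - t ^ 2 : ℝ) : ℂ) ^ ((h : ℂ) - 1) * ((σ - t : ℝ) : ℂ) ^ (-(h : ℂ))) := by
    rw [← integral_Ioc_eq_integral_Ioo, ← intervalIntegral.integral_of_le (by norm_num), hQ]
    have h2 := cst_mul_gamma hh
    have e5 : ((2 ^ (-h) : ℝ) : ℂ) * (σ : ℂ) ^ (-(h : ℂ)) = ((1 / (2 * σ) : ℝ) : ℂ) ^ (h : ℂ) := by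
      rw [← Complex.ofReal_neg, ← Complex.ofReal_cpow hσ0.le, ← Complex.ofReal_mul,
        ← Complex.ofReal_cpow (by positivity), one_div, Real.inv_rpow (by positivity),
        ← Real.rpow_neg (by positivity), Real.mul_rpow (by norm_num) hσ0.le]
    rw [gfun, ← e5]
    linear_combination (-((2 ^ (-h) : ℝ) : ℂ) * (σ : ℂ) ^ (-(h : ℂ)) *
      ordinaryHypergeometric ((h : ℂ) / 2) ((h : ℂ) / 2 + 1 / 2) ((h : ℂ) + 1 / 2)
            ((1 / (σ : ℂ)) ^ 2)) * h2
  have hpt : ∀ t ∈ Ioo (-1 : ℝ) 1, ‖((1 - t ^ 2 : ℝ) : ℂ) ^ ((h : ℂ) - 1) *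
      ((σ - t : ℝ) : ℂ) ^ (-(h : ℂ))‖ ≤ (σ - 1) ^ (-κ) * σ ^ (κ - h) * maj t := by
    intro t ht
    have h1 : 0 < 1 + t := by linarith [ht.1]
    have h2 : 0 < 1 - t := by linarith [ht.2]
    have h3 : 0 < 1 - t ^ 2 := by nlinarith
    have h4 : 0 < σ - t := by linarith
    rw [norm_mul, Complex.norm_cpow_eq_rpow_re_of_pos h3, Complex.norm_cpow_eq_rpow_re_of_pos h4]
    simp only [Complex.sub_re, Complex.ofReal_re, Complex.one_re, Complex.neg_re]
    have b1 : (σ - t) ^ (-h) ≤ (σ - 1) ^ (-κ) * (σ ^ (κ - h) * (2 ^ (h - κ) * (1 - t) ^ (κ - h))) := by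
      rw [show -h = -κ + (κ - h) by ring, Real.rpow_add h4]
      refine mul_le_mul (Real.rpow_le_rpow_of_nonpos (by linarith) (by linarith [ht.2])
        (by linarith)) ?_ (by positivity) (Real.rpow_nonneg (by linarith) _)
      have e : σ ^ (κ - h) * (2 ^ (h - κ) * (1 - t) ^ (κ - h)) = (σ * ((1 - t) / 2)) ^ (κ - h) := by
        rw [Real.mul_rpow hσ0.le (by positivity), Real.div_rpow h2.le (by norm_num),
          show h - κ = -(κ - h) by ring, Real.rpow_neg (by norm_num)]
        ring
      rw [e]
      refine Real.rpow_le_rpow_of_nonpos (by positivity) ?_ (by linarith)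
      nlinarith [ht.1]
    have b2 : (1 - t ^ 2) ^ (h - 1) * (1 - t) ^ (κ - h) ≤
        2 ^ h * ((1 + t) ^ (h - 1) + (1 - t) ^ (κ - 1)) := by
      have e : (1 - t ^ 2) ^ (h - 1) * (1 - t) ^ (κ - h) = (1 + t) ^ (h - 1) * (1 - t) ^ (κ - 1) := by
        rw [show 1 - t ^ 2 = (1 + t) * (1 - t) by ring, Real.mul_rpow h1.le h2.le, mul_assoc,
          ← Real.rpow_add h2]
        ring_nf
      rw [e]
      have p1 : 0 ≤ (1 + t) ^ (h - 1) := by positivity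
      have p2 : 0 ≤ (1 - t) ^ (κ - 1) := by positivity
      have p3 : (1 : ℝ) ≤ 2 ^ h := Real.one_le_rpow (by norm_num) hh.le
      rcases le_total t 0 with h0 | h0
      · have : (1 - t) ^ (κ - 1) ≤ 1 :=
          Real.rpow_le_one_of_one_le_of_nonpos (by linarith) (by linarith)
        nlinarith
      · have q1 : (1 + t) ^ (h - 1) ≤ (1 + t) ^ h :=
          Real.rpow_le_rpow_of_exponent_le (by linarith) (by linarith)
        have q2 : (1 + t) ^ h ≤ 2 ^ h := Real.rpow_le_rpow h1.le (by linarith [ht.2]) hh.le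
        nlinarith
    have c1 : 0 ≤ (σ - 1) ^ (-κ) * σ ^ (κ - h) :=
      mul_nonneg (Real.rpow_nonneg (by linarith) _) (Real.rpow_nonneg hσ0.le _)
    calc (1 - t ^ 2) ^ (h - 1) * (σ - t) ^ (-h)
        ≤ (1 - t ^ 2) ^ (h - 1) *
          ((σ - 1) ^ (-κ) * (σ ^ (κ - h) * (2 ^ (h - κ) * (1 - t) ^ (κ - h)))) :=
          mul_le_mul_of_nonneg_left b1 (by positivity)
      _ = (σ - 1) ^ (-κ) * σ ^ (κ - h) *
          (2 ^ (h - κ) * ((1 - t ^ 2) ^ (h - 1) * (1 - t) ^ (κ - h))) := by ring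
      _ ≤ _ := mul_le_mul_of_nonneg_left (mul_le_mul_of_nonneg_left b2 (by positivity)) c1
  have hn := norm_integral_le_of_norm_le (μ := volume.restrict (Ioo (-1 : ℝ) 1))
    (hmi.const_mul ((σ - 1) ^ (-κ) * σ ^ (κ - h)))
    (by filter_upwards [ae_restrict_mem measurableSet_Ioo] with t ht using hpt t ht)
  rw [integral_const_mul] at hn
  rw [e1, norm_mul (cst h * Complex.I), norm_mul ((2 ^ (-h) : ℝ) : ℂ), Complex.norm_real,
    Real.norm_of_nonneg (by positivity)]
  calc ‖cst h * Complex.I‖ * (2 ^ (-h) * _) ≤ ‖cst h * Complex.I‖ * (2 ^ (-h) *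
        ((σ - 1) ^ (-κ) * σ ^ (κ - h) * ∫ t in Ioo (-1 : ℝ) 1, maj t)) := by gcongr
    _ = _ := by ring

/-- The propagator on the real axis has an integrable singularity, uniformly in `u`. -/
theorem exists_norm_gfun_sig_le {h a : ℝ} (hh : 0 < h) (ha : 0 < a) :
    ∃ C : ℝ, 0 ≤ C ∧ ∀ u s : ℝ, 0 < u → s ∈ Ioc (0 : ℝ) 1 →
      ‖gfun h (sig a u s)‖ ≤ C * poisson h a u * s ^ (-(1 / 2 : ℝ)) := by
  -- With `κ ≤ 1 / 4` the factor `(s²) ^ (-κ)` is at most `s ^ (-1/2)` on `(0, 1]`, which is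
  -- integrable.
  set κ := min (h / 2) (1 / 4) with hκ
  have hκ0 : 0 < κ := lt_min (by linarith) (by norm_num)
  have hκh : κ < h := (min_le_left _ _).trans_lt (by linarith)
  have hκ4 : κ ≤ 1 / 4 := min_le_right _ _
  obtain ⟨C, hC0, hC⟩ := exists_norm_gfun_le hκ0 hκh (by linarith)
  refine ⟨C * ((3 * a ^ 2 + 2) ^ κ * (2 * a) ^ h), by positivity, fun u s hu hs => ?_⟩
  have hs0 : 0 < s := hs.1
  set σ := sig a u s with hσdef
  have hσ : 1 < σ := one_lt_sig ha hu (Or.inr hs0.ne')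
  have hσ0 : 0 < σ := by linarith
  have hD : 0 < u ^ 2 + a ^ 2 + s ^ 2 := by positivity
  have e1 : (σ - 1) / σ = ((u - a) ^ 2 + s ^ 2) / (u ^ 2 + a ^ 2 + s ^ 2) := by
    rw [hσdef, sig]
    field_simp
    ring
  -- The constant comes from `u² ≤ 2 (u - a)² + 2 a²` and `s ≤ 1`; the bound holds for all `u`, near
  -- `a` as well as at infinity.
  have b1 : s ^ 2 / (3 * a ^ 2 + 2) ≤ (σ - 1) / σ := by
    rw [e1, div_le_div_iff₀ (by positivity) hD]
    have : s ^ 2 ≤ 1 := by nlinarith [hs.2]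
    nlinarith [mul_nonneg (sq_nonneg (u - 2 * a)) (sq_nonneg s), sq_nonneg s,
      mul_nonneg (sq_nonneg (u - a)) (sq_nonneg a),
      mul_nonneg (sq_nonneg (u - a)) (sub_nonneg.2 this),
      mul_nonneg (sq_nonneg s) (sub_nonneg.2 this)]
  have b2 : (σ - 1) ^ (-κ) * σ ^ (κ - h) ≤
      ((3 * a ^ 2 + 2) ^ κ * s ^ (-(1 / 2 : ℝ))) * ((2 * a) ^ h * poisson h a u) := by
    have e2 : (σ - 1) ^ (-κ) * σ ^ (κ - h) = ((σ - 1) / σ) ^ (-κ) * (σ⁻¹) ^ h := by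
      rw [Real.div_rpow (by linarith) hσ0.le, Real.inv_rpow hσ0.le, Real.rpow_sub hσ0,
        Real.rpow_neg hσ0.le]
      have : σ ^ κ ≠ 0 := by positivity
      field_simp
    rw [e2]
    refine mul_le_mul ?_ ?_ (by positivity) (by positivity)
    · refine (Real.rpow_le_rpow_of_nonpos (by positivity) b1 (by linarith)).trans ?_
      rw [Real.div_rpow (by positivity) (by positivity), div_eq_mul_inv, mul_comm,
        Real.rpow_neg (by positivity) κ, inv_inv]
      refine mul_le_mul_of_nonneg_left ?_ (by positivity)
      rw [← Real.rpow_natCast, ← Real.rpow_mul hs0.le]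
      refine Real.rpow_le_rpow_of_exponent_ge hs0 hs.2 ?_
      push_cast
      linarith
    · rw [poisson, ← Real.mul_rpow (by positivity) (by positivity)]
      refine Real.rpow_le_rpow (by positivity) ?_ hh.le
      rw [hσdef, sig, inv_div, ← mul_div_assoc]
      refine div_le_div₀ (by positivity) (by linarith) (by positivity) (by nlinarith)
  refine (hC σ hσ).trans ((mul_le_mul_of_nonneg_left b2 hC0).trans_eq ?_)
  ring


/-! ### The Legendre function between the light cones. -/

/-- Laplace's base is smallest at `φ = π`. Measured from there and rescaled to `(0, r)`, the angle
`θ` satisfies `σ - q cos(πθ / r) ≥ (1/σ + σ θ²) / 4`, by `cos ψ ≤ 1 - 2ψ² / π²`. The resulting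
integrand has the shape of the majorant kernel. -/
theorem norm_legP_le_integral {h r : ℝ} (hh : 0 < h) (hr : 0 < r) (hr1 : r ≤ 1) {σ : ℝ}
    (hσ : 1 ≤ σ) :
    ‖legP h σ‖ ≤ 4 ^ h / r * ∫ θ in Ioo 0 r, (1 / σ + σ * θ ^ 2) ^ (-h) := by
  have hσ0 : 0 < σ := by linarith
  set q := Real.sqrt (σ ^ 2 - 1) with hq
  have hq0 : 0 ≤ q := Real.sqrt_nonneg _
  have hq2 : q ^ 2 = σ ^ 2 - 1 := Real.sq_sqrt (by nlinarith)
  have hqσ : q < σ := by nlinarith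
  have hpos : ∀ φ : ℝ, 0 < σ + q * Real.cos φ := by
    intro φ
    nlinarith [Real.neg_one_le_cos φ]
  set f : ℝ → ℝ := fun φ => (σ + q * Real.cos φ) ^ (-h) with hf
  have hfc : Continuous f := by
    refine Continuous.rpow_const (by fun_prop) fun φ => Or.inl (hpos φ).ne'
  have hpi := Real.pi_pos
  have e1 : ‖legP h σ‖ ≤ 1 / (2 * Real.pi) * ∫ φ in (-Real.pi)..Real.pi, f φ := by
    have h0 : 0 ≤ 1 / (2 * Real.pi) := div_nonneg zero_le_one (by linarith)
    rw [legP, norm_mul, Complex.norm_real, Real.norm_of_nonneg h0,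
      intervalIntegral.integral_of_le (by linarith)]
    refine mul_le_mul_of_nonneg_left ((norm_integral_le_integral_norm _).trans_eq ?_) h0
    refine setIntegral_congr_fun measurableSet_Ioc fun φ _ => ?_
    change ‖((σ + q * Real.cos φ : ℝ) : ℂ) ^ (-(h : ℂ))‖ = f φ
    rw [Complex.norm_cpow_eq_rpow_re_of_pos (hpos φ)]
    simp [hf]
  have e2 : ∫ φ in (-Real.pi)..Real.pi, f φ = 2 * ∫ φ in (0 : ℝ)..Real.pi, f φ := by
    have h1 := intervalIntegral.integral_comp_neg (a := 0) (b := Real.pi) f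
    rw [neg_zero] at h1
    have h2 : ∫ φ in (0 : ℝ)..Real.pi, f (-φ) = ∫ φ in (0 : ℝ)..Real.pi, f φ :=
      intervalIntegral.integral_congr fun φ _ => by simp only [hf, Real.cos_neg]
    rw [← intervalIntegral.integral_add_adjacent_intervals (hfc.intervalIntegrable _ 0)
      (hfc.intervalIntegrable 0 _), ← h1, h2]
    ring
  have e3 : ∫ φ in (0 : ℝ)..Real.pi, f φ = Real.pi / r * ∫ θ in (0 : ℝ)..r,
      (σ - q * Real.cos (Real.pi / r * θ)) ^ (-h) := by
    have h1 := intervalIntegral.integral_comp_sub_left (a := 0) (b := Real.pi) f Real.pi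
    rw [sub_self, sub_zero] at h1
    have h2 := intervalIntegral.smul_integral_comp_mul_left (a := 0) (b := r)
      (fun ψ => f (Real.pi - ψ)) (Real.pi / r)
    rw [mul_zero, div_mul_cancel₀ _ hr.ne', smul_eq_mul, h1] at h2
    rw [← h2]
    congr 1
    refine intervalIntegral.integral_congr fun θ _ => ?_
    simp only [hf, Real.cos_pi_sub, mul_neg]
    rw [sub_eq_add_neg]
  have hb : ∀ θ ∈ Icc 0 r, (1 / σ + σ * θ ^ 2) / 4 ≤ σ - q * Real.cos (Real.pi / r * θ) := by
    intro θ hθ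
    have hψ0 : 0 ≤ Real.pi / r * θ := mul_nonneg (by positivity) hθ.1
    have hψ1 : Real.pi / r * θ ≤ Real.pi := by
      rw [div_mul_eq_mul_div, div_le_iff₀ hr]
      exact mul_le_mul_of_nonneg_left hθ.2 hpi.le
    have hcos := Real.cos_le_one_sub_mul_cos_sq (by rwa [abs_of_nonneg hψ0])
    have e : 2 / Real.pi ^ 2 * (Real.pi / r * θ) ^ 2 = 2 * (θ ^ 2 / r ^ 2) := by
      field_simp
    rw [e] at hcos
    have h1 : θ ^ 2 ≤ θ ^ 2 / r ^ 2 := by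
      rw [le_div_iff₀ (by positivity)]
      have : r ^ 2 ≤ 1 := by nlinarith
      nlinarith [sq_nonneg θ]
    have h2 : θ ^ 2 ≤ 1 := by nlinarith [hθ.1, hθ.2]
    have h3 : 1 / (2 * σ) ≤ σ - q := by
      rw [div_le_iff₀ (by positivity)]
      nlinarith
    have h4 : 1 / (2 * σ) = 1 / σ / 2 := by field_simp
    have h5 : σ - q + 2 * q * θ ^ 2 ≤ σ - q * Real.cos (Real.pi / r * θ) := by nlinarith
    have h6 : 0 ≤ 1 / σ := by positivity
    rw [h4] at h3
    refine le_trans ?_ h5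
    -- Either `q` is comparable to `σ` and the term `2 q θ²` suffices, or `σ - q ≥ σ / 2` already
    -- dominates `σ θ²`.
    rcases le_total (σ / 2) q with h7 | h7
    · nlinarith [mul_nonneg (sub_nonneg.2 h7) (sq_nonneg θ), mul_nonneg hσ0.le (sq_nonneg θ)]
    · nlinarith [mul_nonneg hq0 (sq_nonneg θ), mul_nonneg hσ0.le (sub_nonneg.2 h2)]
  have hposb : ∀ θ : ℝ, 0 < 1 / σ + σ * θ ^ 2 := fun θ => by positivity
  have e4 : ∫ θ in (0 : ℝ)..r, (σ - q * Real.cos (Real.pi / r * θ)) ^ (-h) ≤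
      ∫ θ in (0 : ℝ)..r, 4 ^ h * (1 / σ + σ * θ ^ 2) ^ (-h) := by
    refine intervalIntegral.integral_mono_on hr.le ?_ ?_ fun θ hθ => ?_
    · refine ContinuousOn.intervalIntegrable ?_
      rw [uIcc_of_le hr.le]
      refine ContinuousOn.rpow_const (by fun_prop) fun θ hθ => Or.inl ?_
      exact (lt_of_lt_of_le (div_pos (hposb θ) (by norm_num)) (hb θ hθ)).ne'
    · refine Continuous.intervalIntegrable ?_ _ _
      exact continuous_const.mul (Continuous.rpow_const (by fun_prop) fun θ =>
        Or.inl (hposb θ).ne')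
    · refine (Real.rpow_le_rpow_of_nonpos (div_pos (hposb θ) (by norm_num)) (hb θ hθ)
        (by linarith)).trans_eq ?_
      rw [Real.div_rpow (hposb θ).le (by norm_num), Real.rpow_neg (by norm_num : (0 : ℝ) ≤ 4),
        div_inv_eq_mul, mul_comm]
  rw [intervalIntegral.integral_const_mul, intervalIntegral.integral_of_le hr.le,
    intervalIntegral.integral_of_le hr.le, integral_Ioc_eq_integral_Ioo,
    integral_Ioc_eq_integral_Ioo] at e4
  rw [e2, e3, intervalIntegral.integral_of_le hr.le, integral_Ioc_eq_integral_Ioo] at e1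
  refine e1.trans ?_
  rw [show ∀ x : ℝ, 1 / (2 * Real.pi) * (2 * (Real.pi / r * x)) = 1 / r * x from fun x => by
    field_simp]
  refine (mul_le_mul_of_nonneg_left e4 (by positivity)).trans_eq ?_
  ring

/-- The Legendre function between the light cones is controlled by the majorant kernel. -/
theorem exists_norm_legP_le {h a r : ℝ} (hh : 0 < h) (ha : 0 < a) (hr : 0 < r) (hr1 : r ≤ 1) :
    ∃ C : ℝ, 0 ≤ C ∧ ∀ u y : ℝ, 0 < u → |y| < a - u →
      ‖legP h ((u ^ 2 + a ^ 2 - y ^ 2) / (2 * u * a))‖ ≤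
        C * ((a - |y|) / a) ^ (h - 1) * ∫ s in Ioo 0 r, poisson h s u := by
  set c := min (2 / (3 * a)) (a / 2) with hc
  have hc0 : 0 < c := lt_min (by positivity) (by positivity)
  refine ⟨4 ^ h / r * c ^ (-h), by positivity, fun u y hu hy => ?_⟩
  set σ := (u ^ 2 + a ^ 2 - y ^ 2) / (2 * u * a) with hσ
  -- The relative distance of `y` from the end of the `w`-segment; the condition on `y` reads `u < k
  -- a`. Then `u² + a² - y²` lies between `k a²` and `3 k a²`, so `σ` is comparable to `k / u`, and
  -- `s = k θ` produces the majorant kernel with the factor `k ^ (h - 1)`.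
  set k := (a - |y|) / a with hk
  have hy0 := abs_nonneg y
  have hk0 : 0 < k := div_pos (by linarith) ha
  have hk1 : k ≤ 1 := by
    rw [hk, div_le_one ha]
    linarith
  have hya : |y| = a - k * a := by
    rw [hk]
    field_simp
    ring
  have hy2 : y ^ 2 = (a - k * a) ^ 2 := by rw [← hya, sq_abs]
  have huk : u < k * a := by linarith
  have hσ1 : 1 ≤ σ := by
    rw [hσ, le_div_iff₀ (by positivity), hy2]
    nlinarith
  have hD1 : k * a ^ 2 ≤ u ^ 2 + a ^ 2 - y ^ 2 := by
    rw [hy2]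
    nlinarith [mul_nonneg hk0.le (sub_nonneg.2 hk1), sq_nonneg u, sq_nonneg a,
      mul_nonneg (mul_nonneg hk0.le (sub_nonneg.2 hk1)) (sq_nonneg a)]
  have hD2 : u ^ 2 + a ^ 2 - y ^ 2 ≤ 3 * k * a ^ 2 := by
    rw [hy2]
    have : u ^ 2 ≤ (k * a) ^ 2 := by nlinarith
    nlinarith [mul_nonneg (mul_nonneg hk0.le (sub_nonneg.2 hk1)) (sq_nonneg a)]
  have hσ0 : 0 < σ := by linarith
  have b1 : c * (u / k) ≤ 1 / σ := by
    have h1 : 2 / (3 * a) * (u / k) ≤ 1 / σ := by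
      rw [hσ, one_div_div, div_mul_div_comm, div_le_div_iff₀ (by positivity) (by nlinarith)]
      nlinarith
    exact (mul_le_mul_of_nonneg_right (min_le_left _ _) (by positivity)).trans h1
  have b2 : c * (k / u) ≤ σ := by
    have h1 : a / 2 * (k / u) ≤ σ := by
      rw [hσ, div_mul_div_comm, div_le_div_iff₀ (by positivity) (by positivity)]
      nlinarith
    exact (mul_le_mul_of_nonneg_right (min_le_right _ _) (by positivity)).trans h1
  have e1 : ∫ θ in Ioo 0 r, (1 / σ + σ * θ ^ 2) ^ (-h) ≤
      ∫ θ in Ioo 0 r, c ^ (-h) * (k ^ h * poisson h (k * θ) u) := by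
    refine setIntegral_mono_on ?_ ?_ measurableSet_Ioo fun θ hθ => ?_
    · refine (Continuous.integrableOn_Icc (a := 0) (b := r) ?_).mono_set Ioo_subset_Icc_self
      exact Continuous.rpow_const (by fun_prop) fun θ => Or.inl (by positivity)
    · refine (Continuous.integrableOn_Icc (a := 0) (b := r) ?_).mono_set Ioo_subset_Icc_self
      unfold poisson
      refine continuous_const.mul (continuous_const.mul (Continuous.rpow_const ?_ fun θ =>
        Or.inl (by positivity)))
      exact continuous_const.div (by fun_prop) fun θ => by positivity
    · have h1 : c * ((u ^ 2 + (k * θ) ^ 2) / (u * k)) ≤ 1 / σ + σ * θ ^ 2 := by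
        have : c * ((u ^ 2 + (k * θ) ^ 2) / (u * k)) = c * (u / k) + c * (k / u) * θ ^ 2 := by
          field_simp
        rw [this]
        exact add_le_add b1 (mul_le_mul_of_nonneg_right b2 (sq_nonneg θ))
      have h2 : 0 < (u ^ 2 + (k * θ) ^ 2) / (u * k) := by positivity
      refine (Real.rpow_le_rpow_of_nonpos (by positivity) h1 (by linarith)).trans_eq ?_
      rw [Real.mul_rpow hc0.le h2.le, poisson, ← Real.mul_rpow hk0.le (by positivity),
        Real.rpow_neg h2.le, ← Real.inv_rpow h2.le, inv_div]
      congr 2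
      ring
  have e2 : ∫ θ in Ioo 0 r, c ^ (-h) * (k ^ h * poisson h (k * θ) u) =
      c ^ (-h) * k ^ (h - 1) * ∫ s in Ioo 0 (k * r), poisson h s u := by
    rw [integral_const_mul, integral_const_mul, ← integral_Ioc_eq_integral_Ioo,
      ← integral_Ioc_eq_integral_Ioo, ← intervalIntegral.integral_of_le hr.le,
      ← intervalIntegral.integral_of_le (by positivity)]
    have := intervalIntegral.integral_comp_mul_left (a := 0) (b := r)
      (fun s => poisson h s u) hk0.ne'
    rw [mul_zero, smul_eq_mul] at this
    rw [this, Real.rpow_sub hk0, Real.rpow_one]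
    ring
  have e3 : ∫ s in Ioo 0 (k * r), poisson h s u ≤ ∫ s in Ioo 0 r, poisson h s u := by
    refine setIntegral_mono_set ?_ (Eventually.of_forall fun s => poisson_nonneg hu.le)
      (Ioo_subset_Ioo_right (by nlinarith)).eventuallyLE
    refine (Continuous.integrableOn_Icc (a := 0) (b := r) ?_).mono_set Ioo_subset_Icc_self
    unfold poisson
    refine Continuous.rpow_const ?_ fun θ => Or.inl (by positivity)
    exact continuous_const.div (by fun_prop) fun θ => by positivity
  refine (norm_legP_le_integral hh hr hr1 hσ1).trans ?_
  calc 4 ^ h / r * ∫ θ in Ioo 0 r, (1 / σ + σ * θ ^ 2) ^ (-h)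
      ≤ 4 ^ h / r * (c ^ (-h) * k ^ (h - 1) * ∫ s in Ioo 0 r, poisson h s u) :=
        mul_le_mul_of_nonneg_left ((e1.trans_eq e2).trans
          (mul_le_mul_of_nonneg_left e3 (by positivity))) (by positivity)
    _ = _ := by ring


/-! ### Test functions near the contours; convergence and evaluation of the compact term. -/

/-- Local data of a test function, in the coordinate `ζ = z - z₀`. -/
structure LocalData (h a z₀ r : ℝ) (f : ℝ → ℂ → ℂ) (M : ℝ → ℝ) : Prop where
  pos : 0 < r
  le_one : r ≤ 1
  diff : ∀ u > 0, DifferentiableOn ℂ (fun ζ => f u (z₀ + ζ)) (rect a 0 r)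
  cont : ContinuousOn (fun p : ℝ × ℂ => f p.1 (z₀ + p.2)) (Ioi 0 ×ˢ rect a 0 r)
  bound : ∀ u > 0, ∀ ζ ∈ rect a 0 r, ‖f u (z₀ + ζ)‖ ≤ M u
  int : IntegrableOn (fun p : ℝ × ℝ => M p.1 / p.1 ^ 2 * poisson h p.2 p.1) (Ioi 0 ×ˢ Ioo (-r) r)

/-- The radius is cut down to at most `1`, as the bounds for the propagator and the Legendre
function require. -/
theorem exists_localData {h a z₀ : ℝ} {f : ℝ → ℂ → ℂ} (hf : IsTestFunction h a z₀ f) :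
    ∃ r M, LocalData h a z₀ r f M := by
  obtain ⟨r, hr, hd, hc, -, M, hM, hi⟩ := hf
  have hm : MapsTo (fun ζ : ℂ => (z₀ : ℂ) + ζ) (rect a 0 (min r 1)) (rect a z₀ r) := by
    rintro ζ ⟨h1, h2⟩
    rw [sub_zero] at h1
    constructor
    · simpa using h1.trans_le (min_le_left _ _)
    · simpa using h2.trans_le (by gcongr; exact min_le_left _ _)
  refine ⟨min r 1, M, lt_min hr one_pos, min_le_right _ _, fun u hu => ?_, ?_, fun u hu ζ hζ => ?_,
    ?_⟩
  · exact (hd u hu).comp (by fun_prop) hm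
  · exact hc.comp (f := fun p : ℝ × ℂ => ((p.1, (z₀ : ℂ) + p.2) : ℝ × ℂ)) (by fun_prop)
      fun p hp => ⟨hp.1, hm hp.2⟩
  · exact hM u hu _ (hm hζ)
  · exact hi.mono_set (prod_mono le_rfl
      (Ioo_subset_Ioo (neg_le_neg (min_le_left _ _)) (min_le_left _ _)))

variable {h a z₀ r : ℝ} {f : ℝ → ℂ → ℂ} {M : ℝ → ℝ}

theorem LocalData.M_nonneg (D : LocalData h a z₀ r f M) (ha : 0 < a) {u : ℝ} (hu : 0 < u) :
    0 ≤ M u := by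
  refine (norm_nonneg _).trans (D.bound u hu 0 ⟨?_, ?_⟩)
  · simpa using D.pos
  · have := D.pos
    simp only [Complex.zero_im, abs_zero]
    positivity

theorem LocalData.integrableOn_majorant (D : LocalData h a z₀ r f M) (hh : 0 < h) {b : ℝ}
    (hb : b ≠ 0) : IntegrableOn (fun u => M u / u ^ 2 * poisson h b u) (Ioi 0) :=
  AdS2.integrableOn_majorant hh D.pos D.int hb

theorem LocalData.integrableOn_majorant_integral (D : LocalData h a z₀ r f M) :
    IntegrableOn (fun u => M u / u ^ 2 * ∫ s in Ioo 0 r, poisson h s u) (Ioi 0) := by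
  have h1 := D.int.mono_set (prod_mono le_rfl (Ioo_subset_Ioo_left (by linarith [D.pos] : -r ≤ 0)))
  rw [IntegrableOn, Measure.volume_eq_prod, ← Measure.prod_restrict] at h1
  refine h1.integral_prod_left.congr (Eventually.of_forall fun u => ?_)
  change ∫ s in Ioo 0 r, M u / u ^ 2 * poisson h s u = _
  rw [integral_const_mul]

theorem compactSeg_eq (a z₀ u s : ℝ) :
    compactSeg a z₀ u s = z₀ + Complex.I * ((a - u) * (1 - 2 * s) : ℝ) := by
  rw [compactSeg, seg]
  push_cast
  ring

theorem deriv_seg (p q : ℂ) (s : ℝ) : deriv (seg p q) s = q - p := by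
  have h1 : HasDerivAt (fun s : ℝ => (s : ℂ)) 1 s := Complex.ofRealCLM.hasDerivAt
  have h2 := (h1.mul_const (q - p)).const_add p
  rw [one_mul] at h2
  exact h2.deriv

theorem deriv_compactSeg (a z₀ u s : ℝ) :
    deriv (compactSeg a z₀ u) s = 2 * Complex.I * (u - a) := by
  rw [compactSeg, deriv_seg]
  ring

theorem Gtilde_compact (hh : 0 < h) {u y : ℝ} (hu : 0 < u) (hy : |y| < a - u) :
    Gtilde h u (z₀ + Complex.I * y) a z₀ =
      cst h * legP h ((u ^ 2 + a ^ 2 - y ^ 2) / (2 * u * a)) := by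
  have ha : 0 < a := by linarith [abs_nonneg y]
  refine Gtilde_eq hh hu ha ?_ ?_
  · rw [lt_div_iff₀ (by positivity)]
    have := abs_lt.1 hy
    nlinarith
  · rw [mul_div_cancel₀ _ (by positivity), dist2, add_sub_cancel_left, mul_pow, Complex.I_sq]
    push_cast
    ring

theorem abs_compact_lt {u s : ℝ} (hu : u < a) (hs : s ∈ Ioo (0 : ℝ) 1) :
    |(a - u) * (1 - 2 * s)| < a - u := by
  rw [abs_mul, abs_of_pos (by linarith)]
  have : |1 - 2 * s| < 1 := abs_lt.2 ⟨by linarith [hs.2], by linarith [hs.1]⟩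
  nlinarith

/-- The base is at most `1`, which settles `h ≥ 1`. For `h < 1` it is at least `1 - |1 - 2s|`, so
the singularities at the ends are controlled uniformly in `u`. -/
theorem rpow_compact_le {u s : ℝ} (ha : 0 < a) (hu : u ∈ Ioo 0 a) (hs : s ∈ Ioo (0 : ℝ) 1) :
    ((a - |(a - u) * (1 - 2 * s)|) / a) ^ (h - 1) ≤
      1 + ((2 * s) ^ (h - 1) + (2 * (1 - s)) ^ (h - 1)) := by
  have hlt := abs_compact_lt hu.2 hs
  set k := (a - |(a - u) * (1 - 2 * s)|) / a with hk
  have hk0 : 0 < k := div_pos (by linarith [hu.1]) ha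
  have hk1 : k ≤ 1 := by
    rw [hk, div_le_one ha]
    linarith [abs_nonneg ((a - u) * (1 - 2 * s))]
  have hs0 : 0 < 2 * s := by linarith [hs.1]
  have hs1 : 0 < 2 * (1 - s) := by linarith [hs.2]
  have p1 : 0 ≤ (2 * s) ^ (h - 1) := by positivity
  have p2 : 0 ≤ (2 * (1 - s)) ^ (h - 1) := by positivity
  rcases le_total 1 h with h1 | h1
  · have := Real.rpow_le_one hk0.le hk1 (by linarith : 0 ≤ h - 1)
    linarith
  · have hk2 : 1 - |1 - 2 * s| ≤ k := by
      rw [hk, le_div_iff₀ ha, abs_mul, abs_of_pos (by linarith [hu.2] : 0 < a - u)]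
      nlinarith [abs_nonneg (1 - 2 * s), hu.1]
    rcases le_total s (1 / 2) with h2 | h2
    · rw [abs_of_nonneg (by linarith)] at hk2
      have := Real.rpow_le_rpow_of_nonpos hs0 (by linarith : 2 * s ≤ k) (by linarith : h - 1 ≤ 0)
      linarith
    · rw [abs_of_nonpos (by linarith)] at hk2
      have := Real.rpow_le_rpow_of_nonpos hs1 (by linarith : 2 * (1 - s) ≤ k)
        (by linarith : h - 1 ≤ 0)
      linarith

theorem imag_mem_rect (hr : 0 < r) {y : ℝ} (hy : |y| < a) : Complex.I * y ∈ rect a 0 r := by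
  have := mem_rect (x := 0) (y := y) (a := a) (r := r) (by rwa [abs_zero]) (by linarith)
  rwa [Complex.ofReal_zero, zero_add] at this

/-- The Legendre bound splits the majorant into a product: a function of `u`, integrable by the
hypothesis on `M`, and a function of `s` with integrable end singularities. -/
theorem LocalData.compactConverges (D : LocalData h a z₀ r f M) (hh : 0 < h) (ha : 0 < a) :
    CompactConverges h a z₀ f := by
  obtain ⟨C, hC0, hC⟩ := exists_norm_legP_le hh ha D.pos D.le_one
  -- The ends of the segment lie on the light cones, where `σ = 1` and the Legendre formula for
  -- `Gtilde` is not available; they form a null set.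
  have hset : (volume : Measure (ℝ × ℝ)).restrict (Ioo 0 a ×ˢ Icc 0 1) =
      (volume.restrict (Ioo 0 a)).prod (volume.restrict (Ioo 0 1)) := by
    rw [Measure.volume_eq_prod, ← Measure.prod_restrict,
      restrict_Ioo_eq_restrict_Icc (a := (0 : ℝ)) (b := 1)]
  rw [CompactConverges, IntegrableOn, hset]
  have hg1 : IntegrableOn (fun u => M u / u ^ 2 * ∫ s in Ioo 0 r, poisson h s u) (Ioo 0 a) :=
    D.integrableOn_majorant_integral.mono_set Ioo_subset_Ioi_self
  have hg2 : IntegrableOn (fun s : ℝ => ‖cst h‖ * C * (2 * a) *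
      (1 + ((2 * s) ^ (h - 1) + (2 * (1 - s)) ^ (h - 1)))) (Ioo 0 1) := by
    refine Integrable.const_mul (Integrable.add (by simp) (Integrable.add ?_ ?_)) _
    · have h1 := intervalIntegrable_abs_sub_rpow (r := h - 1) (by linarith) 0 0 1
      rw [intervalIntegrable_iff_integrableOn_Ioo_of_le zero_le_one] at h1
      have h2 : IntegrableOn (fun s : ℝ => 2 ^ (h - 1) * |0 - s| ^ (h - 1)) (Ioo 0 1) :=
        h1.const_mul _
      refine h2.congr_fun (fun s hs => ?_) measurableSet_Ioo
      simp only
      rw [zero_sub, abs_neg, abs_of_pos hs.1, Real.mul_rpow (by norm_num) hs.1.le]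
    · have h1 := intervalIntegrable_abs_sub_rpow (r := h - 1) (by linarith) 1 0 1
      rw [intervalIntegrable_iff_integrableOn_Ioo_of_le zero_le_one] at h1
      have h2 : IntegrableOn (fun s : ℝ => 2 ^ (h - 1) * |1 - s| ^ (h - 1)) (Ioo 0 1) :=
        h1.const_mul _
      refine h2.congr_fun (fun s hs => ?_) measurableSet_Ioo
      have : 0 < 1 - s := by linarith [hs.2]
      simp only
      rw [abs_of_pos this, Real.mul_rpow (by norm_num) this.le]
  set g : ℝ × ℝ → ℂ := fun p => ((p.1 : ℂ) ^ 2)⁻¹ * (cst h *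
    legP h ((p.1 ^ 2 + a ^ 2 - ((a - p.1) * (1 - 2 * p.2)) ^ 2) / (2 * p.1 * a)) *
    f p.1 (z₀ + Complex.I * ((a - p.1) * (1 - 2 * p.2) : ℝ)) * (2 * Complex.I * (p.1 - a))) with hg
  have hmem : ∀ p ∈ Ioo 0 a ×ˢ Ioo (0 : ℝ) 1,
      Complex.I * ((a - p.1) * (1 - 2 * p.2) : ℝ) ∈ rect a 0 r := fun p hp =>
    imag_mem_rect D.pos (by linarith [abs_compact_lt hp.1.2 hp.2, hp.1.1])
  have hae : ∀ᵐ p ∂((volume.restrict (Ioo 0 a)).prod (volume.restrict (Ioo (0 : ℝ) 1))),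
      p ∈ Ioo 0 a ×ˢ Ioo (0 : ℝ) 1 := by
    rw [Measure.prod_restrict]
    exact ae_restrict_mem (measurableSet_Ioo.prod measurableSet_Ioo)
  have hgi : Integrable g ((volume.restrict (Ioo 0 a)).prod (volume.restrict (Ioo 0 1))) := by
    refine Integrable.mono' (Integrable.mul_prod hg1 hg2) ?_ ?_
    · refine AEStronglyMeasurable.mul (by fun_prop) (AEStronglyMeasurable.mul
        (AEStronglyMeasurable.mul (AEStronglyMeasurable.const_mul ?_ _) ?_) (by fun_prop))
      · exact ((measurable_legP h).comp (by fun_prop)).aestronglyMeasurable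
      · rw [Measure.prod_restrict]
        refine ContinuousOn.aestronglyMeasurable ?_ (measurableSet_Ioo.prod measurableSet_Ioo)
        exact D.cont.comp (f := fun p : ℝ × ℝ => ((p.1,
          Complex.I * ((a - p.1) * (1 - 2 * p.2) : ℝ)) : ℝ × ℂ)) (by fun_prop)
          fun p hp => ⟨hp.1.1, hmem p hp⟩
    · filter_upwards [hae] with p hp
      have hu : 0 < p.1 := hp.1.1
      have h1 := hC p.1 ((a - p.1) * (1 - 2 * p.2)) hu (abs_compact_lt hp.1.2 hp.2)
      have h2 := rpow_compact_le (h := h) ha hp.1 hp.2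
      have h3 := D.bound p.1 hu _ (hmem p hp)
      have hM := D.M_nonneg ha hu
      have hI : 0 ≤ ∫ s in Ioo 0 r, poisson h s p.1 :=
        integral_nonneg fun s => poisson_nonneg hu.le
      have h4 : ‖2 * Complex.I * ((p.1 : ℂ) - a)‖ ≤ 2 * a := by
        rw [norm_mul, norm_mul, Complex.norm_I, ← Complex.ofReal_sub, Complex.norm_real,
          Real.norm_eq_abs, abs_of_neg (by linarith [hp.1.2])]
        norm_num
        exact hu.le
      have h5 : ‖((p.1 : ℂ) ^ 2)⁻¹‖ = 1 / p.1 ^ 2 := by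
        rw [norm_inv, norm_pow, Complex.norm_real, Real.norm_of_nonneg hu.le, one_div]
      have h6 := h1.trans (mul_le_mul_of_nonneg_right (mul_le_mul_of_nonneg_left h2 hC0) hI)
      have h8 := (norm_nonneg _).trans h6
      simp only [hg]
      rw [norm_mul, norm_mul, norm_mul, norm_mul, h5]
      calc _ ≤ 1 / p.1 ^ 2 * (‖cst h‖ * (C * (1 + ((2 * p.2) ^ (h - 1) +
              (2 * (1 - p.2)) ^ (h - 1))) * ∫ s in Ioo 0 r, poisson h s p.1) * M p.1 * (2 * a)) :=
            mul_le_mul_of_nonneg_left (mul_le_mul (mul_le_mul (mul_le_mul_of_nonneg_left h6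
              (norm_nonneg _)) h3 (norm_nonneg _) (mul_nonneg (norm_nonneg _) h8)) h4
              (norm_nonneg _) (mul_nonneg (mul_nonneg (norm_nonneg _) h8) hM)) (by positivity)
        _ = _ := by ring
  refine hgi.congr ?_
  filter_upwards [hae] with p hp
  simp only [hg]
  rw [deriv_compactSeg, compactSeg_eq, Gtilde_compact hh hp.1.1 (abs_compact_lt hp.1.2 hp.2)]

/-- The integral over the segment between the light cones, up to a factor. -/
noncomputable def coneInt (h a u : ℝ) (F : ℂ → ℂ) : ℂ :=
  (∫ η in Ioo 0 (a - u), legP h ((u ^ 2 + a ^ 2 - η ^ 2) / (2 * u * a)) * F (Complex.I * η)) +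
    ∫ η in Ioo 0 (a - u), legP h ((u ^ 2 + a ^ 2 - η ^ 2) / (2 * u * a)) * F (-(Complex.I * η))

/-- For `u < a` the segment is traversed downwards, from `z₀ + i (a - u)`, whence the factor `-i`.
Folding at the real axis gives the two halves of `coneInt`. -/
theorem lineInt_compactSeg (D : LocalData h a z₀ r f M) (hh : 0 < h) (ha : 0 < a) {u : ℝ}
    (hu : u ∈ Ioo 0 a) :
    lineInt (fun z => Gtilde h u z a z₀ * f u z) (compactSeg a z₀ u) (Icc 0 1) =
      -Complex.I * cst h * coneInt h a u (fun ζ => f u (z₀ + ζ)) := by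
  set F : ℂ → ℂ := fun ζ => f u (z₀ + ζ) with hF
  set b := a - u with hb
  have hb0 : 0 < b := by linarith [hu.2]
  have hba : b < a := by linarith [hu.1]
  have hFc := (D.diff u hu.1).continuousOn
  set g : ℝ → ℂ := fun y => legP h ((u ^ 2 + a ^ 2 - y ^ 2) / (2 * u * a)) * F (Complex.I * y)
    with hg
  have hgi : IntegrableOn g (Icc (-b) b) := by
    have h1 : IntegrableOn (fun y : ℝ => F (Complex.I * y)) (Icc (-b) b) := by
      refine ContinuousOn.integrableOn_compact isCompact_Icc ?_
      exact hFc.comp (by fun_prop) fun y hy => imag_mem_rect D.pos ((abs_le.2 hy).trans_lt hba)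
    refine Integrable.bdd_mul (c := (2 * ((u ^ 2 + a ^ 2) / (2 * u * a))) ^ h) h1 ?_ ?_
    · exact ((measurable_legP h).comp (by fun_prop)).aestronglyMeasurable
    · filter_upwards [ae_restrict_mem measurableSet_Icc] with y hy
      have hu0 := hu.1
      have h2 : 1 ≤ (u ^ 2 + a ^ 2 - y ^ 2) / (2 * u * a) := by
        rw [le_div_iff₀ (by positivity)]
        nlinarith [hy.1, hy.2]
      refine (norm_legP_le (h := h) (by simpa using hh.le) h2).trans ?_
      rw [Complex.ofReal_re]
      refine Real.rpow_le_rpow (by linarith) ?_ hh.le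
      gcongr
      nlinarith [sq_nonneg y]
  have e1 : lineInt (fun z => Gtilde h u z a z₀ * f u z) (compactSeg a z₀ u) (Icc 0 1) =
      -Complex.I * cst h * ((2 * b : ℝ) * ∫ s in (0 : ℝ)..1, g (b - 2 * b * s)) := by
    rw [lineInt, integral_Icc_eq_integral_Ioc, integral_Ioc_eq_integral_Ioo,
      intervalIntegral.integral_of_le zero_le_one, integral_Ioc_eq_integral_Ioo,
      ← integral_const_mul, ← integral_const_mul]
    refine setIntegral_congr_fun measurableSet_Ioo fun s hs => ?_
    rw [deriv_compactSeg, compactSeg_eq, Gtilde_compact hh hu.1 (abs_compact_lt hu.2 hs)]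
    simp only [hg, hF]
    rw [show b - 2 * b * s = (a - u) * (1 - 2 * s) by rw [hb]; ring, hb]
    push_cast
    ring
  have e2 : ((2 * b : ℝ) : ℂ) * ∫ s in (0 : ℝ)..1, g (b - 2 * b * s) = ∫ y in (-b)..b, g y := by
    have := intervalIntegral.smul_integral_comp_sub_mul (a := 0) (b := 1) g (2 * b) b
    rw [Complex.real_smul, mul_zero, sub_zero, mul_one, show b - 2 * b = -b by ring] at this
    exact this
  have hii : ∀ p q : ℝ, p ∈ Icc (-b) b → q ∈ Icc (-b) b → IntervalIntegrable g volume p q :=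
    fun p q hp hq => (hgi.mono_set (ordConnected_Icc.uIcc_subset hp hq)).intervalIntegrable
  have hm1 : -b ∈ Icc (-b) b := ⟨le_rfl, by linarith⟩
  have hm2 : b ∈ Icc (-b) b := ⟨by linarith, le_rfl⟩
  have hm3 : (0 : ℝ) ∈ Icc (-b) b := ⟨by linarith, hb0.le⟩
  rw [e1, e2, ← intervalIntegral.integral_add_adjacent_intervals (hii _ 0 hm1 hm3) (hii 0 _ hm3 hm2),
    add_comm, coneInt]
  congr 2
  · rw [intervalIntegral.integral_of_le hb0.le, integral_Ioc_eq_integral_Ioo]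
  · have := intervalIntegral.integral_comp_neg (a := 0) (b := b) g
    rw [neg_zero] at this
    rw [← this, intervalIntegral.integral_of_le hb0.le, integral_Ioc_eq_integral_Ioo]
    refine setIntegral_congr_fun measurableSet_Ioo fun y _ => ?_
    simp only [hg]
    rw [neg_sq, Complex.ofReal_neg, mul_neg]

theorem coneInt_of_le {u : ℝ} (hu : a ≤ u) (F : ℂ → ℂ) : coneInt h a u F = 0 := by
  rw [coneInt, Ioo_eq_empty (by linarith)]
  simp


/-! ### The `w`-segment and absolute convergence over `C_i(ε)`. -/

theorem wSeg_eq (a z₀ p : ℝ) : wSeg a z₀ p = z₀ + Complex.I * (a * (2 * p - 1) : ℝ) := by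
  rw [wSeg, seg]
  push_cast
  ring

theorem deriv_wSeg (a z₀ p : ℝ) : deriv (wSeg a z₀) p = 2 * Complex.I * a := by
  rw [wSeg, deriv_seg]
  ring

/-- With `t = 2p - 1` one has `a² + (z₀ - w)² = a² (1 - t²) ≥ 0`, and inversion commutes with the
power on nonnegative reals, including the value `0` at the ends. -/
theorem Ghat_wSeg (ha : 0 < a) {p : ℝ} (hp : p ∈ Icc (0 : ℝ) 1) (u : ℝ) (z : ℂ) :
    Ghat h u z a z₀ (wSeg a z₀ p) =
      cst h * wt h a (2 * p - 1) * kern h a u (z - z₀) (2 * p - 1) := by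
  have ha' : (a : ℂ) ≠ 0 := Complex.ofReal_ne_zero.2 ha.ne'
  have h0 : 0 ≤ a * (1 - (2 * p - 1) ^ 2) := by
    have : 0 ≤ 1 - (2 * p - 1) ^ 2 := by nlinarith [hp.1, hp.2]
    positivity
  have h1 : (a : ℂ) / ((a : ℂ) ^ 2 + (z₀ - wSeg a z₀ p) ^ 2) =
      ((a * (1 - (2 * p - 1) ^ 2) : ℝ) : ℂ)⁻¹ := by
    have : (a : ℂ) ^ 2 + (z₀ - wSeg a z₀ p) ^ 2 = a * ((a * (1 - (2 * p - 1) ^ 2) : ℝ) : ℂ) := by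
      rw [wSeg_eq, show (z₀ : ℂ) - (z₀ + Complex.I * (a * (2 * p - 1) : ℝ)) =
        -(Complex.I * (a * (2 * p - 1) : ℝ)) by ring, neg_sq, mul_pow, Complex.I_sq]
      push_cast
      ring
    rw [this, div_mul_eq_div_div, div_self ha', one_div]
  rw [Ghat, h1, Complex.inv_cpow _ _ (by rw [Complex.arg_ofReal_of_nonneg h0]; exact Real.pi_pos.ne),
    ← Complex.cpow_neg, neg_sub, wSeg_eq, kern, wt]
  congr 4
  · push_cast
    ring

theorem integral_wSeg (φ : ℝ → ℂ) :
    ∫ p in Icc (0 : ℝ) 1, φ (2 * p - 1) = 2⁻¹ * ∫ t in Ioo (-1 : ℝ) 1, φ t := by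
  have := intervalIntegral.integral_comp_mul_sub (a := 0) (b := 1) φ (two_ne_zero (α := ℝ)) 1
  rw [integral_Icc_eq_integral_Ioc, ← intervalIntegral.integral_of_le zero_le_one,
    ← integral_Ioc_eq_integral_Ioo, ← intervalIntegral.integral_of_le (by norm_num), this,
    Complex.real_smul]
  norm_num

theorem integrableOn_wSeg {φ : ℝ → ℂ} (hφ : IntegrableOn φ (Ioo (-1) 1)) :
    IntegrableOn (fun p => φ (2 * p - 1)) (Icc 0 1) := by
  rw [integrableOn_Icc_iff_integrableOn_Ioc, ← intervalIntegrable_iff_integrableOn_Ioc_of_le zero_le_one]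
  rw [← intervalIntegrable_iff_integrableOn_Ioo_of_le (by norm_num)] at hφ
  have := (hφ.comp_sub_right 1).comp_mul_left (c := 2)
  norm_num at this
  exact this

theorem integral_Ghat_wSeg (hh : 0 < h) (ha : 0 < a) {u : ℝ} (hu : 0 < u) {z : ℂ}
    (hz : z.re ≠ z₀) :
    2 * Complex.I * a * ∫ p in Icc (0 : ℝ) 1, Ghat h u z a z₀ (wSeg a z₀ p) = G h u z a z₀ := by
  have h1 : ∀ p ∈ Icc (0 : ℝ) 1, Ghat h u z a z₀ (wSeg a z₀ p) =
      (fun t => cst h * (wt h a t * kern h a u (z - z₀) t)) (2 * p - 1) := by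
    intro p hp
    rw [Ghat_wSeg ha hp, mul_assoc]
  have h2 : G h u z a z₀ = G h u (z - z₀) a 0 := by
    simp only [G, dist2, sub_zero]
  rw [setIntegral_congr_fun measurableSet_Icc h1, integral_wSeg
    (fun t => cst h * (wt h a t * kern h a u (z - z₀) t)), h2,
    ← superposition hh ha hu (ζ := z - z₀) (by simpa [sub_eq_zero] using hz),
    intervalIntegral.integral_of_le (by norm_num), integral_Ioc_eq_integral_Ioo,
    integral_const_mul]
  ring

theorem integrableOn_wt_wSeg (hh : 0 < h) (ha : 0 < a) :
    IntegrableOn (fun p => wt h a (2 * p - 1)) (Icc 0 1) :=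
  integrableOn_wSeg (integrableOn_wt (by simpa using hh) ha)

/-- Common scheme for the three sides. The bound `N` must not depend on `p`, so that the majorant is
a product of the integrable weight and a function of `(u, s)`; the remaining factor is continuous,
hence measurable. -/
theorem LocalData.hatConverges (D : LocalData h a z₀ r f M) (hh : 0 < h) (ha : 0 < a)
    {Γ : ℂ → ℝ → ℂ} {ζ d : ℝ → ℝ → ℂ} {N : ℝ × ℝ → ℝ}
    (hΓ : ∀ p s, Γ (wSeg a z₀ p) s = z₀ + ζ p s) (hd : ∀ p s, deriv (Γ (wSeg a z₀ p)) s = d p s)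
    (cζ : Continuous fun q : ℝ × ℝ => ζ q.1 q.2) (cd : Continuous fun q : ℝ × ℝ => d q.1 q.2)
    (mem : ∀ p ∈ Icc (0 : ℝ) 1, ∀ s ∈ Icc (0 : ℝ) 1, ζ p s ∈ rect a 0 r)
    (off : ∀ p s, (ζ p s).re ≠ 0 ∨ (ζ p s).im = a * (2 * p - 1))
    (bound : ∀ p ∈ Icc (0 : ℝ) 1, ∀ u > 0, ∀ s ∈ Icc (0 : ℝ) 1,
      ‖kern h a u (ζ p s) (2 * p - 1) * d p s‖ ≤ N (u, s))
    (int : IntegrableOn (fun q : ℝ × ℝ => M q.1 / q.1 ^ 2 * N q) (Ioi 0 ×ˢ Icc 0 1)) :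
    HatConverges h a z₀ f Γ (Icc 0 1) := by
  have hms : MeasurableSet (Icc (0 : ℝ) 1 ×ˢ (Ioi (0 : ℝ) ×ˢ Icc (0 : ℝ) 1)) :=
    measurableSet_Icc.prod (measurableSet_Ioi.prod measurableSet_Icc)
  have hset : (volume : Measure (ℝ × ℝ × ℝ)).restrict (Icc 0 1 ×ˢ Ioi 0 ×ˢ Icc 0 1) =
      (volume.restrict (Icc (0 : ℝ) 1)).prod
        ((volume : Measure (ℝ × ℝ)).restrict (Ioi 0 ×ˢ Icc 0 1)) := by
    rw [Measure.volume_eq_prod, ← Measure.prod_restrict]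
  set B : ℝ × ℝ × ℝ → ℂ := fun p => ((p.2.1 : ℂ) ^ 2)⁻¹ *
    (kern h a p.2.1 (ζ p.1 p.2.2) (2 * p.1 - 1) * f p.2.1 (z₀ + ζ p.1 p.2.2) * d p.1 p.2.2) with hB
  have cB : ContinuousOn B (Icc 0 1 ×ˢ Ioi 0 ×ˢ Icc 0 1) := by
    rintro ⟨p, u, s⟩ ⟨hp, hu, hs⟩
    change p ∈ Icc (0 : ℝ) 1 at hp
    change (0 : ℝ) < u at hu
    change s ∈ Icc (0 : ℝ) 1 at hs
    refine ContinuousAt.continuousWithinAt ?_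
    have cζ' : Continuous fun p : ℝ × ℝ × ℝ => ζ p.1 p.2.2 :=
      cζ.comp (f := fun p : ℝ × ℝ × ℝ => (p.1, p.2.2)) (by fun_prop)
    have cd' : Continuous fun p : ℝ × ℝ × ℝ => d p.1 p.2.2 :=
      cd.comp (f := fun p : ℝ × ℝ × ℝ => (p.1, p.2.2)) (by fun_prop)
    have hopen : IsOpen (Ioi (0 : ℝ) ×ˢ rect a 0 r) := isOpen_Ioi.prod (isOpen_rect a 0 r)
    refine ContinuousAt.mul (ContinuousAt.inv₀ (by fun_prop)
      (pow_ne_zero _ (Complex.ofReal_ne_zero.2 hu.ne'))) (ContinuousAt.mul (ContinuousAt.mul ?_ ?_)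
      cd'.continuousAt)
    · exact ContinuousAt.comp (f := fun p : ℝ × ℝ × ℝ =>
        (((h : ℂ), p.2.1, ζ p.1 p.2.2, 2 * p.1 - 1) : ℂ × ℝ × ℂ × ℝ)) (x := (p, u, s))
        (continuousAt_kern (a := a) (p := ((h : ℂ), u, ζ p s, 2 * p - 1)) hu (off p s))
        (by fun_prop)
    · exact ContinuousAt.comp (f := fun p : ℝ × ℝ × ℝ => ((p.2.1, ζ p.1 p.2.2) : ℝ × ℂ))
        (x := (p, u, s)) (D.cont.continuousAt (hopen.mem_nhds (x := (u, ζ p s))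
          ⟨hu, mem p hp s hs⟩)) (by fun_prop)
  have hw := integrableOn_wt_wSeg hh ha
  have hwm : AEStronglyMeasurable (fun p : ℝ × ℝ × ℝ => cst h * wt h a (2 * p.1 - 1))
      (volume.restrict (Icc 0 1 ×ˢ Ioi 0 ×ˢ Icc 0 1)) := by
    rw [hset]
    exact (hw.aestronglyMeasurable.comp_fst).const_mul _
  have hg : IntegrableOn (fun p : ℝ × ℝ × ℝ => ‖cst h * wt h a (2 * p.1 - 1)‖ *
      (M p.2.1 / p.2.1 ^ 2 * N p.2)) (Icc 0 1 ×ˢ Ioi 0 ×ˢ Icc 0 1) := by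
    rw [IntegrableOn, hset]
    exact (Integrable.const_mul hw (cst h)).norm.mul_prod int
  have hmain : IntegrableOn (fun p : ℝ × ℝ × ℝ => cst h * wt h a (2 * p.1 - 1) * B p)
      (Icc 0 1 ×ˢ Ioi 0 ×ˢ Icc 0 1) := by
    refine Integrable.mono' hg (hwm.mul (cB.aestronglyMeasurable hms)) ?_
    filter_upwards [ae_restrict_mem hms] with ⟨p, u, s⟩ ⟨hp, hu, hs⟩
    change p ∈ Icc (0 : ℝ) 1 at hp
    change (0 : ℝ) < u at hu
    change s ∈ Icc (0 : ℝ) 1 at hs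
    rw [norm_mul]
    refine mul_le_mul_of_nonneg_left ?_ (norm_nonneg _)
    have e : B (p, u, s) = ((u : ℂ) ^ 2)⁻¹ * f u (z₀ + ζ p s) *
        (kern h a u (ζ p s) (2 * p - 1) * d p s) := by
      rw [hB]
      ring
    rw [e, norm_mul, norm_mul, norm_inv, norm_pow, Complex.norm_real, Real.norm_of_nonneg hu.le,
      div_eq_inv_mul]
    have := D.M_nonneg ha hu
    gcongr
    · exact D.bound u hu _ (mem p hp s hs)
    · exact bound p hp u hu s hs
  refine hmain.congr_fun (fun p hp => ?_) hms
  simp only [hB]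
  rw [hΓ, hd, Ghat_wSeg ha hp.1, add_sub_cancel_left]
  ring

theorem kern_vertical (h : ℂ) (a u ε y t : ℝ) :
    kern h a u (-ε + Complex.I * y) t = offKern h u (-ε) (a * t - y) := by
  rw [← kern_eq_offKern, Complex.ofReal_neg]

/-- On the horizontal side `z - w` is real, so the size of the kernel is exactly the majorant kernel
of the test functions. -/
theorem norm_kern_horizontal {u : ℝ} (hu : 0 < u) (t x : ℝ) :
    ‖kern h a u (Complex.I * (a * t : ℝ) + x) t‖ = poisson h x u := by
  rw [add_comm, kern_eq_offKern, norm_offKern _ _ _ _ hu, sub_self, poisson]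
  congr 2
  rw [Complex.ofReal_zero, mul_zero, sub_zero, ← Complex.ofReal_pow, ← Complex.ofReal_pow,
    ← Complex.ofReal_add, Complex.norm_real, Real.norm_of_nonneg (by positivity)]

theorem LocalData.integrableOn_vertical (D : LocalData h a z₀ r f M) (hh : 0 < h) {ε : ℝ}
    (hε : ε ≠ 0) (c : ℝ) : IntegrableOn (fun q : ℝ × ℝ => M q.1 / q.1 ^ 2 * (c * poisson h ε q.1))
      (Ioi 0 ×ˢ Icc 0 1) := by
  rw [IntegrableOn, Measure.volume_eq_prod, ← Measure.prod_restrict]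
  refine (Integrable.comp_fst (Integrable.const_mul (D.integrableOn_majorant hh hε) c) _).congr
    (Eventually.of_forall fun q => ?_)
  change c * (M q.1 / q.1 ^ 2 * poisson h ε q.1) = _
  ring

theorem measurableEmbedding_affine {ε : ℝ} (hε : 0 < ε) :
    MeasurableEmbedding fun s : ℝ => (2 * s - 1) * ε := by
  have h1 := (measurableEmbedding_addRight (-ε)).comp
    (measurableEmbedding_mulLeft₀ (by positivity : 2 * ε ≠ 0))
  convert h1 using 1
  ext s
  simp only [Function.comp]
  ring

theorem map_affine_volume {ε : ℝ} (hε : 0 < ε) :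
    Measure.map (fun s : ℝ => (2 * s - 1) * ε) volume = ENNReal.ofReal |(2 * ε)⁻¹| • volume := by
  have e1 : (fun s : ℝ => (2 * s - 1) * ε) = (fun x => x + -ε) ∘ fun s => 2 * ε * s := by
    ext s
    simp only [Function.comp]
    ring
  rw [e1, ← Measure.map_map (by fun_prop) (by fun_prop), Real.map_volume_mul_left (by positivity),
    Measure.map_smul, map_add_right_eq_self]

theorem map_prod_affine_volume {ε : ℝ} (hε : 0 < ε) :
    Measure.map (Prod.map (id : ℝ → ℝ) fun s : ℝ => (2 * s - 1) * ε) volume =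
      ENNReal.ofReal |(2 * ε)⁻¹| • volume := by
  rw [Measure.volume_eq_prod, ← Measure.map_prod_map _ _ measurable_id
    (measurableEmbedding_affine hε).measurable, map_affine_volume hε, Measure.map_id,
    Measure.prod_smul_right]

theorem integrableOn_comp_affine {g : ℝ × ℝ → ℝ} {ε : ℝ} (hε : 0 < ε) {S : Set (ℝ × ℝ)}
    (hg : IntegrableOn g S) :
    IntegrableOn (fun q : ℝ × ℝ => g (q.1, (2 * q.2 - 1) * ε))
      ((Prod.map (id : ℝ → ℝ) fun s : ℝ => (2 * s - 1) * ε) ⁻¹' S) := by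
  have hemb : MeasurableEmbedding (Prod.map (id : ℝ → ℝ) fun s : ℝ => (2 * s - 1) * ε) :=
    MeasurableEmbedding.id.prodMap (measurableEmbedding_affine hε)
  refine (hemb.integrableOn_map_iff (μ := volume)).1 ?_
  rw [map_prod_affine_volume hε, IntegrableOn, Measure.restrict_smul]
  exact Integrable.smul_measure hg ENNReal.ofReal_ne_top

theorem LocalData.integrableOn_horizontal (D : LocalData h a z₀ r f M) {ε : ℝ} (hε : 0 < ε)
    (hεr : ε < r) : IntegrableOn (fun q : ℝ × ℝ => M q.1 / q.1 ^ 2 *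
      (2 * ε * poisson h ((2 * q.2 - 1) * ε) q.1)) (Ioi 0 ×ˢ Icc 0 1) := by
  have hs : Ioi (0 : ℝ) ×ˢ Icc (0 : ℝ) 1 ⊆
      (Prod.map (id : ℝ → ℝ) fun s : ℝ => (2 * s - 1) * ε) ⁻¹' (Ioi 0 ×ˢ Ioo (-r) r) := by
    rintro ⟨u, s⟩ ⟨hu, hs⟩
    change s ∈ Icc (0 : ℝ) 1 at hs
    refine ⟨hu, ?_, ?_⟩
    · change -r < (2 * s - 1) * ε
      nlinarith [hs.1]
    · change (2 * s - 1) * ε < r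
      nlinarith [hs.2]
  refine (Integrable.const_mul ((integrableOn_comp_affine hε D.int).mono_set hs) (2 * ε)).congr
    (Eventually.of_forall fun q => ?_)
  change 2 * ε * (M q.1 / q.1 ^ 2 * poisson h ((2 * q.2 - 1) * ε) q.1) = _
  ring

theorem LocalData.hatConverges_side₁ (D : LocalData h a z₀ r f M) (hh : 0 < h) (ha : 0 < a) {ε : ℝ}
    (hε : 0 < ε) (hεr : ε < r) : HatConverges h a z₀ f (side₁ z₀ ε) (Icc 0 1) := by
  refine D.hatConverges hh ha (ζ := fun p s => -ε + Complex.I * (s * (a * (2 * p - 1)) : ℝ))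
    (d := fun p s => Complex.I * (a * (2 * p - 1) : ℝ))
    (N := fun q => Real.sqrt (3 + a ^ 2 / ε ^ 2) ^ h * a * poisson h (-ε) q.1)
    (fun p s => ?_) (fun p s => ?_) (by fun_prop) (by fun_prop) (fun p hp s hs => ?_)
    (fun p s => Or.inl (by simpa using hε.ne')) (fun p hp u hu s hs => ?_)
    (D.integrableOn_vertical hh (neg_ne_zero.2 hε.ne') _)
  · rw [side₁, seg, wSeg_eq]
    push_cast
    ring
  · rw [side₁, deriv_seg, wSeg_eq]
    ring
  · have ht := abs_mul_lt ha D.pos (t := s * (2 * p - 1))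
      ⟨by nlinarith [hp.1, hp.2, hs.1, hs.2], by nlinarith [hp.1, hp.2, hs.1, hs.2]⟩
    have := mem_rect (x := -ε) (y := s * (a * (2 * p - 1))) (a := a) (r := r)
      (by rwa [abs_neg, abs_of_pos hε]) (by rwa [mul_left_comm])
    rwa [Complex.ofReal_neg] at this
  · have h1 : |a * (2 * p - 1)| ≤ a := by
      rw [abs_mul, abs_of_pos ha]
      have : |2 * p - 1| ≤ 1 := abs_le.2 ⟨by linarith [hp.1], by linarith [hp.2]⟩
      nlinarith
    have h2 : |a * (2 * p - 1) - s * (a * (2 * p - 1))| ≤ a := by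
      rw [← one_sub_mul, abs_mul, abs_of_nonneg (by linarith [hs.2])]
      nlinarith [hs.1, abs_nonneg (a * (2 * p - 1)), hs.2]
    rw [norm_mul, kern_vertical, norm_mul, Complex.norm_I, one_mul, Complex.norm_real,
      Real.norm_eq_abs]
    have h3 := norm_offKern_le_poisson hh hu (neg_ne_zero.2 hε.ne') h2
    rw [neg_sq] at h3
    have := poisson_nonneg (h := h) (b := -ε) hu.le
    calc _ ≤ (Real.sqrt (3 + a ^ 2 / ε ^ 2) ^ h * poisson h (-ε) u) * a := by gcongr
      _ = _ := by ring

theorem LocalData.hatConverges_side₃ (D : LocalData h a z₀ r f M) (hh : 0 < h) (ha : 0 < a) {ε : ℝ}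
    (hε : 0 < ε) (hεr : ε < r) : HatConverges h a z₀ f (side₃ z₀ ε) (Icc 0 1) := by
  refine D.hatConverges hh ha (ζ := fun p s => ε + Complex.I * ((1 - s) * (a * (2 * p - 1)) : ℝ))
    (d := fun p s => -(Complex.I * (a * (2 * p - 1) : ℝ)))
    (N := fun q => Real.sqrt (3 + a ^ 2 / ε ^ 2) ^ h * a * poisson h ε q.1)
    (fun p s => ?_) (fun p s => ?_) (by fun_prop) (by fun_prop) (fun p hp s hs => ?_)
    (fun p s => Or.inl (by simpa using hε.ne')) (fun p hp u hu s hs => ?_)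
    (D.integrableOn_vertical hh hε.ne' _)
  · rw [side₃, seg, wSeg_eq]
    push_cast
    ring
  · rw [side₃, deriv_seg, wSeg_eq]
    ring
  · have ht := abs_mul_lt ha D.pos (t := (1 - s) * (2 * p - 1))
      ⟨by nlinarith [hp.1, hp.2, hs.1, hs.2], by nlinarith [hp.1, hp.2, hs.1, hs.2]⟩
    exact mem_rect (x := ε) (y := (1 - s) * (a * (2 * p - 1))) (a := a) (r := r)
      (by rwa [abs_of_pos hε]) (by rwa [mul_left_comm])
  · have h1 : |a * (2 * p - 1)| ≤ a := by
      rw [abs_mul, abs_of_pos ha]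
      have : |2 * p - 1| ≤ 1 := abs_le.2 ⟨by linarith [hp.1], by linarith [hp.2]⟩
      nlinarith
    have h2 : |a * (2 * p - 1) - (1 - s) * (a * (2 * p - 1))| ≤ a := by
      rw [← one_sub_mul, sub_sub_cancel, abs_mul, abs_of_nonneg hs.1]
      nlinarith [hs.1, abs_nonneg (a * (2 * p - 1)), hs.2]
    rw [norm_mul, kern_eq_offKern, norm_neg, norm_mul, Complex.norm_I, one_mul, Complex.norm_real,
      Real.norm_eq_abs]
    have h3 := norm_offKern_le_poisson hh hu hε.ne' h2
    have := poisson_nonneg (h := h) (b := ε) hu.le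
    calc _ ≤ (Real.sqrt (3 + a ^ 2 / ε ^ 2) ^ h * poisson h ε u) * a := by gcongr
      _ = _ := by ring

theorem LocalData.hatConverges_side₂ (D : LocalData h a z₀ r f M) (hh : 0 < h) (ha : 0 < a) {ε : ℝ}
    (hε : 0 < ε) (hεr : ε < r) : HatConverges h a z₀ f (side₂ ε) (Icc 0 1) := by
  refine D.hatConverges hh ha
    (ζ := fun p s => Complex.I * (a * (2 * p - 1) : ℝ) + ((2 * s - 1) * ε : ℝ))
    (d := fun p s => 2 * ε) (N := fun q => 2 * ε * poisson h ((2 * q.2 - 1) * ε) q.1)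
    (fun p s => ?_) (fun p s => ?_) (by fun_prop) (by fun_prop) (fun p hp s hs => ?_)
    (fun p s => Or.inr (by simp)) (fun p hp u hu s hs => ?_)
    (D.integrableOn_horizontal hε hεr)
  · rw [side₂, seg, wSeg_eq]
    push_cast
    ring
  · rw [side₂, deriv_seg]
    ring
  · rw [add_comm]
    refine mem_rect ?_ (abs_mul_lt ha D.pos ⟨by linarith [hp.1], by linarith [hp.2]⟩)
    rw [abs_mul, abs_of_pos hε]
    have : |2 * s - 1| ≤ 1 := abs_le.2 ⟨by linarith [hs.1], by linarith [hs.2]⟩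
    nlinarith
  · rw [norm_mul, norm_kern_horizontal hu, mul_comm, norm_mul, Complex.norm_real,
      Real.norm_of_nonneg hε.le, RCLike.norm_ofNat]


/-! ### Fubini: the difference reduces to the contours `C_i(ε)`. -/

theorem integrableOn_integral_right {g : ℝ × ℝ × ℝ → ℂ} {S T I : Set ℝ}
    (hg : IntegrableOn g (S ×ˢ T ×ˢ I)) :
    IntegrableOn (fun q : ℝ × ℝ => ∫ s in I, g (q.1, q.2, s)) (S ×ˢ T) ∧
      ∫ q in S ×ˢ T, ∫ s in I, g (q.1, q.2, s) = ∫ p in S ×ˢ T ×ˢ I, g p := by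
  have hm : MeasurePreserving (MeasurableEquiv.prodAssoc : (ℝ × ℝ) × ℝ ≃ᵐ ℝ × ℝ × ℝ)
      ((volume.restrict (S ×ˢ T)).prod (volume.restrict I)) (volume.restrict (S ×ˢ T ×ˢ I)) := by
    rw [Measure.volume_eq_prod ℝ ℝ, Measure.volume_eq_prod ℝ (ℝ × ℝ), Measure.volume_eq_prod ℝ ℝ,
      ← Measure.prod_restrict S T, ← Measure.prod_restrict S (T ×ˢ I), ← Measure.prod_restrict T I]
    exact measurePreserving_prodAssoc _ _ _
  have h1 := (hm.integrable_comp_emb (MeasurableEquiv.measurableEmbedding _)).2 hg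
  refine ⟨h1.integral_prod_left, ?_⟩
  rw [← hm.integral_comp (MeasurableEquiv.measurableEmbedding _)]
  exact (integral_prod _ h1).symm

/-- The inner integral of the boundary representation. -/
noncomputable def hatTerm (h a z₀ : ℝ) (f : ℝ → ℂ → ℂ) (Γ : ℂ → ℝ → ℂ) (I : Set ℝ) (q : ℝ × ℝ) : ℂ :=
  ((q.2 : ℂ) ^ 2)⁻¹ * lineInt (fun z => Ghat h q.2 z a z₀ (wSeg a z₀ q.1) * f q.2 z)
    (Γ (wSeg a z₀ q.1)) I

theorem HatConverges.integrableOn_hatTerm {Γ : ℂ → ℝ → ℂ} {I : Set ℝ}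
    (hΓ : HatConverges h a z₀ f Γ I) :
    IntegrableOn (hatTerm h a z₀ f Γ I) (Icc 0 1 ×ˢ Ioi 0) ∧
      ∫ q in Icc 0 1 ×ˢ Ioi 0, hatTerm h a z₀ f Γ I q =
        ∫ p in Icc (0 : ℝ) 1 ×ˢ Ioi (0 : ℝ) ×ˢ I, ((p.2.1 : ℂ) ^ 2)⁻¹ *
        (Ghat h p.2.1 (Γ (wSeg a z₀ p.1) p.2.2) a z₀ (wSeg a z₀ p.1) *
          f p.2.1 (Γ (wSeg a z₀ p.1) p.2.2) * deriv (Γ (wSeg a z₀ p.1)) p.2.2) := by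
  have h1 := integrableOn_integral_right hΓ
  have e : (fun q : ℝ × ℝ => ∫ s in I, ((q.2 : ℂ) ^ 2)⁻¹ *
        (Ghat h q.2 (Γ (wSeg a z₀ q.1) s) a z₀ (wSeg a z₀ q.1) *
          f q.2 (Γ (wSeg a z₀ q.1) s) * deriv (Γ (wSeg a z₀ q.1)) s)) =
        hatTerm h a z₀ f Γ I := by
    ext q
    rw [integral_const_mul]
    rfl
  rw [← e]
  exact h1

/-- The contour does not depend on `w`, so `w` may be integrated first; as the contour avoids `Re z
= z₀`, the superposition formula turns `Ĝ_h` into `G_h` pointwise, and absolute convergence is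
inherited. -/
theorem HatConverges.bulk (hh : 0 < h) (ha : 0 < a) {γ : ℝ → ℂ} {I : Set ℝ}
    (hI : MeasurableSet I) (hre : ∀ s ∈ I, (γ s).re ≠ z₀)
    (hγ : HatConverges h a z₀ f (fun _ => γ) I) :
    BulkConverges h a z₀ f γ I ∧
      2 * Complex.I * a * ∫ q in Icc 0 1 ×ˢ Ioi 0, hatTerm h a z₀ f (fun _ => γ) I q =
        ∫ u in Ioi (0 : ℝ), ((u : ℂ) ^ 2)⁻¹ * lineInt (fun z => G h u z a z₀ * f u z) γ I := by
  have h1 := hγ.integrableOn_hatTerm.2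
  have hms : MeasurableSet (Ioi (0 : ℝ) ×ˢ I) := measurableSet_Ioi.prod hI
  have hset : (volume : Measure (ℝ × ℝ × ℝ)).restrict (Icc 0 1 ×ˢ Ioi 0 ×ˢ I) =
      (volume.restrict (Icc (0 : ℝ) 1)).prod ((volume : Measure (ℝ × ℝ)).restrict (Ioi 0 ×ˢ I)) := by
    rw [Measure.volume_eq_prod, ← Measure.prod_restrict]
  have hγ' := hγ
  rw [HatConverges, IntegrableOn, hset] at hγ'
  have e : ∀ q ∈ Ioi (0 : ℝ) ×ˢ I, 2 * Complex.I * a * ∫ p in Icc (0 : ℝ) 1, ((q.1 : ℂ) ^ 2)⁻¹ *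
      (Ghat h q.1 (γ q.2) a z₀ (wSeg a z₀ p) * f q.1 (γ q.2) * deriv γ q.2) =
      ((q.1 : ℂ) ^ 2)⁻¹ * (G h q.1 (γ q.2) a z₀ * f q.1 (γ q.2) * deriv γ q.2) := by
    intro q hq
    rw [← integral_Ghat_wSeg hh ha hq.1 (hre _ hq.2), integral_const_mul, integral_mul_const,
      integral_mul_const]
    ring
  have hb : BulkConverges h a z₀ f γ I :=
    IntegrableOn.congr_fun (Integrable.const_mul hγ'.integral_prod_right (2 * Complex.I * a)) e hms
  refine ⟨hb, ?_⟩
  rw [h1, hset, integral_prod_symm _ hγ', ← integral_const_mul, setIntegral_congr_fun hms e]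
  rw [BulkConverges] at hb
  rw [Measure.volume_eq_prod, setIntegral_prod _ hb]
  refine setIntegral_congr_fun measurableSet_Ioi fun u _ => ?_
  change ∫ s in I, ((u : ℂ) ^ 2)⁻¹ * (G h u (γ s) a z₀ * f u (γ s) * deriv γ s) = _
  rw [integral_const_mul]
  rfl

theorem BulkConverges.integrableOn {γ : ℝ → ℂ} {I : Set ℝ} (hb : BulkConverges h a z₀ f γ I) :
    IntegrableOn (fun u : ℝ => ((u : ℂ) ^ 2)⁻¹ * lineInt (fun z => G h u z a z₀ * f u z) γ I)
      (Ioi 0) := by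
  rw [BulkConverges, IntegrableOn, Measure.volume_eq_prod, ← Measure.prod_restrict] at hb
  refine hb.integral_prod_left.congr (Eventually.of_forall fun u => ?_)
  change ∫ s in I, ((u : ℂ) ^ 2)⁻¹ * (G h u (γ s) a z₀ * f u (γ s) * deriv γ s) = _
  rw [integral_const_mul]
  rfl

theorem hatIntegral_eq {ε : ℝ} {γ₁ γ₂ : ℝ → ℂ}
    (h₁ : HatConverges h a z₀ f (fun _ => γ₁) (Iic 0))
    (h₂ : HatConverges h a z₀ f (fun _ => γ₂) (Ici 0))
    (s₁ : HatConverges h a z₀ f (side₁ z₀ ε) (Icc 0 1))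
    (s₂ : HatConverges h a z₀ f (side₂ ε) (Icc 0 1))
    (s₃ : HatConverges h a z₀ f (side₃ z₀ ε) (Icc 0 1)) :
    hatIntegral h a z₀ f ε γ₁ γ₂ = 2 * Complex.I * a *
      ((∫ q in Icc 0 1 ×ˢ Ioi 0, hatTerm h a z₀ f (fun _ => γ₁) (Iic 0) q) +
        (∫ q in Icc 0 1 ×ˢ Ioi 0, hatTerm h a z₀ f (fun _ => γ₂) (Ici 0) q) +
        ∫ q in Icc 0 1 ×ˢ Ioi 0, (hatTerm h a z₀ f (side₁ z₀ ε) (Icc 0 1) q +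
          hatTerm h a z₀ f (side₂ ε) (Icc 0 1) q +
          hatTerm h a z₀ f (side₃ z₀ ε) (Icc 0 1) q)) := by
  have i₁ := h₁.integrableOn_hatTerm.1
  have i₂ := h₂.integrableOn_hatTerm.1
  have i₃ := (s₁.integrableOn_hatTerm.1.add s₂.integrableOn_hatTerm.1).add
    s₃.integrableOn_hatTerm.1
  have i := (i₁.add i₂).add i₃
  have e : (∫ q in Icc 0 1 ×ˢ Ioi 0, hatTerm h a z₀ f (fun _ => γ₁) (Iic 0) q) +
        (∫ q in Icc 0 1 ×ˢ Ioi 0, hatTerm h a z₀ f (fun _ => γ₂) (Ici 0) q) +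
        (∫ q in Icc 0 1 ×ˢ Ioi 0, (hatTerm h a z₀ f (side₁ z₀ ε) (Icc 0 1) q +
          hatTerm h a z₀ f (side₂ ε) (Icc 0 1) q +
          hatTerm h a z₀ f (side₃ z₀ ε) (Icc 0 1) q)) =
      ∫ q in Icc 0 1 ×ˢ Ioi 0, (hatTerm h a z₀ f (fun _ => γ₁) (Iic 0) q +
        hatTerm h a z₀ f (fun _ => γ₂) (Ici 0) q + (hatTerm h a z₀ f (side₁ z₀ ε) (Icc 0 1) q +
          hatTerm h a z₀ f (side₂ ε) (Icc 0 1) q +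
          hatTerm h a z₀ f (side₃ z₀ ε) (Icc 0 1) q)) := by
    rw [← integral_add i₁ i₂]
    exact (integral_add (i₁.add i₂) i₃).symm
  rw [Measure.volume_eq_prod] at i
  rw [e, hatIntegral, lineInt, Measure.volume_eq_prod]
  refine Eq.trans ?_ (congrArg _ (setIntegral_prod _ i).symm)
  rw [mul_comm, ← integral_mul_const]
  congr 1
  ext p
  rw [deriv_wSeg]
  congr 2
  ext u
  simp only [Pi.add_apply, hatTerm, outerInt, bumpInt]
  ring

/-- Reversing the third side parametrises both vertical sides away from the real axis, so that they
enter as a difference. -/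
theorem bumpInt_eq {g : ℂ → ℂ} {y ε : ℝ} (hg : BumpRegular (fun ζ => g (z₀ + ζ)) a r y)
    (hε : 0 < ε) (hεr : ε < r) :
    bumpInt g z₀ ε (z₀ + Complex.I * y) = bump (fun ζ => g (z₀ + ζ)) ε y := by
  set g' : ℂ → ℂ := fun ζ => g (z₀ + ζ) with hg'
  have habs : |ε| < r := by rwa [abs_of_pos hε]
  have habs' : |(-ε)| < r := by rwa [abs_neg]
  have c1 := hg.continuousOn_vert habs' (neg_ne_zero.2 hε.ne')
  have c2 := hg.continuousOn_vert habs hε.ne'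
  rw [Complex.ofReal_neg] at c1
  have hm : MapsTo (fun s : ℝ => s * y) (uIcc 0 1) (uIcc 0 y) := by
    intro s hs
    rw [uIcc_of_le zero_le_one] at hs
    rcases le_total 0 y with h0 | h0
    · rw [uIcc_of_le h0]
      exact ⟨mul_nonneg hs.1 h0, by nlinarith [hs.2]⟩
    · rw [uIcc_of_ge h0]
      exact ⟨by nlinarith [hs.1, hs.2], mul_nonpos_of_nonneg_of_nonpos hs.1 h0⟩
  have hm2 : MapsTo (fun s : ℝ => (2 * s - 1) * ε) (uIcc 0 1) (Ioo (-r) r) := by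
    intro s hs
    rw [uIcc_of_le zero_le_one] at hs
    constructor <;> nlinarith [hs.1, hs.2]
  have i1 : IntervalIntegrable (fun s : ℝ => Complex.I * y * g' (-ε + Complex.I * (s * y : ℝ)))
      volume 0 1 :=
    (continuousOn_const.mul (c1.comp (by fun_prop) hm)).intervalIntegrable
  have i3 : IntervalIntegrable (fun s : ℝ => Complex.I * y * g' (ε + Complex.I * (s * y : ℝ)))
      volume 0 1 :=
    (continuousOn_const.mul (c2.comp (by fun_prop) hm)).intervalIntegrable
  have i2 : IntervalIntegrable (fun s : ℝ => 2 * (ε : ℂ) *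
      g' (Complex.I * y + ((2 * s - 1) * ε : ℝ))) volume 0 1 :=
    (continuousOn_const.mul (hg.continuousOn_horiz.comp (by fun_prop) hm2)).intervalIntegrable
  have e1 : lineInt g (side₁ z₀ ε (z₀ + Complex.I * y)) (Icc 0 1) =
      ∫ s in (0 : ℝ)..1, Complex.I * y * g' (-ε + Complex.I * (s * y : ℝ)) := by
    rw [lineInt, integral_Icc_eq_integral_Ioc, ← intervalIntegral.integral_of_le zero_le_one]
    refine intervalIntegral.integral_congr fun s _ => ?_
    simp only [hg']
    rw [side₁, deriv_seg, mul_comm]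
    congr 2
    · ring
    · rw [seg]
      push_cast
      ring
  have e2 : lineInt g (side₂ ε (z₀ + Complex.I * y)) (Icc 0 1) =
      ∫ s in (0 : ℝ)..1, 2 * (ε : ℂ) * g' (Complex.I * y + ((2 * s - 1) * ε : ℝ)) := by
    rw [lineInt, integral_Icc_eq_integral_Ioc, ← intervalIntegral.integral_of_le zero_le_one]
    refine intervalIntegral.integral_congr fun s _ => ?_
    simp only [hg']
    rw [side₂, deriv_seg, mul_comm]
    congr 2
    · ring
    · rw [seg]
      push_cast
      ring
  have e3 : lineInt g (side₃ z₀ ε (z₀ + Complex.I * y)) (Icc 0 1) =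
      -∫ s in (0 : ℝ)..1, Complex.I * y * g' (ε + Complex.I * (s * y : ℝ)) := by
    have := intervalIntegral.integral_comp_sub_left (a := 0) (b := 1)
      (fun s : ℝ => Complex.I * y * g' (ε + Complex.I * (s * y : ℝ))) 1
    rw [sub_self, sub_zero] at this
    rw [lineInt, integral_Icc_eq_integral_Ioc, ← intervalIntegral.integral_of_le zero_le_one,
      ← this, ← intervalIntegral.integral_neg]
    refine intervalIntegral.integral_congr fun s _ => ?_
    simp only [hg']
    rw [side₃, deriv_seg, mul_comm, ← neg_mul]
    congr 2
    · ring
    · rw [seg]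
      push_cast
      ring
  rw [bumpInt, e1, e2, e3, bump, intervalIntegral.integral_add _ i2]
  · simp only [mul_sub]
    rw [intervalIntegral.integral_sub i1 i3]
    ring
  · simp only [mul_sub]
    exact i1.sub i3

theorem LocalData.bumpTerm_eq (D : LocalData h a z₀ r f M) (ha : 0 < a) {ε : ℝ}
    (hε : 0 < ε) (hεr : ε < r) {p u : ℝ} (hp : p ∈ Icc (0 : ℝ) 1) (hu : 0 < u) :
    hatTerm h a z₀ f (side₁ z₀ ε) (Icc 0 1) (p, u) + hatTerm h a z₀ f (side₂ ε) (Icc 0 1) (p, u) +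
      hatTerm h a z₀ f (side₃ z₀ ε) (Icc 0 1) (p, u) = ((u : ℂ) ^ 2)⁻¹ * cst h *
        (wt h a (2 * p - 1) * bump (fun ζ => kern h a u ζ (2 * p - 1) * f u (z₀ + ζ)) ε
          (a * (2 * p - 1))) := by
  have ht : 2 * p - 1 ∈ Icc (-1 : ℝ) 1 := ⟨by linarith [hp.1], by linarith [hp.2]⟩
  have hg := bumpRegular_kern (h := h) ha D.pos hu ht (D.diff u hu)
  have e : ∀ γ : ℝ → ℂ, lineInt (fun z => Ghat h u z a z₀ (wSeg a z₀ p) * f u z) γ (Icc 0 1) =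
      cst h * wt h a (2 * p - 1) *
        lineInt (fun z => kern h a u (z - z₀) (2 * p - 1) * f u z) γ (Icc 0 1) := by
    intro γ
    rw [lineInt, lineInt, ← integral_const_mul]
    congr 1
    ext s
    rw [Ghat_wSeg ha hp]
    ring
  have hb := bumpInt_eq (z₀ := z₀) (g := fun z => kern h a u (z - z₀) (2 * p - 1) * f u z)
    (y := a * (2 * p - 1)) (ε := ε) (a := a) (r := r) (by simpa only [add_sub_cancel_left] using hg)
    hε hεr
  simp only [add_sub_cancel_left] at hb
  rw [← hb, ← wSeg_eq, bumpInt]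
  simp only [hatTerm, e]
  ring

theorem LocalData.bumpIntegral_eq (D : LocalData h a z₀ r f M) (hh : 0 < h) (ha : 0 < a) {ε : ℝ}
    (hε : 0 < ε) (hεr : ε < r) :
    IntegrableOn (fun u : ℝ => ((u : ℂ) ^ 2)⁻¹ * (cst h * Complex.I *
      bumpTotal h a u (fun ζ => f u (z₀ + ζ)) ε)) (Ioi 0) ∧
    2 * Complex.I * a * (∫ q in Icc 0 1 ×ˢ Ioi 0, (hatTerm h a z₀ f (side₁ z₀ ε) (Icc 0 1) q +
          hatTerm h a z₀ f (side₂ ε) (Icc 0 1) q + hatTerm h a z₀ f (side₃ z₀ ε) (Icc 0 1) q)) =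
      -∫ u in Ioi (0 : ℝ), ((u : ℂ) ^ 2)⁻¹ * (cst h * Complex.I *
        bumpTotal h a u (fun ζ => f u (z₀ + ζ)) ε) := by
  have i := ((D.hatConverges_side₁ hh ha hε hεr).integrableOn_hatTerm.1.add
    (D.hatConverges_side₂ hh ha hε hεr).integrableOn_hatTerm.1).add
    (D.hatConverges_side₃ hh ha hε hεr).integrableOn_hatTerm.1
  rw [IntegrableOn, Measure.volume_eq_prod, ← Measure.prod_restrict] at i
  have e : ∀ u ∈ Ioi (0 : ℝ), 2 * Complex.I * a * ∫ p in Icc (0 : ℝ) 1,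
      (hatTerm h a z₀ f (side₁ z₀ ε) (Icc 0 1) (p, u) +
        hatTerm h a z₀ f (side₂ ε) (Icc 0 1) (p, u) +
        hatTerm h a z₀ f (side₃ z₀ ε) (Icc 0 1) (p, u)) =
      -(((u : ℂ) ^ 2)⁻¹ * (cst h * Complex.I * bumpTotal h a u (fun ζ => f u (z₀ + ζ)) ε)) := by
    intro u hu
    rw [setIntegral_congr_fun measurableSet_Icc fun p hp => D.bumpTerm_eq ha hε hεr hp hu,
      integral_const_mul, integral_wSeg (fun t => wt h a t *
        bump (fun ζ => kern h a u ζ t * f u (z₀ + ζ)) ε (a * t)),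
      bumpTotal_eq (by simpa using hh) ha D.pos hε hεr hu (D.diff u hu).continuousOn]
    ring
  constructor
  · refine IntegrableOn.congr_fun (Integrable.const_mul i.integral_prod_right
      (2 * Complex.I * a)).neg (fun u hu => ?_) measurableSet_Ioi
    exact neg_eq_iff_eq_neg.2 (e u hu)
  · rw [Measure.volume_eq_prod, ← Measure.prod_restrict]
    refine (congrArg _ (integral_prod_symm _ i)).trans ?_
    rw [← integral_const_mul, ← integral_neg]
    exact setIntegral_congr_fun measurableSet_Ioi e

/-- The two integrals over `C(ε)` cancel exactly, so the choice of the outer contour no longer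
matters. -/
theorem LocalData.bulkIntegral_sub_hatIntegral (D : LocalData h a z₀ r f M) (hh : 0 < h)
    (ha : 0 < a) {ε : ℝ} (hε : 0 < ε) (hεr : ε < r) {γ₁ γ₂ : ℝ → ℂ}
    (r₁ : ∀ s ≤ 0, (γ₁ s).re ≠ z₀) (r₂ : ∀ s ≥ 0, (γ₂ s).re ≠ z₀)
    (h₁ : HatConverges h a z₀ f (fun _ => γ₁) (Iic 0))
    (h₂ : HatConverges h a z₀ f (fun _ => γ₂) (Ici 0)) :
    bulkIntegral h a z₀ f γ₁ γ₂ - hatIntegral h a z₀ f ε γ₁ γ₂ =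
      ∫ u in Ioi (0 : ℝ), ((u : ℂ) ^ 2)⁻¹ * (cst h * Complex.I *
        bumpTotal h a u (fun ζ => f u (z₀ + ζ)) ε) := by
  obtain ⟨b₁, e₁⟩ := h₁.bulk hh ha measurableSet_Iic r₁
  obtain ⟨b₂, e₂⟩ := h₂.bulk hh ha measurableSet_Ici r₂
  rw [hatIntegral_eq h₁ h₂ (D.hatConverges_side₁ hh ha hε hεr) (D.hatConverges_side₂ hh ha hε hεr)
    (D.hatConverges_side₃ hh ha hε hεr), mul_add, mul_add, e₁, e₂,
    (D.bumpIntegral_eq hh ha hε hεr).2, ← integral_add b₁.integrableOn b₂.integrableOn,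
    bulkIntegral]
  simp only [outerInt, mul_add]
  ring


/-! ### Dominated convergence in `u`. -/

theorem intervalIntegrable_rpow_neg_half (δ : ℝ) :
    IntervalIntegrable (fun s : ℝ => s ^ (-(1 / 2 : ℝ))) volume 0 δ :=
  intervalIntegral.intervalIntegrable_rpow' (by norm_num)

/-- Compare with the contour at the fixed distance `δ`, whose contribution is integrable in `u`. The
difference is an integral of the propagator along the real axis, bounded through `s ^ (-1/2)`
uniformly in `ε` and in `u`, even near `u = a`. -/
theorem LocalData.exists_norm_bumpTotal_le (D : LocalData h a z₀ r f M) (hh : 0 < h) (ha : 0 < a)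
    {δ : ℝ} (hδr : δ < r) : ∃ K : ℝ, ∀ ε ∈ Ioc 0 δ, ∀ u > (0 : ℝ),
      ‖((u : ℂ) ^ 2)⁻¹ * (cst h * Complex.I * bumpTotal h a u (fun ζ => f u (z₀ + ζ)) ε)‖ ≤
        ‖((u : ℂ) ^ 2)⁻¹ * (cst h * Complex.I * bumpTotal h a u (fun ζ => f u (z₀ + ζ)) δ)‖ +
          K * (M u / u ^ 2 * poisson h a u) := by
  obtain ⟨C, hC0, hC⟩ := exists_norm_gfun_sig_le hh ha
  set J := ∫ s in (0 : ℝ)..δ, s ^ (-(1 / 2 : ℝ)) with hJ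
  refine ⟨‖cst h * Complex.I * cQ h‖ * (C * 2 * J), fun ε hε u hu => ?_⟩
  have hδ : 0 < δ := hε.1.trans_le hε.2
  have hM := D.M_nonneg ha hu
  have hp := poisson_nonneg (h := h) (b := a) hu.le
  have hmem : ∀ s : ℝ, 0 < s → s ≤ δ → ((s : ℂ)) ∈ rect a 0 r := by
    intro s h1 h2
    have := mem_rect (x := s) (y := 0) (a := a) (r := r) (by rw [abs_of_pos h1]; linarith)
      (by rw [abs_zero]; linarith)
    simpa using this
  have hI : ‖∫ s in ε..δ, gfun h (sig a u s) * (f u (z₀ + s) + f u (z₀ + -s))‖ ≤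
      C * 2 * J * (M u * poisson h a u) := by
    have hint := intervalIntegrable_rpow_neg_half δ
    have hsub : uIcc ε δ ⊆ uIcc 0 δ := by
      rw [uIcc_of_le hε.2, uIcc_of_le hδ.le]
      exact Icc_subset_Icc_left hε.1.le
    calc ‖∫ s in ε..δ, gfun h (sig a u s) * (f u (z₀ + s) + f u (z₀ + -s))‖
        ≤ ∫ s in ε..δ, C * 2 * (M u * poisson h a u) * s ^ (-(1 / 2 : ℝ)) := by
          refine intervalIntegral.norm_integral_le_of_norm_le hε.2
            (Eventually.of_forall fun s hs => ?_) ((hint.mono_set hsub).const_mul _)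
          have hs0 : 0 < s := hε.1.trans hs.1
          have hsm := hmem s hs0 hs.2
          have h1 := hC u s hu ⟨hs0, by linarith [hs.2, D.le_one]⟩
          have h2 : ‖f u (z₀ + s) + f u (z₀ + -s)‖ ≤ M u + M u :=
            (norm_add_le _ _).trans (add_le_add (D.bound u hu _ hsm)
              (D.bound u hu _ (neg_mem_rect hsm)))
          rw [norm_mul]
          calc _ ≤ (C * poisson h a u * s ^ (-(1 / 2 : ℝ))) * (M u + M u) := by gcongr
            _ = _ := by ring
      _ ≤ ∫ s in (0 : ℝ)..δ, C * 2 * (M u * poisson h a u) * s ^ (-(1 / 2 : ℝ)) := by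
          refine intervalIntegral.integral_mono_interval hε.1.le hε.2 le_rfl ?_ (hint.const_mul _)
          filter_upwards [ae_restrict_mem measurableSet_Ioc] with s hs
          have := Real.rpow_nonneg hs.1.le (-(1 / 2 : ℝ))
          change 0 ≤ _
          positivity
      _ = C * 2 * J * (M u * poisson h a u) := by
          rw [intervalIntegral.integral_const_mul]
          ring
  rw [bumpTotal_eq_add hh ha hu hε.1 hε.2 hδr (D.diff u hu), mul_add, mul_add]
  refine (norm_add_le _ _).trans (add_le_add le_rfl ?_)
  rw [norm_mul, ← mul_assoc (cst h * Complex.I), norm_mul, norm_inv, norm_pow, Complex.norm_real,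
    Real.norm_of_nonneg hu.le]
  calc (u ^ 2)⁻¹ * (‖cst h * Complex.I * cQ h‖ * _)
      ≤ (u ^ 2)⁻¹ * (‖cst h * Complex.I * cQ h‖ * (C * 2 * J * (M u * poisson h a u))) := by
        gcongr
    _ = _ := by
        rw [div_eq_mul_inv]
        ring

theorem LocalData.tendsto_integral_bumpTotal (D : LocalData h a z₀ r f M) (hh : 0 < h)
    (ha : 0 < a) :
    Tendsto (fun ε => ∫ u in Ioi (0 : ℝ), ((u : ℂ) ^ 2)⁻¹ * (cst h * Complex.I *
      bumpTotal h a u (fun ζ => f u (z₀ + ζ)) ε)) (𝓝[>] 0)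
      (𝓝 (Real.pi * compactIntegral h a z₀ f)) := by
  have hδ0 : 0 < r / 2 := half_pos D.pos
  have hδr : r / 2 < r := half_lt_self D.pos
  obtain ⟨K, hK⟩ := D.exists_norm_bumpTotal_le hh ha hδr
  have hlim : ∫ u in Ioi (0 : ℝ), ((u : ℂ) ^ 2)⁻¹ * (cst h * Complex.I *
      (-Real.pi * coneInt h a u (fun ζ => f u (z₀ + ζ)))) =
      Real.pi * compactIntegral h a z₀ f := by
    rw [compactIntegral, ← integral_const_mul]
    -- For `u ≥ a` nothing lies between the light cones, hence the upper limit `a`.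
    refine (setIntegral_eq_of_subset_of_forall_sdiff_eq_zero measurableSet_Ioi Ioo_subset_Ioi_self
      fun u hu => ?_).trans (setIntegral_congr_fun measurableSet_Ioo fun u hu => ?_)
    · have : a ≤ u := by
        by_contra! hlt
        exact hu.2 ⟨hu.1, hlt⟩
      rw [coneInt_of_le this]
      ring
    · rw [lineInt_compactSeg D hh ha hu]
      ring
  rw [← hlim]
  refine tendsto_integral_filter_of_dominated_convergence (fun u =>
    ‖((u : ℂ) ^ 2)⁻¹ * (cst h * Complex.I * bumpTotal h a u (fun ζ => f u (z₀ + ζ)) (r / 2))‖ +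
      K * (M u / u ^ 2 * poisson h a u)) ?_ ?_ ?_ ?_
  · filter_upwards [Ioo_mem_nhdsGT D.pos] with ε hε
    exact (D.bumpIntegral_eq hh ha hε.1 hε.2).1.aestronglyMeasurable
  · filter_upwards [Ioc_mem_nhdsGT hδ0] with ε hε
    filter_upwards [ae_restrict_mem measurableSet_Ioi] with u hu
    exact hK ε hε u hu
  · exact (D.bumpIntegral_eq hh ha hδ0 hδr).1.norm.add
      ((D.integrableOn_majorant hh ha.ne').const_mul K)
  -- The pointwise limit is known except at `u = a`, where the bulk point itself lies on the
  -- contour's limit; this is a null set.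
  · have hne : ∀ᵐ u : ℝ ∂volume.restrict (Ioi 0), u ≠ a :=
      ae_restrict_of_ae (Measure.ae_ne volume a)
    filter_upwards [ae_restrict_mem measurableSet_Ioi, hne] with u hu hua
    exact ((tendsto_bumpTotal hh ha hu hua D.pos (D.diff u hu)).const_mul _).const_mul _

end AdS2

theorem lemma4 (h a z₀ : ℝ) (hh : 0 < h) (ha : 0 < a)
    (f : ℝ → ℂ → ℂ) (hf : AdS2.IsTestFunction h a z₀ f)
    (ε₀ : ℝ) (hε₀ : 0 < ε₀) (γ₁ γ₂ : ℝ → ℝ → ℂ)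
    (hC : ∀ ε ∈ Ioo 0 ε₀, AdS2.IsOuterContour z₀ ε (γ₁ ε) (γ₂ ε))
    (hconv₁ : ∀ ε ∈ Ioo 0 ε₀, AdS2.HatConverges h a z₀ f (fun _ => γ₁ ε) (Iic 0))
    (hconv₂ : ∀ ε ∈ Ioo 0 ε₀, AdS2.HatConverges h a z₀ f (fun _ => γ₂ ε) (Ici 0)) :
    -- the integrals in the identity converge absolutely
    AdS2.CompactConverges h a z₀ f ∧
    (∀ᶠ ε in 𝓝[>] (0 : ℝ),
      AdS2.BulkConverges h a z₀ f (γ₁ ε) (Iic 0) ∧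
      AdS2.BulkConverges h a z₀ f (γ₂ ε) (Ici 0) ∧
      AdS2.HatConverges h a z₀ f (AdS2.side₁ z₀ ε) (Icc 0 1) ∧
      AdS2.HatConverges h a z₀ f (AdS2.side₂ ε) (Icc 0 1) ∧
      AdS2.HatConverges h a z₀ f (AdS2.side₃ z₀ ε) (Icc 0 1)) ∧
    -- the difference of the two `ε`-dependent integrals tends to the compact term
    Tendsto
      (fun ε => AdS2.bulkIntegral h a z₀ f (γ₁ ε) (γ₂ ε) -
        AdS2.hatIntegral h a z₀ f ε (γ₁ ε) (γ₂ ε))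
      (𝓝[>] 0) (𝓝 (Real.pi * AdS2.compactIntegral h a z₀ f)) ∧
    -- hence each of the two limits exists if the other does, and the identity holds between them
    ∀ L : ℂ,
      Tendsto (fun ε => AdS2.bulkIntegral h a z₀ f (γ₁ ε) (γ₂ ε)) (𝓝[>] 0)
          (𝓝 (Real.pi * AdS2.compactIntegral h a z₀ f + L)) ↔
        Tendsto (fun ε => AdS2.hatIntegral h a z₀ f ε (γ₁ ε) (γ₂ ε)) (𝓝[>] 0) (𝓝 L) := by
  obtain ⟨r, M, D⟩ := AdS2.exists_localData hf
  have hsmall : ∀ᶠ ε in 𝓝[>] (0 : ℝ), ε ∈ Ioo 0 ε₀ ∧ ε ∈ Ioo 0 r :=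
    Filter.Eventually.and (Ioo_mem_nhdsGT hε₀) (Ioo_mem_nhdsGT D.pos)
  have hdiff : Tendsto (fun ε => AdS2.bulkIntegral h a z₀ f (γ₁ ε) (γ₂ ε) -
      AdS2.hatIntegral h a z₀ f ε (γ₁ ε) (γ₂ ε)) (𝓝[>] 0)
      (𝓝 (Real.pi * AdS2.compactIntegral h a z₀ f)) := by
    refine (D.tendsto_integral_bumpTotal hh ha).congr' ?_
    filter_upwards [hsmall] with ε hε
    exact (D.bulkIntegral_sub_hatIntegral hh ha hε.2.1 hε.2.2 (hC ε hε.1).left_re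
      (hC ε hε.1).right_re (hconv₁ ε hε.1) (hconv₂ ε hε.1)).symm
  refine ⟨D.compactConverges hh ha, ?_, hdiff, fun L => ⟨fun hL => ?_, fun hL => ?_⟩⟩
  · filter_upwards [hsmall] with ε hε
    exact ⟨((hconv₁ ε hε.1).bulk hh ha measurableSet_Iic (hC ε hε.1).left_re).1,
      ((hconv₂ ε hε.1).bulk hh ha measurableSet_Ici (hC ε hε.1).right_re).1,
      D.hatConverges_side₁ hh ha hε.2.1 hε.2.2, D.hatConverges_side₂ hh ha hε.2.1 hε.2.2,
      D.hatConverges_side₃ hh ha hε.2.1 hε.2.2⟩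
  · simpa using hL.sub hdiff
  · simpa using hdiff.add hL
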